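/- **Model.** Fix $j>0$. For a positive integer $N$ put $\epsilon=1/N$. Let $(\xi_t)_{t\ge0}$ be the Markov process on $\mathbb N^{\{0,\dots,N\}}$ with generator $L=L^0+L_b+L_a$, where $$L^0f(\xi)=\tfrac12\sum_{x=0}^{N-1}\big\{\xi(x)[f(\xi^{x,x+1})-f(\xi)]+\xi(x+1)[f(\xi^{x+1,x})-f(\xi)]\big\},$$ $$L_bf(\xi)=j\epsilon\,[f(\xi^+)-f(\xi)],\qquad L_af(\xi)=j\epsilon\,[f(\xi^-)-f(\xi)]\ \text{ for }\xi\not\equiv0,\qquad L_af(0)=0.$$ Here $\xi^{x,y}$ is $\xi$ with one particle moved from $x$ to $y$, $\xi^+$ is $\xi$ with one particle added at site $0$, and $\xi^-$ is $\xi$ with one particle removed from $R_\xi$, the largest $x$ with $\xi(x)>0$ (we set $R_\xi=0$ if $\xi\equiv 0$). Let $P^{(\epsilon)}_\xi$ be the law of this process started from $\xi$. Put $F_\epsilon(x;\xi)=\sum_{y\ge x}\xi(y)$ and, for $u\in L^\infty([0,1],\mathbb R_+)$, $F(r;u)=\int_r^1u(r')\,dr'$ for $r\in[0,1]$, $F(r;u)=0$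 for $r>1$, and $R(u)=\inf\{r\in[0,1]:F(r;u)=0\}$; $u$ has an edge if $R(u)<1$. **Initial data.** Let $\rho_{\rm init}\in L^\infty([0,1],\mathbb R_+)$, let $\ell$ be the integer part of $\epsilon^{-9/10}$, and suppose that for every $\epsilon=1/N$ the initial configuration $\xi=\xi^{(\epsilon)}$ satisfies $$\max_{0\le x\le N-\ell+1}\Big|\frac1\ell\sum_{y=x}^{x+\ell-1}\xi(y)-\frac{F(\epsilon x;\rho_{\rm init})-F(\epsilon(x+\ell);\rho_{\rm init})}{\epsilon\ell}\Big|\le\epsilon^{1/20}$$ and, if $\rho_{\rm init}$ has an edge, $|\epsilon R_\xi-R(\rho_{\rm init})|\le\epsilon^{1/20}$. **Theorem (existence of the hydrodynamic limit).** There is a nonnegative continuous function $\rho(r,t)$, $r\in[0,1]$, $t>0$, such that for every $r\in[0,1]$ $$\lim_{t\to0^+}F(r;\rho(\cdot,t))=F(r;\rho_{\rm init}),$$ and for all $t>0$ and $\zeta>0$ $$\lim_{\epsilon\to0}P^{(\epsilon)}_\xi\Big[\max_{x\in\{0,\dots,N\}}\big|\epsilon F_\epsilon(x;\xi_{\epsilon^{-2}t})-F(\epsilon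 x;\rho(\cdot,t))\big|\le\zeta\Big]=1.$$ Moreover, if $\rho_{\rm init}\in C([0,1],\mathbb R_+)$, then $\rho$, extended by $\rho(\cdot,0)=\rho_{\rm init}$, is continuous on $[0,1]\times[0,\infty)$. -/

import Mathlib

open MeasureTheory ProbabilityTheory Filter Topology Set
open scoped NNReal ENNReal

noncomputable section

namespace TopReservoir

/-! ### Microscopic model.  The system size is `N = ε⁻¹`, a positive integer. -/

/-- The lattice spacing `ε = 1 / N`. -/
def eps (N : ℕ) : ℝ := 1 / (N : ℝ)

/-- Particle configurations on the sites `0, 1, …, N`: `ξ x` is the number of particles at `x`. -/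
abbrev Config (N : ℕ) : Type := Fin (N + 1) → ℕ

variable {N : ℕ}

/-- `ξ^{x,y}`: one particle of `ξ` is moved from `x` to `y` (used for `x ≠ y` and, because of the
prefactor in the generator, for `ξ x > 0`). -/
def hop (ξ : Config N) (x y : Fin (N + 1)) : Config N :=
  fun z => if z = x then ξ z - 1 else if z = y then ξ z + 1 else ξ z

/-- `ξ⁺`: one particle is put at site `0`. -/
def inject (ξ : Config N) : Config N :=
  fun z => if z = 0 then ξ z + 1 else ξ z

/-- `R_ξ`: the largest site `x` with `ξ x > 0`; it is `0` for the empty configuration. -/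
def rightmost (ξ : Config N) : ℕ :=
  (Finset.univ.filter fun x : Fin (N + 1) => 0 < ξ x).sup fun x => (x : ℕ)

/-- `ξ⁻`: one particle is taken out from the rightmost occupied site. -/
def remove (ξ : Config N) : Config N :=
  fun z => if (z : ℕ) = rightmost ξ then ξ z - 1 else ξ z

/-- `L⁰`: independent symmetric random walks, jumps out of `[0, N]` being suppressed. -/
def genBulk (f : Config N → ℝ) (ξ : Config N) : ℝ :=
  (1 / 2) * ∑ x : Fin N,
    ((ξ x.castSucc : ℝ) * (f (hop ξ x.castSucc x.succ) - f ξ)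
      + (ξ x.succ : ℝ) * (f (hop ξ x.succ x.castSucc) - f ξ))

/-- `L_b`: injection at site `0` at rate `j ε`. -/
def genBirth (j : ℝ) (f : Config N → ℝ) (ξ : Config N) : ℝ :=
  j * eps N * (f (inject ξ) - f ξ)

/-- `L_a`: removal of a rightmost particle at rate `j ε`, with no effect on the empty
configuration. -/
def genDeath (j : ℝ) (f : Config N → ℝ) (ξ : Config N) : ℝ :=
  if ξ = 0 then 0 else j * eps N * (f (remove ξ) - f ξ)

/-- The generator `L = L⁰ + L_b + L_a`. -/
def gen (j : ℝ) (f : Config N → ℝ) (ξ : Config N) : ℝ :=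
  genBulk f ξ + genBirth j f ξ + genDeath j f ξ

/-- `X` is (a realization of) the Markov process with generator `L` started from `ξ₀`: a process
with càdlàg paths in the countable discrete space `Config N` which solves the martingale problem
for `L` on the finitely supported functions.  The jump rates do not lead to explosion (the particle
number grows at rate at most `j ε`), so that the law of `X` exists and is determined by these
properties. -/
structure IsParticleProcess (j : ℝ) (ξ₀ : Config N) {Ω : Type*} [mΩ : MeasurableSpace Ω]
    (P : Measure Ω) (X : ℝ≥0 → Ω → Config N) : Prop where
  measurable : ∀ t, Measurable (X t)
  initial : ∀ᵐ ω ∂P, X 0 ω = ξ₀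
  right_continuous : ∀ ω t, ContinuousWithinAt (fun s => X s ω) (Ici t) t
  left_limits : ∀ ω t, 0 < t → ∃ η : Config N, Tendsto (fun s => X s ω) (𝓝[<] t) (𝓝 η)
  martingale : ∃ ℱ : Filtration ℝ≥0 mΩ, (∀ t, Measurable[ℱ t] (X t)) ∧
    ∀ f : Config N → ℝ, (Function.support f).Finite →
      Martingale (fun (t : ℝ≥0) (ω : Ω) =>
        f (X t ω) - f (X 0 ω) - ∫ s in (0 : ℝ)..(t : ℝ), gen j f (X s.toNNReal ω)) ℱ P

/-- `F_ε(x; ξ) = ∑_{y ≥ x} ξ(y)`. -/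
def tailCount (ξ : Config N) (x : Fin (N + 1)) : ℕ :=
  ∑ y ∈ Finset.univ.filter (fun y : Fin (N + 1) => x ≤ y), ξ y

/-! ### Macroscopic profiles and the comparison with configurations. -/

/-- `F(r; u) = ∫_r^1 u(r') dr'`; it vanishes for `r > 1`, profiles being measures on `[0,1]`. -/
def tailMass (u : ℝ → ℝ) (r : ℝ) : ℝ := ∫ r' in Icc r 1, u r'

/-- `R(u) = inf {r ∈ [0,1] : F(r; u) = 0}`; `u` has an edge when this is `< 1`. -/
def macroEdge (u : ℝ → ℝ) : ℝ := sInf {r : ℝ | r ∈ Icc (0 : ℝ) 1 ∧ tailMass u r = 0}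

/-- `𝒜_ℓ(x, ξ)`: the average of `ξ` over the sites `x, …, x + ℓ - 1`. -/
def microAvg (l x : ℕ) (ξ : Config N) : ℝ :=
  (1 / (l : ℝ)) *
    ∑ y ∈ Finset.univ.filter (fun y : Fin (N + 1) => x ≤ (y : ℕ) ∧ (y : ℕ) < x + l), (ξ y : ℝ)

/-- `𝒜'_ℓ(x, u) = (F(εx; u) - F(ε(x + ℓ); u)) / (ε ℓ)`, where `ε = 1 / N`. -/
def macroAvg (N l x : ℕ) (u : ℝ → ℝ) : ℝ :=
  (1 / (eps N * (l : ℝ))) *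
    (tailMass u (eps N * (x : ℝ)) - tailMass u (eps N * ((x : ℝ) + (l : ℝ))))

/-- `ℓ`, the integer part of `ε^{-b}` with `b = 9/10`. -/
def blockLength (N : ℕ) : ℕ := ⌊eps N ^ (-(9 / 10) : ℝ)⌋₊

/-- The configuration `ξ` approximates the profile `u` (with `a = 1/20`): block averages are
within `ε^a` of each other for all blocks contained in the lattice, and if `u` has an edge then
the edges are within `ε^a` in macroscopic units. -/
def Approximates (ξ : Config N) (u : ℝ → ℝ) : Prop :=
  (∀ x : ℕ, x + blockLength N ≤ N + 1 →
    |microAvg (blockLength N) x ξ - macroAvg N (blockLength N) x u| ≤ eps N ^ (1 / 20 : ℝ)) ∧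
  (macroEdge u < 1 →
    |eps N * (rightmost ξ : ℝ) - macroEdge u| ≤ eps N ^ (1 / 20 : ℝ))

end TopReservoir

end

open TopReservoir

/-!
In terms of the tail masses `F(r, t) = ∫_r^1 ρ(r', t) dr'` the limiting free boundary problem is

  `∂ₜ F = ½ F'' - j H`,  `F(0, t) = M`,  `F(1, t) = 0`,  `H ∈ sign F`,

where `M` is the total mass, which is conserved because births and deaths balance, and `sign` is the
maximal monotone sign graph: `H = 1` where there is mass to the right of `r`, and the value of `H`
beyond the edge is not prescribed. Since `sign` is monotone, two solutions stay close to each other,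
in the uniform norm by the maximum principle and in mean square by an energy estimate. The edge never
has to be followed, neither in the limit nor in the particle system.

*The profile.* `V` is an approximate solution with error `a` (`IsApprox`) if it solves
`∂ₜ V = ½ V'' - j H` exactly, for some `H` with `|H| ≤ 1 + a` and `V * H ≥ |V| - a`. Picard
iteration for a steep smeared sign function gives approximate solutions for all `a > 0`
(`exists_isApprox`). Odd `2`-periodic extension turns the boundary conditions into a symmetry, so
that only the heat semigroup on the line is needed, as an expectation over a Gaussian variable. The
maximum principle (`parabolic_max_principle`) shows that approximate solutions for the same datum are
close to each other and almost nonincreasing in `r`. Their gradients are uniformly `½`-Hölder for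
`t > 0`, hence converge as well, and `-ρ` is the limit of the gradients (`exists_profile`).

*The particle system.* In macroscopic time the process is a jump process with an explicit generator.
The tail counts, minus a linear interpolation that accounts for the total mass, are decomposed into
discrete sine modes. Under the generator each mode relaxes at the eigenvalue `λ_k ≥ k² / 2` and is
forced by the reservoirs. The distance of a mode from the solution of the relaxation equation with
the actual path of the reservoir forcing inserted is at most, in mean square, the carré du champ
divided by `λ_k` (`IsJumpProcess.lintegral_sub_relax_sq_le`). The sum of these fluctuations over all
modes is `O(1 / N)` (`lintegral_fluctEnergy_le`). What remains of the difference between the tails and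
`V` satisfies an energy inequality path by path. There the reservoir terms pair to something
nonpositive up to small errors: removal at the rightmost particle means that the absorption acts
exactly at the sites where the tail is positive, so it is in the sign graph of the tail
(`sub_mul_absorption_le`). The empty configuration, where no particle can be removed, is covered
by the bound on the fluctuations of the total mass (`integral_mass_sq_le`). This makes the mean
square distance small in expectation (`lintegral_meanSqDist_le`), and monotonicity of the tails turns
this into uniform closeness in probability (`abs_tail_sub_le_of_meanSqDist_lt`).
-/

namespace TopReservoir

/-! ### The heat semigroup on the line -/

/-- The standard Gaussian measure on `ℝ`. -/
noncomputable abbrev stdGauss : Measure ℝ := gaussianReal 0 1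

/-- The heat semigroup of `½ ∂²` on the line, `P_t f (r) = E f (r + √t Z)`, in a form which also
makes sense for `t ≤ 0`, where it is the identity. -/
noncomputable def heat (t : ℝ) (f : ℝ → ℝ) (r : ℝ) : ℝ := ∫ z, f (r + √t * z) ∂stdGauss

lemma integrable_stdGauss_of_bound {f : ℝ → ℝ} (hf : Continuous f) {C : ℝ} (hC : ∀ z, |f z| ≤ C) :
    Integrable f stdGauss :=
  Integrable.of_bound hf.aestronglyMeasurable C (ae_of_all _ fun z => by
    simpa [Real.norm_eq_abs] using hC z)

lemma integrable_id_stdGauss : Integrable (fun z : ℝ => z) stdGauss := by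
  have := (memLp_id_gaussianReal (μ := 0) (v := 1) 1).integrable (by simp)
  exact this

lemma integrable_sq_stdGauss : Integrable (fun z : ℝ => z ^ 2) stdGauss := by
  have := (memLp_id_gaussianReal (μ := 0) (v := 1) 2)
  have h := this.integrable_sq
  exact h

lemma integral_sq_stdGauss : ∫ z, z ^ 2 ∂stdGauss = 1 := by
  have h := variance_id_gaussianReal (μ := 0) (v := 1)
  rw [variance_eq_integral (by fun_prop)] at h
  simpa using h

lemma integrable_abs_stdGauss : Integrable (fun z : ℝ => |z|) stdGauss :=
  integrable_id_stdGauss.abs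

lemma integral_abs_stdGauss_le : ∫ z, |z| ∂stdGauss ≤ 1 := by
  have h : ∫ z, |z| ∂stdGauss ≤ ∫ z, (1 + z ^ 2) / 2 ∂stdGauss := by
    apply integral_mono integrable_abs_stdGauss
    · exact ((integrable_const _).add integrable_sq_stdGauss).div_const 2
    · intro z
      have := sq_nonneg (|z| - 1)
      simp only
      nlinarith [sq_abs z]
  rw [integral_div, integral_add (integrable_const _) integrable_sq_stdGauss,
    integral_sq_stdGauss] at h
  simpa using h.trans (by norm_num)

lemma integrable_mul_stdGauss {f w : ℝ → ℝ} (hf : Continuous f) {C : ℝ} (hC : ∀ z, |f z| ≤ C)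
    (hw : Integrable w stdGauss) : Integrable (fun z => f z * w z) stdGauss :=
  hw.bdd_mul (c := C) hf.aestronglyMeasurable (ae_of_all _ fun z => by
    simpa [Real.norm_eq_abs] using hC z)

lemma abs_integral_mul_stdGauss_le {f w : ℝ → ℝ} {C : ℝ} (hC : ∀ z, |f z| ≤ C)
    (hw : Integrable w stdGauss) :
    |∫ z, f z * w z ∂stdGauss| ≤ C * ∫ z, |w z| ∂stdGauss := by
  rw [← integral_const_mul]
  refine abs_integral_le_integral_abs.trans ?_
  refine integral_mono_of_nonneg (ae_of_all _ fun z => abs_nonneg _) (hw.abs.const_mul C)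
    (ae_of_all _ fun z => ?_)
  simp only [abs_mul]
  exact mul_le_mul_of_nonneg_right (hC z) (abs_nonneg _)

/-- Gaussian integration by parts. -/
lemma stdGauss_integral_by_parts {G G' : ℝ → ℝ} (hG : ∀ z, HasDerivAt G (G' z) z)
    (h0 : Integrable G stdGauss) (h1 : Integrable (fun z => G z * z) stdGauss)
    (h2 : Integrable G' stdGauss) :
    ∫ z, G z * z ∂stdGauss = ∫ z, G' z ∂stdGauss := by
  have key : ∀ F : ℝ → ℝ, Integrable F stdGauss →
      Integrable (fun z => F z * gaussianPDFReal 0 1 z) := by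
    intro F hF
    rw [stdGauss, gaussianReal_of_var_ne_zero 0 one_ne_zero] at hF
    have := (integrable_withDensity_iff (measurable_gaussianPDF 0 1)
      (ae_of_all _ fun z => by simp [gaussianPDF])).1 hF
    refine this.congr (ae_of_all _ fun z => ?_)
    simp [gaussianPDF, ENNReal.toReal_ofReal (gaussianPDFReal_nonneg 0 1 z)]
  have hd : ∀ z, HasDerivAt (gaussianPDFReal 0 1) (-z * gaussianPDFReal 0 1 z) z := by
    intro z
    unfold gaussianPDFReal
    have : HasDerivAt (fun x : ℝ => -(x - 0) ^ 2 / (2 * ((1 : ℝ≥0) : ℝ))) (-z) z := by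
      have := (((hasDerivAt_id' z).sub_const 0).fun_pow 2).fun_neg.div_const (2 * ((1 : ℝ≥0) : ℝ))
      refine this.congr_deriv ?_
      push_cast
      ring
    refine (this.exp.const_mul ((√(2 * Real.pi * ((1 : ℝ≥0) : ℝ)))⁻¹)).congr_deriv ?_
    ring
  have := integral_mul_deriv_eq_deriv_mul_of_integrable (u := G) (v := gaussianPDFReal 0 1)
    (u' := G') (v' := fun z => -z * gaussianPDFReal 0 1 z) (fun z _ => hG z) (fun z _ => hd z)
    (by
      refine (key _ h1).neg.congr (ae_of_all _ fun z => ?_)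
      simp
      ring) (key _ h2) (key _ h0)
  rw [integral_gaussianReal_eq_integral_smul one_ne_zero,
    integral_gaussianReal_eq_integral_smul one_ne_zero]
  have e1 : ∫ z, gaussianPDFReal 0 1 z • (G z * z) = -∫ z, G z * (-z * gaussianPDFReal 0 1 z) := by
    rw [← integral_neg]
    congr 1
    ext z
    simp
    ring
  rw [e1, this, neg_neg]
  congr 1
  ext z
  simp [mul_comm]

lemma continuous_integral_stdGauss {X : Type*} [TopologicalSpace X] [FirstCountableTopology X]
    {F : X → ℝ → ℝ} (hF : Continuous (Function.uncurry F)) {C : ℝ} (hC : ∀ x z, |F x z| ≤ C)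
    {w : ℝ → ℝ} (hw : Integrable w stdGauss) :
    Continuous fun x => ∫ z, F x z * w z ∂stdGauss := by
  refine continuous_of_dominated (bound := fun z => C * |w z|) (fun x => ?_) (fun x => ?_)
    (hw.abs.const_mul C) (ae_of_all _ fun z => ?_)
  · exact (Continuous.uncurry_left x hF).aestronglyMeasurable.mul hw.aestronglyMeasurable
  · refine ae_of_all _ fun z => ?_
    rw [Real.norm_eq_abs, abs_mul]
    exact mul_le_mul_of_nonneg_right (hC x z) (abs_nonneg _)
  · exact (Continuous.uncurry_right z hF).mul continuous_const

/-- Joint continuity of the heat semigroup in time, space and further parameters. -/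
lemma continuous_heat {X : Type*} [TopologicalSpace X] [FirstCountableTopology X]
    {F : X → ℝ → ℝ} (hF : Continuous (Function.uncurry F)) {C : ℝ} (hC : ∀ x z, |F x z| ≤ C)
    {τ ρ : X → ℝ} (hτ : Continuous τ) (hρ : Continuous ρ) :
    Continuous fun x => heat (τ x) (F x) (ρ x) := by
  have := continuous_integral_stdGauss (X := X) (F := fun x z => F x (ρ x + √(τ x) * z))
    (w := fun _ => 1) (C := C)
    (hF.comp (g := Function.uncurry F) (f := fun p : X × ℝ => (p.1, ρ p.1 + √(τ p.1) * p.2))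
      (by fun_prop)) (fun x z => hC x _) (integrable_const _)
  simpa [heat] using this

lemma abs_heat_le {f : ℝ → ℝ} {C : ℝ} (hC : ∀ z, |f z| ≤ C) (t r : ℝ) : |heat t f r| ≤ C := by
  have := abs_integral_mul_stdGauss_le (f := fun z => f (r + √t * z)) (w := fun _ => 1)
    (fun z => hC _) (integrable_const _)
  simpa [heat] using this

lemma heat_integrable {f : ℝ → ℝ} (hf : Continuous f) {C : ℝ} (hC : ∀ z, |f z| ≤ C) (t r : ℝ) :
    Integrable (fun z => f (r + √t * z)) stdGauss :=
  integrable_stdGauss_of_bound (C := C) (by fun_prop) fun z => hC _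

lemma heat_sub {f g : ℝ → ℝ} (hf : Continuous f) {C : ℝ} (hC : ∀ z, |f z| ≤ C)
    (hg : Continuous g) {D : ℝ} (hD : ∀ z, |g z| ≤ D) (t r : ℝ) :
    heat t (fun y => f y - g y) r = heat t f r - heat t g r :=
  integral_sub (heat_integrable hf hC t r) (heat_integrable hg hD t r)

lemma heat_zero (f : ℝ → ℝ) (r : ℝ) : heat 0 f r = f r := by
  simp [heat]

/-- The heat semigroup preserves oddness about a point. -/
lemma heat_odd {f : ℝ → ℝ} {a : ℝ} (hf : ∀ y, f (2 * a - y) = - f y) (t : ℝ) (r : ℝ) :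
    heat t f (2 * a - r) = - heat t f r := by
  unfold heat
  rw [← integral_neg]
  have hmap : stdGauss.map (fun z => -z) = stdGauss := by
    have := gaussianReal_map_neg (μ := 0) (v := 1)
    simpa using this
  conv_lhs => rw [← hmap]
  rw [show (fun z : ℝ => -z) = MeasurableEquiv.neg ℝ from rfl,
    integral_map_equiv (MeasurableEquiv.neg ℝ) (fun z => f (2 * a - r + √t * z))]
  refine integral_congr_ae (ae_of_all _ fun z => ?_)
  simp only [MeasurableEquiv.neg_apply]
  rw [← hf]
  congr 1
  ring

/-- The space derivative of the heat semigroup. -/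
lemma hasDerivAt_heat {f f' : ℝ → ℝ} (hf : ∀ z, HasDerivAt f (f' z) z) {C : ℝ}
    (hC : ∀ z, |f z| ≤ C) (hf' : Continuous f') {C' : ℝ} (hC' : ∀ z, |f' z| ≤ C') (t r : ℝ) :
    HasDerivAt (heat t f) (heat t f' r) r := by
  have hfc : Continuous f := continuous_iff_continuousAt.2 fun z => (hf z).continuousAt
  refine (hasDerivAt_integral_of_dominated_loc_of_deriv_le (μ := stdGauss)
    (F := fun r z => f (r + √t * z)) (F' := fun r z => f' (r + √t * z)) (bound := fun _ => C')
    (s := univ) univ_mem (Eventually.of_forall fun x => ?_) (heat_integrable hfc hC t r) ?_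
    (ae_of_all _ fun z x _ => ?_) (integrable_const _) (ae_of_all _ fun z x _ => ?_)).2
  · exact (heat_integrable hfc hC t x).aestronglyMeasurable
  · exact (heat_integrable hf' hC' t r).aestronglyMeasurable
  · simpa using hC' _
  · simpa using (hf (x + √t * z)).comp_add_const x (√t * z)

/-- The derivative of `P_t f` in terms of `f` itself. -/
lemma heat_deriv_eq {f f' : ℝ → ℝ} (hf : ∀ z, HasDerivAt f (f' z) z) {C : ℝ}
    (hC : ∀ z, |f z| ≤ C) (hf' : Continuous f') {C' : ℝ} (hC' : ∀ z, |f' z| ≤ C') (t r : ℝ) :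
    √t * heat t f' r = ∫ z, f (r + √t * z) * z ∂stdGauss := by
  have hfc : Continuous f := continuous_iff_continuousAt.2 fun z => (hf z).continuousAt
  have := stdGauss_integral_by_parts (G := fun z => f (r + √t * z))
    (G' := fun z => √t * f' (r + √t * z)) (fun z => ?_) (heat_integrable hfc hC t r) ?_ ?_
  · rw [this, integral_const_mul]
    rfl
  · have h1 : HasDerivAt (fun z => r + √t * z) (√t) z := by
      simpa using ((hasDerivAt_id z).const_mul (√t)).const_add r
    exact ((hf (r + √t * z)).comp z h1).congr_deriv (mul_comm _ _)
  · exact integrable_mul_stdGauss (f := fun z => f (r + √t * z)) (by fun_prop) (fun z => hC _)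
      integrable_id_stdGauss
  · exact (heat_integrable hf' hC' t r).const_mul _

lemma abs_heat_deriv_le {f f' : ℝ → ℝ} (hf : ∀ z, HasDerivAt f (f' z) z) {C : ℝ}
    (hC : ∀ z, |f z| ≤ C) (hf' : Continuous f') {C' : ℝ} (hC' : ∀ z, |f' z| ≤ C') (t r : ℝ) :
    √t * |heat t f' r| ≤ C := by
  rw [← abs_of_nonneg (Real.sqrt_nonneg t), ← abs_mul, heat_deriv_eq hf hC hf' hC']
  refine (abs_integral_mul_stdGauss_le (f := fun z => f (r + √t * z)) (fun z => hC _)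
    integrable_id_stdGauss).trans ?_
  have : 0 ≤ C := (abs_nonneg _).trans (hC 0)
  nlinarith [integral_abs_stdGauss_le]

lemma abs_heat_deriv2_le {f f' f'' : ℝ → ℝ} (hf : ∀ z, HasDerivAt f (f' z) z) {C : ℝ}
    (hC : ∀ z, |f z| ≤ C) (hf' : ∀ z, HasDerivAt f' (f'' z) z) {C' : ℝ} (hC' : ∀ z, |f' z| ≤ C')
    (hf'' : Continuous f'') {C'' : ℝ} (hC'' : ∀ z, |f'' z| ≤ C'') {t : ℝ} (ht : 0 < t) (r : ℝ) :
    t * |heat t f'' r| ≤ 2 * C := by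
  have hfc : Continuous f := continuous_iff_continuousAt.2 fun z => (hf z).continuousAt
  have hfc' : Continuous f' := continuous_iff_continuousAt.2 fun z => (hf' z).continuousAt
  have e1 := heat_deriv_eq hf' hC' hf'' hC'' t r
  have i1 : Integrable (fun z => f (r + √t * z)) stdGauss := heat_integrable hfc hC t r
  have i2 : Integrable (fun z => f' (r + √t * z) * z) stdGauss :=
    integrable_mul_stdGauss (f := fun z => f' (r + √t * z)) (by fun_prop) (fun z => hC' _)
      integrable_id_stdGauss
  have i3 : Integrable (fun z => f (r + √t * z) * z ^ 2) stdGauss :=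
    integrable_mul_stdGauss (f := fun z => f (r + √t * z)) (by fun_prop) (fun z => hC _)
      integrable_sq_stdGauss
  have e2 := stdGauss_integral_by_parts (G := fun z => f (r + √t * z) * z)
    (G' := fun z => √t * (f' (r + √t * z) * z) + f (r + √t * z)) (fun z => ?_)
    (integrable_mul_stdGauss (f := fun z => f (r + √t * z)) (by fun_prop) (fun z => hC _)
      integrable_id_stdGauss) (i3.congr (ae_of_all _ fun z => by ring))
    ((i2.const_mul _).add i1)
  · rw [integral_add (i2.const_mul _) i1, integral_const_mul, ← e1] at e2
    have hs : √t * (√t * heat t f'' r) = t * heat t f'' r := by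
      rw [← mul_assoc, Real.mul_self_sqrt ht.le]
    have e3 : t * heat t f'' r = (∫ z, f (r + √t * z) * z ^ 2 ∂stdGauss) - heat t f r := by
      rw [← hs]
      have : ∫ z, f (r + √t * z) * z ^ 2 ∂stdGauss = ∫ z, f (r + √t * z) * z * z ∂stdGauss := by
        congr 1
        ext z
        ring
      rw [this, e2, hs]
      simp [heat]
    have b1 : |∫ z, f (r + √t * z) * z ^ 2 ∂stdGauss| ≤ C := by
      refine (abs_integral_mul_stdGauss_le (f := fun z => f (r + √t * z)) (fun z => hC _)
        integrable_sq_stdGauss).trans ?_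
      simp [integral_sq_stdGauss]
    have b2 := abs_heat_le hC t r
    calc t * |heat t f'' r| = |t * heat t f'' r| := by rw [abs_mul, abs_of_pos ht]
      _ ≤ |∫ z, f (r + √t * z) * z ^ 2 ∂stdGauss| + |heat t f r| := by rw [e3]; exact abs_sub _ _
      _ ≤ 2 * C := by linarith
  · have h1 : HasDerivAt (fun z => r + √t * z) (√t) z := by
      simpa using ((hasDerivAt_id z).const_mul (√t)).const_add r
    refine (((hf (r + √t * z)).comp z h1).mul (hasDerivAt_id' z)).congr_deriv ?_
    simp only [Function.comp]
    ring

/-- The heat equation in integrated form. -/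
lemma heat_sub_self {f f' f'' : ℝ → ℝ} (hf : ∀ z, HasDerivAt f (f' z) z) {C : ℝ}
    (hC : ∀ z, |f z| ≤ C) (hf' : ∀ z, HasDerivAt f' (f'' z) z) {C' : ℝ} (hC' : ∀ z, |f' z| ≤ C')
    (hf'' : Continuous f'') {C'' : ℝ} (hC'' : ∀ z, |f'' z| ≤ C'') {t : ℝ} (ht : 0 ≤ t) (r : ℝ) :
    heat t f r - f r = ∫ s in (0 : ℝ)..t, heat s f'' r / 2 := by
  have hfc : Continuous f := continuous_iff_continuousAt.2 fun z => (hf z).continuousAt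
  have hfc' : Continuous f' := continuous_iff_continuousAt.2 fun z => (hf' z).continuousAt
  have hcont : ∀ (g : ℝ → ℝ) (D : ℝ), Continuous g → (∀ z, |g z| ≤ D) →
      Continuous fun s => heat s g r := fun g D hg hD =>
    continuous_heat (F := fun _ => g) (hg.comp continuous_snd) (fun _ => hD) continuous_id
      continuous_const
  rw [show heat t f r - f r = heat t f r - heat 0 f r by rw [heat_zero]]
  symm
  refine intervalIntegral.integral_eq_sub_of_hasDerivAt_of_le ht
    (hcont f C hfc hC).continuousOn (fun s hs => ?_)
    (((hcont f'' C'' hf'' hC'').div_const 2).intervalIntegrable _ _)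
  have hs0 : 0 < s := hs.1
  have hsq : 0 < √s := Real.sqrt_pos.2 hs0
  have e1 := heat_deriv_eq hf' hC' hf'' hC'' s r
  have main := (hasDerivAt_integral_of_dominated_loc_of_deriv_le (μ := stdGauss)
    (F := fun s z => f (r + √s * z)) (F' := fun s z => f' (r + √s * z) * (1 / (2 * √s) * z))
    (bound := fun z => C' * (1 / √s * |z|)) (x₀ := s)
    (s := Ioi (s / 4)) (Ioi_mem_nhds (by linarith)) (Eventually.of_forall fun x => ?_)
    (heat_integrable hfc hC s r) ?_
    (ae_of_all _ fun z x hx => ?_) ?_ (ae_of_all _ fun z x hx => ?_)).2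
  · refine main.congr_deriv ?_
    have : ∫ z, f' (r + √s * z) * (1 / (2 * √s) * z) ∂stdGauss =
        1 / (2 * √s) * ∫ z, f' (r + √s * z) * z ∂stdGauss := by
      rw [← integral_const_mul]
      congr 1
      ext z
      ring
    rw [this, ← e1]
    field_simp
  · exact (heat_integrable hfc hC x r).aestronglyMeasurable
  · exact (Continuous.aestronglyMeasurable (by fun_prop))
  · have hx' : s / 4 < x := hx
    have h4 : √s ≤ 2 * √x := by
      rw [show (2 : ℝ) = √4 by rw [show (4 : ℝ) = 2 ^ 2 by norm_num]; simp,
        ← Real.sqrt_mul (by norm_num)]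
      exact Real.sqrt_le_sqrt (by linarith)
    have hsx : 0 < √x := by linarith
    rw [Real.norm_eq_abs, abs_mul, abs_mul, abs_of_pos (by positivity : 0 < 1 / (2 * √x))]
    have : 1 / (2 * √x) ≤ 1 / √s := one_div_le_one_div_of_le hsq h4
    exact mul_le_mul (hC' _) (mul_le_mul_of_nonneg_right this (abs_nonneg _)) (by positivity)
      ((abs_nonneg _).trans (hC' 0))
  · exact (integrable_abs_stdGauss.const_mul _).const_mul _
  · have hx' : s / 4 < x := hx
    have h1 : HasDerivAt (fun x => r + √x * z) (1 / (2 * √x) * z) x := by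
      simpa using ((Real.hasDerivAt_sqrt (by linarith : x ≠ 0)).mul_const z).const_add r
    exact (hf (r + √x * z)).comp x h1

/-! ### Steklov averages -/

/-- The Steklov average of `f` over `[r - m, r + m]`. -/
noncomputable def steklov (m : ℝ) (f : ℝ → ℝ) (r : ℝ) : ℝ :=
  (∫ y in (r - m)..(r + m), f y) / (2 * m)

/-- The symmetric difference quotient, which is the derivative of the Steklov average. -/
noncomputable def diffQuot (m : ℝ) (f : ℝ → ℝ) (r : ℝ) : ℝ := (f (r + m) - f (r - m)) / (2 * m)

/-- The twice iterated Steklov average, a `C²` approximation of a continuous function. -/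
noncomputable def smooth (m : ℝ) (f : ℝ → ℝ) : ℝ → ℝ := steklov m (steklov m f)

/-- The derivative of `smooth m f`. -/
noncomputable def smoothD (m : ℝ) (f : ℝ → ℝ) : ℝ → ℝ := diffQuot m (steklov m f)

/-- The second derivative of `smooth m f`. -/
noncomputable def smoothDD (m : ℝ) (f : ℝ → ℝ) : ℝ → ℝ := diffQuot m (diffQuot m f)

lemma continuous_steklov_param {X : Type*} [TopologicalSpace X] [FirstCountableTopology X]
    {F : X → ℝ → ℝ} (hF : Continuous (Function.uncurry F)) {ρ : X → ℝ} (hρ : Continuous ρ) (m : ℝ) :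
    Continuous fun x => steklov m (F x) (ρ x) := by
  have h : ∀ x, steklov m (F x) (ρ x)
      = ((∫ y in (0 : ℝ)..(ρ x + m), F x y) - ∫ y in (0 : ℝ)..(ρ x - m), F x y) / (2 * m) := by
    intro x
    have hx : Continuous (F x) := hF.comp (by fun_prop : Continuous fun y => (x, y))
    rw [steklov, intervalIntegral.integral_interval_sub_left (hx.intervalIntegrable _ _)
      (hx.intervalIntegrable _ _)]
  simp only [h]
  refine Continuous.div_const (Continuous.sub ?_ ?_) _
  · exact intervalIntegral.continuous_parametric_intervalIntegral_of_continuous hF (by fun_prop)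
  · exact intervalIntegral.continuous_parametric_intervalIntegral_of_continuous hF (by fun_prop)

lemma continuous_steklov {f : ℝ → ℝ} (hf : Continuous f) (m : ℝ) : Continuous (steklov m f) :=
  continuous_steklov_param (F := fun _ : ℝ => f) (hf.comp continuous_snd) continuous_id m

lemma continuous_diffQuot {f : ℝ → ℝ} (hf : Continuous f) (m : ℝ) : Continuous (diffQuot m f) := by
  unfold diffQuot
  fun_prop

lemma hasDerivAt_steklov {f : ℝ → ℝ} (hf : Continuous f) (m r : ℝ) :
    HasDerivAt (steklov m f) (diffQuot m f r) r := by
  have h : steklov m f = fun r =>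
      ((∫ y in (0 : ℝ)..(r + m), f y) - ∫ y in (0 : ℝ)..(r - m), f y) / (2 * m) := by
    ext r
    rw [steklov, intervalIntegral.integral_interval_sub_left (hf.intervalIntegrable _ _)
      (hf.intervalIntegrable _ _)]
  rw [h]
  have d : ∀ x, HasDerivAt (fun u => ∫ y in (0 : ℝ)..u, f y) (f x) x := fun x =>
    intervalIntegral.integral_hasDerivAt_right (hf.intervalIntegrable _ _)
      hf.aestronglyMeasurable.stronglyMeasurableAtFilter hf.continuousAt
  exact (((d (r + m)).comp_add_const r m).sub ((d (r - m)).comp_sub_const r m)).div_const _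

lemma hasDerivAt_diffQuot {f f' : ℝ → ℝ} (hf : ∀ z, HasDerivAt f (f' z) z) (m r : ℝ) :
    HasDerivAt (diffQuot m f) (diffQuot m f' r) r :=
  (((hf (r + m)).comp_add_const r m).sub ((hf (r - m)).comp_sub_const r m)).div_const _

lemma abs_steklov_le {f : ℝ → ℝ} {C : ℝ} (hC : ∀ z, |f z| ≤ C) {m : ℝ} (hm : 0 < m) (r : ℝ) :
    |steklov m f r| ≤ C := by
  rw [steklov, abs_div, abs_of_pos (by positivity : 0 < 2 * m), div_le_iff₀ (by positivity)]
  have := intervalIntegral.norm_integral_le_of_norm_le_const (a := r - m) (b := r + m) (f := f)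
    (C := C) (fun x _ => hC x)
  rwa [Real.norm_eq_abs, show r + m - (r - m) = 2 * m by ring,
    abs_of_pos (by positivity : 0 < 2 * m)] at this

lemma abs_diffQuot_le {f : ℝ → ℝ} {C : ℝ} (hC : ∀ z, |f z| ≤ C) {m : ℝ} (hm : 0 < m) (r : ℝ) :
    |diffQuot m f r| ≤ C / m := by
  rw [diffQuot, abs_div, abs_of_pos (by positivity : 0 < 2 * m), div_le_div_iff₀ (by positivity) hm]
  have := abs_sub (f (r + m)) (f (r - m))
  nlinarith [hC (r + m), hC (r - m)]

lemma steklov_sub {f g : ℝ → ℝ} (hf : Continuous f) (hg : Continuous g) (m r : ℝ) :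
    steklov m (fun y => f y - g y) r = steklov m f r - steklov m g r := by
  rw [steklov, intervalIntegral.integral_sub (hf.intervalIntegrable _ _)
    (hg.intervalIntegrable _ _), sub_div]
  rfl

lemma steklov_odd {f : ℝ → ℝ} {a : ℝ} (hf : ∀ y, f (2 * a - y) = - f y) (m r : ℝ) :
    steklov m f (2 * a - r) = - steklov m f r := by
  unfold steklov
  have := intervalIntegral.integral_comp_sub_left (a := r - m) (b := r + m) f (2 * a)
  simp only [hf, intervalIntegral.integral_neg] at this
  rw [show 2 * a - r - m = 2 * a - (r + m) by ring, show 2 * a - r + m = 2 * a - (r - m) by ring,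
    ← this, neg_div]

lemma steklov_shift (f : ℝ → ℝ) (m r d : ℝ) :
    steklov m (fun y => f (y + d)) r = steklov m f (r + d) := by
  unfold steklov
  rw [intervalIntegral.integral_comp_add_right (fun y => f y)]
  congr 2 <;> ring

lemma abs_steklov_sub_self_le {f : ℝ → ℝ} (hf : Continuous f) {m : ℝ} (hm : 0 < m) {e : ℝ} (r : ℝ)
    (he : ∀ y, |y - r| ≤ m → |f y - f r| ≤ e) : |steklov m f r - f r| ≤ e := by
  have h : steklov m f r - f r = (∫ y in (r - m)..(r + m), (f y - f r)) / (2 * m) := by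
    rw [intervalIntegral.integral_sub (hf.intervalIntegrable _ _)
      (intervalIntegrable_const), intervalIntegral.integral_const, steklov]
    simp only [smul_eq_mul]
    field_simp
    ring
  rw [h, abs_div, abs_of_pos (by positivity : 0 < 2 * m), div_le_iff₀ (by positivity)]
  have := intervalIntegral.norm_integral_le_of_norm_le_const (a := r - m) (b := r + m)
    (f := fun y => f y - f r) (C := e) (fun x hx => by
      rw [uIoc_of_le (by linarith)] at hx
      exact he x (abs_le.2 ⟨by linarith [hx.1], by linarith [hx.2]⟩))
  rwa [Real.norm_eq_abs, show r + m - (r - m) = 2 * m by ring,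
    abs_of_pos (by positivity : 0 < 2 * m)] at this

/-- Steklov averages do not increase the modulus of continuity. -/
lemma steklov_modulus {f : ℝ → ℝ} (hf : Continuous f) {m : ℝ} (hm : 0 < m) {η e : ℝ}
    (he : ∀ y y', |y - y'| ≤ η → |f y - f y'| ≤ e) (y y' : ℝ) (hy : |y - y'| ≤ η) :
    |steklov m f y - steklov m f y'| ≤ e := by
  have h1 : steklov m f y = steklov m (fun z => f (z + (y - y'))) y' := by
    rw [steklov_shift]
    congr 1
    ring
  rw [h1, ← steklov_sub (by fun_prop) hf]
  exact abs_steklov_le (fun z => he _ _ (by simpa using hy)) hm _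

lemma abs_smooth_sub_self_le {f : ℝ → ℝ} (hf : Continuous f) {m : ℝ} (hm : 0 < m) {e : ℝ}
    (he : ∀ y y', |y - y'| ≤ m → |f y - f y'| ≤ e) (r : ℝ) : |smooth m f r - f r| ≤ 2 * e := by
  have h1 := abs_steklov_sub_self_le hf hm r (fun y hy => he y r hy)
  have h2 := abs_steklov_sub_self_le (continuous_steklov hf m) hm r
    (fun y hy => steklov_modulus hf hm he y r hy)
  calc |smooth m f r - f r| = |(smooth m f r - steklov m f r) + (steklov m f r - f r)| := by ring_nf
    _ ≤ _ := abs_add_le _ _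
    _ ≤ 2 * e := by unfold smooth; linarith

lemma continuous_smooth_param {X : Type*} [TopologicalSpace X] [FirstCountableTopology X]
    {F : X → ℝ → ℝ} (hF : Continuous (Function.uncurry F)) (m : ℝ) :
    Continuous (Function.uncurry fun x => smooth m (F x)) := by
  have h1 : Continuous (Function.uncurry fun x => steklov m (F x)) :=
    continuous_steklov_param (X := X × ℝ) (F := fun p => F p.1) (ρ := fun p => p.2)
      (hF.comp (by fun_prop : Continuous fun p : (X × ℝ) × ℝ => (p.1.1, p.2))) continuous_snd m
  exact continuous_steklov_param (X := X × ℝ) (F := fun p => steklov m (F p.1)) (ρ := fun p => p.2)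
      (h1.comp (by fun_prop : Continuous fun p : (X × ℝ) × ℝ => (p.1.1, p.2))) continuous_snd m

lemma continuous_diffQuot_param {X : Type*} [TopologicalSpace X]
    {F : X → ℝ → ℝ} (hF : Continuous (Function.uncurry F)) (m : ℝ) :
    Continuous (Function.uncurry fun x => diffQuot m (F x)) := by
  have h : ∀ a : ℝ, Continuous fun p : X × ℝ => F p.1 (p.2 + a) := fun a =>
    hF.comp (by fun_prop : Continuous fun p : X × ℝ => (p.1, p.2 + a))
  have := ((h m).sub (h (-m))).div_const (2 * m)
  exact this

lemma continuous_smoothD_param {X : Type*} [TopologicalSpace X] [FirstCountableTopology X]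
    {F : X → ℝ → ℝ} (hF : Continuous (Function.uncurry F)) (m : ℝ) :
    Continuous (Function.uncurry fun x => smoothD m (F x)) :=
  continuous_diffQuot_param (continuous_steklov_param (X := X × ℝ) (F := fun p => F p.1)
    (ρ := fun p => p.2)
    (hF.comp (by fun_prop : Continuous fun p : (X × ℝ) × ℝ => (p.1.1, p.2))) continuous_snd m) m

lemma continuous_smoothDD_param {X : Type*} [TopologicalSpace X]
    {F : X → ℝ → ℝ} (hF : Continuous (Function.uncurry F)) (m : ℝ) :
    Continuous (Function.uncurry fun x => smoothDD m (F x)) :=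
  continuous_diffQuot_param (continuous_diffQuot_param hF m) m

lemma hasDerivAt_smooth {f : ℝ → ℝ} (hf : Continuous f) (m r : ℝ) :
    HasDerivAt (smooth m f) (smoothD m f r) r :=
  hasDerivAt_steklov (continuous_steklov hf m) m r

lemma hasDerivAt_smoothD {f : ℝ → ℝ} (hf : Continuous f) (m r : ℝ) :
    HasDerivAt (smoothD m f) (smoothDD m f r) r :=
  hasDerivAt_diffQuot (hasDerivAt_steklov hf m) m r

lemma abs_smooth_le {f : ℝ → ℝ} {C : ℝ} (hC : ∀ z, |f z| ≤ C) {m : ℝ} (hm : 0 < m) (r : ℝ) :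
    |smooth m f r| ≤ C := abs_steklov_le (abs_steklov_le hC hm) hm r

lemma abs_smoothD_le {f : ℝ → ℝ} {C : ℝ} (hC : ∀ z, |f z| ≤ C) {m : ℝ} (hm : 0 < m) (r : ℝ) :
    |smoothD m f r| ≤ C / m := abs_diffQuot_le (abs_steklov_le hC hm) hm r

lemma abs_smoothDD_le {f : ℝ → ℝ} {C : ℝ} (hC : ∀ z, |f z| ≤ C) {m : ℝ} (hm : 0 < m) (r : ℝ) :
    |smoothDD m f r| ≤ C / m / m := abs_diffQuot_le (abs_diffQuot_le hC hm) hm r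

lemma smooth_odd {f : ℝ → ℝ} {a : ℝ} (hf : ∀ y, f (2 * a - y) = - f y) (m r : ℝ) :
    smooth m f (2 * a - r) = - smooth m f r :=
  steklov_odd (fun y => steklov_odd hf m y) m r

lemma smooth_sub {f g : ℝ → ℝ} (hf : Continuous f) (hg : Continuous g) (m r : ℝ) :
    smooth m (fun y => f y - g y) r = smooth m f r - smooth m g r := by
  unfold smooth
  rw [← steklov_sub (continuous_steklov hf m) (continuous_steklov hg m)]
  congr 1
  ext y
  exact steklov_sub hf hg m y

/-! ### The Duhamel integral -/

/-- The Duhamel integral `∫₀ᵗ P_{t-s} K_s ds`. -/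
noncomputable def duhamel (K : ℝ → ℝ → ℝ) (t r : ℝ) : ℝ := ∫ s in (0 : ℝ)..t, heat (t - s) (K s) r

lemma continuous_duhamel_integrand {K : ℝ → ℝ → ℝ} (hK : Continuous (Function.uncurry K)) {C : ℝ}
    (hC : ∀ s y, |K s y| ≤ C) :
    Continuous fun p : (ℝ × ℝ) × ℝ => heat (p.1.1 - p.2) (K p.2) p.1.2 :=
  continuous_heat (F := fun p : (ℝ × ℝ) × ℝ => K p.2) (τ := fun p => p.1.1 - p.2)
    (ρ := fun p => p.1.2)
    (hK.comp (by fun_prop : Continuous fun q : ((ℝ × ℝ) × ℝ) × ℝ => (q.1.2, q.2)))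
    (fun _ _ => hC _ _) (by fun_prop) (by fun_prop)

lemma continuous_duhamel {K : ℝ → ℝ → ℝ} (hK : Continuous (Function.uncurry K)) {C : ℝ}
    (hC : ∀ s y, |K s y| ≤ C) : Continuous (Function.uncurry (duhamel K)) :=
  intervalIntegral.continuous_parametric_intervalIntegral_of_continuous (X := ℝ × ℝ)
    (f := fun p s => heat (p.1 - s) (K s) p.2) (continuous_duhamel_integrand hK hC) continuous_fst

lemma continuous_duhamel_slice {K : ℝ → ℝ → ℝ} (hK : Continuous (Function.uncurry K)) {C : ℝ}
    (hC : ∀ s y, |K s y| ≤ C) (t r : ℝ) : Continuous fun s => heat (t - s) (K s) r :=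
  (continuous_duhamel_integrand hK hC).comp
    (by fun_prop : Continuous fun s : ℝ => (((t, r), s) : (ℝ × ℝ) × ℝ))

lemma duhamel_odd {K : ℝ → ℝ → ℝ} {a : ℝ} (hK : ∀ s y, K s (2 * a - y) = - K s y) (t r : ℝ) :
    duhamel K t (2 * a - r) = - duhamel K t r := by
  unfold duhamel
  rw [← intervalIntegral.integral_neg]
  congr 1
  ext s
  exact heat_odd (hK s) _ _

lemma abs_duhamel_le {K : ℝ → ℝ → ℝ} {C : ℝ}
    (hC : ∀ s y, |K s y| ≤ C) {t : ℝ} (ht : 0 ≤ t) (r : ℝ) : |duhamel K t r| ≤ C * t := by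
  have := intervalIntegral.norm_integral_le_of_norm_le_const (a := 0) (b := t)
    (f := fun s => heat (t - s) (K s) r) (C := C) (fun s _ => abs_heat_le (hC s) _ _)
  simpa [duhamel, abs_of_nonneg ht] using this

lemma hasDerivAt_duhamel {K K' : ℝ → ℝ → ℝ} (hK : Continuous (Function.uncurry K)) {C : ℝ}
    (hC : ∀ s y, |K s y| ≤ C) (hKK : ∀ s y, HasDerivAt (K s) (K' s y) y)
    (hK' : Continuous (Function.uncurry K')) {C' : ℝ} (hC' : ∀ s y, |K' s y| ≤ C') (t r : ℝ) :
    HasDerivAt (duhamel K t) (duhamel K' t r) r := by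
  have hc : ∀ s, Continuous (K' s) := fun s =>
    hK'.comp (by fun_prop : Continuous fun y : ℝ => (s, y))
  refine (intervalIntegral.hasDerivAt_integral_of_dominated_loc_of_deriv_le
    (F := fun r s => heat (t - s) (K s) r) (F' := fun r s => heat (t - s) (K' s) r)
    (bound := fun _ => C') (s := univ) univ_mem (Eventually.of_forall fun x => ?_) ?_ ?_
    (ae_of_all _ fun s _ x _ => ?_) intervalIntegrable_const (ae_of_all _ fun s _ x _ => ?_)).2
  · exact (continuous_duhamel_slice hK hC t x).aestronglyMeasurable
  · exact (continuous_duhamel_slice hK hC t r).intervalIntegrable _ _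
  · exact (continuous_duhamel_slice hK' hC' t r).aestronglyMeasurable
  · exact abs_heat_le (hC' s) _ _
  · exact hasDerivAt_heat (hKK s) (hC s) (hc s) (hC' s) _ _

/-- Fubini's theorem on a triangle. -/
lemma integral_triangle_swap {ψ : ℝ → ℝ → ℝ} (hψ : Continuous (Function.uncurry ψ)) {t : ℝ}
    (ht : 0 ≤ t) :
    ∫ s in (0 : ℝ)..t, ∫ τ in s..t, ψ s τ = ∫ τ in (0 : ℝ)..t, ∫ s in (0 : ℝ)..τ, ψ s τ := by
  have hsub : ∀ s, Continuous (ψ s) := fun s =>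
    hψ.comp (by fun_prop : Continuous fun y : ℝ => (s, y))
  have hsub' : ∀ τ, Continuous (fun s => ψ s τ) := fun τ =>
    hψ.comp (by fun_prop : Continuous fun s : ℝ => (s, τ))
  have e1 : ∀ s ∈ Ioc 0 t, ∫ τ in s..t, ψ s τ =
      ∫ τ in Ioc 0 t, (if s < τ then ψ s τ else 0) := by
    intro s hs
    rw [intervalIntegral.integral_of_le hs.2, ← integral_indicator measurableSet_Ioc,
      ← integral_indicator measurableSet_Ioc]
    congr 1
    ext τ
    by_cases h : s < τ
    · have : 0 < τ := hs.1.trans h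
      simp [indicator, h, this]
    · simp [indicator, h]
  have e2 : ∀ τ ∈ Ioc 0 t, ∫ s in (0 : ℝ)..τ, ψ s τ =
      ∫ s in Ioc 0 t, (if s < τ then ψ s τ else 0) := by
    intro τ hτ
    rw [intervalIntegral.integral_of_le hτ.1.le, integral_Ioc_eq_integral_Ioo,
      ← integral_indicator measurableSet_Ioo,
      ← integral_indicator measurableSet_Ioc]
    congr 1
    ext s
    by_cases h : s < τ
    · have : s ≤ t := h.le.trans hτ.2
      simp [indicator, h, this]
    · simp [indicator, h]
  rw [intervalIntegral.integral_of_le ht, intervalIntegral.integral_of_le ht,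
    setIntegral_congr_fun measurableSet_Ioc e1, setIntegral_congr_fun measurableSet_Ioc e2]
  refine integral_integral_swap ?_
  obtain ⟨C, hC⟩ := (isCompact_Icc.prod isCompact_Icc :
    IsCompact (Icc (0 : ℝ) t ×ˢ Icc (0 : ℝ) t)).exists_bound_of_continuousOn
    hψ.continuousOn
  rw [Measure.prod_restrict]
  have : IsFiniteMeasure ((volume.prod volume).restrict (Ioc (0 : ℝ) t ×ˢ Ioc (0 : ℝ) t)) := by
    constructor
    simp [Measure.prod_prod, ENNReal.mul_lt_top]
  refine Integrable.of_bound (C := |C|) ?_ ?_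
  · refine Measurable.aestronglyMeasurable ?_
    exact Measurable.ite (measurableSet_lt measurable_fst measurable_snd) hψ.measurable
      measurable_const
  · refine (ae_restrict_iff' (measurableSet_Ioc.prod measurableSet_Ioc)).2 (ae_of_all _ ?_)
    rintro ⟨s, τ⟩ ⟨h1, h2⟩
    have := hC (s, τ) ⟨Ioc_subset_Icc_self h1, Ioc_subset_Icc_self h2⟩
    simp only [Function.uncurry] at this ⊢
    split_ifs
    · exact this.trans (le_abs_self C)
    · simp

/-- The Duhamel integral solves the inhomogeneous heat equation. -/
lemma duhamel_eq_integral {K K' K'' : ℝ → ℝ → ℝ} (hK : Continuous (Function.uncurry K)) {C : ℝ}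
    (hC : ∀ s y, |K s y| ≤ C) (hKK : ∀ s y, HasDerivAt (K s) (K' s y) y)
    {C' : ℝ} (hC' : ∀ s y, |K' s y| ≤ C')
    (hKK' : ∀ s y, HasDerivAt (K' s) (K'' s y) y)
    (hK'' : Continuous (Function.uncurry K'')) {C'' : ℝ} (hC'' : ∀ s y, |K'' s y| ≤ C'')
    {t : ℝ} (ht : 0 ≤ t) (r : ℝ) :
    duhamel K t r = ∫ τ in (0 : ℝ)..t, (duhamel K'' τ r / 2 + K τ r) := by
  have hc : ∀ s, Continuous (K'' s) := fun s =>
    hK''.comp (by fun_prop : Continuous fun y : ℝ => (s, y))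
  have hψ : Continuous (Function.uncurry fun s τ => heat (τ - s) (K'' s) r / 2) :=
    ((continuous_duhamel_integrand hK'' hC'').comp
      (by fun_prop : Continuous fun p : ℝ × ℝ => (((p.2, r), p.1) : (ℝ × ℝ) × ℝ))).div_const 2
  have hKr : Continuous fun s => K s r := hK.comp (by fun_prop : Continuous fun s : ℝ => (s, r))
  have h1 : ∀ s ∈ uIcc 0 t, heat (t - s) (K s) r
      = K s r + ∫ τ in s..t, heat (τ - s) (K'' s) r / 2 := by
    intro s hs
    rw [uIcc_of_le ht] at hs
    have := heat_sub_self (hKK s) (hC s) (hKK' s) (hC' s) (hc s) (hC'' s)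
      (sub_nonneg.2 hs.2) r
    have h2 := intervalIntegral.integral_comp_sub_right (a := s) (b := t)
      (fun σ => heat σ (K'' s) r / 2) s
    rw [sub_self] at h2
    rw [h2, ← this]
    ring
  have hi : Continuous fun s => ∫ τ in s..t, heat (τ - s) (K'' s) r / 2 := by
    have : ∀ s, ∫ τ in s..t, heat (τ - s) (K'' s) r / 2
        = -∫ τ in t..s, heat (τ - s) (K'' s) r / 2 := fun s =>
      intervalIntegral.integral_symm _ _
    simp only [this]
    exact (intervalIntegral.continuous_parametric_intervalIntegral_of_continuous
      (f := fun s τ => heat (τ - s) (K'' s) r / 2) hψ continuous_id).neg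
  rw [duhamel, intervalIntegral.integral_congr h1, intervalIntegral.integral_add
    (hKr.intervalIntegrable _ _) (hi.intervalIntegrable _ _),
    integral_triangle_swap (ψ := fun s τ => heat (τ - s) (K'' s) r / 2) hψ ht,
    intervalIntegral.integral_add _ (hKr.intervalIntegrable _ _), add_comm]
  · congr 1
    refine intervalIntegral.integral_congr fun τ _ => ?_
    simp only [duhamel, intervalIntegral.integral_div]
  · exact (((continuous_duhamel hK'' hC'').comp
      (by fun_prop : Continuous fun τ : ℝ => (τ, r))).div_const 2).intervalIntegrable _ _

lemma duhamel_eq_reverse (K : ℝ → ℝ → ℝ) (t r : ℝ) :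
    duhamel K t r = ∫ σ in (0 : ℝ)..t, heat σ (K (t - σ)) r := by
  have := intervalIntegral.integral_comp_sub_left (a := 0) (b := t)
    (fun s => heat (t - s) (K s) r) t
  simp only [sub_sub_cancel, sub_self, sub_zero] at this
  rw [duhamel, ← this]

/-- The Duhamel integral of a bounded source has a gradient bounded in terms of the sup norm of the
source only. -/
lemma abs_duhamel_deriv_le {K K' : ℝ → ℝ → ℝ} {C : ℝ}
    (hC : ∀ s y, |K s y| ≤ C) (hKK : ∀ s y, HasDerivAt (K s) (K' s y) y)
    (hK' : Continuous (Function.uncurry K')) {C' : ℝ} (hC' : ∀ s y, |K' s y| ≤ C') {t : ℝ}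
    (ht : 0 ≤ t) (r : ℝ) : |duhamel K' t r| ≤ 2 * C * √t := by
  have hc : ∀ s, Continuous (K' s) := fun s =>
    hK'.comp (by fun_prop : Continuous fun y : ℝ => (s, y))
  rw [duhamel_eq_reverse]
  have := intervalIntegral.norm_integral_le_of_norm_le (a := 0) (b := t) (μ := volume)
    (f := fun σ => heat σ (K' (t - σ)) r) (g := fun σ => C * σ ^ (-(1 / 2) : ℝ)) ht
    (ae_of_all _ fun σ hσ => ?_)
    ((intervalIntegral.intervalIntegrable_rpow' (by norm_num)).const_mul _)
  · rw [intervalIntegral.integral_const_mul, integral_rpow (Or.inl (by norm_num))] at this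
    refine this.trans (le_of_eq ?_)
    norm_num
    rw [Real.sqrt_eq_rpow]
    ring
  · have h1 := abs_heat_deriv_le (hKK (t - σ)) (hC _) (hc _) (hC' _) σ r
    have hs : 0 < √σ := Real.sqrt_pos.2 hσ.1
    rw [Real.rpow_neg hσ.1.le, ← Real.sqrt_eq_rpow, Real.norm_eq_abs, ← div_eq_mul_inv,
      le_div_iff₀ hs]
    linarith

lemma abs_duhamel_sub_le {K K' : ℝ → ℝ → ℝ} (hK : Continuous (Function.uncurry K)) {C : ℝ}
    (hC : ∀ s y, |K s y| ≤ C) (hKK : ∀ s y, HasDerivAt (K s) (K' s y) y)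
    (hK' : Continuous (Function.uncurry K')) {C' : ℝ} (hC' : ∀ s y, |K' s y| ≤ C') {t : ℝ}
    (ht : 0 ≤ t) (r r' : ℝ) : |duhamel K t r - duhamel K t r'| ≤ 2 * C * √t * |r - r'| := by
  have := Convex.norm_image_sub_le_of_norm_hasDerivWithin_le (f := duhamel K t)
    (f' := duhamel K' t) (s := univ) (C := 2 * C * √t) (x := r') (y := r)
    (fun x _ => (hasDerivAt_duhamel hK hC hKK hK' hC' t x).hasDerivWithinAt)
    (fun x _ => abs_duhamel_deriv_le hC hKK hK' hC' ht x) convex_univ (mem_univ _) (mem_univ _)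
  exact this

/-- The gradient of the Duhamel integral of a bounded source is Hölder continuous in space, with
a constant depending on the sup norm of the source only. -/
lemma abs_duhamel_deriv_sub_le {K K' K'' : ℝ → ℝ → ℝ} {C : ℝ}
    (hC : ∀ s y, |K s y| ≤ C) (hKK : ∀ s y, HasDerivAt (K s) (K' s y) y)
    (hK' : Continuous (Function.uncurry K')) {C' : ℝ} (hC' : ∀ s y, |K' s y| ≤ C')
    (hKK' : ∀ s y, HasDerivAt (K' s) (K'' s y) y)
    (hK'' : Continuous (Function.uncurry K'')) {C'' : ℝ} (hC'' : ∀ s y, |K'' s y| ≤ C'')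
    {t : ℝ} (ht : 0 ≤ t) (r r' : ℝ) :
    |duhamel K' t r - duhamel K' t r'| ≤ 8 * C * t ^ (1 / 4 : ℝ) * √|r - r'| := by
  have hc : ∀ s, Continuous (K' s) := fun s =>
    hK'.comp (by fun_prop : Continuous fun y : ℝ => (s, y))
  have hc' : ∀ s, Continuous (K'' s) := fun s =>
    hK''.comp (by fun_prop : Continuous fun y : ℝ => (s, y))
  have hC0 : 0 ≤ C := (abs_nonneg _).trans (hC 0 0)
  have hcs : ∀ r, Continuous fun σ => heat σ (K' (t - σ)) r := fun r =>
    continuous_heat (F := fun σ => K' (t - σ)) (τ := fun σ => σ) (ρ := fun _ => r)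
      (hK'.comp (by fun_prop : Continuous fun q : ℝ × ℝ => (t - q.1, q.2)))
      (fun _ _ => hC' _ _) (by fun_prop) (by fun_prop)
  rw [duhamel_eq_reverse, duhamel_eq_reverse, ← intervalIntegral.integral_sub
    ((hcs r).intervalIntegrable _ _) ((hcs r').intervalIntegrable _ _)]
  have := intervalIntegral.norm_integral_le_of_norm_le (a := 0) (b := t) (μ := volume)
    (f := fun σ => heat σ (K' (t - σ)) r - heat σ (K' (t - σ)) r')
    (g := fun σ => 2 * C * √|r - r'| * σ ^ (-(3 / 4) : ℝ)) ht
    (ae_of_all _ fun σ hσ => ?_)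
    ((intervalIntegral.intervalIntegrable_rpow' (by norm_num)).const_mul _)
  · rw [intervalIntegral.integral_const_mul, integral_rpow (Or.inl (by norm_num))] at this
    refine this.trans (le_of_eq ?_)
    norm_num
    ring
  · have hσ0 : 0 < σ := hσ.1
    have hs : 0 < √σ := Real.sqrt_pos.2 hσ0
    have a1 := abs_heat_deriv_le (hKK (t - σ)) (hC _) (hc _) (hC' _) σ r
    have a2 := abs_heat_deriv_le (hKK (t - σ)) (hC _) (hc _) (hC' _) σ r'
    set A := heat σ (K' (t - σ)) r - heat σ (K' (t - σ)) r'
    have b1 : √σ * |A| ≤ 2 * C := by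
      have := abs_sub (heat σ (K' (t - σ)) r) (heat σ (K' (t - σ)) r')
      nlinarith
    have b2 : σ * |A| ≤ 2 * C * |r - r'| := by
      have := Convex.norm_image_sub_le_of_norm_hasDerivWithin_le (f := heat σ (K' (t - σ)))
        (f' := heat σ (K'' (t - σ))) (s := univ) (C := 2 * C / σ) (x := r') (y := r)
        (fun x _ => (hasDerivAt_heat (hKK' (t - σ)) (hC' _) (hc' _) (hC'' _) σ x).hasDerivWithinAt)
        (fun x _ => by
          rw [le_div_iff₀ hσ0, mul_comm]
          exact abs_heat_deriv2_le (hKK _) (hC _) (hKK' _) (hC' _) (hc' _) (hC'' _) hσ0 x)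
        convex_univ (mem_univ _) (mem_univ _)
      rw [Real.norm_eq_abs, Real.norm_eq_abs, div_mul_eq_mul_div, le_div_iff₀ hσ0] at this
      linarith
    -- the geometric mean of the two bounds is integrable in `σ`
    have e1 : σ ^ (3 / 4 : ℝ) * σ ^ (3 / 4 : ℝ) = √σ * σ := by
      rw [Real.sqrt_eq_rpow, ← Real.rpow_add hσ0]
      nth_rw 3 [← Real.rpow_one σ]
      rw [← Real.rpow_add hσ0]
      norm_num
    have hp : 0 < σ ^ (3 / 4 : ℝ) := Real.rpow_pos_of_pos hσ0 _
    rw [Real.rpow_neg hσ0.le, ← div_eq_mul_inv, le_div_iff₀ hp, Real.norm_eq_abs]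
    refine abs_le_of_sq_le_sq' ?_ (by positivity) |>.2
    calc (|A| * σ ^ (3 / 4 : ℝ)) ^ 2 = |A| ^ 2 * (σ ^ (3 / 4 : ℝ) * σ ^ (3 / 4 : ℝ)) := by ring
      _ = (√σ * |A|) * (σ * |A|) := by rw [e1]; ring
      _ ≤ (2 * C) * (2 * C * |r - r'|) := mul_le_mul b1 b2 (by positivity) (by positivity)
      _ = (2 * C * √|r - r'|) ^ 2 := by
        rw [mul_pow, Real.sq_sqrt (abs_nonneg _)]
        ring

/-! ### Odd periodic extension -/

/-- The distance of a real number to the even integers. -/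
noncomputable def fold (y : ℝ) : ℝ := ‖(y : AddCircle (2 : ℝ))‖

/-- The `2`-periodic odd extension of a function on `[0, 1]` vanishing at both end points. -/
noncomputable def oddExt (f : ℝ → ℝ) (y : ℝ) : ℝ :=
  if 0 ≤ Real.sin (Real.pi * y) then f (fold y) else - f (fold y)

lemma fold_nonneg (y : ℝ) : 0 ≤ fold y := norm_nonneg _

lemma fold_le_one (y : ℝ) : fold y ≤ 1 := by
  have := AddCircle.norm_le_half_period (2 : ℝ) (x := (y : AddCircle (2 : ℝ))) two_ne_zero
  simpa [fold] using this

lemma fold_mem (y : ℝ) : fold y ∈ Icc (0 : ℝ) 1 := ⟨fold_nonneg y, fold_le_one y⟩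

lemma fold_of_abs_le {y : ℝ} (hy : |y| ≤ 1) : fold y = |y| := by
  have := (AddCircle.norm_coe_eq_abs_iff (2 : ℝ) (x := y) two_ne_zero).2 (by simpa using hy)
  exact this

lemma fold_of_mem {y : ℝ} (hy : y ∈ Icc (0 : ℝ) 1) : fold y = y := by
  rw [fold_of_abs_le (abs_le.2 ⟨by linarith [hy.1], hy.2⟩), abs_of_nonneg hy.1]

lemma fold_neg (y : ℝ) : fold (-y) = fold y := by
  simp [fold]

lemma fold_add_two_mul (y : ℝ) (k : ℤ) : fold (y + 2 * k) = fold y := by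
  unfold fold
  congr 1
  have : ((2 * k : ℝ) : AddCircle (2 : ℝ)) = 0 := by
    rw [AddCircle.coe_eq_zero_iff]
    exact ⟨k, by simp [mul_comm]⟩
  rw [AddCircle.coe_add, this, add_zero]

lemma abs_fold_sub_le (y y' : ℝ) : |fold y - fold y'| ≤ |y - y'| := by
  refine (abs_norm_sub_norm_le _ _).trans ?_
  rw [← AddCircle.coe_sub, AddCircle.norm_eq]
  have := round_le ((2 : ℝ)⁻¹ * (y - y')) 0
  simp only [Int.cast_zero, sub_zero] at this
  have e : y - y' - round ((2 : ℝ)⁻¹ * (y - y')) * 2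
      = 2 * ((2 : ℝ)⁻¹ * (y - y') - round ((2 : ℝ)⁻¹ * (y - y'))) := by ring
  rw [e, abs_mul]
  rw [abs_mul] at this
  norm_num at this ⊢
  linarith

@[fun_prop]
lemma continuous_fold : Continuous fold := by
  refine Metric.continuous_iff.2 fun y e he => ⟨e, he, fun y' h => ?_⟩
  rw [Real.dist_eq] at h ⊢
  exact (abs_fold_sub_le _ _).trans_lt h

lemma apply_fold_eq_zero {f : ℝ → ℝ} (h0 : f 0 = 0) (h1 : f 1 = 0) {y : ℝ}
    (hy : Real.sin (Real.pi * y) = 0) : f (fold y) = 0 := by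
  obtain ⟨n, hn⟩ := Real.sin_eq_zero_iff.1 hy
  have hy' : y = n := by
    have := Real.pi_ne_zero
    rw [mul_comm] at hn
    exact (mul_left_cancel₀ this hn).symm
  obtain ⟨k, hk | hk⟩ := Int.even_or_odd' n
  · have := fold_add_two_mul 0 k
    rw [zero_add, fold_of_mem (y := 0) (by simp)] at this
    rw [hy', hk]
    push_cast
    rw [this, h0]
  · have := fold_add_two_mul 1 k
    rw [fold_of_mem (y := 1) (by simp)] at this
    rw [hy', hk]
    push_cast
    rw [add_comm, this, h1]

lemma oddExt_of_mem {f : ℝ → ℝ} {y : ℝ} (hy : y ∈ Icc (0 : ℝ) 1) : oddExt f y = f y := by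
  have : 0 ≤ Real.sin (Real.pi * y) := by
    apply Real.sin_nonneg_of_nonneg_of_le_pi
    · exact mul_nonneg Real.pi_pos.le hy.1
    · nlinarith [Real.pi_pos, hy.2]
  rw [oddExt, if_pos this, fold_of_mem hy]

lemma oddExt_neg {f : ℝ → ℝ} (h0 : f 0 = 0) (h1 : f 1 = 0) (y : ℝ) :
    oddExt f (-y) = - oddExt f y := by
  unfold oddExt
  rw [mul_neg, Real.sin_neg, fold_neg]
  rcases lt_trichotomy (Real.sin (Real.pi * y)) 0 with h | h | h
  · rw [if_pos (by linarith), if_neg (by linarith)]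
    ring
  · simp [h, apply_fold_eq_zero h0 h1 h]
  · rw [if_neg (by linarith), if_pos h.le]

lemma oddExt_periodic (f : ℝ → ℝ) (y : ℝ) (k : ℤ) : oddExt f (y + 2 * k) = oddExt f y := by
  unfold oddExt
  rw [fold_add_two_mul]
  have : Real.sin (Real.pi * (y + 2 * k)) = Real.sin (Real.pi * y) := by
    rw [show Real.pi * (y + 2 * k) = Real.pi * y + k * (2 * Real.pi) by ring,
      Real.sin_add_int_mul_two_pi]
  rw [this]

lemma oddExt_odd_zero {f : ℝ → ℝ} (h0 : f 0 = 0) (h1 : f 1 = 0) (y : ℝ) :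
    oddExt f (2 * 0 - y) = - oddExt f y := by
  rw [show (2 : ℝ) * 0 - y = -y by ring, oddExt_neg h0 h1]

lemma oddExt_odd_one {f : ℝ → ℝ} (h0 : f 0 = 0) (h1 : f 1 = 0) (y : ℝ) :
    oddExt f (2 * 1 - y) = - oddExt f y := by
  have := oddExt_periodic f (-y) 1
  rw [oddExt_neg h0 h1] at this
  rw [← this]
  congr 1
  push_cast
  ring

lemma abs_oddExt_le {f : ℝ → ℝ} {C : ℝ} (hC : ∀ y ∈ Icc (0 : ℝ) 1, |f y| ≤ C) (y : ℝ) :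
    |oddExt f y| ≤ C := by
  unfold oddExt
  split_ifs
  · exact hC _ (fold_mem y)
  · rw [abs_neg]
    exact hC _ (fold_mem y)

lemma continuous_oddExt_param {X : Type*} [TopologicalSpace X] {F : X → ℝ → ℝ}
    (hF : Continuous (Function.uncurry F)) (h0 : ∀ x, F x 0 = 0) (h1 : ∀ x, F x 1 = 0) :
    Continuous (Function.uncurry fun x => oddExt (F x)) := by
  have hc : Continuous fun p : X × ℝ => F p.1 (fold p.2) :=
    hF.comp (by fun_prop : Continuous fun p : X × ℝ => (p.1, fold p.2))
  refine Continuous.if_le (f := fun _ : X × ℝ => (0 : ℝ))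
    (g := fun p : X × ℝ => Real.sin (Real.pi * p.2)) hc hc.neg
    continuous_const (by fun_prop) fun p hp => ?_
  have := apply_fold_eq_zero (h0 p.1) (h1 p.1) hp.symm
  simp [this]

lemma oddExt_modulus {f : ℝ → ℝ} (h0 : f 0 = 0) (h1 : f 1 = 0) {η e : ℝ}
    (he : ∀ a ∈ Icc (0 : ℝ) 1, ∀ b ∈ Icc (0 : ℝ) 1, |a - b| ≤ η → |f a - f b| ≤ e)
    (y y' : ℝ) (hy : |y - y'| ≤ η) : |oddExt f y - oddExt f y'| ≤ 2 * e := by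
  have he0 : 0 ≤ e := by
    have := he 0 (by simp) 0 (by simp) (by simpa using (abs_nonneg _).trans hy)
    simpa using this
  have hfold : ∀ z z', |z - z'| ≤ η → |f (fold z) - f (fold z')| ≤ e := fun z z' h =>
    he _ (fold_mem z) _ (fold_mem z') ((abs_fold_sub_le z z').trans h)
  -- across a sign change of the sine, there is a zero of `f ∘ fold` in between
  have cross : ∀ z z', |z - z'| ≤ η → 0 ≤ Real.sin (Real.pi * z) → Real.sin (Real.pi * z') < 0 →
      |f (fold z) + f (fold z')| ≤ 2 * e := by
    intro z z' h hz hz'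
    have hcont : ContinuousOn (fun x => Real.sin (Real.pi * x)) (uIcc z z') := by fun_prop
    have := intermediate_value_uIcc hcont
    obtain ⟨x, hx, hx0⟩ := this (show (0 : ℝ) ∈ uIcc (Real.sin (Real.pi * z))
      (Real.sin (Real.pi * z')) from mem_uIcc.2 (Or.inr ⟨hz'.le, hz⟩))
    have hfx := apply_fold_eq_zero h0 h1 hx0
    have d1 : |z - x| ≤ η := by
      have := abs_sub_left_of_mem_uIcc hx
      rw [abs_sub_comm] at this
      exact this.trans (by rwa [abs_sub_comm])
    have d2 : |z' - x| ≤ η := (abs_sub_right_of_mem_uIcc hx).trans (by rwa [abs_sub_comm])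
    have b1 := hfold _ _ d1
    have b2 := hfold _ _ d2
    rw [hfx, sub_zero] at b1 b2
    exact (abs_add_le _ _).trans (by linarith)
  unfold oddExt
  split_ifs with h h' h'
  · exact (hfold _ _ hy).trans (by linarith)
  · rw [sub_neg_eq_add]
    exact cross _ _ hy h (not_le.1 h')
  · have := cross _ _ (by rwa [abs_sub_comm] at hy) h' (not_le.1 h)
    rw [show -f (fold y) - f (fold y') = -(f (fold y') + f (fold y)) by ring, abs_neg]
    exact this
  · rw [show -f (fold y) - -f (fold y') = -(f (fold y) - f (fold y')) by ring, abs_neg]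
    exact (hfold _ _ hy).trans (by linarith)

/-! ### Approximate solutions of the limiting equation -/

/-- The sign function smeared out on `[-1, 1]`. -/
noncomputable def clamp (x : ℝ) : ℝ := max (-1) (min x 1)

lemma abs_clamp_le (x : ℝ) : |clamp x| ≤ 1 :=
  abs_le.2 ⟨le_max_left _ _, max_le (by norm_num) (min_le_right _ _)⟩

lemma abs_clamp_sub_le (x y : ℝ) : |clamp x - clamp y| ≤ |x - y| := by
  unfold clamp
  have h1 := abs_max_sub_max_le_max (-1 : ℝ) (min x 1) (-1) (min y 1)
  have h2 := abs_min_sub_min_le_max x 1 y 1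
  simp only [sub_self, abs_zero] at h1 h2
  rw [max_eq_right (abs_nonneg (min x 1 - min y 1))] at h1
  rw [max_eq_left (abs_nonneg (x - y))] at h2
  exact h1.trans h2

@[fun_prop]
lemma continuous_clamp : Continuous clamp := by
  unfold clamp
  fun_prop

lemma abs_sub_le_mul_clamp (x : ℝ) : |x| - 1 ≤ x * clamp x := by
  unfold clamp
  rcases le_total x (-1) with h | h
  · rw [min_eq_left (by linarith), max_eq_left h, abs_of_neg (by linarith)]
    linarith
  rcases le_total x 1 with h' | h'
  · rw [min_eq_left h', max_eq_right h]
    nlinarith [abs_le.2 ⟨h, h'⟩, mul_self_nonneg x]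
  · rw [min_eq_right h', max_eq_right (by norm_num), abs_of_pos (by linarith)]
    linarith

/-- A reference source, equal to `c` at `0` and vanishing at `1`. -/
noncomputable def refSource (c r : ℝ) : ℝ := c * (1 - r)

/-- The stationary solution of `½ V'' = j * refSource c` with `V 0 = M` and `V 1 = 0`. -/
noncomputable def refProfile (j M c r : ℝ) : ℝ :=
  M * (1 - r) + j * c / 3 * ((1 - r) ^ 3 - (1 - r))

/-- The derivative of `refProfile`. -/
noncomputable def refProfileD (j M c r : ℝ) : ℝ := -M + j * c / 3 * (1 - 3 * (1 - r) ^ 2)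

lemma hasDerivAt_refProfile (j M c r : ℝ) :
    HasDerivAt (refProfile j M c) (refProfileD j M c r) r := by
  have h : HasDerivAt (fun r : ℝ => 1 - r) (-1) r := by
    simpa using (hasDerivAt_id' r).const_sub 1
  refine ((h.const_mul M).add (((h.fun_pow 3).sub h).const_mul (j * c / 3))).congr_deriv ?_
  unfold refProfileD
  push_cast
  ring

lemma hasDerivAt_refProfileD (j M c r : ℝ) :
    HasDerivAt (refProfileD j M c) (2 * j * refSource c r) r := by
  have h : HasDerivAt (fun r : ℝ => 1 - r) (-1) r := by
    simpa using (hasDerivAt_id' r).const_sub 1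
  refine (((((h.fun_pow 2).const_mul 3).const_sub 1).const_mul (j * c / 3)).const_add
    (-M)).congr_deriv ?_
  unfold refSource
  push_cast
  ring

@[fun_prop]
lemma continuous_refSource (c : ℝ) : Continuous (refSource c) := by
  unfold refSource
  fun_prop

@[fun_prop]
lemma continuous_refProfile (j M c : ℝ) : Continuous (refProfile j M c) := by
  unfold refProfile
  fun_prop

@[fun_prop]
lemma continuous_refProfileD (j M c : ℝ) : Continuous (refProfileD j M c) := by
  unfold refProfileD
  fun_prop

/-- The sources admitted in the Duhamel formula: jointly continuous functions of time and space,
bounded by `2`, odd about `0` and about `1`. -/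
structure IsSource (k : ℝ → ℝ → ℝ) : Prop where
  continuous : Continuous (Function.uncurry k)
  bound : ∀ s y, |k s y| ≤ 2
  odd_zero : ∀ s y, k s (2 * 0 - y) = - k s y
  odd_one : ∀ s y, k s (2 * 1 - y) = - k s y

/-- Initial data for the heat equation: continuous bounded functions, odd about `0` and `1`. -/
structure IsDatum (X₀ : ℝ → ℝ) : Prop where
  continuous : Continuous X₀
  bounded : ∃ C, ∀ y, |X₀ y| ≤ C
  odd_zero : ∀ y, X₀ (2 * 0 - y) = - X₀ y
  odd_one : ∀ y, X₀ (2 * 1 - y) = - X₀ y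

/-- The solution of `∂ₜ X = ½ X'' - j k` with mollified datum `X₀` and mollified source `k`. -/
noncomputable def mildSol (j m : ℝ) (X₀ : ℝ → ℝ) (k : ℝ → ℝ → ℝ) (t r : ℝ) : ℝ :=
  heat t (smooth m X₀) r - j * duhamel (fun s => smooth m (k s)) t r

/-- The first space derivative of `mildSol`. -/
noncomputable def mildSolD (j m : ℝ) (X₀ : ℝ → ℝ) (k : ℝ → ℝ → ℝ) (t r : ℝ) : ℝ :=
  heat t (smoothD m X₀) r - j * duhamel (fun s => smoothD m (k s)) t r

/-- The second space derivative of `mildSol`. -/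
noncomputable def mildSolDD (j m : ℝ) (X₀ : ℝ → ℝ) (k : ℝ → ℝ → ℝ) (t r : ℝ) : ℝ :=
  heat t (smoothDD m X₀) r - j * duhamel (fun s => smoothDD m (k s)) t r

section MildSol

variable {j m : ℝ} {X₀ : ℝ → ℝ} {k : ℝ → ℝ → ℝ}

lemma IsSource.slice (hk : IsSource k) (s : ℝ) : Continuous (k s) :=
  hk.continuous.comp (by fun_prop : Continuous fun y : ℝ => (s, y))

lemma continuous_heat_uncurry {f : ℝ → ℝ} (hf : Continuous f) {C : ℝ} (hC : ∀ y, |f y| ≤ C) :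
    Continuous (Function.uncurry fun t r => heat t f r) :=
  continuous_heat (X := ℝ × ℝ) (F := fun _ => f) (τ := fun p => p.1) (ρ := fun p => p.2)
    (hf.comp continuous_snd) (fun _ => hC) continuous_fst continuous_snd

lemma continuous_mildSol (hX : IsDatum X₀) (hk : IsSource k) (hm : 0 < m) :
    Continuous (Function.uncurry (mildSol j m X₀ k)) := by
  obtain ⟨C, hC⟩ := hX.bounded
  exact (continuous_heat_uncurry (continuous_steklov (continuous_steklov hX.continuous m) m)
    (abs_smooth_le hC hm)).sub ((continuous_duhamel (continuous_smooth_param hk.continuous m)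
      (fun s => abs_smooth_le (hk.bound s) hm)).const_mul j)

lemma continuous_mildSolDD (hX : IsDatum X₀) (hk : IsSource k) (hm : 0 < m) :
    Continuous (Function.uncurry (mildSolDD j m X₀ k)) := by
  obtain ⟨C, hC⟩ := hX.bounded
  exact (continuous_heat_uncurry (continuous_diffQuot (continuous_diffQuot hX.continuous m) m)
    (abs_smoothDD_le hC hm)).sub ((continuous_duhamel (continuous_smoothDD_param hk.continuous m)
      (fun s => abs_smoothDD_le (hk.bound s) hm)).const_mul j)

lemma continuous_mildSolD (hX : IsDatum X₀) (hk : IsSource k) (hm : 0 < m) :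
    Continuous (Function.uncurry (mildSolD j m X₀ k)) := by
  obtain ⟨C, hC⟩ := hX.bounded
  exact (continuous_heat_uncurry (continuous_diffQuot (continuous_steklov hX.continuous m) m)
    (abs_smoothD_le hC hm)).sub ((continuous_duhamel (continuous_smoothD_param hk.continuous m)
      (fun s => abs_smoothD_le (hk.bound s) hm)).const_mul j)

lemma hasDerivAt_mildSol (hX : IsDatum X₀) (hk : IsSource k) (hm : 0 < m) (t r : ℝ) :
    HasDerivAt (mildSol j m X₀ k t) (mildSolD j m X₀ k t r) r := by
  obtain ⟨C, hC⟩ := hX.bounded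
  exact (hasDerivAt_heat (hasDerivAt_smooth hX.continuous m) (abs_smooth_le hC hm)
    (continuous_diffQuot (continuous_steklov hX.continuous m) m) (abs_smoothD_le hC hm) t r).sub
    ((hasDerivAt_duhamel (continuous_smooth_param hk.continuous m)
      (fun s => abs_smooth_le (hk.bound s) hm) (fun s => hasDerivAt_smooth (hk.slice s) m)
      (continuous_smoothD_param hk.continuous m) (fun s => abs_smoothD_le (hk.bound s) hm)
      t r).const_mul j)

lemma hasDerivAt_mildSolD (hX : IsDatum X₀) (hk : IsSource k) (hm : 0 < m) (t r : ℝ) :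
    HasDerivAt (mildSolD j m X₀ k t) (mildSolDD j m X₀ k t r) r := by
  obtain ⟨C, hC⟩ := hX.bounded
  exact (hasDerivAt_heat (hasDerivAt_smoothD hX.continuous m) (abs_smoothD_le hC hm)
    (continuous_diffQuot (continuous_diffQuot hX.continuous m) m) (abs_smoothDD_le hC hm) t r).sub
    ((hasDerivAt_duhamel (continuous_smoothD_param hk.continuous m)
      (fun s => abs_smoothD_le (hk.bound s) hm) (fun s => hasDerivAt_smoothD (hk.slice s) m)
      (continuous_smoothDD_param hk.continuous m) (fun s => abs_smoothDD_le (hk.bound s) hm)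
      t r).const_mul j)

lemma mildSol_zero (r : ℝ) : mildSol j m X₀ k 0 r = smooth m X₀ r := by
  simp [mildSol, heat_zero, duhamel]

/-- The equation solved by `mildSol`, integrated in time. -/
lemma mildSol_eq_integral (hX : IsDatum X₀) (hk : IsSource k) (hm : 0 < m) {t : ℝ} (ht : 0 ≤ t)
    (r : ℝ) : mildSol j m X₀ k t r = smooth m X₀ r
      + ∫ s in (0 : ℝ)..t, (mildSolDD j m X₀ k s r / 2 - j * smooth m (k s) r) := by
  obtain ⟨C, hC⟩ := hX.bounded
  have e1 := heat_sub_self (hasDerivAt_smooth hX.continuous m) (abs_smooth_le hC hm)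
    (hasDerivAt_smoothD hX.continuous m) (abs_smoothD_le hC hm)
    (continuous_diffQuot (continuous_diffQuot hX.continuous m) m) (abs_smoothDD_le hC hm) ht r
  have e2 := duhamel_eq_integral (continuous_smooth_param hk.continuous m)
      (fun s => abs_smooth_le (hk.bound s) hm) (fun s => hasDerivAt_smooth (hk.slice s) m)
      (fun s => abs_smoothD_le (hk.bound s) hm) (fun s => hasDerivAt_smoothD (hk.slice s) m)
      (continuous_smoothDD_param hk.continuous m) (fun s => abs_smoothDD_le (hk.bound s) hm) ht r
  have c1 : Continuous fun s => heat s (smoothDD m X₀) r :=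
    (continuous_heat_uncurry (continuous_diffQuot (continuous_diffQuot hX.continuous m) m)
      (abs_smoothDD_le hC hm)).comp (by fun_prop : Continuous fun s : ℝ => (s, r))
  have c2 : Continuous fun s => duhamel (fun s => smoothDD m (k s)) s r :=
    (continuous_duhamel (continuous_smoothDD_param hk.continuous m)
      (fun s => abs_smoothDD_le (hk.bound s) hm)).comp
      (by fun_prop : Continuous fun s : ℝ => (s, r))
  have c3 : Continuous fun s => smooth m (k s) r :=
    (continuous_smooth_param hk.continuous m).comp (by fun_prop : Continuous fun s : ℝ => (s, r))
  have e3 : ∀ s, mildSolDD j m X₀ k s r / 2 - j * smooth m (k s) r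
      = heat s (smoothDD m X₀) r / 2
        - j * (duhamel (fun s => smoothDD m (k s)) s r / 2 + smooth m (k s) r) := by
    intro s
    unfold mildSolDD
    ring
  have c4 : Continuous fun s =>
      j * (duhamel (fun s => smoothDD m (k s)) s r / 2 + smooth m (k s) r) := by fun_prop
  simp only [e3]
  rw [intervalIntegral.integral_sub ((c1.div_const 2).intervalIntegrable _ _)
    (c4.intervalIntegrable _ _),
    intervalIntegral.integral_const_mul, ← e1, ← e2]
  unfold mildSol
  ring

lemma mildSol_odd (hX : IsDatum X₀) (hk : IsSource k) (t r : ℝ) :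
    mildSol j m X₀ k t (2 * 0 - r) = - mildSol j m X₀ k t r ∧
    mildSol j m X₀ k t (2 * 1 - r) = - mildSol j m X₀ k t r := by
  unfold mildSol
  constructor
  · rw [heat_odd (smooth_odd hX.odd_zero m), duhamel_odd fun s => smooth_odd (hk.odd_zero s) m]
    ring
  · rw [heat_odd (smooth_odd hX.odd_one m), duhamel_odd fun s => smooth_odd (hk.odd_one s) m]
    ring

lemma mildSol_at_zero (hX : IsDatum X₀) (hk : IsSource k) (t : ℝ) : mildSol j m X₀ k t 0 = 0 := by
  have := (mildSol_odd (j := j) (m := m) hX hk t 0).1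
  norm_num at this
  linarith

lemma mildSol_at_one (hX : IsDatum X₀) (hk : IsSource k) (t : ℝ) : mildSol j m X₀ k t 1 = 0 := by
  have := (mildSol_odd (j := j) (m := m) hX hk t 1).2
  norm_num at this
  linarith

lemma abs_mildSol_le (hj : 0 < j) (hk : IsSource k) (hm : 0 < m) {C : ℝ}
    (hC : ∀ y, |X₀ y| ≤ C) {t : ℝ} (ht : 0 ≤ t) (r : ℝ) :
    |mildSol j m X₀ k t r| ≤ C + 2 * j * t := by
  have h1 := abs_heat_le (abs_smooth_le hC hm) t r
  have h2 := abs_duhamel_le (fun s => abs_smooth_le (hk.bound s) hm) ht r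
  unfold mildSol
  refine (abs_sub _ _).trans ?_
  rw [abs_mul, abs_of_pos hj]
  nlinarith

lemma heat_modulus {f : ℝ → ℝ} (hf : Continuous f) {C : ℝ} (hC : ∀ y, |f y| ≤ C) {η e : ℝ}
    (he : ∀ y y', |y - y'| ≤ η → |f y - f y'| ≤ e) (t y y' : ℝ) (hy : |y - y'| ≤ η) :
    |heat t f y - heat t f y'| ≤ e := by
  have h1 : heat t f y = heat t (fun z => f (z + (y - y'))) y' := by
    unfold heat
    congr 1
    ext z
    congr 1
    ring
  rw [h1, ← heat_sub (by fun_prop) (fun z => hC _) hf hC]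
  exact abs_heat_le (fun z => he _ _ (by simpa using hy)) _ _

lemma mildSol_modulus (hj : 0 < j) (hX : IsDatum X₀) (hk : IsSource k) (hm : 0 < m) {η e : ℝ}
    (he : ∀ y y', |y - y'| ≤ η → |X₀ y - X₀ y'| ≤ e) {t : ℝ} (ht : 0 ≤ t) (y y' : ℝ)
    (hy : |y - y'| ≤ η) :
    |mildSol j m X₀ k t y - mildSol j m X₀ k t y'| ≤ e + 4 * j * √t * |y - y'| := by
  obtain ⟨C, hC⟩ := hX.bounded
  have h1 := heat_modulus (continuous_steklov (continuous_steklov hX.continuous m) m)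
    (abs_smooth_le hC hm) (fun y y' h => steklov_modulus (continuous_steklov hX.continuous m) hm
      (steklov_modulus hX.continuous hm he) y y' h) t y y' hy
  have h2 := abs_duhamel_sub_le (continuous_smooth_param hk.continuous m)
      (fun s => abs_smooth_le (hk.bound s) hm) (fun s => hasDerivAt_smooth (hk.slice s) m)
      (continuous_smoothD_param hk.continuous m) (fun s => abs_smoothD_le (hk.bound s) hm) ht y y'
  unfold mildSol
  rw [show ∀ a b c d : ℝ, a - j * b - (c - j * d) = (a - c) - j * (b - d) by intros; ring]
  refine (abs_sub _ _).trans ?_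
  rw [abs_mul, abs_of_pos hj]
  have h3 := mul_le_mul_of_nonneg_left h2 hj.le
  have h4 : |heat t (smooth m X₀) y - heat t (smooth m X₀) y'| ≤ e := h1
  linarith

end MildSol

/-- The approximate profile `F(r, t)` built from a source `k`. -/
noncomputable def approxV (j M c m : ℝ) (X₀ : ℝ → ℝ) (k : ℝ → ℝ → ℝ) (t r : ℝ) : ℝ :=
  refProfile j M c r + mildSol j m X₀ k t r

/-- The absorption term which goes with `approxV`. -/
noncomputable def approxH (c m : ℝ) (k : ℝ → ℝ → ℝ) (t r : ℝ) : ℝ :=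
  refSource c r + smooth m (k t) r

/-- `V = approxV` solves `∂ₜ V = ½ V'' - j H` exactly; the relation `H ∈ sign V` between the profile
and the absorption term is satisfied up to an error `a` on the time interval `[0, T]`.
Source and datum are mollified at scale `m`, which makes `V` a classical solution. -/
structure IsApprox (j M c : ℝ) (X₀ : ℝ → ℝ) (a T m : ℝ) (k : ℝ → ℝ → ℝ) : Prop where
  source : IsSource k
  pos : 0 < m
  datum_close : ∀ y, |smooth m X₀ y - X₀ y| ≤ a
  abs_le : ∀ t ∈ Icc 0 T, ∀ r ∈ Icc (0 : ℝ) 1, |approxH c m k t r| ≤ 1 + a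
  sign : ∀ t ∈ Icc 0 T, ∀ r ∈ Icc (0 : ℝ) 1,
    |approxV j M c m X₀ k t r| - a ≤ approxV j M c m X₀ k t r * approxH c m k t r

/-- The source corresponding to the profile `refProfile + X`, for the smeared sign function. -/
noncomputable def picardSource (j M c κ : ℝ) (X : ℝ → ℝ → ℝ) (t : ℝ) : ℝ → ℝ :=
  oddExt fun r => clamp ((refProfile j M c r + X t r) / κ) - refSource c r

/-- Picard iteration for `∂ₜ V = ½ V'' - j clamp (V / κ)`. -/
noncomputable def picard (j M c κ m : ℝ) (X₀ : ℝ → ℝ) : ℕ → ℝ → ℝ → ℝ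
  | 0 => fun _ _ => 0
  | n + 1 => mildSol j m X₀ (picardSource j M c κ (picard j M c κ m X₀ n))

section Picard

variable {j M κ m : ℝ} {X₀ : ℝ → ℝ}

lemma abs_refSource_le {r : ℝ} (hr : r ∈ Icc (0 : ℝ) 1) : |refSource 1 r| ≤ 1 := by
  unfold refSource
  exact abs_le.2 ⟨by linarith [hr.2], by linarith [hr.1]⟩

lemma isSource_picardSource (hκ : 0 < κ) (hκM : κ ≤ M) {X : ℝ → ℝ → ℝ}
    (hX : Continuous (Function.uncurry X)) (h0 : ∀ t, X t 0 = 0) (h1 : ∀ t, X t 1 = 0) :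
    IsSource (picardSource j M 1 κ X) := by
  have e0 : ∀ t, clamp ((refProfile j M 1 0 + X t 0) / κ) - refSource 1 0 = 0 := by
    intro t
    have : 1 ≤ M / κ := (one_le_div hκ).2 hκM
    rw [h0]
    simp [refProfile, refSource, clamp, this]
  have e1 : ∀ t, clamp ((refProfile j M 1 1 + X t 1) / κ) - refSource 1 1 = 0 := by
    intro t
    rw [h1]
    simp [refProfile, refSource, clamp]
  refine ⟨?_, fun s y => ?_, fun s y => oddExt_odd_zero (e0 s) (e1 s) y,
    fun s y => oddExt_odd_one (e0 s) (e1 s) y⟩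
  · refine continuous_oddExt_param
      (F := fun t r => clamp ((refProfile j M 1 r + X t r) / κ) - refSource 1 r) ?_ e0 e1
    have hX' : Continuous fun p : ℝ × ℝ => X p.1 p.2 := hX
    simp only [Function.uncurry_def]
    fun_prop
  · refine abs_oddExt_le (fun r hr => ?_) y
    refine (abs_sub _ _).trans ?_
    linarith [abs_clamp_le ((refProfile j M 1 r + X s r) / κ), abs_refSource_le hr]

lemma picard_props (hX : IsDatum X₀) (hκ : 0 < κ) (hκM : κ ≤ M) (hm : 0 < m) (n : ℕ) :
    Continuous (Function.uncurry (picard j M 1 κ m X₀ n)) ∧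
      (∀ t, picard j M 1 κ m X₀ n t 0 = 0) ∧ (∀ t, picard j M 1 κ m X₀ n t 1 = 0) := by
  induction n with
  | zero => exact ⟨continuous_const, fun _ => rfl, fun _ => rfl⟩
  | succ n ih =>
    have hs := isSource_picardSource (j := j) hκ hκM ih.1 ih.2.1 ih.2.2
    exact ⟨continuous_mildSol hX hs hm, mildSol_at_zero hX hs, mildSol_at_one hX hs⟩

lemma isSource_picard (hX : IsDatum X₀) (hκ : 0 < κ) (hκM : κ ≤ M) (hm : 0 < m) (n : ℕ) :
    IsSource (picardSource j M 1 κ (picard j M 1 κ m X₀ n)) :=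
  have h := picard_props (j := j) hX hκ hκM hm n
  isSource_picardSource hκ hκM h.1 h.2.1 h.2.2

lemma abs_oddExt_sub_le {f g : ℝ → ℝ} {b : ℝ} (h : ∀ r ∈ Icc (0 : ℝ) 1, |f r - g r| ≤ b) (y : ℝ) :
    |oddExt f y - oddExt g y| ≤ b := by
  unfold oddExt
  split_ifs
  · exact h _ (fold_mem y)
  · rw [show -f (fold y) - -g (fold y) = -(f (fold y) - g (fold y)) by ring, abs_neg]
    exact h _ (fold_mem y)

lemma abs_mildSol_sub_le (hj : 0 < j) {k k' : ℝ → ℝ → ℝ} (hk : IsSource k) (hk' : IsSource k')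
    (hm : 0 < m) {b : ℝ → ℝ} (hb : Continuous b) {t : ℝ} (ht : 0 ≤ t)
    (h : ∀ s ∈ Icc 0 t, ∀ y, |k s y - k' s y| ≤ b s) (r : ℝ) :
    |mildSol j m X₀ k t r - mildSol j m X₀ k' t r| ≤ j * ∫ s in (0 : ℝ)..t, b s := by
  have c : ∀ {k : ℝ → ℝ → ℝ}, IsSource k →
      Continuous fun s => heat (t - s) (smooth m (k s)) r := fun hk =>
    continuous_duhamel_slice (continuous_smooth_param hk.continuous m)
      (fun s => abs_smooth_le (hk.bound s) hm) t r
  unfold mildSol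
  rw [show ∀ a b d : ℝ, a - j * b - (a - j * d) = -(j * (b - d)) by intros; ring, abs_neg, abs_mul,
    abs_of_pos hj]
  refine mul_le_mul_of_nonneg_left ?_ hj.le
  rw [duhamel, duhamel, ← intervalIntegral.integral_sub ((c hk).intervalIntegrable _ _)
    ((c hk').intervalIntegrable _ _)]
  rw [← Real.norm_eq_abs]
  refine intervalIntegral.norm_integral_le_of_norm_le (μ := volume)
    (f := fun s => heat (t - s) (smooth m (k s)) r - heat (t - s) (smooth m (k' s)) r) (g := b) ht
    (ae_of_all _ fun s hs => ?_) (hb.intervalIntegrable _ _)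
  have hc : ∀ {k : ℝ → ℝ → ℝ}, IsSource k → Continuous (smooth m (k s)) := fun hk =>
    continuous_steklov (continuous_steklov (hk.slice s) m) m
  rw [Real.norm_eq_abs, ← heat_sub (hc hk) (abs_smooth_le (hk.bound s) hm) (hc hk')
    (abs_smooth_le (hk'.bound s) hm)]
  refine abs_heat_le (fun z => ?_) _ _
  rw [← smooth_sub (hk.slice s) (hk'.slice s)]
  exact abs_smooth_le (h s (Ioc_subset_Icc_self hs)) hm z

lemma abs_picardSource_sub_le (hκ : 0 < κ) {X X' : ℝ → ℝ → ℝ} {t b : ℝ}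
    (h : ∀ r, |X t r - X' t r| ≤ b) (y : ℝ) :
    |picardSource j M 1 κ X t y - picardSource j M 1 κ X' t y| ≤ b / κ := by
  refine abs_oddExt_sub_le (fun r _ => ?_) y
  rw [sub_sub_sub_cancel_right]
  refine (abs_clamp_sub_le _ _).trans ?_
  rw [← sub_div, add_sub_add_left_eq_sub, abs_div, abs_of_pos hκ]
  exact div_le_div_of_nonneg_right (h r) hκ.le

lemma abs_picard_succ_sub_le (hj : 0 < j) (hX : IsDatum X₀) (hκ : 0 < κ) (hκM : κ ≤ M)
    (hm : 0 < m) {C : ℝ} (hC : ∀ y, |X₀ y| ≤ C) {T : ℝ} (n : ℕ) :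
    ∀ t ∈ Icc 0 T, ∀ r, |picard j M 1 κ m X₀ (n + 1) t r - picard j M 1 κ m X₀ n t r|
      ≤ (C + 2 * j * T) * ((j / κ * t) ^ n / n.factorial) := by
  induction n with
  | zero =>
    intro t ht r
    have h := abs_mildSol_le hj (isSource_picard (j := j) hX hκ hκM hm 0) hm hC ht.1 r
    have : 2 * j * t ≤ 2 * j * T := by nlinarith [ht.2]
    simp only [picard, sub_zero, pow_zero, Nat.factorial_zero, Nat.cast_one, div_one, mul_one]
    simp only [picard] at h
    linarith
  | succ n ih =>
    intro t ht r
    refine (abs_mildSol_sub_le hj (isSource_picard hX hκ hκM hm (n + 1))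
      (isSource_picard hX hκ hκM hm n) hm
      (b := fun s => (C + 2 * j * T) * ((j / κ * s) ^ n / n.factorial) / κ) (by fun_prop) ht.1
      (fun s hs y => abs_picardSource_sub_le hκ (ih s ⟨hs.1, hs.2.trans ht.2⟩) y) r).trans
      (le_of_eq ?_)
    have : ∀ s : ℝ, (C + 2 * j * T) * ((j / κ * s) ^ n / n.factorial) / κ
        = (C + 2 * j * T) * (j / κ) ^ n / n.factorial / κ * s ^ n := by
      intro s
      rw [mul_pow]
      ring
    simp only [this]
    rw [intervalIntegral.integral_const_mul, integral_pow, Nat.factorial_succ]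
    push_cast
    have h1 : (n.factorial : ℝ) ≠ 0 := by positivity
    have h2 : (n : ℝ) + 1 ≠ 0 := by positivity
    rw [mul_pow, pow_succ (j / κ)]
    simp only [ne_eq, Nat.add_eq_zero_iff, one_ne_zero, and_false, not_false_eq_true, zero_pow,
      sub_zero]
    field_simp

lemma abs_refProfile_le (hj : 0 < j) (hM : 0 ≤ M) {r : ℝ} (hr : r ∈ Icc (0 : ℝ) 1) :
    |refProfile j M 1 r| ≤ M + j := by
  obtain ⟨h0, h1⟩ := hr
  unfold refProfile
  have a1 : 0 ≤ (1 - r) ^ 3 := by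
    have : 0 ≤ 1 - r := by linarith
    positivity
  have a2 : (1 - r) ^ 3 ≤ 1 := pow_le_one₀ (by linarith) (by linarith)
  have b1 : |M * (1 - r)| ≤ M := by
    rw [abs_mul, abs_of_nonneg hM, abs_of_nonneg (by linarith)]
    nlinarith
  have b2 : |j * 1 / 3 * ((1 - r) ^ 3 - (1 - r))| ≤ j := by
    rw [abs_mul, abs_of_pos (by positivity : 0 < j * 1 / 3)]
    have : |(1 - r) ^ 3 - (1 - r)| ≤ 1 := abs_le.2 ⟨by linarith, by linarith⟩
    nlinarith
  exact (abs_add_le _ _).trans (by linarith)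

lemma abs_refProfileD_le (hj : 0 < j) (hM : 0 ≤ M) {c : ℝ} (hc : c ∈ Icc (0 : ℝ) 1)
    {r : ℝ} (hr : r ∈ Icc (0 : ℝ) 1) :
    |refProfileD j M c r| ≤ M + j := by
  obtain ⟨h0, h1⟩ := hr
  unfold refProfileD
  have a2 : (1 - r) ^ 2 ≤ 1 := pow_le_one₀ (by linarith) (by linarith)
  have b2 : |j * c / 3 * (1 - 3 * (1 - r) ^ 2)| ≤ j := by
    have hjc : 0 ≤ j * c := mul_nonneg hj.le hc.1
    have hjc' : j * c ≤ j := by nlinarith [hc.2]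
    rw [abs_mul, abs_of_nonneg (by positivity : 0 ≤ j * c / 3)]
    have : |1 - 3 * (1 - r) ^ 2| ≤ 3 := abs_le.2 ⟨by linarith, by nlinarith [sq_nonneg (1 - r)]⟩
    nlinarith
  refine (abs_add_le _ _).trans ?_
  rw [abs_neg, abs_of_nonneg hM]
  linarith

lemma abs_refProfile_sub_le (hj : 0 < j) (hM : 0 ≤ M) {c : ℝ} (hc : c ∈ Icc (0 : ℝ) 1) {a b : ℝ}
    (ha : a ∈ Icc (0 : ℝ) 1) (hb : b ∈ Icc (0 : ℝ) 1) :
    |refProfile j M c a - refProfile j M c b| ≤ (M + j) * |a - b| :=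
  Convex.norm_image_sub_le_of_norm_hasDerivWithin_le (f := refProfile j M c)
    (f' := refProfileD j M c) (s := Icc (0 : ℝ) 1)
    (fun _ _ => (hasDerivAt_refProfile j M c _).hasDerivWithinAt)
    (fun _ hx => abs_refProfileD_le hj hM hc hx) (convex_Icc _ _) hb ha

/-- Existence of approximate solutions of arbitrary accuracy: a late Picard iterate, for a steep
smeared sign function and a fine mollification. -/
lemma exists_isApprox (hj : 0 < j) (hM : 0 < M) (hX : IsDatum X₀)
    (hmod : ∀ e > 0, ∃ η > 0, ∀ y y', |y - y'| ≤ η → |X₀ y - X₀ y'| ≤ e) {a T : ℝ} (ha : 0 < a)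
    (hT : 0 < T) : ∃ m k, IsApprox j M 1 X₀ a T m k := by
  obtain ⟨C, hC⟩ := hX.bounded
  have hC0 : 0 ≤ C := (abs_nonneg _).trans (hC 0)
  set κ := min M (a / 4) with hκdef
  have hκ : 0 < κ := lt_min hM (by linarith)
  have hκM : κ ≤ M := min_le_left _ _
  have hκa : κ ≤ a / 4 := min_le_right _ _
  set B := M + j + (C + 2 * j * T) with hB
  have hB0 : 0 < B := by positivity
  -- the accuracy of the mollification and of the iteration
  set a₁ := a / (4 * (3 + B)) with ha₁
  have ha₁pos : 0 < a₁ := by positivity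
  have ha₁mul : (3 + B) * a₁ = a / 4 := by
    rw [ha₁]
    field_simp
  have ha₁a : a₁ ≤ a := by nlinarith
  obtain ⟨η₀, hη₀, hmod₀⟩ := hmod (min (a / 2) (κ * a₁ / 8)) (by positivity)
  set L := M + j + 4 * j * √T with hL
  have hL0 : 0 < L := by positivity
  set m := min η₀ (a₁ / (8 * (L / κ + 1))) with hm_def
  have hm : 0 < m := by positivity
  have hmL : (L / κ + 1) * m ≤ a₁ / 8 := by
    have : m ≤ a₁ / (8 * (L / κ + 1)) := min_le_right _ _
    calc (L / κ + 1) * m ≤ (L / κ + 1) * (a₁ / (8 * (L / κ + 1))) := by gcongr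
      _ = a₁ / 8 := by field_simp
  -- enough iterations
  obtain ⟨n, hn⟩ : ∃ n : ℕ, (C + 2 * j * T) * ((j / κ * T) ^ n / n.factorial) ≤ a₁ := by
    have := (FloorSemiring.tendsto_pow_div_factorial_atTop (j / κ * T)).const_mul (C + 2 * j * T)
    rw [mul_zero] at this
    exact (this.eventually (ge_mem_nhds ha₁pos)).exists
  set X := picard j M 1 κ m X₀ with hXdef
  set k := picardSource j M 1 κ (X n) with hk_def
  have hk : IsSource k := isSource_picard hX hκ hκM hm n
  have hclose : ∀ t ∈ Icc 0 T, ∀ r, |mildSol j m X₀ k t r - X n t r| ≤ a₁ := by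
    intro t ht r
    refine (abs_picard_succ_sub_le hj hX hκ hκM hm hC n t ht r).trans (le_trans ?_ hn)
    have : 0 ≤ j / κ * t := mul_nonneg (by positivity) ht.1
    have h2 : j / κ * t ≤ j / κ * T := by
      have := ht.2
      gcongr
    gcongr
  have hXmod : ∀ t ∈ Icc 0 T, ∀ y y', |y - y'| ≤ m →
      |X n t y - X n t y'| ≤ κ * a₁ / 8 + 4 * j * √T * |y - y'| := by
    intro t ht y y' hy
    cases n with
    | zero =>
      simp only [hXdef, picard, sub_self, abs_zero]
      positivity
    | succ n =>
      refine (mildSol_modulus hj hX (isSource_picard hX hκ hκM hm n) hm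
        (fun y y' h => (hmod₀ y y' h).trans (min_le_right _ _)) ht.1 y y'
        (hy.trans (min_le_left _ _))).trans ?_
      have := Real.sqrt_le_sqrt ht.2
      gcongr
  have hkmod : ∀ t ∈ Icc 0 T, ∀ y y', |y - y'| ≤ m → |k t y - k t y'| ≤ a₁ / 2 := by
    intro t ht y y' hy
    have hp := picard_props (j := j) hX hκ hκM hm n
    have e0 : clamp ((refProfile j M 1 0 + X n t 0) / κ) - refSource 1 0 = 0 := by
      have := hk.odd_zero t 0
      norm_num at this
      have h0 : k t 0 = 0 := by linarith
      rwa [hk_def, picardSource, oddExt_of_mem (by simp)] at h0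
    have e1 : clamp ((refProfile j M 1 1 + X n t 1) / κ) - refSource 1 1 = 0 := by
      have := hk.odd_one t 1
      norm_num at this
      have h0 : k t 1 = 0 := by linarith
      rwa [hk_def, picardSource, oddExt_of_mem (by simp)] at h0
    have := oddExt_modulus (f := fun r => clamp ((refProfile j M 1 r + X n t r) / κ) - refSource 1 r)
      e0 e1 (η := m) (e := a₁ / 4) (fun b hb d hd hbd => ?_) y y' hy
    · exact this.trans (by linarith)
    · have h1 := abs_clamp_sub_le ((refProfile j M 1 b + X n t b) / κ)
        ((refProfile j M 1 d + X n t d) / κ)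
      have h2 := abs_refProfile_sub_le hj hM.le (c := 1) (by simp) hb hd
      have h3 := hXmod t ht b d hbd
      rw [← sub_div, abs_div, abs_of_pos hκ] at h1
      have h4 : |refProfile j M 1 b + X n t b - (refProfile j M 1 d + X n t d)|
          ≤ L * |b - d| + κ * a₁ / 8 := by
        rw [show ∀ a b c d : ℝ, a + b - (c + d) = (a - c) + (b - d) by intros; ring]
        refine (abs_add_le _ _).trans ?_
        rw [hL]
        linarith
      have h5 : |refSource 1 b - refSource 1 d| = |b - d| := by
        unfold refSource
        rw [← abs_neg]
        congr 1
        ring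
      rw [show ∀ a b c d : ℝ, a - b - (c - d) = (a - c) - (b - d) by intros; ring]
      refine (abs_sub _ _).trans ?_
      rw [h5]
      have h6 : |refProfile j M 1 b + X n t b - (refProfile j M 1 d + X n t d)| / κ
          ≤ L / κ * |b - d| + a₁ / 8 := by
        rw [div_le_iff₀ hκ]
        refine h4.trans (le_of_eq ?_)
        field_simp
      have h7 : (L / κ + 1) * |b - d| ≤ (L / κ + 1) * m := by gcongr
      linarith
  have hH : ∀ t ∈ Icc 0 T, ∀ r ∈ Icc (0 : ℝ) 1,
      |approxH 1 m k t r - clamp ((refProfile j M 1 r + X n t r) / κ)| ≤ a₁ := by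
    intro t ht r hr
    have h1 := abs_smooth_sub_self_le (hk.slice t) hm (hkmod t ht) r
    have h2 : k t r = clamp ((refProfile j M 1 r + X n t r) / κ) - refSource 1 r := by
      rw [hk_def, picardSource, oddExt_of_mem hr]
    unfold approxH
    rw [h2] at h1
    rw [show ∀ a b c : ℝ, a + b - c = b - (c - a) by intros; ring]
    linarith
  refine ⟨m, k, hk, hm, fun y => ?_, fun t ht r hr => ?_, fun t ht r hr => ?_⟩
  · have := abs_smooth_sub_self_le hX.continuous hm (fun y y' h =>
      (hmod₀ y y' (h.trans (min_le_left _ _))).trans (min_le_left _ _)) y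
    linarith
  · have h1 := hH t ht r hr
    have h2 := abs_clamp_le ((refProfile j M 1 r + X n t r) / κ)
    have := abs_sub_abs_le_abs_sub (approxH 1 m k t r)
      (clamp ((refProfile j M 1 r + X n t r) / κ))
    linarith
  · set W := refProfile j M 1 r + X n t r with hW
    set V := approxV j M 1 m X₀ k t r with hV
    set H := approxH 1 m k t r with hHdef
    have h1 := hH t ht r hr
    have h2 : |V - W| ≤ a₁ := by
      rw [hV, hW, approxV, add_sub_add_left_eq_sub]
      exact hclose t ht r
    have h3 : |V| ≤ B := by
      rw [hV, approxV, hB]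
      refine (abs_add_le _ _).trans (add_le_add (abs_refProfile_le hj hM.le hr) ?_)
      refine (abs_mildSol_le hj hk hm hC ht.1 r).trans ?_
      nlinarith [ht.2]
    have h4 : |W| - κ ≤ W * clamp (W / κ) := by
      have := mul_le_mul_of_nonneg_left (abs_sub_le_mul_clamp (W / κ)) hκ.le
      rw [abs_div, abs_of_pos hκ] at this
      calc |W| - κ = κ * (|W| / κ - 1) := by field_simp
        _ ≤ κ * (W / κ * clamp (W / κ)) := this
        _ = W * clamp (W / κ) := by field_simp
    have h5 : |V * (H - clamp (W / κ))| ≤ B * a₁ := by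
      rw [abs_mul]
      exact mul_le_mul h3 h1 (abs_nonneg _) hB0.le
    have h6 : |(V - W) * clamp (W / κ)| ≤ a₁ := by
      rw [abs_mul]
      calc _ ≤ a₁ * 1 := mul_le_mul h2 (abs_clamp_le _) (abs_nonneg _) ha₁pos.le
        _ = a₁ := mul_one _
    have h7 : V * H = V * (H - clamp (W / κ)) + (V - W) * clamp (W / κ) + W * clamp (W / κ) := by
      ring
    have h8 := abs_sub_abs_le_abs_sub V W
    rw [h7]
    linarith [(abs_le.1 h5).1, (abs_le.1 h6).1]

end Picard

/-! ### Comparison of approximate solutions -/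

lemma second_deriv_nonpos_of_isLocalMax {f f' : ℝ → ℝ} {f'' x : ℝ}
    (hf : ∀ y, HasDerivAt f (f' y) y) (hf' : HasDerivAt f' f'' x) (hx : IsLocalMax f x) :
    f'' ≤ 0 := by
  by_contra! hpos
  have hd : deriv f = f' := funext fun y => (hf y).deriv
  have h0 : f' x = 0 := hx.hasDerivAt_eq_zero (hf x)
  have hmin : IsLocalMin f x := isLocalMin_of_deriv_deriv_pos (by rw [hd, hf'.deriv]; exact hpos)
    (by rw [hd, h0]) (hf x).continuousAt
  have hconst : f =ᶠ[𝓝 x] fun _ => f x := by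
    filter_upwards [hx, hmin] with y h1 h2 using le_antisymm h1 h2
  have h1 : f' =ᶠ[𝓝 x] fun _ => 0 := by
    have := hconst.deriv
    rw [hd] at this
    simpa using this
  have := hf'.congr_of_eventuallyEq h1.symm
  have := this.unique (hasDerivAt_const x (0 : ℝ))
  linarith

lemma deriv_nonneg_of_isMaxOn_left {f : ℝ → ℝ} {f' x a : ℝ} (hf : HasDerivAt f f' x) (ha : a < x)
    (hx : ∀ y ∈ Icc a x, f y ≤ f x) : 0 ≤ f' := by
  have h := (hasDerivWithinAt_iff_tendsto_slope' (s := Iio x) (by simp)).1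
    (hf.hasDerivWithinAt (s := Iio x))
  refine ge_of_tendsto h ?_
  filter_upwards [Ioo_mem_nhdsLT ha] with y hy
  rw [slope_def_field]
  exact div_nonneg_of_nonpos (by linarith [hx y ⟨hy.1.le, hy.2.le⟩]) (by linarith [hy.2])

/-- The parabolic maximum principle, for functions which are subsolutions up to an error `c` only
where they exceed the level `b` that bounds their boundary values. -/
lemma parabolic_max_principle {D Dt D' D'' : ℝ → ℝ → ℝ} {α β T b c : ℝ}
    (hcont : ContinuousOn (Function.uncurry D) (Icc 0 T ×ˢ Icc α β))
    (ht : ∀ t ∈ Ioc 0 T, ∀ r ∈ Ioo α β, HasDerivAt (fun s => D s r) (Dt t r) t)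
    (hr : ∀ t r, HasDerivAt (D t) (D' t r) r) (hr' : ∀ t r, HasDerivAt (D' t) (D'' t r) r)
    (hineq : ∀ t ∈ Ioc 0 T, ∀ r ∈ Ioo α β, b < D t r → Dt t r ≤ D'' t r / 2 + c) (hc : 0 ≤ c)
    (hα : ∀ t ∈ Icc 0 T, D t α ≤ b) (hβ : ∀ t ∈ Icc 0 T, D t β ≤ b)
    (h0 : ∀ r ∈ Icc α β, D 0 r ≤ b) {t r : ℝ} (htT : t ∈ Icc 0 T) (hrI : r ∈ Icc α β) :
    D t r ≤ b + c * t := by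
  by_contra! hcon
  have htpos : 0 < t := by
    rcases htT.1.eq_or_lt with h | h
    · rw [← h] at hcon
      linarith [h0 r hrI]
    · exact h
  -- tilting by a slightly larger slope makes the inequality at the maximum strict
  set δ := (D t r - (b + c * t)) / (2 * t) with hδ
  have hδpos : 0 < δ := div_pos (by linarith) (by linarith)
  have hδt : δ * t = (D t r - (b + c * t)) / 2 := by
    rw [hδ]
    field_simp
  have hcomp : IsCompact (Icc 0 T ×ˢ Icc α β) := isCompact_Icc.prod isCompact_Icc
  obtain ⟨⟨t₁, r₁⟩, ⟨ht₁, hr₁⟩, hmax⟩ := hcomp.exists_isMaxOn ⟨(t, r), htT, hrI⟩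
    (f := fun p : ℝ × ℝ => D p.1 p.2 - (c + δ) * p.1)
    (hcont.sub (by fun_prop))
  have hval : b < D t₁ r₁ - (c + δ) * t₁ := by
    have h1 : D t r - (c + δ) * t ≤ D t₁ r₁ - (c + δ) * t₁ := hmax (show (t, r) ∈ _ from ⟨htT, hrI⟩)
    have : (c + δ) * t = c * t + δ * t := by ring
    linarith
  have hpos : 0 ≤ (c + δ) * t₁ := mul_nonneg (by linarith) ht₁.1
  have hb : b < D t₁ r₁ := by linarith
  have ht₁pos : 0 < t₁ := by
    rcases ht₁.1.eq_or_lt with h | h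
    · have := h0 r₁ hr₁
      rw [h] at this
      linarith
    · exact h
  have hr₁' : r₁ ∈ Ioo α β := by
    refine ⟨lt_of_le_of_ne hr₁.1 ?_, lt_of_le_of_ne hr₁.2 ?_⟩
    · rintro rfl
      linarith [hα t₁ ht₁]
    · rintro rfl
      linarith [hβ t₁ ht₁]
  have hD'' : D'' t₁ r₁ ≤ 0 := by
    refine second_deriv_nonpos_of_isLocalMax (hr t₁) (hr' t₁ r₁) ?_
    filter_upwards [Icc_mem_nhds hr₁'.1 hr₁'.2] with y hy
    have : D t₁ y - (c + δ) * t₁ ≤ D t₁ r₁ - (c + δ) * t₁ := hmax (show (t₁, y) ∈ _ from ⟨ht₁, hy⟩)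
    linarith
  have hDt : 0 ≤ Dt t₁ r₁ - (c + δ) := by
    have hd : HasDerivAt (fun s => D s r₁ - (c + δ) * s) (Dt t₁ r₁ - (c + δ)) t₁ :=
      ((ht t₁ ⟨ht₁pos, ht₁.2⟩ r₁ hr₁').fun_sub ((hasDerivAt_id' t₁).const_mul (c + δ))).congr_deriv
        (by ring)
    refine deriv_nonneg_of_isMaxOn_left hd ht₁pos fun y hy => ?_
    exact hmax (show (y, r₁) ∈ _ from ⟨⟨hy.1, hy.2.trans ht₁.2⟩, hr₁⟩)
  have := hineq t₁ ⟨ht₁pos, ht₁.2⟩ r₁ hr₁' hb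
  linarith

/-- The space derivative of `approxV`. -/
noncomputable def approxVD (j M c m : ℝ) (X₀ : ℝ → ℝ) (k : ℝ → ℝ → ℝ) (t r : ℝ) : ℝ :=
  refProfileD j M c r + mildSolD j m X₀ k t r

/-- The second space derivative of `approxV`. -/
noncomputable def approxVDD (j c m : ℝ) (X₀ : ℝ → ℝ) (k : ℝ → ℝ → ℝ) (t r : ℝ) : ℝ :=
  2 * j * refSource c r + mildSolDD j m X₀ k t r

section Approx

variable {j M c a a' T T' m m' : ℝ} {X₀ : ℝ → ℝ} {k k' : ℝ → ℝ → ℝ}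

lemma IsApprox.mono (h : IsApprox j M c X₀ a T m k) (ha : a ≤ a') (hT : T' ≤ T) :
    IsApprox j M c X₀ a' T' m k where
  source := h.source
  pos := h.pos
  datum_close y := (h.datum_close y).trans ha
  abs_le t ht r hr := (h.abs_le t ⟨ht.1, ht.2.trans hT⟩ r hr).trans (by linarith)
  sign t ht r hr := by linarith [h.sign t ⟨ht.1, ht.2.trans hT⟩ r hr]

lemma continuous_approxV (hX : IsDatum X₀) (hk : IsSource k) (hm : 0 < m) :
    Continuous (Function.uncurry (approxV j M c m X₀ k)) :=
  ((continuous_refProfile j M c).comp continuous_snd).add (continuous_mildSol hX hk hm)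

lemma continuous_approxVD (hX : IsDatum X₀) (hk : IsSource k) (hm : 0 < m) :
    Continuous (Function.uncurry (approxVD j M c m X₀ k)) :=
  ((continuous_refProfileD j M c).comp continuous_snd).add (continuous_mildSolD hX hk hm)

lemma continuous_approxVDD (hX : IsDatum X₀) (hk : IsSource k) (hm : 0 < m) :
    Continuous (Function.uncurry (approxVDD j c m X₀ k)) :=
  (((continuous_refSource c).comp continuous_snd).const_mul (2 * j)).add
    (continuous_mildSolDD hX hk hm)

lemma continuous_approxH (hk : IsSource k) : Continuous (Function.uncurry (approxH c m k)) :=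
  ((continuous_refSource c).comp continuous_snd).add (continuous_smooth_param hk.continuous m)

lemma hasDerivAt_approxV (hX : IsDatum X₀) (hk : IsSource k) (hm : 0 < m) (t r : ℝ) :
    HasDerivAt (approxV j M c m X₀ k t) (approxVD j M c m X₀ k t r) r :=
  (hasDerivAt_refProfile j M c r).add (hasDerivAt_mildSol hX hk hm t r)

lemma hasDerivAt_approxVD (hX : IsDatum X₀) (hk : IsSource k) (hm : 0 < m) (t r : ℝ) :
    HasDerivAt (approxVD j M c m X₀ k t) (approxVDD j c m X₀ k t r) r :=
  (hasDerivAt_refProfileD j M c r).add (hasDerivAt_mildSolD hX hk hm t r)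

lemma approxV_at_zero (hX : IsDatum X₀) (hk : IsSource k) (t : ℝ) :
    approxV j M c m X₀ k t 0 = M := by
  rw [approxV, mildSol_at_zero hX hk]
  simp [refProfile]

lemma approxV_at_one (hX : IsDatum X₀) (hk : IsSource k) (t : ℝ) :
    approxV j M c m X₀ k t 1 = 0 := by
  rw [approxV, mildSol_at_one hX hk]
  simp [refProfile]

lemma approxV_eq_integral (hX : IsDatum X₀) (hk : IsSource k) (hm : 0 < m) {t : ℝ} (ht : 0 ≤ t)
    (r : ℝ) : approxV j M c m X₀ k t r = approxV j M c m X₀ k 0 r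
      + ∫ s in (0 : ℝ)..t, (approxVDD j c m X₀ k s r / 2 - j * approxH c m k s r) := by
  have e : ∀ s, approxVDD j c m X₀ k s r / 2 - j * approxH c m k s r
      = mildSolDD j m X₀ k s r / 2 - j * smooth m (k s) r := by
    intro s
    unfold approxVDD approxH
    ring
  simp only [e]
  rw [approxV, approxV, mildSol_zero, mildSol_eq_integral hX hk hm ht]
  ring

lemma hasDerivAt_approxV_time (hX : IsDatum X₀) (hk : IsSource k) (hm : 0 < m) {t : ℝ} (ht : 0 < t)
    (r : ℝ) : HasDerivAt (fun s => approxV j M c m X₀ k s r)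
      (approxVDD j c m X₀ k t r / 2 - j * approxH c m k t r) t := by
  have hc : Continuous fun s => approxVDD j c m X₀ k s r / 2 - j * approxH c m k s r := by
    have h1 : Continuous fun s => approxVDD j c m X₀ k s r :=
      (continuous_approxVDD hX hk hm).comp (by fun_prop : Continuous fun s : ℝ => (s, r))
    have h2 : Continuous fun s => approxH c m k s r :=
      (continuous_approxH hk).comp (by fun_prop : Continuous fun s : ℝ => (s, r))
    fun_prop
  have := (intervalIntegral.integral_hasDerivAt_right (hc.intervalIntegrable 0 t)
    hc.aestronglyMeasurable.stronglyMeasurableAtFilter hc.continuousAt).const_add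
    (approxV j M c m X₀ k 0 r)
  refine this.congr_of_eventuallyEq ?_
  filter_upwards [Ioi_mem_nhds ht] with s hs
  exact approxV_eq_integral hX hk hm (le_of_lt hs) r

lemma approxV_initial_sub (h : IsApprox j M c X₀ a T m k) (r : ℝ) :
    |approxV j M c m X₀ k 0 r - (refProfile j M c r + X₀ r)| ≤ a := by
  rw [approxV, mildSol_zero, add_sub_add_left_eq_sub]
  exact h.datum_close r

lemma approxV_le (hj : 0 < j) (hM : 0 ≤ M) (hX : IsDatum X₀)
    (hU : ∀ r ∈ Icc (0 : ℝ) 1, refProfile j M c r + X₀ r ≤ M)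
    (h : IsApprox j M c X₀ a T m k) (ha : 0 < a) {t r : ℝ} (ht : t ∈ Icc 0 T)
    (hr : r ∈ Icc (0 : ℝ) 1) : approxV j M c m X₀ k t r ≤ M + a := by
  have := parabolic_max_principle (D := fun t r => approxV j M c m X₀ k t r - M)
    (Dt := fun t r => approxVDD j c m X₀ k t r / 2 - j * approxH c m k t r)
    (D' := approxVD j M c m X₀ k) (D'' := approxVDD j c m X₀ k) (α := 0) (β := 1) (T := T) (b := a)
    (c := 0) ((continuous_approxV hX h.source h.pos).sub continuous_const).continuousOn
    (fun t ht r _ => (hasDerivAt_approxV_time hX h.source h.pos ht.1 r).sub_const M)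
    (fun t r => (hasDerivAt_approxV hX h.source h.pos t r).sub_const M)
    (fun t r => hasDerivAt_approxVD hX h.source h.pos t r)
    (fun t ht r hr hb => ?_) le_rfl (fun t _ => ?_) (fun t _ => ?_) (fun r hr => ?_) ht hr
  · simp only [zero_mul, add_zero] at this
    linarith
  · have hs := h.sign t (Ioc_subset_Icc_self ht) r (Ioo_subset_Icc_self hr)
    have hV : a < approxV j M c m X₀ k t r := by linarith
    rw [abs_of_pos (by linarith)] at hs
    have : 0 < approxH c m k t r := by
      by_contra! hneg
      nlinarith
    nlinarith
  · simp only [approxV_at_zero hX h.source]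
    linarith
  · simp only [approxV_at_one hX h.source]
    linarith
  · have h1 := (abs_le.1 (approxV_initial_sub h r)).2
    linarith [hU r hr]

lemma neg_le_approxV (hj : 0 < j) (hM : 0 ≤ M) (hX : IsDatum X₀)
    (hU : ∀ r ∈ Icc (0 : ℝ) 1, 0 ≤ refProfile j M c r + X₀ r)
    (h : IsApprox j M c X₀ a T m k) (ha : 0 < a) {t r : ℝ} (ht : t ∈ Icc 0 T)
    (hr : r ∈ Icc (0 : ℝ) 1) : -a ≤ approxV j M c m X₀ k t r := by
  have := parabolic_max_principle (D := fun t r => -approxV j M c m X₀ k t r)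
    (Dt := fun t r => -(approxVDD j c m X₀ k t r / 2 - j * approxH c m k t r))
    (D' := fun t r => -approxVD j M c m X₀ k t r) (D'' := fun t r => -approxVDD j c m X₀ k t r)
    (α := 0) (β := 1) (T := T) (b := a)
    (c := 0) (continuous_approxV hX h.source h.pos).neg.continuousOn
    (fun t ht r _ => (hasDerivAt_approxV_time hX h.source h.pos ht.1 r).fun_neg)
    (fun t r => (hasDerivAt_approxV hX h.source h.pos t r).fun_neg)
    (fun t r => (hasDerivAt_approxVD hX h.source h.pos t r).fun_neg)
    (fun t ht r hr hb => ?_) le_rfl (fun t _ => ?_) (fun t _ => ?_) (fun r hr => ?_) ht hr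
  · simp only [zero_mul, add_zero] at this
    linarith
  · have hs := h.sign t (Ioc_subset_Icc_self ht) r (Ioo_subset_Icc_self hr)
    rw [abs_of_neg (by linarith)] at hs
    have : approxH c m k t r < 0 := by
      by_contra! hneg
      nlinarith
    nlinarith
  · simp only [approxV_at_zero hX h.source]
    linarith
  · simp only [approxV_at_one hX h.source]
    linarith
  · have h1 := (abs_le.1 (approxV_initial_sub h r)).1
    linarith [hU r hr]

/-- The monotonicity of the sign graph, for approximate pairs. -/
lemma sign_graph_monotone {v w g h a B : ℝ} (hv : |v| - a ≤ v * g) (hw : |w| - a ≤ w * h)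
    (hg : |g| ≤ 1 + a) (hh : |h| ≤ 1 + a) (hvB : |v| ≤ B) (hwB : |w| ≤ B) (ha : 0 ≤ a) :
    -(2 * a * (1 + B)) ≤ (v - w) * (g - h) := by
  have h1 : v * h ≤ |v| * (1 + a) :=
    (le_abs_self _).trans (by rw [abs_mul]; exact mul_le_mul_of_nonneg_left hh (abs_nonneg _))
  have h2 : w * g ≤ |w| * (1 + a) :=
    (le_abs_self _).trans (by rw [abs_mul]; exact mul_le_mul_of_nonneg_left hg (abs_nonneg _))
  nlinarith

/-- Comparison of an approximate solution with a space shift of another one. -/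
lemma approxV_shift_sub_le (hj : 0 < j) (hX : IsDatum X₀)
    (h : IsApprox j M c X₀ a T m k) (h' : IsApprox j M c X₀ a T m' k') (ha : 0 < a) {B b s : ℝ}
    (hB : ∀ t ∈ Icc 0 T, ∀ r ∈ Icc (0 : ℝ) 1, |approxV j M c m X₀ k t r| ≤ B)
    (hB' : ∀ t ∈ Icc 0 T, ∀ r ∈ Icc (0 : ℝ) 1, |approxV j M c m' X₀ k' t r| ≤ B)
    (hs0 : 0 ≤ s) (hb : 0 < b)
    (hleft : ∀ t ∈ Icc 0 T, approxV j M c m X₀ k t s - M ≤ b)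
    (hright : ∀ t ∈ Icc 0 T, 0 - approxV j M c m' X₀ k' t (1 - s) ≤ b)
    (hinit : ∀ r ∈ Icc (0 : ℝ) (1 - s), approxV j M c m X₀ k 0 (r + s)
      - approxV j M c m' X₀ k' 0 r ≤ b) {t r : ℝ} (ht : t ∈ Icc 0 T)
    (hr : r ∈ Icc (0 : ℝ) (1 - s)) :
    approxV j M c m X₀ k t (r + s) - approxV j M c m' X₀ k' t r
      ≤ b + j * (2 * a * (1 + B) / b) * t := by
  have hB0 : 0 ≤ B := (abs_nonneg _).trans (hB t ht r ⟨hr.1, hr.2.trans (by linarith)⟩)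
  refine parabolic_max_principle (D := fun t r => approxV j M c m X₀ k t (r + s)
      - approxV j M c m' X₀ k' t r)
    (Dt := fun t r => (approxVDD j c m X₀ k t (r + s) / 2 - j * approxH c m k t (r + s))
      - (approxVDD j c m' X₀ k' t r / 2 - j * approxH c m' k' t r))
    (D' := fun t r => approxVD j M c m X₀ k t (r + s) - approxVD j M c m' X₀ k' t r)
    (D'' := fun t r => approxVDD j c m X₀ k t (r + s) - approxVDD j c m' X₀ k' t r)
    (α := 0) (β := 1 - s) (T := T) (b := b)
    (c := j * (2 * a * (1 + B) / b))
    (Continuous.continuousOn (Continuous.sub ((continuous_approxV hX h.source h.pos).comp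
      (by fun_prop : Continuous fun p : ℝ × ℝ => (p.1, p.2 + s)))
      (continuous_approxV hX h'.source h'.pos)))
    (fun t ht r _ => (hasDerivAt_approxV_time hX h.source h.pos ht.1 (r + s)).sub
      (hasDerivAt_approxV_time hX h'.source h'.pos ht.1 r))
    (fun t r => ((hasDerivAt_approxV hX h.source h.pos t (r + s)).comp_add_const r s).sub
      (hasDerivAt_approxV hX h'.source h'.pos t r))
    (fun t r => ((hasDerivAt_approxVD hX h.source h.pos t (r + s)).comp_add_const r s).sub
      (hasDerivAt_approxVD hX h'.source h'.pos t r))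
    (fun t ht r hr hb' => ?_) (by positivity) (fun t ht => ?_) (fun t ht => ?_) hinit ht hr
  · have ht' := Ioc_subset_Icc_self ht
    have m1 : r + s ∈ Icc (0 : ℝ) 1 := ⟨by linarith [hr.1], by linarith [hr.2]⟩
    have m2 : r ∈ Icc (0 : ℝ) 1 := ⟨hr.1.le, by linarith [hr.2]⟩
    have hmono := sign_graph_monotone (h.sign t ht' _ m1) (h'.sign t ht' _ m2)
      (h.abs_le t ht' _ m1) (h'.abs_le t ht' _ m2) (hB t ht' _ m1) (hB' t ht' _ m2) ha.le
    set D := approxV j M c m X₀ k t (r + s) - approxV j M c m' X₀ k' t r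
    set g := approxH c m k t (r + s) - approxH c m' k' t r with hg
    have hgb : -(2 * a * (1 + B) / b) ≤ g := by
      rw [← neg_div, div_le_iff₀ hb]
      by_contra! hcon
      have hA : 0 ≤ 2 * a * (1 + B) := by positivity
      have hg0 : g < 0 := by
        by_contra! h0
        nlinarith
      nlinarith
    have := mul_le_mul_of_nonneg_left hgb hj.le
    have e : j * g = j * approxH c m k t (r + s) - j * approxH c m' k' t r := by
      rw [hg]
      ring
    linarith
  · simp only [zero_add, approxV_at_zero hX h'.source]
    exact hleft t ht
  · simp only [sub_add_cancel, approxV_at_one hX h.source]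
    exact hright t ht

/-- Two approximate solutions are close to each other. -/
lemma abs_approxV_sub_le (hj : 0 < j) (hX : IsDatum X₀)
    (h : IsApprox j M c X₀ a T m k) (h' : IsApprox j M c X₀ a T m' k') (ha : 0 < a) (ha1 : a ≤ 1)
    {B : ℝ}
    (hB : ∀ t ∈ Icc 0 T, ∀ r ∈ Icc (0 : ℝ) 1, |approxV j M c m X₀ k t r| ≤ B)
    (hB' : ∀ t ∈ Icc 0 T, ∀ r ∈ Icc (0 : ℝ) 1, |approxV j M c m' X₀ k' t r| ≤ B)
    {t r : ℝ} (ht : t ∈ Icc 0 T) (hr : r ∈ Icc (0 : ℝ) 1) :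
    |approxV j M c m X₀ k t r - approxV j M c m' X₀ k' t r| ≤ √a * (2 + j * (1 + B) * T) := by
  have key : ∀ {m m' : ℝ} {k k' : ℝ → ℝ → ℝ}, IsApprox j M c X₀ a T m k →
      IsApprox j M c X₀ a T m' k' →
      (∀ t ∈ Icc 0 T, ∀ r ∈ Icc (0 : ℝ) 1, |approxV j M c m X₀ k t r| ≤ B) →
      (∀ t ∈ Icc 0 T, ∀ r ∈ Icc (0 : ℝ) 1, |approxV j M c m' X₀ k' t r| ≤ B) →
      approxV j M c m X₀ k t r - approxV j M c m' X₀ k' t r ≤ √a * (2 + j * (1 + B) * T) := by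
    intro m m' k k' h h' hB hB'
    have hB0 : 0 ≤ B := (abs_nonneg _).trans (hB t ht r hr)
    have hsa : 0 < √a := Real.sqrt_pos.2 ha
    have haa : √a * √a = a := Real.mul_self_sqrt ha.le
    have hsa1 : √a ≤ 1 := Real.sqrt_le_one.2 ha1
    have := approxV_shift_sub_le hj hX h h' ha (b := 2 * √a) (s := 0) hB hB' le_rfl (by positivity)
      (fun t _ => by rw [approxV_at_zero hX h.source]; linarith)
      (fun t _ => by rw [sub_zero, approxV_at_one hX h'.source]; linarith)
      (fun r hr => by
        have h1 := (abs_le.1 (approxV_initial_sub h r)).2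
        have h2 := (abs_le.1 (approxV_initial_sub h' r)).1
        rw [add_zero]
        nlinarith) ht (by simpa using hr)
    rw [add_zero] at this
    refine this.trans ?_
    have e : 2 * a * (1 + B) / (2 * √a) = √a * (1 + B) := by
      rw [div_eq_iff (by positivity)]
      linear_combination (-2 * (1 + B)) * haa
    rw [e]
    have : j * (√a * (1 + B)) * t ≤ j * (√a * (1 + B)) * T := by
      have := ht.2
      gcongr
    linarith
  rw [abs_le]
  constructor
  · linarith [key h' h hB' hB]
  · exact key h h' hB hB'

/-- An approximate solution which starts from a nonincreasing profile stays almost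
nonincreasing. -/
lemma approxV_almost_antitone (hj : 0 < j) (hM : 0 ≤ M) (hX : IsDatum X₀)
    (hU : AntitoneOn (fun r => refProfile j M c r + X₀ r) (Icc (0 : ℝ) 1))
    (h : IsApprox j M c X₀ a T m k) (ha : 0 < a) (ha1 : a ≤ 1)
    {B : ℝ}
    (hB : ∀ t ∈ Icc 0 T, ∀ r ∈ Icc (0 : ℝ) 1, |approxV j M c m X₀ k t r| ≤ B)
    {t r r' : ℝ} (ht : t ∈ Icc 0 T) (hr : r ∈ Icc (0 : ℝ) 1) (hr' : r' ∈ Icc (0 : ℝ) 1)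
    (hrr : r ≤ r') :
    approxV j M c m X₀ k t r' - approxV j M c m X₀ k t r ≤ √a * (2 + j * (1 + B) * T) := by
  have hB0 : 0 ≤ B := (abs_nonneg _).trans (hB t ht r hr)
  have hsa : 0 < √a := Real.sqrt_pos.2 ha
  have haa : √a * √a = a := Real.mul_self_sqrt ha.le
  have hsa1 : √a ≤ 1 := Real.sqrt_le_one.2 ha1
  have hx0 : X₀ 0 = 0 := by
    have := hX.odd_zero 0
    norm_num at this
    linarith
  have hx1 : X₀ 1 = 0 := by
    have := hX.odd_one 1
    norm_num at this
    linarith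
  have hUM : ∀ r ∈ Icc (0 : ℝ) 1, refProfile j M c r + X₀ r ≤ M := by
    intro r hr
    have := hU (by simp : (0 : ℝ) ∈ Icc (0 : ℝ) 1) hr hr.1
    simpa [refProfile, hx0] using this
  have hU0 : ∀ r ∈ Icc (0 : ℝ) 1, 0 ≤ refProfile j M c r + X₀ r := by
    intro r hr
    have := hU hr (by simp : (1 : ℝ) ∈ Icc (0 : ℝ) 1) hr.2
    simpa [refProfile, hx1] using this
  have := approxV_shift_sub_le hj hX h h ha (b := 2 * √a) (s := r' - r) (r := r) hB hB
    (by linarith) (by positivity)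
    (fun t ht => by
      have := approxV_le hj hM hX hUM h ha ht (r := r' - r) ⟨by linarith, by linarith [hr.1, hr'.2]⟩
      nlinarith)
    (fun t ht => by
      have := neg_le_approxV hj hM hX hU0 h ha ht (r := 1 - (r' - r))
        ⟨by linarith [hr.1, hr'.2], by linarith⟩
      nlinarith)
    (fun y hy => by
      have h1 := (abs_le.1 (approxV_initial_sub h (y + (r' - r)))).2
      have h2 := (abs_le.1 (approxV_initial_sub h y)).1
      have h3 := hU (a := y) (b := y + (r' - r)) ⟨hy.1, by linarith [hy.2]⟩
        ⟨by linarith [hy.1], by linarith [hy.2]⟩ (by linarith)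
      simp only at h3
      nlinarith) ht ⟨hr.1, by linarith [hr'.2]⟩
  rw [add_sub_cancel] at this
  refine this.trans ?_
  have e : 2 * a * (1 + B) / (2 * √a) = √a * (1 + B) := by
    rw [div_eq_iff (by positivity)]
    linear_combination (-2 * (1 + B)) * haa
  rw [e]
  have : j * (√a * (1 + B)) * t ≤ j * (√a * (1 + B)) * T := by
    have := ht.2
    gcongr
  linarith

end Approx

/-! ### The limiting profile -/

lemma continuous_smooth {f : ℝ → ℝ} (hf : Continuous f) (m : ℝ) : Continuous (smooth m f) :=
  continuous_steklov (continuous_steklov hf m) m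

lemma exists_limit_of_uniform_cauchy {X : Type*} {S : ℕ → Set X} {f : ℕ → X → ℝ}
    (h : ∀ K, ∀ e > 0, ∃ N, ∀ n ≥ N, ∀ n' ≥ N, ∀ x ∈ S K, |f n x - f n' x| ≤ e) :
    ∃ g : X → ℝ, ∀ K, ∀ e > 0, ∃ N, ∀ n ≥ N, ∀ x ∈ S K, |f n x - g x| ≤ e := by
  refine ⟨fun x => limUnder atTop fun n => f n x, fun K e he => ?_⟩
  obtain ⟨N, hN⟩ := h K e he
  refine ⟨N, fun n hn x hx => ?_⟩
  have hc : CauchySeq fun n => f n x := by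
    refine Metric.cauchySeq_iff.2 fun d hd => ?_
    obtain ⟨N', hN'⟩ := h K (d / 2) (by linarith)
    exact ⟨N', fun a ha b hb => by
      rw [Real.dist_eq]
      linarith [hN' a ha b hb x hx]⟩
  have hl := tendsto_nhds_limUnder (cauchySeq_tendsto_of_complete hc)
  refine le_of_tendsto ((tendsto_const_nhds.sub hl).abs) ?_
  filter_upwards [eventually_ge_atTop N] with n' hn' using hN n hn n' hn' x hx

lemma continuousOn_of_uniform_limit {X : Type*} [TopologicalSpace X] {S : Set X} {f : ℕ → X → ℝ}
    {g : X → ℝ} (hf : ∀ n, ContinuousOn (f n) S)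
    (h : ∀ e > 0, ∃ N, ∀ n ≥ N, ∀ x ∈ S, |f n x - g x| ≤ e) : ContinuousOn g S := by
  have : TendstoUniformlyOn f g atTop S := by
    rw [Metric.tendstoUniformlyOn_iff]
    intro e he
    obtain ⟨N, hN⟩ := h (e / 2) (by linarith)
    filter_upwards [eventually_ge_atTop N] with n hn x hx
    rw [dist_comm, Real.dist_eq]
    linarith [hN n hn x hx]
  exact this.continuousOn (Eventually.of_forall hf).frequently

/-- A small function on `[0, 1]` with a `½`-Hölder derivative has a small derivative. -/
lemma abs_deriv_le_of_holder {f f' : ℝ → ℝ} (hf : ∀ r, HasDerivAt f (f' r) r) {e H : ℝ}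
    (he : 0 < e) (he' : e ≤ 1 / 4) (hfe : ∀ r ∈ Icc (0 : ℝ) 1, |f r| ≤ e)
    (hH : ∀ r r', |f' r - f' r'| ≤ H * √|r - r'|) {r : ℝ} (hr : r ∈ Icc (0 : ℝ) 1) :
    |f' r| ≤ 2 * √e + H * √(√e) := by
  have hH0 : 0 ≤ H := by
    have := (abs_nonneg _).trans (hH 1 0)
    simpa using this
  set η := √e with hη
  have hηpos : 0 < η := Real.sqrt_pos.2 he
  have hηη : η * η = e := Real.mul_self_sqrt he.le
  have hη2 : η ≤ 1 / 2 := by nlinarith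
  obtain ⟨u, v, huv, hu, hv, hur⟩ : ∃ u v, v = u + η ∧ u ∈ Icc (0 : ℝ) 1 ∧ v ∈ Icc (0 : ℝ) 1 ∧
      r ∈ Icc u v := by
    rcases le_total r (1 / 2) with h | h
    · exact ⟨r, r + η, rfl, hr, ⟨by linarith [hr.1], by linarith⟩, ⟨le_rfl, by linarith⟩⟩
    · exact ⟨r - η, r, by ring, ⟨by linarith, by linarith [hr.2]⟩, hr, ⟨by linarith, le_rfl⟩⟩
  obtain ⟨ξ, hξ, hξ'⟩ := exists_hasDerivAt_eq_slope f f' (show u < v by linarith)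
    (fun x _ => (hf x).continuousAt.continuousWithinAt) (fun x _ => hf x)
  have h1 : |f' ξ| ≤ 2 * η := by
    rw [hξ', show v - u = η by linarith, abs_div, abs_of_pos hηpos, div_le_iff₀ hηpos]
    have := abs_sub (f v) (f u)
    have h1 := hfe v hv
    have h2 := hfe u hu
    nlinarith
  have h2 : |f' r - f' ξ| ≤ H * √η := by
    refine (hH r ξ).trans (mul_le_mul_of_nonneg_left (Real.sqrt_le_sqrt ?_) hH0)
    rw [abs_le]
    constructor <;> linarith [hur.1, hur.2, hξ.1, hξ.2]
  have := abs_sub_abs_le_abs_sub (f' r) (f' ξ)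
  linarith

/-- The gradient at time `t > 0` of the heat flow from `X₀`, written without differentiating
`X₀`. -/
noncomputable def heatGrad (X₀ : ℝ → ℝ) (t r : ℝ) : ℝ := (∫ z, X₀ (r + √t * z) * z ∂stdGauss) / √t

lemma continuousOn_heatGrad {X₀ : ℝ → ℝ} (hX : Continuous X₀) {C : ℝ} (hC : ∀ y, |X₀ y| ≤ C) :
    ContinuousOn (Function.uncurry (heatGrad X₀)) (Ioi 0 ×ˢ univ) := by
  have h1 : Continuous fun p : ℝ × ℝ => ∫ z, X₀ (p.2 + √p.1 * z) * z ∂stdGauss :=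
    continuous_integral_stdGauss (F := fun (p : ℝ × ℝ) z => X₀ (p.2 + √p.1 * z))
      (by simp only [Function.uncurry_def]; fun_prop) (fun _ _ => hC _) integrable_id_stdGauss
  refine h1.continuousOn.div (by fun_prop) ?_
  rintro ⟨t, r⟩ ⟨ht, -⟩
  exact (Real.sqrt_pos.2 ht).ne'

lemma abs_heat_smoothD_sub_le {X₀ : ℝ → ℝ} (hX : IsDatum X₀) {m a : ℝ} (hm : 0 < m)
    (ha : ∀ y, |smooth m X₀ y - X₀ y| ≤ a) {t : ℝ} (ht : 0 < t) (r : ℝ) :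
    |heat t (smoothD m X₀) r - heatGrad X₀ t r| ≤ a / √t := by
  obtain ⟨C, hC⟩ := hX.bounded
  have hs : 0 < √t := Real.sqrt_pos.2 ht
  have hsm : Continuous (smooth m X₀) := continuous_steklov (continuous_steklov hX.continuous m) m
  have e := heat_deriv_eq (hasDerivAt_smooth hX.continuous m) (abs_smooth_le hC hm)
    (continuous_diffQuot (continuous_steklov hX.continuous m) m) (abs_smoothD_le hC hm) t r
  have e1 : heat t (smoothD m X₀) r = (∫ z, smooth m X₀ (r + √t * z) * z ∂stdGauss) / √t := by
    rw [eq_div_iff hs.ne', ← e, mul_comm]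
  rw [e1, heatGrad, ← sub_div, abs_div, abs_of_pos hs]
  refine div_le_div_of_nonneg_right ?_ hs.le
  have hXc := hX.continuous
  rw [← integral_sub
    (integrable_mul_stdGauss (f := fun z => smooth m X₀ (r + √t * z)) (by fun_prop)
      (fun z => abs_smooth_le hC hm _) integrable_id_stdGauss)
    (integrable_mul_stdGauss (f := fun z => X₀ (r + √t * z)) (by fun_prop)
      (fun z => hC _) integrable_id_stdGauss)]
  simp only [← sub_mul]
  refine (abs_integral_mul_stdGauss_le (f := fun z => smooth m X₀ (r + √t * z) - X₀ (r + √t * z))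
    (fun z => ha _) integrable_id_stdGauss).trans ?_
  have : 0 ≤ a := (abs_nonneg _).trans (ha 0)
  nlinarith [integral_abs_stdGauss_le]

set_option maxHeartbeats 1000000 in
/-- The limit of the approximate solutions, and the convergence of their gradients. -/
lemma exists_limit_profile {j M c C : ℝ} {X₀ : ℝ → ℝ} (hj : 0 < j) (hM : 0 ≤ M)
    (hX : IsDatum X₀) (hC : ∀ y, |X₀ y| ≤ C)
    (hU : AntitoneOn (fun r => refProfile j M c r + X₀ r) (Icc (0 : ℝ) 1))
    {m : ℕ → ℝ} {k : ℕ → ℝ → ℝ → ℝ}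
    (happ : ∀ n : ℕ, IsApprox j M c X₀ (1 / (n + 1)) (n + 1) (m n) (k n))
    {B₀ : ℝ} (hB₀ : ∀ r ∈ Icc (0 : ℝ) 1, |refProfile j M c r| ≤ B₀) :
    ∃ U θ : ℝ × ℝ → ℝ,
      (∀ T e : ℝ, 0 < e → ∃ N : ℕ, ∀ n ≥ N, ∀ t ∈ Icc 0 T, ∀ r ∈ Icc (0 : ℝ) 1,
        |approxV j M c (m n) X₀ (k n) t r - U (t, r)| ≤ e) ∧
      ContinuousOn U (Ici 0 ×ˢ Icc 0 1) ∧
      ContinuousOn θ (Ici 0 ×ˢ Icc 0 1) ∧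
      (∀ r ∈ Icc (0 : ℝ) 1, U (0, r) = refProfile j M c r + X₀ r) ∧
      (∀ t, 0 ≤ t → U (t, 1) = 0) ∧
      (∀ t, 0 ≤ t → AntitoneOn (fun r => U (t, r)) (Icc 0 1)) ∧
      (∀ r ∈ Icc (0 : ℝ) 1, θ (0, r) = 0) ∧
      (∀ t, 0 < t → ∀ r ∈ Icc (0 : ℝ) 1, U (t, r) = ∫ y in r..1,
        (j * θ (t, y) - heatGrad X₀ t y - refProfileD j M c y)) := by
  have hbnd : ∀ n : ℕ, ∀ T, ∀ t ∈ Icc 0 T, ∀ r ∈ Icc (0 : ℝ) 1,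
      |approxV j M c (m n) X₀ (k n) t r| ≤ B₀ + (C + 2 * j * T) := by
    intro n T t ht r hr
    refine (abs_add_le _ _).trans (add_le_add (hB₀ r hr) ?_)
    refine (abs_mildSol_le hj (happ n).source (happ n).pos hC ht.1 r).trans ?_
    nlinarith [ht.2]
  have happ' : ∀ (K N n : ℕ), K ≤ N → N ≤ n →
      IsApprox j M c X₀ (1 / (N + 1)) K (m n) (k n) := by
    intro K N n hK hn
    refine (happ n).mono ?_ ?_
    · have : (N : ℝ) ≤ n := by exact_mod_cast hn
      exact one_div_le_one_div_of_le (by positivity) (by linarith)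
    · have : (K : ℝ) ≤ n := by exact_mod_cast hK.trans hn
      linarith
  have hfrac : ∀ N : ℕ, (1 : ℝ) / (N + 1) ≤ 1 := fun N => by
    rw [div_le_one (by positivity)]
    have : (0 : ℝ) ≤ N := by positivity
    linarith
  -- choice of a precision
  have hsmall : ∀ A e : ℝ, 0 < e → ∃ N₀ : ℕ, ∀ N ≥ N₀, √(1 / ((N : ℝ) + 1)) * A ≤ e := by
    intro A e he
    have h1 : Tendsto (fun N : ℕ => √(1 / ((N : ℝ) + 1)) * A) atTop (𝓝 0) := by
      have := (Real.continuous_sqrt.tendsto 0).comp (tendsto_one_div_add_atTop_nhds_zero_nat (𝕜 := ℝ))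
      rw [Real.sqrt_zero] at this
      simpa using this.mul_const A
    exact eventually_atTop.1 (h1.eventually (ge_mem_nhds he))
  have cauchyV : ∀ K : ℕ, ∀ e > 0, ∃ N : ℕ, ∀ n ≥ N, ∀ n' ≥ N, ∀ p ∈ Icc (0 : ℝ) K ×ˢ Icc (0 : ℝ) 1,
      |approxV j M c (m n) X₀ (k n) p.1 p.2 - approxV j M c (m n') X₀ (k n') p.1 p.2| ≤ e := by
    intro K e he
    obtain ⟨N₀, hN₀⟩ := hsmall (2 + j * (1 + (B₀ + (C + 2 * j * K))) * K) e he
    refine ⟨max N₀ K, fun n hn n' hn' p hp => ?_⟩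
    exact (abs_approxV_sub_le hj hX (happ' K (max N₀ K) n (le_max_right _ _) hn)
      (happ' K (max N₀ K) n' (le_max_right _ _) hn') (by positivity) (hfrac _) (hbnd n K) (hbnd n' K)
      hp.1 hp.2).trans (hN₀ _ (le_max_left _ _))
  obtain ⟨U, hUlim⟩ := exists_limit_of_uniform_cauchy (X := ℝ × ℝ)
    (S := fun K : ℕ => Icc (0 : ℝ) K ×ˢ Icc (0 : ℝ) 1)
    (f := fun n p => approxV j M c (m n) X₀ (k n) p.1 p.2) cauchyV
  have hUT : ∀ T e : ℝ, 0 < e → ∃ N : ℕ, ∀ n ≥ N, ∀ t ∈ Icc 0 T, ∀ r ∈ Icc (0 : ℝ) 1,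
        |approxV j M c (m n) X₀ (k n) t r - U (t, r)| ≤ e := by
    intro T e he
    obtain ⟨K, hK⟩ := exists_nat_ge T
    obtain ⟨N, hN⟩ := hUlim K e he
    exact ⟨N, fun n hn t ht r hr => hN n hn (t, r) ⟨⟨ht.1, ht.2.trans hK⟩, hr⟩⟩
  have hptw : ∀ t, 0 ≤ t → ∀ r ∈ Icc (0 : ℝ) 1,
      Tendsto (fun n => approxV j M c (m n) X₀ (k n) t r) atTop (𝓝 (U (t, r))) := by
    intro t ht r hr
    refine Metric.tendsto_atTop.2 fun e he => ?_
    obtain ⟨N, hN⟩ := hUT t (e / 2) (by linarith)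
    exact ⟨N, fun n hn => by
      rw [Real.dist_eq]
      linarith [hN n hn t ⟨ht, le_rfl⟩ r hr]⟩
  -- the Duhamel parts
  set Λ : ℕ → ℝ → ℝ → ℝ := fun n => duhamel fun s => smooth (m n) (k n s) with hΛ
  set Λ' : ℕ → ℝ → ℝ → ℝ := fun n => duhamel fun s => smoothD (m n) (k n s) with hΛ'
  have hΛd : ∀ n t r, HasDerivAt (Λ n t) (Λ' n t r) r := fun n t r =>
    hasDerivAt_duhamel (continuous_smooth_param (happ n).source.continuous _)
      (fun s => abs_smooth_le ((happ n).source.bound s) (happ n).pos)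
      (fun s => hasDerivAt_smooth ((happ n).source.slice s) _)
      (continuous_smoothD_param (happ n).source.continuous _)
      (fun s => abs_smoothD_le ((happ n).source.bound s) (happ n).pos) t r
  have hΛc : ∀ n, Continuous (Function.uncurry (Λ' n)) := fun n =>
    continuous_duhamel (continuous_smoothD_param (happ n).source.continuous _)
      (fun s => abs_smoothD_le ((happ n).source.bound s) (happ n).pos)
  have hΛH : ∀ n, ∀ K : ℕ, ∀ t ∈ Icc (0 : ℝ) K, ∀ r r',
      |Λ' n t r - Λ' n t r'| ≤ 16 * (K : ℝ) ^ (1 / 4 : ℝ) * √|r - r'| := by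
    intro n K t ht r r'
    have := abs_duhamel_deriv_sub_le
      (fun s => abs_smooth_le ((happ n).source.bound s) (happ n).pos)
      (fun s => hasDerivAt_smooth ((happ n).source.slice s) _)
      (continuous_smoothD_param (happ n).source.continuous _)
      (fun s => abs_smoothD_le ((happ n).source.bound s) (happ n).pos)
      (fun s => hasDerivAt_smoothD ((happ n).source.slice s) _)
      (continuous_smoothDD_param (happ n).source.continuous _)
      (fun s => abs_smoothDD_le ((happ n).source.bound s) (happ n).pos) ht.1 r r'
    refine this.trans ?_
    have h2 : t ^ (1 / 4 : ℝ) ≤ (K : ℝ) ^ (1 / 4 : ℝ) :=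
      Real.rpow_le_rpow ht.1 ht.2 (by norm_num)
    have h3 : (8 : ℝ) * 2 * t ^ (1 / 4 : ℝ) ≤ 16 * (K : ℝ) ^ (1 / 4 : ℝ) := by linarith
    exact mul_le_mul_of_nonneg_right h3 (Real.sqrt_nonneg _)
  have cauchyΛ : ∀ K : ℕ, ∀ e > 0, ∃ N : ℕ, ∀ n ≥ N, ∀ n' ≥ N, ∀ t ∈ Icc (0 : ℝ) K,
      ∀ r ∈ Icc (0 : ℝ) 1, |Λ n t r - Λ n' t r| ≤ e := by
    intro K e he
    obtain ⟨N₁, hN₁⟩ := cauchyV K (j * e / 2) (by positivity)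
    obtain ⟨N₂, hN₂⟩ := hsmall 1 (min 1 (j * e / 4)) (by positivity)
    refine ⟨max N₁ N₂, fun n hn n' hn' t ht r hr => ?_⟩
    have hdat : ∀ n ≥ max N₁ N₂, |heat t (smooth (m n) X₀) r - heat t X₀ r| ≤ j * e / 4 := by
      intro n hn
      rw [← heat_sub (continuous_smooth hX.continuous _)
        (abs_smooth_le hC (happ n).pos) hX.continuous hC]
      refine abs_heat_le (fun z => ((happ n).datum_close z).trans ?_) _ _
      have h1 := hN₂ n ((le_max_right _ _).trans hn)
      rw [mul_one] at h1
      have h2 := h1.trans (min_le_left _ _)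
      have h3 := h1.trans (min_le_right _ _)
      have h4 := Real.mul_self_sqrt (show (0 : ℝ) ≤ 1 / ((n : ℝ) + 1) by positivity)
      nlinarith [Real.sqrt_nonneg (1 / ((n : ℝ) + 1))]
    have h1 := hN₁ n ((le_max_left _ _).trans hn) n' ((le_max_left _ _).trans hn') (t, r) ⟨ht, hr⟩
    have h2 := hdat n hn
    have h3 := hdat n' hn'
    have h4 : j * (Λ n t r - Λ n' t r) =
        (heat t (smooth (m n) X₀) r - heat t X₀ r) - (heat t (smooth (m n') X₀) r - heat t X₀ r)
        - (approxV j M c (m n) X₀ (k n) t r - approxV j M c (m n') X₀ (k n') t r) := by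
      simp only [approxV, mildSol, hΛ]
      ring
    have h5 : |j * (Λ n t r - Λ n' t r)| ≤ j * e := by
      rw [h4]
      refine (abs_sub _ _).trans ?_
      have := abs_sub (heat t (smooth (m n) X₀) r - heat t X₀ r)
        (heat t (smooth (m n') X₀) r - heat t X₀ r)
      simp only at h1
      linarith
    rw [abs_mul, abs_of_pos hj] at h5
    exact le_of_mul_le_mul_left h5 hj
  have cauchyΛ' : ∀ K : ℕ, ∀ e > 0, ∃ N : ℕ, ∀ n ≥ N, ∀ n' ≥ N,
      ∀ p ∈ Icc (0 : ℝ) K ×ˢ Icc (0 : ℝ) 1, |Λ' n p.1 p.2 - Λ' n' p.1 p.2| ≤ e := by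
    intro K e he
    have hlim : Tendsto (fun d : ℝ => 2 * √d + (32 * (K : ℝ) ^ (1 / 4 : ℝ)) * √(√d)) (𝓝[>] 0)
        (𝓝 0) := by
      have : Continuous fun d : ℝ => 2 * √d + (32 * (K : ℝ) ^ (1 / 4 : ℝ)) * √(√d) := by fun_prop
      have := this.tendsto 0
      simp only [Real.sqrt_zero, mul_zero, add_zero] at this
      exact this.mono_left nhdsWithin_le_nhds
    obtain ⟨d, hd, hd0, hd4⟩ := ((hlim.eventually (ge_mem_nhds he)).and
      (Ioc_mem_nhdsGT (show (0 : ℝ) < 1 / 4 by norm_num))).exists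
    obtain ⟨N, hN⟩ := cauchyΛ K d hd0
    refine ⟨N, fun n hn n' hn' p hp => ?_⟩
    refine (abs_deriv_le_of_holder (f := fun r => Λ n p.1 r - Λ n' p.1 r)
      (f' := fun r => Λ' n p.1 r - Λ' n' p.1 r) (H := 32 * (K : ℝ) ^ (1 / 4 : ℝ))
      (fun r => (hΛd n p.1 r).sub (hΛd n' p.1 r)) hd0 hd4 (hN n hn n' hn' p.1 hp.1)
      (fun r r' => ?_) hp.2).trans hd
    have h1 := hΛH n K p.1 hp.1 r r'
    have h2 := hΛH n' K p.1 hp.1 r r'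
    rw [show ∀ a b c d : ℝ, a - b - (c - d) = (a - c) - (b - d) by intros; ring]
    refine (abs_sub _ _).trans ?_
    linarith
  obtain ⟨θ, hθlim⟩ := exists_limit_of_uniform_cauchy (X := ℝ × ℝ)
    (S := fun K : ℕ => Icc (0 : ℝ) K ×ˢ Icc (0 : ℝ) 1) (f := fun n p => Λ' n p.1 p.2) cauchyΛ'
  have hcontOn : ∀ {g : ℝ × ℝ → ℝ} {f : ℕ → ℝ × ℝ → ℝ}, (∀ n, Continuous (f n)) →
      (∀ K : ℕ, ∀ e > 0, ∃ N, ∀ n ≥ N, ∀ x ∈ Icc (0 : ℝ) K ×ˢ Icc (0 : ℝ) 1, |f n x - g x| ≤ e) →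
      ContinuousOn g (Ici 0 ×ˢ Icc 0 1) := by
    intro g f hf hlim
    rintro ⟨t, r⟩ ⟨ht, hr⟩
    obtain ⟨K, hK⟩ := exists_nat_gt t
    have h1 := continuousOn_of_uniform_limit (fun n => (hf n).continuousOn) (hlim K) (t, r)
      ⟨⟨ht, hK.le⟩, hr⟩
    refine h1.mono_of_mem_nhdsWithin ?_
    have : (Iio (K : ℝ) ×ˢ (univ : Set ℝ)) ∈ 𝓝 (t, r) :=
      prod_mem_nhds (Iio_mem_nhds hK) univ_mem
    filter_upwards [mem_nhdsWithin_of_mem_nhds this, self_mem_nhdsWithin] with q h1 h2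
    exact ⟨⟨h2.1, le_of_lt h1.1⟩, h2.2⟩
  have hθcont : ContinuousOn θ (Ici 0 ×ˢ Icc 0 1) := hcontOn (fun n => hΛc n) hθlim
  refine ⟨U, θ, hUT, hcontOn (fun n => continuous_approxV hX (happ n).source (happ n).pos) hUlim,
    hθcont, fun r hr => ?_, fun t ht => ?_, fun t ht r hr r' hr' hrr => ?_,
    fun r hr => ?_, fun t ht r hr => ?_⟩
  · refine tendsto_nhds_unique (hptw 0 le_rfl r hr) (Metric.tendsto_atTop.2 fun e he => ?_)
    obtain ⟨N, hN⟩ := hsmall 1 (min 1 (e / 2)) (by positivity)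
    refine ⟨N, fun n hn => ?_⟩
    rw [Real.dist_eq]
    have h1 := hN n hn
    rw [mul_one] at h1
    have h2 := h1.trans (min_le_left _ _)
    have h3 := h1.trans (min_le_right _ _)
    have h4 := Real.mul_self_sqrt (show (0 : ℝ) ≤ 1 / ((n : ℝ) + 1) by positivity)
    have h5 := approxV_initial_sub (happ n) r
    nlinarith [Real.sqrt_nonneg (1 / ((n : ℝ) + 1))]
  · refine tendsto_nhds_unique (hptw t ht 1 (by simp)) ?_
    simp only [approxV_at_one hX (happ _).source]
    exact tendsto_const_nhds
  · obtain ⟨K, hK⟩ := exists_nat_ge t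
    refine le_of_forall_pos_le_add fun e he => ?_
    have hlim := (hptw t ht r' hr').sub (hptw t ht r hr)
    have : U (t, r') - U (t, r) ≤ e := by
      refine le_of_tendsto hlim ?_
      obtain ⟨N, hN⟩ := hsmall (2 + j * (1 + (B₀ + (C + 2 * j * K))) * K) e he
      filter_upwards [eventually_ge_atTop (max N K)] with n hn
      exact (approxV_almost_antitone hj hM hX hU (happ' K n n ((le_max_right _ _).trans hn) le_rfl)
        (by positivity) (hfrac _) (hbnd n K) ⟨ht, hK⟩ hr hr' hrr).trans
        (hN _ ((le_max_left _ _).trans hn))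
    simp only
    linarith
  · refine tendsto_nhds_unique (f := fun n => Λ' n 0 r) (l := atTop)
      (Metric.tendsto_atTop.2 fun e he => ?_) ?_
    · obtain ⟨N, hN⟩ := hθlim 0 (e / 2) (by linarith)
      refine ⟨N, fun n hn => ?_⟩
      rw [Real.dist_eq]
      linarith [hN n hn (0, r) ⟨by simp, hr⟩]
    · simp [hΛ', duhamel]
  · have hst : 0 < √t := Real.sqrt_pos.2 ht
    have hsub : uIcc r 1 ⊆ Icc (0 : ℝ) 1 := by
      rw [uIcc_of_le hr.2]
      exact Icc_subset_Icc_left hr.1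
    have hG : ContinuousOn (fun y => j * θ (t, y) - heatGrad X₀ t y - refProfileD j M c y)
        (Icc (0 : ℝ) 1) := by
      refine ContinuousOn.sub (ContinuousOn.sub (ContinuousOn.const_mul ?_ _) ?_)
        (continuous_refProfileD j M c).continuousOn
      · exact hθcont.comp (f := fun y => (t, y)) (by fun_prop) fun y hy => ⟨ht.le, hy⟩
      · exact (continuousOn_heatGrad hX.continuous hC).comp (f := fun y => (t, y)) (by fun_prop)
          fun y hy => ⟨ht, mem_univ _⟩
    have hGi : IntervalIntegrable (fun y => j * θ (t, y) - heatGrad X₀ t y - refProfileD j M c y)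
        volume r 1 := (hG.mono hsub).intervalIntegrable
    obtain ⟨K, hK⟩ := exists_nat_ge t
    refine tendsto_nhds_unique (hptw t ht.le r hr) (Metric.tendsto_atTop.2 fun e he => ?_)
    obtain ⟨N₁, hN₁⟩ := hθlim K (e / (4 * j)) (by positivity)
    obtain ⟨N₂, hN₂⟩ := hsmall 1 (min 1 (√t * e / 4)) (by positivity)
    refine ⟨max N₁ N₂, fun n hn => ?_⟩
    have hc : Continuous (approxVD j M c (m n) X₀ (k n) t) :=
      (continuous_approxVD hX (happ n).source (happ n).pos).comp
        (by fun_prop : Continuous fun y : ℝ => (t, y))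
    have hV : approxV j M c (m n) X₀ (k n) t r
        = ∫ y in r..1, -approxVD j M c (m n) X₀ (k n) t y := by
      rw [intervalIntegral.integral_neg, intervalIntegral.integral_eq_sub_of_hasDerivAt
        (fun y _ => hasDerivAt_approxV hX (happ n).source (happ n).pos t y)
        (hc.intervalIntegrable _ _), approxV_at_one hX (happ n).source]
      ring
    have hcn : Continuous fun y => -approxVD j M c (m n) X₀ (k n) t y := hc.neg
    rw [Real.dist_eq, hV, ← intervalIntegral.integral_sub (hcn.intervalIntegrable _ _) hGi]
    have hb := intervalIntegral.norm_integral_le_of_norm_le_const (a := r) (b := 1) (C := e / 2)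
      (f := fun y => -approxVD j M c (m n) X₀ (k n) t y
        - (j * θ (t, y) - heatGrad X₀ t y - refProfileD j M c y)) (fun y hy => ?_)
    · rw [Real.norm_eq_abs] at hb
      have h1 : |1 - r| ≤ 1 := abs_le.2 ⟨by linarith [hr.2], by linarith [hr.1]⟩
      have : e / 2 * |1 - r| ≤ e / 2 * 1 := by gcongr
      linarith
    · have hy' : y ∈ Icc (0 : ℝ) 1 := hsub (uIoc_subset_uIcc hy)
      have h1 := hN₁ n ((le_max_left _ _).trans hn) (t, y) ⟨⟨ht.le, hK⟩, hy'⟩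
      have h2 := abs_heat_smoothD_sub_le hX (happ n).pos (happ n).datum_close ht y
      have h3 : (1 : ℝ) / (n + 1) / √t ≤ e / 4 := by
        rw [div_le_iff₀ hst]
        have h1 := hN₂ n ((le_max_right _ _).trans hn)
        rw [mul_one] at h1
        have h2 := h1.trans (min_le_left _ _)
        have h3 := h1.trans (min_le_right _ _)
        have h4 := Real.mul_self_sqrt (show (0 : ℝ) ≤ 1 / ((n : ℝ) + 1) by positivity)
        nlinarith [Real.sqrt_nonneg (1 / ((n : ℝ) + 1))]
      have h4 : |j * (Λ' n t y - θ (t, y))| ≤ e / 4 := by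
        rw [abs_mul, abs_of_pos hj]
        calc j * |Λ' n t y - θ (t, y)| ≤ j * (e / (4 * j)) := by gcongr
          _ = e / 4 := by field_simp
      have e1 : -approxVD j M c (m n) X₀ (k n) t y
          - (j * θ (t, y) - heatGrad X₀ t y - refProfileD j M c y)
          = j * (Λ' n t y - θ (t, y)) - (heat t (smoothD (m n) X₀) y - heatGrad X₀ t y) := by
        simp only [approxVD, mildSolD, hΛ']
        ring
      rw [e1, Real.norm_eq_abs]
      exact (abs_sub _ _).trans (by linarith)

/-! ### The limit profile of a bounded datum -/

lemma eq_of_odd_periodic {f g : ℝ → ℝ} (hf : ∀ y, f (-y) = -f y) (hg : ∀ y, g (-y) = -g y)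
    (hf2 : ∀ y, ∀ k : ℤ, f (y + 2 * k) = f y) (hg2 : ∀ y, ∀ k : ℤ, g (y + 2 * k) = g y)
    (h : ∀ y ∈ Icc (0 : ℝ) 1, f y = g y) (y : ℝ) : f y = g y := by
  obtain ⟨k, hk, -⟩ := existsUnique_sub_zsmul_mem_Ico (two_pos : (0 : ℝ) < 2) y (-1)
  obtain ⟨h1, h2⟩ := hk
  have e : y = (y - k • (2 : ℝ)) + 2 * k := by simp [mul_comm]
  rw [e, hf2, hg2]
  set z := y - k • (2 : ℝ)
  rcases le_total 0 z with hz | hz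
  · exact h z ⟨hz, by linarith⟩
  · have := h (-z) ⟨by linarith, by linarith⟩
    rw [hf, hg] at this
    linarith

/-- The tail mass of `u`, written as an interval integral of the extension of `u` by `0`; unlike
`tailMass u` it is continuous on the whole line. -/
noncomputable def tailIntegral (u : ℝ → ℝ) (r : ℝ) : ℝ :=
  ∫ y in r..1, (Icc (0 : ℝ) 1).indicator u y

lemma tailMass_eq_integral (u : ℝ → ℝ) {r : ℝ} (hr : r ≤ 1) :
    tailMass u r = ∫ y in r..1, u y := by
  rw [tailMass, integral_Icc_eq_integral_Ioc, intervalIntegral.integral_of_le hr]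

lemma tailMass_eq_tailIntegral (u : ℝ → ℝ) {r : ℝ} (hr : r ∈ Icc (0 : ℝ) 1) :
    tailMass u r = tailIntegral u r := by
  rw [tailMass_eq_integral u hr.2, tailIntegral]
  refine intervalIntegral.integral_congr fun y hy => ?_
  rw [uIcc_of_le hr.2] at hy
  simp [indicator_of_mem (show y ∈ Icc (0 : ℝ) 1 from ⟨hr.1.trans hy.1, hy.2⟩)]

section Tail

variable {u : ℝ → ℝ}

lemma integrable_indicator_of_memLp (hu : MemLp u ⊤ (volume.restrict (Icc (0 : ℝ) 1))) :
    Integrable ((Icc (0 : ℝ) 1).indicator u) := by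
  rw [integrable_indicator_iff measurableSet_Icc]
  exact hu.integrable le_top

lemma continuous_tailIntegral (hu : MemLp u ⊤ (volume.restrict (Icc (0 : ℝ) 1))) :
    Continuous (tailIntegral u) := by
  have h := intervalIntegral.continuous_primitive
    (fun a b => (integrable_indicator_of_memLp hu).intervalIntegrable (a := a) (b := b)) 1
  have h2 : tailIntegral u = fun r => -∫ y in (1 : ℝ)..r, (Icc (0 : ℝ) 1).indicator u y := by
    funext r
    rw [tailIntegral, intervalIntegral.integral_symm]
  rw [h2]
  exact h.neg

lemma antitone_tailIntegral (hu : MemLp u ⊤ (volume.restrict (Icc (0 : ℝ) 1)))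
    (hu0 : ∀ᵐ r ∂(volume.restrict (Icc (0 : ℝ) 1)), 0 ≤ u r) : Antitone (tailIntegral u) := by
  intro a b hab
  have hi : ∀ a b, IntervalIntegrable ((Icc (0 : ℝ) 1).indicator u) volume a b := fun a b =>
    (integrable_indicator_of_memLp hu).intervalIntegrable
  have h1 := intervalIntegral.integral_add_adjacent_intervals (hi a b) (hi b 1)
  have h2 : 0 ≤ ∫ y in a..b, (Icc (0 : ℝ) 1).indicator u y := by
    refine intervalIntegral.integral_nonneg_of_ae hab ?_
    have := (ae_restrict_iff' measurableSet_Icc).1 hu0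
    filter_upwards [this] with y hy
    by_cases h : y ∈ Icc (0 : ℝ) 1
    · rw [indicator_of_mem h]
      exact hy h
    · rw [indicator_of_notMem h]
      exact le_rfl
  unfold tailIntegral
  linarith

lemma tailIntegral_one : tailIntegral u 1 = 0 := by simp [tailIntegral]

end Tail

lemma continuous_oddExt {f : ℝ → ℝ} (hf : Continuous f) (h0 : f 0 = 0) (h1 : f 1 = 0) :
    Continuous (oddExt f) := by
  have h := continuous_oddExt_param (X := Unit) (F := fun _ => f) (hf.comp continuous_snd)
    (fun _ => h0) (fun _ => h1)
  have h2 : oddExt f = Function.uncurry (fun _ : Unit => oddExt f) ∘ fun y => ((), y) := rfl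
  rw [h2]
  exact h.comp (Continuous.prodMk continuous_const continuous_id)

/-- The odd periodic datum which, added to `refProfile`, gives the tail masses of `u`. -/
noncomputable def tailDatum (j c : ℝ) (u : ℝ → ℝ) : ℝ → ℝ :=
  oddExt fun r => tailIntegral u r - refProfile j (tailIntegral u 0) c r

lemma refProfile_zero (j M c : ℝ) : refProfile j M c 0 = M := by simp [refProfile]

lemma refProfile_one (j M c : ℝ) : refProfile j M c 1 = 0 := by simp [refProfile]

section Datum

variable {u : ℝ → ℝ} {j c : ℝ}

lemma isDatum_tailDatum (hu : MemLp u ⊤ (volume.restrict (Icc (0 : ℝ) 1))) :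
    IsDatum (tailDatum j c u) ∧
      ∀ e > 0, ∃ η > 0, ∀ y y', |y - y'| ≤ η → |tailDatum j c u y - tailDatum j c u y'| ≤ e := by
  set f : ℝ → ℝ := fun r => tailIntegral u r - refProfile j (tailIntegral u 0) c r with hf
  have hfc : Continuous f := (continuous_tailIntegral hu).sub (continuous_refProfile _ _ _)
  have h0 : f 0 = 0 := by simp [hf, refProfile_zero]
  have h1 : f 1 = 0 := by simp [hf, refProfile_one, tailIntegral_one]
  have hc : Continuous (tailDatum j c u) :=
    continuous_oddExt hfc h0 h1
  obtain ⟨C, hC⟩ := isCompact_Icc.exists_bound_of_continuousOn (s := Icc (0 : ℝ) 1)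
    hfc.continuousOn
  refine ⟨⟨hc, ⟨C, abs_oddExt_le fun y hy => by simpa using hC y hy⟩, oddExt_odd_zero h0 h1,
    oddExt_odd_one h0 h1⟩, fun e he => ?_⟩
  have huc := isCompact_Icc.uniformContinuousOn_of_continuous (s := Icc (0 : ℝ) 1)
    hfc.continuousOn
  obtain ⟨δ, hδ, hd⟩ := Metric.uniformContinuousOn_iff_le.1 huc (e / 2) (by positivity)
  refine ⟨δ, hδ, fun y y' hy => ?_⟩
  have := oddExt_modulus h0 h1 (fun a ha b hb hab => hd a ha b hb hab) y y' hy
  simp only [tailDatum]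
  linarith

lemma refProfile_add_tailDatum {r : ℝ} (hr : r ∈ Icc (0 : ℝ) 1) :
    refProfile j (tailIntegral u 0) c r + tailDatum j c u r = tailIntegral u r := by
  rw [tailDatum, oddExt_of_mem hr]
  ring

lemma tailIntegral_sub_eq (hu : MemLp u ⊤ (volume.restrict (Icc (0 : ℝ) 1))) {r : ℝ}
    (hr : r ∈ Icc (0 : ℝ) 1) :
    tailIntegral u r = tailIntegral u 0 - ∫ y in (0 : ℝ)..r, u (fold y) := by
  have hi : ∀ a b, IntervalIntegrable ((Icc (0 : ℝ) 1).indicator u) volume a b := fun a b =>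
    (integrable_indicator_of_memLp hu).intervalIntegrable
  have h1 := intervalIntegral.integral_add_adjacent_intervals (hi 0 r) (hi r 1)
  have h2 : ∫ y in (0 : ℝ)..r, (Icc (0 : ℝ) 1).indicator u y = ∫ y in (0 : ℝ)..r, u (fold y) := by
    refine intervalIntegral.integral_congr fun y hy => ?_
    rw [uIcc_of_le hr.1] at hy
    have hy' : y ∈ Icc (0 : ℝ) 1 := ⟨hy.1, hy.2.trans hr.2⟩
    simp only [indicator_of_mem hy', fold_of_mem hy']
  unfold tailIntegral
  linarith

/-- If `u` is continuous then `tailDatum` is continuously differentiable. -/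
lemma hasDerivAt_tailDatum (hu : MemLp u ⊤ (volume.restrict (Icc (0 : ℝ) 1)))
    (huc : ContinuousOn u (Icc (0 : ℝ) 1)) (y : ℝ) :
    HasDerivAt (tailDatum j c u)
      (-u (fold y) - refProfileD j (tailIntegral u 0) c (fold y)) y := by
  set a : ℝ → ℝ := fun y => -u (fold y) - refProfileD j (tailIntegral u 0) c (fold y) with ha
  have huf : Continuous fun y => u (fold y) :=
    huc.comp_continuous continuous_fold fold_mem
  have hac : Continuous a :=
    huf.neg.sub ((continuous_refProfileD _ _ _).comp continuous_fold)
  have hai : ∀ x y, IntervalIntegrable a volume x y := fun x y => hac.intervalIntegrable _ _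
  set A : ℝ → ℝ := fun y => ∫ z in (0 : ℝ)..y, a z with hA
  have hDA : HasDerivAt A (a y) y := (hac.integral_hasStrictDerivAt 0 y).hasDerivAt
  have h0 : tailIntegral u 0 - refProfile j (tailIntegral u 0) c 0 = 0 := by
    simp [refProfile_zero]
  have h1 : tailIntegral u 1 - refProfile j (tailIntegral u 0) c 1 = 0 := by
    simp [refProfile_one, tailIntegral_one]
  have hAI : ∀ r ∈ Icc (0 : ℝ) 1, tailDatum j c u r = A r := by
    intro r hr
    rw [tailDatum, oddExt_of_mem hr, tailIntegral_sub_eq hu hr]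
    have e1 : A r = ∫ z in (0 : ℝ)..r, (-u (fold z) - refProfileD j (tailIntegral u 0) c z) := by
      refine intervalIntegral.integral_congr fun z hz => ?_
      rw [uIcc_of_le hr.1] at hz
      simp only [ha, fold_of_mem (show z ∈ Icc (0 : ℝ) 1 from ⟨hz.1, hz.2.trans hr.2⟩)]
    have hn : Continuous fun z => -u (fold z) := huf.neg
    rw [e1, intervalIntegral.integral_sub (hn.intervalIntegrable _ _)
      ((continuous_refProfileD _ _ _).intervalIntegrable _ _), intervalIntegral.integral_neg,
      intervalIntegral.integral_eq_sub_of_hasDerivAt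
        (fun z _ => hasDerivAt_refProfile j (tailIntegral u 0) c z)
        ((continuous_refProfileD _ _ _).intervalIntegrable _ _), refProfile_zero]
    ring
  have haev : ∀ z, a (-z) = a z := fun z => by simp only [ha, fold_neg]
  have haper : Function.Periodic a 2 := fun z => by
    have := fold_add_two_mul z 1
    simp only [Int.cast_one, mul_one] at this
    simp only [ha, this]
  have hAodd : ∀ z, A (-z) = -A z := by
    intro z
    have := intervalIntegral.integral_comp_neg (a := 0) (b := z) a
    simp only [haev, neg_zero] at this
    rw [hA]
    simp only
    rw [this, intervalIntegral.integral_symm]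
  have hA1 : A 1 = 0 := by
    rw [← hAI 1 (by simp), tailDatum, oddExt_of_mem (by simp)]
    exact h1
  have hAper1 : Function.Periodic A 2 := by
    intro z
    have e1 := haper.intervalIntegral_add_eq z (-1)
    have e2 := intervalIntegral.integral_add_adjacent_intervals (hai 0 z) (hai z (z + 2))
    have e3 := intervalIntegral.integral_add_adjacent_intervals (hai 0 (-1)) (hai (-1) (-1 + 2))
    have e4 : A (-1) = 0 := by rw [hAodd, hA1, neg_zero]
    have e5 : A (-1 + 2) = 0 := by rw [show (-1 : ℝ) + 2 = 1 by norm_num, hA1]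
    simp only [hA] at e4 e5 ⊢
    linarith
  have hAper : ∀ z, ∀ k : ℤ, A (z + 2 * k) = A z := fun z k => by
    rw [mul_comm]
    exact hAper1.int_mul k z
  have hE : tailDatum j c u = A := funext fun z =>
    eq_of_odd_periodic (oddExt_neg h0 h1) hAodd (oddExt_periodic _) hAper hAI z
  rw [hE]
  exact hDA

end Datum

lemma nonneg_of_antitoneOn_integral {g : ℝ → ℝ} (hg : ContinuousOn g (Icc (0 : ℝ) 1))
    (h : AntitoneOn (fun r => ∫ y in r..1, g y) (Icc (0 : ℝ) 1)) {r : ℝ}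
    (hr : r ∈ Icc (0 : ℝ) 1) : 0 ≤ g r := by
  have hf : Continuous fun y => g (fold y) := hg.comp_continuous continuous_fold fold_mem
  have e : EqOn (fun r => ∫ y in r..1, g y) (fun r => ∫ y in r..1, g (fold y)) (Icc 0 1) := by
    intro s hs
    refine intervalIntegral.integral_congr fun z hz => ?_
    rw [uIcc_of_le hs.2] at hz
    simp only [fold_of_mem (show z ∈ Icc (0 : ℝ) 1 from ⟨hs.1.trans hz.1, hz.2⟩)]
  have h' := h.congr e
  have hd : HasDerivAt (fun r => ∫ y in r..1, g (fold y)) (-g (fold r)) r :=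
    intervalIntegral.integral_hasDerivAt_left (hf.intervalIntegrable _ _)
      (hf.stronglyMeasurableAtFilter _ _) hf.continuousAt
  have h3 := h'.derivWithin_nonpos (x := r)
  rw [hd.hasDerivWithinAt.derivWithin (uniqueDiffOn_Icc one_pos r hr), fold_of_mem hr] at h3
  linarith

lemma isApprox_zero {j a T : ℝ} (ha : 0 < a) :
    IsApprox j 0 0 (fun _ => 0) a T 1 (fun _ _ => 0) ∧
      ∀ t r, approxV j 0 0 1 (fun _ => 0) (fun _ _ => 0) t r = 0 := by
  have hs : ∀ y, smooth 1 (fun _ => (0 : ℝ)) y = 0 := fun y => by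
    have := abs_smooth_le (f := fun _ => (0 : ℝ)) (C := 0) (by simp) one_pos y
    exact abs_nonpos_iff.1 this
  have hs' : smooth 1 (fun _ => (0 : ℝ)) = fun _ => 0 := funext hs
  have hV : ∀ t r, approxV j 0 0 1 (fun _ => 0) (fun _ _ => 0) t r = 0 := by
    intro t r
    simp [approxV, mildSol, refProfile, hs', heat, duhamel]
  refine ⟨⟨⟨continuous_const, by simp, by simp, by simp⟩, one_pos, fun y => ?_, fun t _ r _ => ?_,
    fun t _ r _ => ?_⟩, hV⟩
  · simpa [hs] using ha.le
  · simp [approxH, refSource, hs]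
    linarith
  · simpa [hV] using ha.le

/-- A sequence of approximate solutions for the datum `u`, with errors tending to zero. The bound
relative to the total mass makes the profile vanish when the total mass does. -/
lemma exists_isApprox_seq {j : ℝ} {u : ℝ → ℝ} (hj : 0 < j)
    (hu : MemLp u ⊤ (volume.restrict (Icc (0 : ℝ) 1)))
    (hu0 : ∀ᵐ r ∂(volume.restrict (Icc (0 : ℝ) 1)), 0 ≤ u r) (hM : 0 ≤ tailIntegral u 0) :
    ∃ (c : ℝ) (m : ℕ → ℝ) (k : ℕ → ℝ → ℝ → ℝ),
      (∀ n : ℕ, IsApprox j (tailIntegral u 0) c (tailDatum j c u) (1 / (n + 1)) (n + 1) (m n) (k n))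
      ∧ ∀ n T, ∃ B, ∀ t ∈ Icc 0 T, ∀ r ∈ Icc (0 : ℝ) 1,
        |approxV j (tailIntegral u 0) c (m n) (tailDatum j c u) (k n) t r
          - tailIntegral u 0 * (1 - r)| ≤ B * tailIntegral u 0 := by
  rcases eq_or_lt_of_le hM with h | h
  · have hmono := antitone_tailIntegral hu hu0
    have hz : ∀ r ∈ Icc (0 : ℝ) 1, tailIntegral u r = 0 := fun r hr => by
      have h1 := hmono hr.1
      have h2 := hmono hr.2
      rw [tailIntegral_one] at h2
      linarith
    have hX : tailDatum j 0 u = fun _ => 0 := by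
      funext y
      have hy := fold_mem y
      simp only [tailDatum, oddExt, hz _ hy, ← h, refProfile]
      simp
    refine ⟨0, fun _ => 1, fun _ _ _ => 0, ?_, fun n T => ⟨0, fun t _ r _ => ?_⟩⟩
    · rw [hX, ← h]
      exact fun n => (isApprox_zero (by positivity)).1
    · rw [hX, ← h, (isApprox_zero (j := j) (T := T) one_pos).2]
      simp
  · obtain ⟨hX, hmod⟩ := isDatum_tailDatum (j := j) (c := 1) hu
    obtain ⟨C, hC⟩ := hX.bounded
    choose m k hmk using fun n : ℕ => exists_isApprox (a := 1 / ((n : ℝ) + 1)) (T := (n : ℝ) + 1)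
      hj h hX hmod (by positivity) (by positivity)
    refine ⟨1, m, k, hmk, fun n T =>
      ⟨(tailIntegral u 0 + j + (C + 2 * j * T) + tailIntegral u 0) / tailIntegral u 0,
        fun t ht r hr => ?_⟩⟩
    rw [div_mul_cancel₀ _ h.ne']
    refine (abs_sub _ _).trans (add_le_add ((abs_add_le _ _).trans (add_le_add
      (abs_refProfile_le hj hM hr) ?_)) ?_)
    · refine (abs_mildSol_le hj (hmk n).source (hmk n).pos hC ht.1 r).trans ?_
      nlinarith [ht.2]
    · rw [abs_mul, abs_of_pos h, abs_of_nonneg (by linarith [hr.2])]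
      nlinarith [hr.1]

/-- Existence of the limit profile `ρ`, and of approximate solutions converging to its tail
masses `U`. -/
theorem exists_profile {j : ℝ} {u : ℝ → ℝ} (hj : 0 < j)
    (hu : MemLp u ⊤ (volume.restrict (Icc (0 : ℝ) 1)))
    (hu0 : ∀ᵐ r ∂(volume.restrict (Icc (0 : ℝ) 1)), 0 ≤ u r) :
    ∃ (ρ : ℝ → ℝ → ℝ) (c : ℝ),
      (∀ r ∈ Icc (0 : ℝ) 1, ∀ t : ℝ, 0 < t → 0 ≤ ρ r t) ∧
      ContinuousOn (fun p : ℝ × ℝ => ρ p.1 p.2) (Icc (0 : ℝ) 1 ×ˢ Ioi (0 : ℝ)) ∧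
      (∀ r ∈ Icc (0 : ℝ) 1,
        Tendsto (fun t : ℝ => tailMass (fun r' => ρ r' t) r) (𝓝[>] 0) (𝓝 (tailMass u r))) ∧
      (ContinuousOn u (Icc (0 : ℝ) 1) →
        ContinuousOn (fun p : ℝ × ℝ => ρ p.1 p.2) (Icc (0 : ℝ) 1 ×ˢ Ici (0 : ℝ)) ∧
        ∀ r ∈ Icc (0 : ℝ) 1, ρ r 0 = u r) ∧
      (∀ T e : ℝ, 0 < e → ∃ m k, IsApprox j (tailIntegral u 0) c (tailDatum j c u) e T m k ∧
        (∃ B, ∀ t ∈ Icc 0 T, ∀ r ∈ Icc (0 : ℝ) 1,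
          |approxV j (tailIntegral u 0) c m (tailDatum j c u) k t r
            - tailIntegral u 0 * (1 - r)| ≤ B * tailIntegral u 0) ∧
        ∀ t ∈ Ioc 0 T, ∀ r ∈ Icc (0 : ℝ) 1,
          |approxV j (tailIntegral u 0) c m (tailDatum j c u) k t r
            - tailMass (fun r' => ρ r' t) r| ≤ e) := by
  have hmono := antitone_tailIntegral hu hu0
  have hM : 0 ≤ tailIntegral u 0 := by
    have := hmono (zero_le_one (α := ℝ))
    rwa [tailIntegral_one] at this
  obtain ⟨c, m, k, happ, hbound⟩ := exists_isApprox_seq hj hu hu0 hM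
  set M := tailIntegral u 0 with hMdef
  set X₀ := tailDatum j c u with hX₀
  obtain ⟨hX, -⟩ := isDatum_tailDatum (j := j) (c := c) hu
  obtain ⟨C, hC⟩ := hX.bounded
  obtain ⟨B₀, hB₀⟩ := isCompact_Icc.exists_bound_of_continuousOn (s := Icc (0 : ℝ) 1)
    (continuous_refProfile j M c).continuousOn
  have hU : AntitoneOn (fun r => refProfile j M c r + X₀ r) (Icc (0 : ℝ) 1) := by
    intro a ha b hb hab
    simp only [hMdef, hX₀, refProfile_add_tailDatum ha, refProfile_add_tailDatum hb]
    exact hmono hab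
  obtain ⟨U, θ, hlim, hUc, hθc, hU0, hU1, hUanti, hθ0, hUint⟩ :=
    exists_limit_profile hj hM hX hC hU happ (fun r hr => by simpa using hB₀ r hr)
  set ρ : ℝ → ℝ → ℝ := fun r t => if t ≤ 0 then u r else
    j * θ (t, r) - heatGrad X₀ t r - refProfileD j M c r with hρ
  have hρt : ∀ t, 0 < t → ∀ r, ρ r t = j * θ (t, r) - heatGrad X₀ t r - refProfileD j M c r :=
    fun t ht r => by simp only [hρ, if_neg (not_le.2 ht)]
  have hgc : ContinuousOn (fun p : ℝ × ℝ => ρ p.1 p.2) (Icc (0 : ℝ) 1 ×ˢ Ioi (0 : ℝ)) := by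
    have h1 : ContinuousOn (fun p : ℝ × ℝ => j * θ (p.2, p.1) - heatGrad X₀ p.2 p.1
        - refProfileD j M c p.1) (Icc (0 : ℝ) 1 ×ˢ Ioi (0 : ℝ)) := by
      refine ContinuousOn.sub (ContinuousOn.sub (ContinuousOn.const_mul ?_ _) ?_)
        ((continuous_refProfileD j M c).comp continuous_fst).continuousOn
      · exact hθc.comp (f := fun p : ℝ × ℝ => (p.2, p.1)) (by fun_prop)
          fun p hp => ⟨mem_Ici.2 (le_of_lt hp.2), hp.1⟩
      · exact (continuousOn_heatGrad hX.continuous hC).comp (f := fun p : ℝ × ℝ => (p.2, p.1))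
          (by fun_prop) fun p hp => ⟨hp.2, mem_univ _⟩
    exact h1.congr fun p hp => hρt _ hp.2 _
  have hslice : ∀ t, 0 < t → ContinuousOn (fun r => ρ r t) (Icc (0 : ℝ) 1) := fun t ht =>
    hgc.comp (f := fun r : ℝ => (r, t)) (by fun_prop) fun r hr => ⟨hr, ht⟩
  have hUρ : ∀ t, 0 < t → ∀ r ∈ Icc (0 : ℝ) 1, U (t, r) = ∫ y in r..1, ρ y t := by
    intro t ht r hr
    rw [hUint t ht r hr]
    simp only [hρt t ht, hX₀]
  have htail : ∀ t, 0 < t → ∀ r ∈ Icc (0 : ℝ) 1, tailMass (fun r' => ρ r' t) r = U (t, r) := by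
    intro t ht r hr
    rw [tailMass_eq_integral _ hr.2, hUρ t ht r hr]
  refine ⟨ρ, c, fun r hr t ht => ?_, hgc, fun r hr => ?_, fun huc => ⟨?_, fun r hr => ?_⟩,
    fun T e he => ?_⟩
  · refine nonneg_of_antitoneOn_integral (hslice t ht) ?_ hr
    exact (hUanti t ht.le).congr fun s hs => hUρ t ht s hs
  · rw [tailMass_eq_tailIntegral u hr, ← refProfile_add_tailDatum (j := j) (c := c) hr,
      ← hMdef, ← hX₀, ← hU0 r hr]
    have h1 : ContinuousWithinAt (fun t => U (t, r)) (Ici 0) 0 :=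
      (hUc.comp (f := fun t : ℝ => (t, r)) (by fun_prop) fun t ht => ⟨ht, hr⟩) 0
        (mem_Ici.2 le_rfl)
    refine (h1.tendsto.mono_left (nhdsWithin_mono _ Ioi_subset_Ici_self)).congr' ?_
    filter_upwards [self_mem_nhdsWithin] with t ht
    exact (htail t ht r hr).symm
  · set a : ℝ → ℝ := fun y => -u (fold y) - refProfileD j M c (fold y) with ha
    have huf : Continuous fun y => u (fold y) := huc.comp_continuous continuous_fold fold_mem
    have hac : Continuous a :=
      huf.neg.sub ((continuous_refProfileD _ _ _).comp continuous_fold)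
    obtain ⟨A, hA⟩ := isCompact_Icc.exists_bound_of_continuousOn (s := Icc (0 : ℝ) 1)
      hac.continuousOn
    have hA' : ∀ y, |a y| ≤ A := fun y => by
      have := hA (fold y) (fold_mem y)
      simpa only [ha, fold_of_mem (fold_mem y), Real.norm_eq_abs] using this
    have h1 : ContinuousOn (fun p : ℝ × ℝ => j * θ (p.2, p.1) - heat p.2 a p.1
        - refProfileD j M c p.1) (Icc (0 : ℝ) 1 ×ˢ Ici (0 : ℝ)) := by
      refine ContinuousOn.sub (ContinuousOn.sub (ContinuousOn.const_mul ?_ _) ?_)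
        ((continuous_refProfileD j M c).comp continuous_fst).continuousOn
      · exact hθc.comp (f := fun p : ℝ × ℝ => (p.2, p.1)) (by fun_prop)
          fun p hp => ⟨hp.2, hp.1⟩
      · exact ((continuous_heat_uncurry hac hA').comp
          (by fun_prop : Continuous fun p : ℝ × ℝ => (p.2, p.1))).continuousOn
    refine h1.congr ?_
    rintro ⟨r, t⟩ ⟨hr, ht⟩
    simp only
    rcases eq_or_lt_of_le (show (0 : ℝ) ≤ t from ht) with h0 | h0
    · rw [← h0, hθ0 r hr, heat_zero]
      simp only [hρ, le_refl, if_true, ha, fold_of_mem hr]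
      ring
    · rw [hρt t h0 r]
      have e := heat_deriv_eq (f := X₀) (f' := a) (fun z => hasDerivAt_tailDatum hu huc z) hC hac
        hA' t r
      rw [heatGrad, ← e, mul_div_cancel_left₀ _ (Real.sqrt_pos.2 h0).ne']
  · simp only [hρ, le_refl, if_true]
  · obtain ⟨N₁, hN₁⟩ := hlim T e he
    obtain ⟨N₂, hN₂⟩ := exists_nat_ge T
    obtain ⟨N₃, hN₃⟩ := exists_nat_one_div_lt he
    set n := max N₁ (max N₂ N₃) with hn
    refine ⟨m n, k n, (happ n).mono ?_ ?_, hbound n T, fun t ht r hr => ?_⟩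
    · refine le_trans ?_ hN₃.le
      have : (N₃ : ℝ) ≤ n := by
        exact_mod_cast (le_max_right _ _).trans (le_max_right _ _)
      exact one_div_le_one_div_of_le (by positivity) (by linarith)
    · have : (N₂ : ℝ) ≤ n := by
        exact_mod_cast (le_max_left _ _).trans (le_max_right _ _)
      linarith
    · rw [htail t ht.1 r hr]
      exact hN₁ n (le_max_left _ _) t ⟨ht.1.le, ht.2⟩ r hr

/-! ### Jump processes on a countable set -/

/-- The generator of the Markov chain which jumps from `x` to `τ i x` at rate `c i x`. -/
noncomputable def jumpGen {S ι : Type*} [Fintype ι] (c : ι → S → ℝ) (τ : ι → S → S) (f : S → ℝ)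
    (x : S) : ℝ :=
  ∑ i, c i x * (f (τ i x) - f x)

/-- The carré du champ `L f² - 2 f L f` of `jumpGen`. -/
noncomputable def carreDuChamp {S ι : Type*} [Fintype ι] (c : ι → S → ℝ) (τ : ι → S → S)
    (f : S → ℝ) (x : S) : ℝ :=
  ∑ i, c i x * (f (τ i x) - f x) ^ 2

lemma carreDuChamp_eq {S ι : Type*} [Fintype ι] (c : ι → S → ℝ) (τ : ι → S → S) (f : S → ℝ)
    (x : S) : carreDuChamp c τ f x =
      jumpGen c τ (fun y => f y ^ 2) x - 2 * f x * jumpGen c τ f x := by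
  simp only [carreDuChamp, jumpGen, Finset.mul_sum, ← Finset.sum_sub_distrib]
  exact Finset.sum_congr rfl fun i _ => by ring

/-- Jump rates controlled by a size function `m` with finite level sets: a jump changes the size by
at most one, the rates grow at most linearly in the size, and the rates of the jumps which increase
the size are bounded. -/
structure JumpRates {S ι : Type*} (c : ι → S → ℝ) (τ : ι → S → S) (m : S → ℕ) (K : ℝ) : Prop where
  nonneg : ∀ i x, 0 ≤ c i x
  bound : ∀ i x, c i x ≤ K * (m x + 1)
  step_le : ∀ i x, m (τ i x) ≤ m x + 1
  le_step : ∀ i x, m x ≤ m (τ i x) + 1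
  growth : ∀ i x, m (τ i x) ≤ m x ∨ c i x ≤ K
  finite : ∀ n, {x | m x ≤ n}.Finite

/-- `Y` has right-continuous paths in the discrete set `S` and solves, in the weak form of
orthogonality to the present state, the martingale problem for `jumpGen c τ` started at `x₀`. -/
structure IsJumpProcess {S ι Ω : Type*} [MeasurableSpace S] [Fintype ι] [MeasurableSpace Ω]
    (c : ι → S → ℝ) (τ : ι → S → S) (x₀ : S) (P : Measure Ω) (Y : ℝ → Ω → S) : Prop where
  measurable : ∀ t, Measurable (Y t)
  initial : ∀ᵐ ω ∂P, Y 0 ω = x₀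
  right_const : ∀ ω t, ∀ᶠ s in 𝓝[≥] t, Y s ω = Y t ω
  dynkin : ∀ f : S → ℝ, (Function.support f).Finite → ∀ (h : S → ℝ) (C : ℝ), (∀ x, |h x| ≤ C) →
    ∀ s t : ℝ, 0 ≤ s → s ≤ t → ∫ ω, h (Y s ω) *
      (f (Y t ω) - f (Y s ω) - ∫ r in s..t, jumpGen c τ f (Y r ω)) ∂P = 0

section Basic

variable {S ι Ω : Type*} [MeasurableSpace S] [DiscreteMeasurableSpace S] [Fintype ι]
  [MeasurableSpace Ω] {c : ι → S → ℝ} {τ : ι → S → S} {x₀ : S} {P : Measure Ω} {Y : ℝ → Ω → S}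

lemma measurable_comp_of_right_const (hm : ∀ t, Measurable (Y t))
    (hc : ∀ ω t, ∀ᶠ s in 𝓝[≥] t, Y s ω = Y t ω) (g : S → ℝ) :
    Measurable fun p : ℝ × Ω => g (Y p.1 p.2) := by
  have hn : ∀ n : ℕ, Measurable fun p : ℝ × Ω =>
      g (Y (((⌊p.1 * (n + 1)⌋ : ℝ) + 1) / (n + 1)) p.2) := by
    intro n
    have h1 : Measurable fun q : ℤ × Ω => g (Y (((q.1 : ℝ) + 1) / (n + 1)) q.2) :=
      measurable_from_prod_countable_right fun k =>
        (Measurable.of_discrete (f := g)).comp (hm (((k : ℝ) + 1) / (n + 1)))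
    exact h1.comp ((Int.measurable_floor.comp (measurable_fst.mul_const _)).prodMk measurable_snd)
  refine measurable_of_tendsto_metrizable hn (tendsto_pi_nhds.2 ?_)
  rintro ⟨t, ω⟩
  have hlim : Tendsto (fun n : ℕ => ((⌊t * (n + 1)⌋ : ℝ) + 1) / (n + 1)) atTop (𝓝[≥] t) := by
    refine tendsto_nhdsWithin_iff.2 ⟨?_, Eventually.of_forall fun n => ?_⟩
    · have h1 : Tendsto (fun n : ℕ => t + 1 / ((n : ℝ) + 1)) atTop (𝓝 t) := by
        simpa using tendsto_one_div_add_atTop_nhds_zero_nat (𝕜 := ℝ) |>.const_add t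
      refine tendsto_of_tendsto_of_tendsto_of_le_of_le tendsto_const_nhds h1 (fun n => ?_)
        fun n => ?_
      · have : (0 : ℝ) < n + 1 := by positivity
        simp only
        rw [le_div_iff₀ this]
        exact (Int.lt_floor_add_one _).le
      · have : (0 : ℝ) < n + 1 := by positivity
        simp only
        rw [div_le_iff₀ this, add_mul, one_div, inv_mul_cancel₀ this.ne']
        linarith [Int.floor_le (t * ((n : ℝ) + 1))]
    · have : (0 : ℝ) < n + 1 := by positivity
      rw [mem_Ici, le_div_iff₀ this]
      exact (Int.lt_floor_add_one _).le
  have h := hlim.eventually (hc ω t)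
  refine tendsto_const_nhds.congr' ?_
  filter_upwards [h] with n hn
  simp only [hn]

lemma IsJumpProcess.measurable_comp (hY : IsJumpProcess c τ x₀ P Y) (g : S → ℝ) :
    Measurable fun p : ℝ × Ω => g (Y p.1 p.2) :=
  measurable_comp_of_right_const hY.measurable hY.right_const g

/-- The time integral of an observable is jointly measurable. -/
lemma IsJumpProcess.measurable_integral (hY : IsJumpProcess c τ x₀ P Y) (g : S → ℝ) (s : ℝ) :
    Measurable fun p : ℝ × Ω => ∫ r in s..p.1, g (Y r p.2) := by
  have hg := hY.measurable_comp g
  have h1 : Measurable fun q : (ℝ × Ω) × ℝ =>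
      {q : (ℝ × Ω) × ℝ | s < q.2 ∧ q.2 ≤ q.1.1}.indicator (fun q => g (Y q.2 q.1.2)) q :=
    (hg.comp (measurable_snd.prodMk (measurable_snd.comp measurable_fst))).indicator
      ((measurableSet_lt measurable_const measurable_snd).inter
        (measurableSet_le measurable_snd (measurable_fst.comp measurable_fst)))
  have h2 : Measurable fun q : (ℝ × Ω) × ℝ =>
      {q : (ℝ × Ω) × ℝ | q.1.1 < q.2 ∧ q.2 ≤ s}.indicator (fun q => g (Y q.2 q.1.2)) q :=
    (hg.comp (measurable_snd.prodMk (measurable_snd.comp measurable_fst))).indicator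
      ((measurableSet_lt (measurable_fst.comp measurable_fst) measurable_snd).inter
        (measurableSet_le measurable_snd measurable_const))
  have e : (fun p : ℝ × Ω => ∫ r in s..p.1, g (Y r p.2)) = fun p =>
      (∫ r, {q : (ℝ × Ω) × ℝ | s < q.2 ∧ q.2 ≤ q.1.1}.indicator
        (fun q => g (Y q.2 q.1.2)) (p, r)) -
      ∫ r, {q : (ℝ × Ω) × ℝ | q.1.1 < q.2 ∧ q.2 ≤ s}.indicator
        (fun q => g (Y q.2 q.1.2)) (p, r) := by
    funext p
    rw [intervalIntegral, ← integral_indicator measurableSet_Ioc,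
      ← integral_indicator measurableSet_Ioc]
    rfl
  rw [e]
  exact (h1.stronglyMeasurable.integral_prod_right.measurable).sub
    h2.stronglyMeasurable.integral_prod_right.measurable

lemma IsJumpProcess.measurable_integral_right (hY : IsJumpProcess c τ x₀ P Y) (g : S → ℝ)
    (s t : ℝ) : Measurable fun ω => ∫ r in s..t, g (Y r ω) :=
  (hY.measurable_integral g s).comp (measurable_const.prodMk measurable_id)

lemma IsJumpProcess.measurable_path (hY : IsJumpProcess c τ x₀ P Y) (g : S → ℝ) (ω : Ω) :
    Measurable fun r => g (Y r ω) :=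
  (hY.measurable_comp g).comp (measurable_id.prodMk measurable_const)

lemma IsJumpProcess.measurable_state (hY : IsJumpProcess c τ x₀ P Y) (g : S → ℝ) (t : ℝ) :
    Measurable fun ω => g (Y t ω) :=
  (hY.measurable_comp g).comp (measurable_const.prodMk measurable_id)

lemma intervalIntegrable_of_bound {g : ℝ → ℝ} (hg : Measurable g) {C : ℝ} (hC : ∀ r, |g r| ≤ C)
    (s t : ℝ) : IntervalIntegrable g volume s t := by
  rw [intervalIntegrable_iff]
  exact Measure.integrableOn_of_bounded (by simp [uIoc]) hg.aestronglyMeasurable (ae_of_all _ hC)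

lemma integrable_of_abs_le [IsFiniteMeasure P] {g : Ω → ℝ} (hg : Measurable g) {C : ℝ}
    (hC : ∀ ω, |g ω| ≤ C) : Integrable g P :=
  Integrable.of_bound hg.aestronglyMeasurable C (ae_of_all _ hC)

lemma abs_intervalIntegral_le {g : ℝ → ℝ} {C s t : ℝ} (hC : ∀ r, |g r| ≤ C) (hst : s ≤ t) :
    |∫ r in s..t, g r| ≤ C * (t - s) := by
  have := intervalIntegral.norm_integral_le_of_norm_le_const (a := s) (b := t) (C := C) (f := g)
    fun r _ => hC r
  rwa [Real.norm_eq_abs, abs_of_nonneg (sub_nonneg.2 hst)] at this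

/-- The primitive of a right-continuous path has the path as its right derivative. -/
lemma hasDerivWithinAt_integral_of_eventually_eq {g : ℝ → ℝ} (hg : Measurable g) {s t : ℝ}
    (hi : IntervalIntegrable g volume s t) (hc : ∀ᶠ r in 𝓝[≥] t, g r = g t) :
    HasDerivWithinAt (fun u => ∫ r in s..u, g r) (g t) (Ioi t) t := by
  have hcont : ContinuousWithinAt g (Ioi t) t := by
    have : Tendsto g (𝓝[>] t) (𝓝 (g t)) := by
      refine tendsto_const_nhds.congr' ?_
      filter_upwards [nhdsWithin_mono t Ioi_subset_Ici_self hc] with r hr using hr.symm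
    exact this
  exact (intervalIntegral.integral_hasDerivWithinAt_right hi (s := Ici t) (t := Ioi t)
    hg.stronglyMeasurable.stronglyMeasurableAtFilter hcont).mono Ioi_subset_Ici_self

end Basic

/-! ### Square-integrability of the martingales -/

lemma continuous_integral_of_bound {g : ℝ → ℝ} (hg : Measurable g) {C : ℝ} (hC : ∀ r, |g r| ≤ C)
    (s : ℝ) : Continuous fun t => ∫ r in s..t, g r :=
  intervalIntegral.continuous_primitive (fun _ _ => intervalIntegrable_of_bound hg hC _ _) s

/-- For a bounded right-continuous path `g`, `∫ₛᵗ g(r) ∫ᵣᵗ g = ½ (∫ₛᵗ g)²`. -/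
lemma integral_mul_integral_eq_half_sq {g : ℝ → ℝ} (hg : Measurable g) {C : ℝ}
    (hC : ∀ r, |g r| ≤ C) (hc : ∀ t, ∀ᶠ r in 𝓝[≥] t, g r = g t) (s t : ℝ) :
    ∫ r in s..t, g r * ∫ q in r..t, g q = (∫ r in s..t, g r) ^ 2 / 2 := by
  set A : ℝ → ℝ := fun r => ∫ q in s..r, g q with hA
  have hi : ∀ a b, IntervalIntegrable g volume a b := fun a b => intervalIntegrable_of_bound hg hC a b
  have hAc : Continuous A := continuous_integral_of_bound hg hC s
  have hgA : IntervalIntegrable (fun r => g r * A r) volume s t :=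
    (hi s t).mul_continuousOn hAc.continuousOn
  have h1 : ∫ r in s..t, (2 : ℝ) * (g r * A r) = A t ^ 2 - A s ^ 2 := by
    refine intervalIntegral.integral_eq_sub_of_hasDeriv_right (hAc.pow 2).continuousOn
      (fun x _ => ?_) (hgA.const_mul 2)
    refine ((hasDerivWithinAt_integral_of_eventually_eq hg (hi s x) (hc x)).fun_pow 2).congr_deriv ?_
    simp only [hA]
    ring
  have h2 : ∀ r, ∫ q in r..t, g q = A t - A r := fun r => by
    rw [eq_sub_iff_add_eq', hA]
    exact intervalIntegral.integral_add_adjacent_intervals (hi _ _) (hi _ _)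
  have h3 : A s = 0 := by simp [hA]
  simp only [h2, mul_sub]
  rw [intervalIntegral.integral_sub ((hi s t).mul_const _) hgA, intervalIntegral.integral_mul_const]
  rw [intervalIntegral.integral_const_mul, h3] at h1
  have h4 : ∫ x in s..t, g x = A t - A s := h2 s
  rw [h4, h3]
  linarith

lemma exists_bound_of_finite_support {S : Type*} {f : S → ℝ} (hf : (Function.support f).Finite) :
    ∃ C, ∀ x, |f x| ≤ C := by
  obtain ⟨C, hC⟩ := (hf.image fun x => |f x|).bddAbove
  refine ⟨max C 0, fun x => ?_⟩
  by_cases h : f x = 0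
  · simp [h]
  · exact (hC (mem_image_of_mem _ h)).trans (le_max_left _ _)

section Rates

variable {S ι : Type*} [Fintype ι] {c : ι → S → ℝ} {τ : ι → S → S} {m : S → ℕ} {K : ℝ}

lemma JumpRates.finite_support_jumpGen (hr : JumpRates c τ m K) {f : S → ℝ}
    (hf : (Function.support f).Finite) : (Function.support (jumpGen c τ f)).Finite := by
  obtain ⟨n, hn⟩ := (hf.image m).bddAbove
  refine (hr.finite (n + 1)).subset fun x hx => ?_
  by_contra h
  simp only [mem_ofPred_eq, not_le] at h
  refine hx (Finset.sum_eq_zero fun i _ => ?_)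
  have h0 : ∀ y, n < m y → f y = 0 := fun y hy => by
    by_contra h'
    exact absurd (hn (mem_image_of_mem _ h')) (not_le.2 hy)
  have := hr.le_step i x
  rw [h0 _ (by omega), h0 x (by omega)]
  simp

end Rates

section Isometry

variable {S ι Ω : Type*} [MeasurableSpace S] [DiscreteMeasurableSpace S] [Fintype ι]
  [MeasurableSpace Ω] {c : ι → S → ℝ} {τ : ι → S → S} {x₀ : S} {P : Measure Ω} {Y : ℝ → Ω → S}
  {m : S → ℕ} {K : ℝ}

lemma integral_swap_of_bound [IsFiniteMeasure P] {g : ℝ → Ω → ℝ}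
    (hg : Measurable (Function.uncurry g)) {C : ℝ} (s t : ℝ)
    (hC : ∀ r ∈ uIoc s t, ∀ ω, |g r ω| ≤ C) :
    ∫ ω, (∫ r in s..t, g r ω) ∂P = ∫ r in s..t, ∫ ω, g r ω ∂P := by
  refine (intervalIntegral_integral_swap (μ := P) ?_).symm
  have : IsFiniteMeasure (volume.restrict (uIoc s t)) := ⟨by simp [uIoc]⟩
  refine Integrable.of_bound hg.aestronglyMeasurable C ?_
  have h1 : ∀ᵐ p ∂((volume.restrict (uIoc s t)).prod P), p.1 ∈ uIoc s t :=
    Measure.quasiMeasurePreserving_fst.ae (ae_restrict_mem measurableSet_uIoc)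
  filter_upwards [h1] with p hp
  exact hC _ hp _

/-- Dynkin's formula for finitely supported observables. -/
lemma IsJumpProcess.dynkin_finite [IsProbabilityMeasure P] (hY : IsJumpProcess c τ x₀ P Y)
    (hr : JumpRates c τ m K) {f : S → ℝ} (hf : (Function.support f).Finite) {t : ℝ} (ht : 0 ≤ t) :
    ∫ ω, f (Y t ω) ∂P = f x₀ + ∫ r in (0 : ℝ)..t, ∫ ω, jumpGen c τ f (Y r ω) ∂P := by
  obtain ⟨C, hC⟩ := exists_bound_of_finite_support hf
  obtain ⟨C', hC'⟩ := exists_bound_of_finite_support (hr.finite_support_jumpGen hf)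
  have h := hY.dynkin f hf (fun _ => 1) 1 (by simp) 0 t le_rfl ht
  simp only [one_mul] at h
  have i1 : ∀ t, Integrable (fun ω => f (Y t ω)) P := fun t =>
    integrable_of_abs_le (hY.measurable_state f t) fun ω => hC _
  have i2 : Integrable (fun ω => ∫ r in (0 : ℝ)..t, jumpGen c τ f (Y r ω)) P :=
    integrable_of_abs_le (hY.measurable_integral_right _ _ _) fun ω =>
      abs_intervalIntegral_le (fun r => hC' (Y r ω)) ht
  have i3 : Integrable (fun ω => f (Y t ω) - f (Y 0 ω)) P := (i1 t).sub (i1 0)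
  rw [integral_sub i3 i2, integral_sub (i1 t) (i1 0),
    integral_swap_of_bound (hY.measurable_comp _) 0 t fun r _ ω => hC' (Y r ω)] at h
  have h0 : ∫ ω, f (Y 0 ω) ∂P = f x₀ := by
    rw [integral_congr_ae (g := fun _ => f x₀)]
    · simp
    · filter_upwards [hY.initial] with ω hω
      rw [hω]
  rw [h0] at h
  linarith

/-- The isometry for the martingale attached to a finitely supported observable. -/
lemma IsJumpProcess.isometry [IsProbabilityMeasure P] (hY : IsJumpProcess c τ x₀ P Y)
    (hr : JumpRates c τ m K) {f : S → ℝ} (hf : (Function.support f).Finite) {s t : ℝ} (hs : 0 ≤ s)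
    (hst : s ≤ t) :
    ∫ ω, (f (Y t ω) - f (Y s ω) - ∫ r in s..t, jumpGen c τ f (Y r ω)) ^ 2 ∂P =
      ∫ r in s..t, ∫ ω, carreDuChamp c τ f (Y r ω) ∂P := by
  obtain ⟨C, hC⟩ := exists_bound_of_finite_support hf
  obtain ⟨C', hC'⟩ := exists_bound_of_finite_support (hr.finite_support_jumpGen hf)
  have hC0 : 0 ≤ C := (abs_nonneg _).trans (hC x₀)
  have hC0' : 0 ≤ C' := (abs_nonneg _).trans (hC' x₀)
  have hf2 : (Function.support fun x => f x ^ 2).Finite := hf.subset fun x hx h => hx (by simp [h])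
  obtain ⟨C₂, hC₂⟩ := exists_bound_of_finite_support hf2
  obtain ⟨C₂', hC₂'⟩ := exists_bound_of_finite_support (hr.finite_support_jumpGen hf2)
  set G := jumpGen c τ f with hG
  set G₂ := jumpGen c τ fun x => f x ^ 2 with hG₂
  have hfG : ∀ x, |f x * G x| ≤ C * C' := fun x => by
    rw [abs_mul]
    exact mul_le_mul (hC x) (hC' x) (abs_nonneg _) hC0
  have hΓ : ∀ x, carreDuChamp c τ f x = G₂ x - 2 * (f x * G x) := fun x => by
    rw [carreDuChamp_eq, hG, hG₂]
    ring
  have hΓb : ∀ x, |carreDuChamp c τ f x| ≤ C₂' + 2 * (C * C') := fun x => by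
    rw [hΓ]
    refine (abs_sub _ _).trans (add_le_add (hC₂' x) ?_)
    rw [abs_mul, abs_two]
    linarith [hfG x]
  -- the martingale increments
  set D : ℝ → Ω → ℝ := fun r ω => f (Y t ω) - f (Y r ω) - ∫ q in r..t, G (Y q ω) with hD
  have hDm : Measurable (Function.uncurry D) := by
    have h1 : Measurable fun p : ℝ × Ω => f (Y t p.2) :=
      (hY.measurable_state f t).comp measurable_snd
    have h2 : Measurable fun p : ℝ × Ω => ∫ q in p.1..t, G (Y q p.2) := by
      have e : (fun p : ℝ × Ω => ∫ q in p.1..t, G (Y q p.2)) =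
          fun p => -∫ q in t..p.1, G (Y q p.2) :=
        funext fun p => intervalIntegral.integral_symm _ _
      rw [e]
      exact (hY.measurable_integral G t).neg
    exact (h1.sub (hY.measurable_comp f)).sub h2
  have hDb : ∀ r ∈ Icc s t, ∀ ω, |D r ω| ≤ 2 * C + C' * (t - s) := by
    intro r hr ω
    refine (abs_sub _ _).trans (add_le_add ((abs_sub _ _).trans ?_) ?_)
    · linarith [hC (Y t ω), hC (Y r ω)]
    · refine (abs_intervalIntegral_le (fun q => hC' (Y q ω)) hr.2).trans ?_
      exact mul_le_mul_of_nonneg_left (by linarith [hr.1]) hC0'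
  have hGD : ∀ r ∈ uIoc s t, ∀ ω, |G (Y r ω) * D r ω| ≤ C' * (2 * C + C' * (t - s)) := by
    intro r hr ω
    rw [abs_mul]
    rw [uIoc_of_le hst] at hr
    exact mul_le_mul (hC' _) (hDb r ⟨hr.1.le, hr.2⟩ ω) (abs_nonneg _) hC0'
  have hpath : ∀ ω, D s ω ^ 2 =
      (f (Y t ω) ^ 2 - f (Y s ω) ^ 2 - ∫ r in s..t, G₂ (Y r ω))
      + (∫ r in s..t, carreDuChamp c τ f (Y r ω)) - 2 * (f (Y s ω) * D s ω)
      - 2 * ∫ r in s..t, G (Y r ω) * D r ω := by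
    intro ω
    have iG : IntervalIntegrable (fun r => G (Y r ω)) volume s t :=
      intervalIntegrable_of_bound (hY.measurable_path _ ω) (fun r => hC' _) _ _
    have iG₂ : IntervalIntegrable (fun r => G₂ (Y r ω)) volume s t :=
      intervalIntegrable_of_bound (hY.measurable_path _ ω) (fun r => hC₂' _) _ _
    have ifG : IntervalIntegrable (fun r => f (Y r ω) * G (Y r ω)) volume s t :=
      intervalIntegrable_of_bound (hY.measurable_path (fun x => f x * G x) ω) (fun r => hfG _) _ _
    have hcont : Continuous fun r => ∫ q in r..t, G (Y q ω) := by
      have := (continuous_integral_of_bound (hY.measurable_path G ω) (fun r => hC' (Y r ω)) t).neg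
      refine this.congr fun r => ?_
      simp only [Pi.neg_apply]
      rw [intervalIntegral.integral_symm, neg_neg]
    have e1 : ∫ r in s..t, carreDuChamp c τ f (Y r ω) =
        (∫ r in s..t, G₂ (Y r ω)) - 2 * ∫ r in s..t, f (Y r ω) * G (Y r ω) := by
      simp only [hΓ]
      rw [intervalIntegral.integral_sub iG₂ (ifG.const_mul 2),
        intervalIntegral.integral_const_mul]
    have e2 : ∫ r in s..t, G (Y r ω) * D r ω = f (Y t ω) * (∫ r in s..t, G (Y r ω))
        - (∫ r in s..t, f (Y r ω) * G (Y r ω)) - (∫ r in s..t, G (Y r ω)) ^ 2 / 2 := by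
      rw [← integral_mul_integral_eq_half_sq (hY.measurable_path G ω) (fun r => hC' (Y r ω))
        (fun r => by filter_upwards [hY.right_const ω r] with q hq; rw [hq]) s t,
        ← intervalIntegral.integral_const_mul, ← intervalIntegral.integral_sub
          (iG.const_mul _) ifG, ← intervalIntegral.integral_sub ((iG.const_mul _).sub ifG)
          (iG.mul_continuousOn hcont.continuousOn)]
      refine intervalIntegral.integral_congr fun r _ => ?_
      simp only [hD]
      ring
    rw [e1, e2]
    simp only [hD]
    ring
  have i1 : Integrable (fun ω => f (Y t ω) ^ 2 - f (Y s ω) ^ 2 - ∫ r in s..t, G₂ (Y r ω)) P := by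
    refine Integrable.sub (Integrable.sub ?_ ?_) ?_
    · exact integrable_of_abs_le (hY.measurable_state (fun x => f x ^ 2) t) fun ω => hC₂ _
    · exact integrable_of_abs_le (hY.measurable_state (fun x => f x ^ 2) s) fun ω => hC₂ _
    · exact integrable_of_abs_le (hY.measurable_integral_right _ _ _) fun ω =>
        abs_intervalIntegral_le (fun r => hC₂' (Y r ω)) hst
  have i2 : Integrable (fun ω => ∫ r in s..t, carreDuChamp c τ f (Y r ω)) P :=
    integrable_of_abs_le (hY.measurable_integral_right _ _ _) fun ω =>
      abs_intervalIntegral_le (fun r => hΓb (Y r ω)) hst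
  have mD : Measurable (D s) := hDm.comp (measurable_const.prodMk measurable_id)
  have i3 : Integrable (fun ω => 2 * (f (Y s ω) * D s ω)) P := by
    refine Integrable.const_mul (integrable_of_abs_le (C := C * (2 * C + C' * (t - s)))
      ((hY.measurable_state f s).mul mD) fun ω => ?_) 2
    rw [Pi.mul_apply, abs_mul]
    exact mul_le_mul (hC _) (hDb s ⟨le_rfl, hst⟩ ω) (abs_nonneg _) hC0
  have mGD : Measurable (Function.uncurry fun r ω => G (Y r ω) * D r ω) :=
    (hY.measurable_comp G).mul hDm
  have i4 : Integrable (fun ω => 2 * ∫ r in s..t, G (Y r ω) * D r ω) P := by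
    refine Integrable.const_mul (integrable_of_abs_le
      (C := C' * (2 * C + C' * (t - s)) * |t - s|) ?_ fun ω => ?_) 2
    · have e : (fun ω => ∫ r in s..t, G (Y r ω) * D r ω) = fun ω =>
          ∫ r in Ioc s t, G (Y r ω) * D r ω := funext fun ω => intervalIntegral.integral_of_le hst
      rw [e]
      exact (StronglyMeasurable.integral_prod_left (f := fun r ω => G (Y r ω) * D r ω)
        mGD.stronglyMeasurable).measurable
    · exact intervalIntegral.norm_integral_le_of_norm_le_const
        (f := fun r => G (Y r ω) * D r ω) fun r hr => hGD r hr ω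
  have z1 : ∫ ω, (f (Y t ω) ^ 2 - f (Y s ω) ^ 2 - ∫ r in s..t, G₂ (Y r ω)) ∂P = 0 := by
    have := hY.dynkin (fun x => f x ^ 2) hf2 (fun _ => 1) 1 (by simp) s t hs hst
    simpa only [one_mul] using this
  have z2 : ∫ ω, f (Y s ω) * D s ω ∂P = 0 := hY.dynkin f hf f C hC s t hs hst
  have z3 : ∫ ω, (∫ r in s..t, G (Y r ω) * D r ω) ∂P = 0 := by
    rw [integral_swap_of_bound mGD s t hGD]
    refine intervalIntegral.integral_zero_ae (ae_of_all _ fun r hr => ?_)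
    rw [uIoc_of_le hst] at hr
    exact hY.dynkin f hf G C' hC' r t (hs.trans hr.1.le) hr.2
  calc ∫ ω, D s ω ^ 2 ∂P = ∫ ω, ((f (Y t ω) ^ 2 - f (Y s ω) ^ 2 - ∫ r in s..t, G₂ (Y r ω))
      + (∫ r in s..t, carreDuChamp c τ f (Y r ω)) - 2 * (f (Y s ω) * D s ω)
      - 2 * ∫ r in s..t, G (Y r ω) * D r ω) ∂P := by simp only [hpath]
    _ = ∫ ω, (∫ r in s..t, carreDuChamp c τ f (Y r ω)) ∂P := by
      have i12 : Integrable (fun ω => (f (Y t ω) ^ 2 - f (Y s ω) ^ 2 - ∫ r in s..t, G₂ (Y r ω))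
        + (∫ r in s..t, carreDuChamp c τ f (Y r ω))) P := i1.add i2
      have i123 : Integrable (fun ω => (f (Y t ω) ^ 2 - f (Y s ω) ^ 2 - ∫ r in s..t, G₂ (Y r ω))
        + (∫ r in s..t, carreDuChamp c τ f (Y r ω)) - 2 * (f (Y s ω) * D s ω)) P := i12.sub i3
      rw [integral_sub i123 i4, integral_sub i12 i3, integral_add i1 i2,
        integral_const_mul, integral_const_mul, z1, z2, z3]
      ring
    _ = ∫ r in s..t, ∫ ω, carreDuChamp c τ f (Y r ω) ∂P :=
      integral_swap_of_bound (hY.measurable_comp _) s t fun r _ ω => hΓb _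

end Isometry

/-! ### Moments and observables of polynomial growth -/

lemma lintegral_le_of_ae_tendsto {Ω : Type*} [MeasurableSpace Ω] {P : Measure Ω} {g : ℕ → Ω → ℝ}
    {g' : Ω → ℝ} (hm : ∀ n, Measurable (g n))
    (h : ∀ᵐ ω ∂P, Tendsto (fun n => g n ω) atTop (𝓝 (g' ω))) {b : ℕ → ℝ≥0∞} {b' : ℝ≥0∞}
    (hb : ∀ n, ∫⁻ ω, ENNReal.ofReal (g n ω) ∂P ≤ b n) (hbl : Tendsto b atTop (𝓝 b')) :
    ∫⁻ ω, ENNReal.ofReal (g' ω) ∂P ≤ b' := by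
  calc ∫⁻ ω, ENNReal.ofReal (g' ω) ∂P
      = ∫⁻ ω, liminf (fun n => ENNReal.ofReal (g n ω)) atTop ∂P := by
        refine lintegral_congr_ae ?_
        filter_upwards [h] with ω hω
        exact ((ENNReal.continuous_ofReal.tendsto _).comp hω).liminf_eq.symm
    _ ≤ liminf (fun n => ∫⁻ ω, ENNReal.ofReal (g n ω) ∂P) atTop :=
        lintegral_liminf_le fun n => (hm n).ennreal_ofReal
    _ ≤ liminf b atTop := liminf_le_liminf (Eventually.of_forall hb)
    _ = b' := hbl.liminf_eq

lemma add_one_pow_succ_le {a : ℝ} (ha : 1 ≤ a) (p : ℕ) :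
    (a + 1) ^ (p + 1) ≤ a ^ (p + 1) + 3 ^ (p + 1) * a ^ p := by
  induction p with
  | zero => norm_num
  | succ p ih =>
    have h1 : (0 : ℝ) ≤ a ^ p := by positivity
    have h2 : (1 : ℝ) ≤ 3 ^ (p + 1) := one_le_pow₀ (by norm_num)
    calc (a + 1) ^ (p + 1 + 1) = (a + 1) * (a + 1) ^ (p + 1) := by ring
      _ ≤ (a + 1) * (a ^ (p + 1) + 3 ^ (p + 1) * a ^ p) := by gcongr
      _ = a ^ (p + 1 + 1) + (a ^ p * a + 3 ^ (p + 1) * (a ^ p * a) + 3 ^ (p + 1) * a ^ p * 1) := by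
        ring
      _ ≤ a ^ (p + 1 + 1) + (3 ^ (p + 1) * (a ^ p * a) + 3 ^ (p + 1) * (a ^ p * a)
          + 3 ^ (p + 1) * a ^ p * a) := by
        have h3 : a ^ p * a ≤ 3 ^ (p + 1) * (a ^ p * a) := by
          nlinarith [mul_nonneg h1 (by linarith : (0 : ℝ) ≤ a)]
        gcongr
      _ = a ^ (p + 1 + 1) + 3 ^ (p + 1 + 1) * a ^ (p + 1) := by ring

section Growth

variable {S ι : Type*} {c : ι → S → ℝ} {τ : ι → S → S} {m : S → ℕ} {K A : ℝ} {d : ℕ}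
  {f : S → ℝ}

lemma JumpRates.abs_step_le (hr : JumpRates c τ m K) (hf : ∀ x, |f x| ≤ A * (m x + 1) ^ d) (i : ι)
    (x : S) : |f (τ i x) - f x| ≤ A * (2 ^ d + 1) * (m x + 1) ^ d := by
  have hA : 0 ≤ A := by
    have h1 := (abs_nonneg _).trans (hf x)
    exact nonneg_of_mul_nonneg_left h1 (by positivity)
  have h1 : ((m (τ i x) : ℝ) + 1) ^ d ≤ (2 * (m x + 1)) ^ d := by
    have : (m (τ i x) : ℝ) ≤ m x + 1 := by exact_mod_cast hr.step_le i x
    have h0 : (0 : ℝ) ≤ m x := Nat.cast_nonneg _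
    exact pow_le_pow_left₀ (by positivity) (by linarith) _
  calc |f (τ i x) - f x| ≤ |f (τ i x)| + |f x| := abs_sub _ _
    _ ≤ A * (2 * (m x + 1)) ^ d + A * (m x + 1) ^ d :=
      add_le_add ((hf _).trans (mul_le_mul_of_nonneg_left h1 hA)) (hf x)
    _ = A * (2 ^ d + 1) * (m x + 1) ^ d := by rw [mul_pow]; ring

/-- The restriction of an observable to the states of size at most `n`. -/
noncomputable def cutoff (m : S → ℕ) (f : S → ℝ) (n : ℕ) (x : S) : ℝ := if m x ≤ n then f x else 0

lemma cutoff_of_le {n : ℕ} {x : S} (h : m x ≤ n) : cutoff m f n x = f x := if_pos h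

lemma abs_cutoff_le (hf : ∀ x, |f x| ≤ A * (m x + 1) ^ d) (n : ℕ) (x : S) :
    |cutoff m f n x| ≤ A * (m x + 1) ^ d := by
  unfold cutoff
  split_ifs
  · exact hf x
  · rw [abs_zero]
    exact (abs_nonneg _).trans (hf x)

lemma JumpRates.finite_support_cutoff (hr : JumpRates c τ m K) (f : S → ℝ) (n : ℕ) :
    (Function.support (cutoff m f n)).Finite :=
  (hr.finite n).subset fun x hx => by
    by_contra h
    exact hx (if_neg h)

lemma growth_const_nonneg (x₀ : S) (hf : ∀ x, |f x| ≤ A * (m x + 1) ^ d) : 0 ≤ A :=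
  nonneg_of_mul_nonneg_left ((abs_nonneg _).trans (hf x₀)) (by positivity)

variable [Fintype ι]

lemma jumpGen_sub_const (f : S → ℝ) (b : ℝ) (x : S) :
    jumpGen c τ (fun y => f y - b) x = jumpGen c τ f x := by
  simp [jumpGen]

lemma JumpRates.abs_jumpGen_le (hr : JumpRates c τ m K) (hf : ∀ x, |f x| ≤ A * (m x + 1) ^ d)
    (x : S) : |jumpGen c τ f x| ≤
      Fintype.card ι * (K * (A * (2 ^ d + 1))) * (m x + 1) ^ (d + 1) := by
  refine (Finset.abs_sum_le_sum_abs _ _).trans ?_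
  have : ∀ i ∈ Finset.univ, |c i x * (f (τ i x) - f x)| ≤
      K * (A * (2 ^ d + 1)) * (m x + 1) ^ (d + 1) := fun i _ => by
    rw [abs_mul, abs_of_nonneg (hr.nonneg i x)]
    calc c i x * |f (τ i x) - f x| ≤ (K * (m x + 1)) * (A * (2 ^ d + 1) * (m x + 1) ^ d) :=
          mul_le_mul (hr.bound i x) (hr.abs_step_le hf i x) (abs_nonneg _)
            ((hr.nonneg i x).trans (hr.bound i x))
      _ = _ := by ring
  refine (Finset.sum_le_sum this).trans (le_of_eq ?_)
  rw [Finset.sum_const, Finset.card_univ, nsmul_eq_mul]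
  ring

lemma JumpRates.abs_carreDuChamp_le (hr : JumpRates c τ m K)
    (hf : ∀ x, |f x| ≤ A * (m x + 1) ^ d) (x : S) : |carreDuChamp c τ f x| ≤
      Fintype.card ι * (K * (A * (2 ^ d + 1)) ^ 2) * (m x + 1) ^ (2 * d + 1) := by
  refine (Finset.abs_sum_le_sum_abs _ _).trans ?_
  have : ∀ i ∈ Finset.univ, |c i x * (f (τ i x) - f x) ^ 2| ≤
      K * (A * (2 ^ d + 1)) ^ 2 * (m x + 1) ^ (2 * d + 1) := fun i _ => by
    rw [abs_mul, abs_of_nonneg (hr.nonneg i x), abs_pow]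
    calc c i x * |f (τ i x) - f x| ^ 2
        ≤ (K * (m x + 1)) * (A * (2 ^ d + 1) * (m x + 1) ^ d) ^ 2 :=
          mul_le_mul (hr.bound i x) (pow_le_pow_left₀ (abs_nonneg _) (hr.abs_step_le hf i x) 2)
            (by positivity) ((hr.nonneg i x).trans (hr.bound i x))
      _ = _ := by ring
  refine (Finset.sum_le_sum this).trans (le_of_eq ?_)
  rw [Finset.sum_const, Finset.card_univ, nsmul_eq_mul]
  ring

lemma JumpRates.jumpGen_cutoff (hr : JumpRates c τ m K) {n : ℕ} {x : S} (h : m x + 1 ≤ n) :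
    jumpGen c τ (cutoff m f n) x = jumpGen c τ f x := by
  refine Finset.sum_congr rfl fun i _ => ?_
  rw [cutoff_of_le ((hr.step_le i x).trans h), cutoff_of_le (by omega)]

lemma JumpRates.carreDuChamp_cutoff (hr : JumpRates c τ m K) {n : ℕ} {x : S} (h : m x + 1 ≤ n) :
    carreDuChamp c τ (cutoff m f n) x = carreDuChamp c τ f x := by
  refine Finset.sum_congr rfl fun i _ => ?_
  rw [cutoff_of_le ((hr.step_le i x).trans h), cutoff_of_le (by omega)]

/-- The generator does not increase the moments of the truncated size by more than a constant times
the moment of one order less. -/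
lemma JumpRates.jumpGen_moment_le (hr : JumpRates c τ m K) (n p : ℕ) (x : S) :
    jumpGen c τ (fun y => ((min (m y) n : ℕ) + 1 : ℝ) ^ (p + 1)) x ≤
      Fintype.card ι * (|K| * 3 ^ (p + 1)) * ((min (m x) n : ℕ) + 1 : ℝ) ^ p := by
  have : ∀ i ∈ Finset.univ, c i x * (((min (m (τ i x)) n : ℕ) + 1 : ℝ) ^ (p + 1)
      - ((min (m x) n : ℕ) + 1 : ℝ) ^ (p + 1)) ≤
      |K| * 3 ^ (p + 1) * ((min (m x) n : ℕ) + 1 : ℝ) ^ p := fun i _ => by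
    have h0 : (0 : ℝ) ≤ |K| * 3 ^ (p + 1) * ((min (m x) n : ℕ) + 1 : ℝ) ^ p := by positivity
    rcases hr.growth i x with h | h
    · have h1 : ((min (m (τ i x)) n : ℕ) + 1 : ℝ) ^ (p + 1) ≤
          ((min (m x) n : ℕ) + 1 : ℝ) ^ (p + 1) := by
        refine pow_le_pow_left₀ (by positivity) ?_ _
        have : min (m (τ i x)) n ≤ min (m x) n := min_le_min_right _ h
        exact_mod_cast Nat.succ_le_succ this
      refine le_trans ?_ h0
      exact mul_nonpos_of_nonneg_of_nonpos (hr.nonneg i x) (by linarith)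
    · have h1 : ((min (m (τ i x)) n : ℕ) + 1 : ℝ) ^ (p + 1) ≤
          ((min (m x) n : ℕ) + 1 + 1 : ℝ) ^ (p + 1) := by
        refine pow_le_pow_left₀ (by positivity) ?_ _
        have := hr.step_le i x
        have : min (m (τ i x)) n ≤ min (m x) n + 1 := by omega
        exact_mod_cast Nat.succ_le_succ this
      have h2 := add_one_pow_succ_le (a := ((min (m x) n : ℕ) + 1 : ℝ))
        (by have : (0 : ℝ) ≤ (min (m x) n : ℕ) := Nat.cast_nonneg _
            linarith) p
      have h3 : c i x ≤ |K| := h.trans (le_abs_self _)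
      calc c i x * (((min (m (τ i x)) n : ℕ) + 1 : ℝ) ^ (p + 1)
            - ((min (m x) n : ℕ) + 1 : ℝ) ^ (p + 1))
          ≤ c i x * (3 ^ (p + 1) * ((min (m x) n : ℕ) + 1 : ℝ) ^ p) :=
            mul_le_mul_of_nonneg_left (by linarith) (hr.nonneg i x)
        _ ≤ |K| * (3 ^ (p + 1) * ((min (m x) n : ℕ) + 1 : ℝ) ^ p) := by gcongr
        _ = _ := by ring
  refine (Finset.sum_le_sum this).trans (le_of_eq ?_)
  rw [Finset.sum_const, Finset.card_univ, nsmul_eq_mul]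
  ring

end Growth

section Moments

variable {S ι Ω : Type*} [MeasurableSpace S] [DiscreteMeasurableSpace S] [Fintype ι]
  [MeasurableSpace Ω] {c : ι → S → ℝ} {τ : ι → S → S} {x₀ : S} {P : Measure Ω} {Y : ℝ → Ω → S}
  {m : S → ℕ} {K A : ℝ} {d : ℕ} {f : S → ℝ}

lemma IsJumpProcess.measurable_mean [SFinite P] (hY : IsJumpProcess c τ x₀ P Y) (g : S → ℝ) :
    Measurable fun r => ∫ ω, g (Y r ω) ∂P :=
  (StronglyMeasurable.integral_prod_right (f := fun r ω => g (Y r ω))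
    (hY.measurable_comp g).stronglyMeasurable).measurable

lemma exists_truncated_moment_bound [IsProbabilityMeasure P] (hY : IsJumpProcess c τ x₀ P Y)
    (hr : JumpRates c τ m K) (p : ℕ) {T : ℝ} (hT : 0 ≤ T) :
    ∃ B, ∀ n : ℕ, ∀ t ∈ Icc 0 T, ∫ ω, ((min (m (Y t ω)) n : ℕ) + 1 : ℝ) ^ p ∂P ≤ B := by
  induction p with
  | zero => exact ⟨1, fun n t _ => by simp⟩
  | succ p ih =>
    obtain ⟨B, hB⟩ := ih
    have hB0 : 0 ≤ B := (integral_nonneg fun ω => by positivity).trans (hB 0 0 ⟨le_rfl, hT⟩)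
    set L : ℝ := Fintype.card ι * (|K| * 3 ^ (p + 1)) with hL
    have hL0 : 0 ≤ L := by positivity
    refine ⟨(m x₀ + 1) ^ (p + 1) + L * B * T, fun n t ht => ?_⟩
    set g : S → ℝ := fun x => ((min (m x) n : ℕ) + 1 : ℝ) ^ (p + 1) with hg
    have hgb : ∀ q : ℕ, ∀ x, |((min (m x) n : ℕ) + 1 : ℝ) ^ q| ≤ (n + 1 : ℝ) ^ q := fun q x => by
      rw [abs_of_nonneg (by positivity)]
      refine pow_le_pow_left₀ (by positivity) ?_ _
      have : ((min (m x) n : ℕ) : ℝ) ≤ n := by exact_mod_cast min_le_right _ _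
      linarith
    have hfin : (Function.support fun x => g x - (n + 1 : ℝ) ^ (p + 1)).Finite := by
      refine (hr.finite n).subset fun x hx => ?_
      by_contra h
      simp only [mem_ofPred_eq, not_le] at h
      exact hx (by simp only [hg]; rw [min_eq_right h.le, sub_self])
    obtain ⟨C', hC'⟩ := exists_bound_of_finite_support (hr.finite_support_jumpGen hfin)
    have h1 := hY.dynkin_finite hr hfin ht.1
    simp only [jumpGen_sub_const] at h1 hC'
    have i1 : ∀ q t, Integrable (fun ω => ((min (m (Y t ω)) n : ℕ) + 1 : ℝ) ^ q) P := fun q t =>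
      integrable_of_abs_le (hY.measurable_state (fun x => ((min (m x) n : ℕ) + 1 : ℝ) ^ q) t)
        fun ω => hgb q _
    rw [integral_sub (i1 (p + 1) t) (integrable_const _)] at h1
    simp only [integral_const, probReal_univ, one_smul] at h1
    have h2 : ∫ r in (0 : ℝ)..t, ∫ ω, jumpGen c τ g (Y r ω) ∂P ≤ ∫ r in (0 : ℝ)..t, L * B := by
      refine intervalIntegral.integral_mono_on ht.1 ?_ intervalIntegrable_const fun r hr' => ?_
      · refine intervalIntegrable_of_bound (hY.measurable_mean _) (C := C') (fun r => ?_) _ _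
        have := norm_integral_le_of_norm_le_const (μ := P) (f := fun ω => jumpGen c τ g (Y r ω))
          (C := C') (ae_of_all _ fun ω => hC' _)
        simpa using this
      · calc ∫ ω, jumpGen c τ g (Y r ω) ∂P
            ≤ ∫ ω, L * ((min (m (Y r ω)) n : ℕ) + 1 : ℝ) ^ p ∂P :=
              integral_mono (integrable_of_abs_le (hY.measurable_state _ _) fun ω => hC' _)
                ((i1 p r).const_mul _) fun ω => hr.jumpGen_moment_le n p _
          _ = L * ∫ ω, ((min (m (Y r ω)) n : ℕ) + 1 : ℝ) ^ p ∂P := integral_const_mul _ _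
          _ ≤ L * B := mul_le_mul_of_nonneg_left (hB n r ⟨hr'.1, hr'.2.trans ht.2⟩) hL0
    rw [intervalIntegral.integral_const, smul_eq_mul, sub_zero] at h2
    have h3 : g x₀ ≤ (m x₀ + 1 : ℝ) ^ (p + 1) := by
      refine pow_le_pow_left₀ (by positivity) ?_ _
      have : ((min (m x₀) n : ℕ) : ℝ) ≤ m x₀ := by exact_mod_cast min_le_left _ _
      linarith
    have h4 : t * (L * B) ≤ L * B * T := by
      rw [mul_comm]
      exact mul_le_mul_of_nonneg_left ht.2 (by positivity)
    linarith

/-- All moments of the size are bounded, uniformly on bounded time intervals. -/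
lemma IsJumpProcess.exists_moment_bound [IsProbabilityMeasure P] (hY : IsJumpProcess c τ x₀ P Y)
    (hr : JumpRates c τ m K) (p : ℕ) {T : ℝ} (hT : 0 ≤ T) :
    ∃ B, 0 ≤ B ∧ ∀ t ∈ Icc 0 T, Integrable (fun ω => ((m (Y t ω) : ℝ) + 1) ^ p) P ∧
      ∫ ω, ((m (Y t ω) : ℝ) + 1) ^ p ∂P ≤ B := by
  obtain ⟨B, hB⟩ := exists_truncated_moment_bound hY hr p hT
  have hB0 : 0 ≤ B := (integral_nonneg fun ω => by positivity).trans (hB 0 0 ⟨le_rfl, hT⟩)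
  refine ⟨B, hB0, fun t ht => ?_⟩
  have hm : ∀ n : ℕ, Measurable fun ω => ((min (m (Y t ω)) n : ℕ) + 1 : ℝ) ^ p := fun n =>
    hY.measurable_state (fun x => ((min (m x) n : ℕ) + 1 : ℝ) ^ p) t
  have h1 : ∫⁻ ω, ENNReal.ofReal (((m (Y t ω) : ℝ) + 1) ^ p) ∂P ≤ ENNReal.ofReal B := by
    refine lintegral_le_of_ae_tendsto hm (ae_of_all _ fun ω => ?_) (b := fun _ => ENNReal.ofReal B)
      (fun n => ?_) tendsto_const_nhds
    · refine tendsto_const_nhds.congr' ?_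
      filter_upwards [eventually_ge_atTop (m (Y t ω))] with n hn
      rw [min_eq_left hn]
    · rw [← ofReal_integral_eq_lintegral_ofReal _ (ae_of_all _ fun ω => by positivity)]
      · exact ENNReal.ofReal_le_ofReal (hB n t ht)
      · refine integrable_of_abs_le (hm n) (C := (n + 1 : ℝ) ^ p) fun ω => ?_
        rw [abs_of_nonneg (by positivity)]
        refine pow_le_pow_left₀ (by positivity) ?_ _
        have : ((min (m (Y t ω)) n : ℕ) : ℝ) ≤ n := by exact_mod_cast min_le_right _ _
        linarith
  have h2 : Measurable fun ω => ((m (Y t ω) : ℝ) + 1) ^ p :=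
    hY.measurable_state (fun x => ((m x : ℝ) + 1) ^ p) t
  have h3 : Integrable (fun ω => ((m (Y t ω) : ℝ) + 1) ^ p) P := by
    refine ⟨h2.aestronglyMeasurable, ?_⟩
    rw [hasFiniteIntegral_iff_ofReal (ae_of_all _ fun ω => by positivity)]
    exact h1.trans_lt ENNReal.ofReal_lt_top
  refine ⟨h3, ?_⟩
  rw [← ofReal_integral_eq_lintegral_ofReal h3 (ae_of_all _ fun ω => by positivity)] at h1
  exact (ENNReal.ofReal_le_ofReal_iff hB0).1 h1

lemma IsJumpProcess.integrable_state [IsProbabilityMeasure P] (hY : IsJumpProcess c τ x₀ P Y)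
    (hr : JumpRates c τ m K) (hf : ∀ x, |f x| ≤ A * (m x + 1) ^ d) {t : ℝ} (ht : 0 ≤ t) :
    Integrable (fun ω => f (Y t ω)) P := by
  obtain ⟨B, -, hB⟩ := hY.exists_moment_bound hr d ht
  exact ((hB t ⟨ht, le_rfl⟩).1.const_mul A).mono'
    (hY.measurable_state f t).aestronglyMeasurable (ae_of_all _ fun ω => hf _)

/-- Almost every path has integrable observables of polynomial growth; moreover these are integrable
in time and chance jointly. -/
lemma IsJumpProcess.integrable_prod [IsProbabilityMeasure P] (hY : IsJumpProcess c τ x₀ P Y)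
    (hr : JumpRates c τ m K) (hf : ∀ x, |f x| ≤ A * (m x + 1) ^ d) {T : ℝ} (hT : 0 ≤ T) :
    Integrable (fun p : ℝ × Ω => f (Y p.1 p.2)) ((volume.restrict (Ioc 0 T)).prod P) := by
  obtain ⟨B, hB0, hB⟩ := hY.exists_moment_bound hr d hT
  have h1 : Integrable (fun p : ℝ × Ω => ((m (Y p.1 p.2) : ℝ) + 1) ^ d)
      ((volume.restrict (Ioc 0 T)).prod P) := by
    have hm := hY.measurable_comp fun x => ((m x : ℝ) + 1) ^ d
    refine (integrable_prod_iff hm.aestronglyMeasurable).2 ⟨?_, ?_⟩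
    · filter_upwards [ae_restrict_mem measurableSet_Ioc] with r hr'
      exact (hB r ⟨hr'.1.le, hr'.2⟩).1
    · have : IsFiniteMeasure (volume.restrict (Ioc 0 T)) := ⟨by simp⟩
      have hm' := hY.measurable_mean fun x => ((m x : ℝ) + 1) ^ d
      have e : ∀ r, ∫ ω, ‖((m (Y r ω) : ℝ) + 1) ^ d‖ ∂P = ∫ ω, ((m (Y r ω) : ℝ) + 1) ^ d ∂P :=
        fun r => integral_congr_ae (ae_of_all _ fun ω => by
          simp only
          rw [Real.norm_eq_abs, abs_of_nonneg (by positivity)])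
      simp only [e]
      refine Integrable.of_bound hm'.aestronglyMeasurable B ?_
      filter_upwards [ae_restrict_mem measurableSet_Ioc] with r hr'
      rw [Real.norm_eq_abs, abs_of_nonneg (integral_nonneg fun ω => by positivity)]
      exact (hB r ⟨hr'.1.le, hr'.2⟩).2
  exact (h1.const_mul A).mono' (hY.measurable_comp f).aestronglyMeasurable
    (ae_of_all _ fun p => hf _)

lemma IsJumpProcess.ae_intervalIntegrable [IsProbabilityMeasure P] (hY : IsJumpProcess c τ x₀ P Y)
    (hr : JumpRates c τ m K) (hf : ∀ x, |f x| ≤ A * (m x + 1) ^ d) {T : ℝ} (hT : 0 ≤ T) :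
    ∀ᵐ ω ∂P, ∀ s ∈ Icc 0 T, ∀ t ∈ Icc 0 T,
      IntervalIntegrable (fun r => f (Y r ω)) volume s t := by
  filter_upwards [(hY.integrable_prod hr hf hT).prod_left_ae] with ω hω s hs t ht
  have h1 : IntervalIntegrable (fun r => f (Y r ω)) volume 0 T :=
    (intervalIntegrable_iff_integrableOn_Ioc_of_le hT).2 hω
  refine h1.mono_set ?_
  rw [uIcc_of_le hT]
  exact uIcc_subset_Icc hs ht

lemma IsJumpProcess.mean_continuous_bound [IsProbabilityMeasure P] (hY : IsJumpProcess c τ x₀ P Y)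
    (hr : JumpRates c τ m K) (hA : 0 ≤ A) {T : ℝ} (hT : 0 ≤ T) :
    ∃ B, ∀ f : S → ℝ, (∀ x, |f x| ≤ A * (m x + 1) ^ d) → ∀ t ∈ Icc 0 T,
      |∫ ω, f (Y t ω) ∂P| ≤ B := by
  obtain ⟨B, hB0, hB⟩ := hY.exists_moment_bound hr d hT
  refine ⟨A * B, fun f hf t ht => ?_⟩
  have h1 := norm_integral_le_of_norm_le (μ := P) (f := fun ω => f (Y t ω))
    (g := fun ω => A * ((m (Y t ω) : ℝ) + 1) ^ d) ((hB t ht).1.const_mul A)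
    (ae_of_all _ fun ω => hf _)
  rw [integral_const_mul, Real.norm_eq_abs] at h1
  exact h1.trans (mul_le_mul_of_nonneg_left (hB t ht).2 hA)

lemma IsJumpProcess.intervalIntegrable_mean [IsProbabilityMeasure P]
    (hY : IsJumpProcess c τ x₀ P Y) (hr : JumpRates c τ m K)
    (hf : ∀ x, |f x| ≤ A * (m x + 1) ^ d) {s t : ℝ} (hs : 0 ≤ s) (hst : s ≤ t) :
    IntervalIntegrable (fun r => ∫ ω, f (Y r ω) ∂P) volume s t := by
  have h := (hY.integrable_prod hr hf (hs.trans hst)).integral_prod_left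
  refine IntervalIntegrable.mono_set (a := 0) (b := t)
    ((intervalIntegrable_iff_integrableOn_Ioc_of_le (hs.trans hst)).2 h) ?_
  rw [uIcc_of_le hst, uIcc_of_le (hs.trans hst)]
  exact Icc_subset_Icc_left hs

/-- Means and time-integrated means pass to the limit along cut-offs. -/
lemma IsJumpProcess.tendsto_mean [IsProbabilityMeasure P]
    (hY : IsJumpProcess c τ x₀ P Y) (hr : JumpRates c τ m K) {g : ℕ → S → ℝ}
    (hg : ∀ n x, |g n x| ≤ A * (m x + 1) ^ d) (hgf : ∀ x, ∀ᶠ n in atTop, g n x = f x)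
    {t : ℝ} (ht : 0 ≤ t) :
    Tendsto (fun n => ∫ ω, g n (Y t ω) ∂P) atTop (𝓝 (∫ ω, f (Y t ω) ∂P)) := by
  obtain ⟨B, -, hB⟩ := hY.exists_moment_bound hr d ht
  refine tendsto_integral_of_dominated_convergence (fun ω => A * ((m (Y t ω) : ℝ) + 1) ^ d)
    (fun n => (hY.measurable_state _ t).aestronglyMeasurable) ((hB t ⟨ht, le_rfl⟩).1.const_mul A)
    (fun n => ae_of_all _ fun ω => hg n _) (ae_of_all _ fun ω => ?_)
  refine tendsto_const_nhds.congr' ?_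
  filter_upwards [hgf (Y t ω)] with n hn using hn.symm

lemma IsJumpProcess.tendsto_integral_mean [IsProbabilityMeasure P]
    (hY : IsJumpProcess c τ x₀ P Y) (hr : JumpRates c τ m K) (hA : 0 ≤ A) {g : ℕ → S → ℝ}
    (hg : ∀ n x, |g n x| ≤ A * (m x + 1) ^ d) (hgf : ∀ x, ∀ᶠ n in atTop, g n x = f x)
    {s t : ℝ} (hs : 0 ≤ s) (hst : s ≤ t) :
    Tendsto (fun n => ∫ r in s..t, ∫ ω, g n (Y r ω) ∂P) atTop
      (𝓝 (∫ r in s..t, ∫ ω, f (Y r ω) ∂P)) := by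
  obtain ⟨B, hB⟩ := hY.mean_continuous_bound (d := d) hr hA (hs.trans hst)
  refine intervalIntegral.tendsto_integral_filter_of_dominated_convergence (fun _ => B)
    (Eventually.of_forall fun n => (hY.measurable_mean _).aestronglyMeasurable)
    (Eventually.of_forall fun n => ae_of_all _ fun r hr' => ?_) intervalIntegrable_const
    (ae_of_all _ fun r hr' => ?_)
  · rw [uIoc_of_le hst] at hr'
    exact hB (g n) (hg n) r ⟨hs.trans hr'.1.le, hr'.2⟩
  · rw [uIoc_of_le hst] at hr'
    exact hY.tendsto_mean hr hg hgf (hs.trans hr'.1.le)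

/-- Dynkin's formula for observables of polynomial growth. -/
lemma IsJumpProcess.dynkin_growth [IsProbabilityMeasure P]
    (hY : IsJumpProcess c τ x₀ P Y) (hr : JumpRates c τ m K)
    (hf : ∀ x, |f x| ≤ A * (m x + 1) ^ d) {t : ℝ} (ht : 0 ≤ t) :
    ∫ ω, f (Y t ω) ∂P = f x₀ + ∫ r in (0 : ℝ)..t, ∫ ω, jumpGen c τ f (Y r ω) ∂P := by
  have hg := fun n => abs_cutoff_le (m := m) (f := f) hf n
  have hG := fun n => hr.abs_jumpGen_le (hg n)
  have h1 := hY.tendsto_mean hr (f := f) hg (fun x => by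
    filter_upwards [eventually_ge_atTop (m x)] with n hn using cutoff_of_le hn) ht
  have h2 := hY.tendsto_integral_mean hr (growth_const_nonneg x₀ (hG 0)) (f := jumpGen c τ f) hG
    (fun x => by
      filter_upwards [eventually_ge_atTop (m x + 1)] with n hn using hr.jumpGen_cutoff hn) le_rfl ht
  have h3 := h2.const_add (f x₀)
  refine tendsto_nhds_unique h1 (h3.congr' ?_)
  filter_upwards [eventually_ge_atTop (m x₀)] with n hn
  rw [hY.dynkin_finite hr (hr.finite_support_cutoff f n) ht, cutoff_of_le hn]

/-- The second moment of the martingale increments, for observables of polynomial growth. -/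
lemma IsJumpProcess.lintegral_increment_sq_le [IsProbabilityMeasure P]
    (hY : IsJumpProcess c τ x₀ P Y) (hr : JumpRates c τ m K)
    (hf : ∀ x, |f x| ≤ A * (m x + 1) ^ d) {s t B : ℝ} (hs : 0 ≤ s) (hst : s ≤ t)
    (hB : ∀ r ∈ Icc s t, ∫ ω, carreDuChamp c τ f (Y r ω) ∂P ≤ B) :
    ∫⁻ ω, ENNReal.ofReal
      ((f (Y t ω) - f (Y s ω) - ∫ r in s..t, jumpGen c τ f (Y r ω)) ^ 2) ∂P ≤
      ENNReal.ofReal (B * (t - s)) := by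
  have ht := hs.trans hst
  have hg := fun n => abs_cutoff_le (m := m) (f := f) hf n
  have hG := fun n => hr.abs_jumpGen_le (hg n)
  have hΓ := fun n => hr.abs_carreDuChamp_le (hg n)
  set A' := Fintype.card ι * (K * (A * (2 ^ d + 1)))
  have h2 := hY.tendsto_integral_mean hr (growth_const_nonneg x₀ (hΓ 0))
    (f := carreDuChamp c τ f) hΓ (fun x => by
      filter_upwards [eventually_ge_atTop (m x + 1)] with n hn using hr.carreDuChamp_cutoff hn)
    hs hst
  have h3 : ∫ r in s..t, ∫ ω, carreDuChamp c τ f (Y r ω) ∂P ≤ B * (t - s) := by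
    have : ∫ r in s..t, ∫ ω, carreDuChamp c τ f (Y r ω) ∂P ≤ ∫ r in s..t, B :=
      intervalIntegral.integral_mono_on hst
        (hY.intervalIntegrable_mean hr (hr.abs_carreDuChamp_le hf) hs hst)
        intervalIntegrable_const hB
    rwa [intervalIntegral.integral_const, smul_eq_mul, mul_comm] at this
  refine le_trans ?_ (ENNReal.ofReal_le_ofReal h3)
  refine lintegral_le_of_ae_tendsto (g := fun n ω => (cutoff m f n (Y t ω) - cutoff m f n (Y s ω)
      - ∫ r in s..t, jumpGen c τ (cutoff m f n) (Y r ω)) ^ 2) (fun n => ?_) ?_ (fun n => ?_)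
    ((ENNReal.continuous_ofReal.tendsto _).comp h2)
  · exact (((hY.measurable_state _ t).sub (hY.measurable_state _ s)).sub
      (hY.measurable_integral_right _ s t)).pow_const 2
  · have hdom : ∀ x, |A' * ((m x : ℝ) + 1) ^ (d + 1)| ≤ A' * (m x + 1) ^ (d + 1) := fun x => by
      rw [abs_of_nonneg]
      exact (abs_nonneg _).trans (hG 0 x)
    filter_upwards [hY.ae_intervalIntegrable hr hdom ht] with ω hω
    have l1 : Tendsto (fun n => ∫ r in s..t, jumpGen c τ (cutoff m f n) (Y r ω)) atTop
        (𝓝 (∫ r in s..t, jumpGen c τ f (Y r ω))) := by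
      refine intervalIntegral.tendsto_integral_filter_of_dominated_convergence
        (fun r => A' * ((m (Y r ω) : ℝ) + 1) ^ (d + 1))
        (Eventually.of_forall fun n => (hY.measurable_path _ ω).aestronglyMeasurable)
        (Eventually.of_forall fun n => ae_of_all _ fun r _ => hG n _)
        (hω s ⟨hs, hst⟩ t ⟨ht, le_rfl⟩) (ae_of_all _ fun r _ => ?_)
      refine tendsto_const_nhds.congr' ?_
      filter_upwards [eventually_ge_atTop (m (Y r ω) + 1)] with n hn
      exact (hr.jumpGen_cutoff hn).symm
    have l2 : ∀ r, Tendsto (fun n => cutoff m f n (Y r ω)) atTop (𝓝 (f (Y r ω))) := fun r => by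
      refine tendsto_const_nhds.congr' ?_
      filter_upwards [eventually_ge_atTop (m (Y r ω))] with n hn using (cutoff_of_le hn).symm
    exact (((l2 t).sub (l2 s)).sub l1).pow 2
  · have hfin := hr.finite_support_cutoff f n
    obtain ⟨C, hC⟩ := exists_bound_of_finite_support hfin
    obtain ⟨C', hC'⟩ := exists_bound_of_finite_support (hr.finite_support_jumpGen hfin)
    have hm : Measurable fun ω => cutoff m f n (Y t ω) - cutoff m f n (Y s ω)
        - ∫ r in s..t, jumpGen c τ (cutoff m f n) (Y r ω) :=
      ((hY.measurable_state _ t).sub (hY.measurable_state _ s)).sub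
        (hY.measurable_integral_right _ s t)
    rw [← ofReal_integral_eq_lintegral_ofReal _ (ae_of_all _ fun ω => sq_nonneg _),
      hY.isometry hr hfin hs hst]
    · rfl
    · refine integrable_of_abs_le (hm.pow_const 2) (C := (C + C + C' * (t - s)) ^ 2) fun ω => ?_
      rw [abs_pow]
      refine pow_le_pow_left₀ (abs_nonneg _) ?_ 2
      exact (abs_sub _ _).trans (add_le_add ((abs_sub _ _).trans (add_le_add (hC _) (hC _)))
        (abs_intervalIntegral_le (fun r => hC' _) hst))

end Moments

/-! ### Relaxation of eigenmodes -/

/-- Variation of constants: the difference between a path `y` and the solution of `w' = -l w + b`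
with the same initial value is an average of the increments of `y - ∫ (-l y + b)`. -/
lemma sub_variation_of_constants {y b : ℝ → ℝ} {l t C : ℝ} (hy : Measurable y) (hb : Measurable b)
    (hyc : ∀ t, ∀ᶠ r in 𝓝[≥] t, y r = y t) (hbc : ∀ t, ∀ᶠ r in 𝓝[≥] t, b r = b t)
    (ht : 0 ≤ t) (hyi : IntervalIntegrable y volume 0 t) (hbC : ∀ r, |b r| ≤ C) :
    y t - Real.exp (-(l * t)) * (y 0 + ∫ s in (0 : ℝ)..t, Real.exp (l * s) * b s) =
      Real.exp (-(l * t)) * (y t - y 0 - ∫ r in (0 : ℝ)..t, (-l * y r + b r)) +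
      ∫ s in (0 : ℝ)..t, l * Real.exp (-(l * (t - s))) *
        (y t - y s - ∫ r in s..t, (-l * y r + b r)) := by
  set q : ℝ → ℝ := fun r => -l * y r + b r with hq
  have hqm : Measurable q := (hy.const_mul _).add hb
  have hqc : ∀ t, ∀ᶠ r in 𝓝[≥] t, q r = q t := fun t => by
    filter_upwards [hyc t, hbc t] with r h1 h2
    simp only [hq, h1, h2]
  have hbi : ∀ a a', IntervalIntegrable b volume a a' := fun a a' =>
    intervalIntegrable_of_bound hb hbC a a'
  have hqi : IntervalIntegrable q volume 0 t := (hyi.const_mul _).add (hbi 0 t)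
  have hsub : ∀ {g : ℝ → ℝ}, IntervalIntegrable g volume 0 t → ∀ a ∈ Icc 0 t, ∀ a' ∈ Icc 0 t,
      IntervalIntegrable g volume a a' := fun hg a ha a' ha' => by
    refine hg.mono_set ?_
    rw [uIcc_of_le ht]
    exact uIcc_subset_Icc ha ha'
  have h0 : (0 : ℝ) ∈ Icc 0 t := ⟨le_rfl, ht⟩
  have ht' : t ∈ Icc 0 t := ⟨ht, le_rfl⟩
  set Q : ℝ → ℝ := fun s => ∫ r in (0 : ℝ)..s, q r with hQ
  have hQc : ContinuousOn Q (Icc 0 t) := by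
    have := intervalIntegral.continuousOn_primitive_interval' hqi left_mem_uIcc
    rwa [uIcc_of_le ht] at this
  have hE : Continuous fun s : ℝ => Real.exp (l * s) := by fun_prop
  have hebm : Measurable fun s => Real.exp (l * s) * b s := hE.measurable.mul hb
  have hebi : IntervalIntegrable (fun s => Real.exp (l * s) * b s) volume 0 t :=
    (hbi 0 t).continuousOn_mul hE.continuousOn
  set I : ℝ → ℝ := fun s => ∫ r in (0 : ℝ)..s, Real.exp (l * r) * b r with hI
  have hIc : ContinuousOn I (Icc 0 t) := by
    have := intervalIntegral.continuousOn_primitive_interval' hebi left_mem_uIcc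
    rwa [uIcc_of_le ht] at this
  have hElc : Continuous fun s : ℝ => l * Real.exp (l * s) := by fun_prop
  have hQi : IntervalIntegrable Q volume 0 t := by
    refine ContinuousOn.intervalIntegrable ?_
    rwa [uIcc_of_le ht]
  have hEQi : IntervalIntegrable (fun s => l * Real.exp (l * s) * (Q s - y s)) volume 0 t :=
    (hQi.sub hyi).continuousOn_mul hElc.continuousOn
  have hftc : ∫ s in (0 : ℝ)..t, l * Real.exp (l * s) * (Q s - y s) =
      Real.exp (l * t) * Q t - I t - (Real.exp (l * 0) * Q 0 - I 0) := by
    refine intervalIntegral.integral_eq_sub_of_hasDeriv_right_of_le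
      (f := fun s => Real.exp (l * s) * Q s - I s) ht
      ((hE.continuousOn.mul hQc).sub hIc) (fun x hx => ?_) hEQi
    have hx' : x ∈ Icc 0 t := ⟨hx.1.le, hx.2.le⟩
    have d1 : HasDerivWithinAt Q (q x) (Ioi x) x :=
      hasDerivWithinAt_integral_of_eventually_eq hqm (hsub hqi 0 h0 x hx') (hqc x)
    have d2 : HasDerivWithinAt I (Real.exp (l * x) * b x) (Ioi x) x := by
      have hcont : ContinuousWithinAt (fun s => Real.exp (l * s) * b s) (Ioi x) x := by
        have hbt : Tendsto b (𝓝[>] x) (𝓝 (b x)) := by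
          refine tendsto_const_nhds.congr' ?_
          filter_upwards [nhdsWithin_mono x Ioi_subset_Ici_self (hbc x)] with r hr using hr.symm
        exact (hE.continuousWithinAt).mul hbt
      exact (intervalIntegral.integral_hasDerivWithinAt_right (hsub hebi 0 h0 x hx') (s := Ici x)
        (t := Ioi x) hebm.stronglyMeasurable.stronglyMeasurableAtFilter hcont).mono
        Ioi_subset_Ici_self
    have d3 : HasDerivWithinAt (fun s : ℝ => Real.exp (l * s)) (Real.exp (l * x) * l) (Ioi x) x := by
      have := ((hasDerivAt_id' x).const_mul l).exp
      simp only [mul_one] at this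
      exact this.hasDerivWithinAt
    refine ((d3.fun_mul d1).fun_sub d2).congr_deriv ?_
    simp only [hq]
    ring
  have hexp : ∫ s in (0 : ℝ)..t, l * Real.exp (l * s) = Real.exp (l * t) - 1 := by
    have := intervalIntegral.integral_eq_sub_of_hasDerivAt (a := 0) (b := t)
      (f := fun s => Real.exp (l * s)) (f' := fun s => l * Real.exp (l * s)) (fun x _ => by
        have := ((hasDerivAt_id' x).const_mul l).exp
        refine this.congr_deriv ?_
        ring) (hElc.intervalIntegrable _ _)
    rw [this]
    simp
  have e1 : ∀ s ∈ uIcc 0 t, l * Real.exp (-(l * (t - s))) * (y t - y s - ∫ r in s..t, q r) =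
      Real.exp (-(l * t)) * ((y t - Q t) * (l * Real.exp (l * s)) +
        l * Real.exp (l * s) * (Q s - y s)) := by
    intro s hs
    rw [uIcc_of_le ht] at hs
    have a1 := intervalIntegral.integral_add_adjacent_intervals (hsub hqi 0 h0 s hs)
      (hsub hqi s hs t ht')
    have a2 : ∫ r in s..t, q r = Q t - Q s := by
      simp only [hQ]
      linarith
    rw [a2, show -(l * (t - s)) = -(l * t) + l * s by ring, Real.exp_add]
    ring
  rw [intervalIntegral.integral_congr e1, intervalIntegral.integral_const_mul,
    intervalIntegral.integral_add ((hElc.intervalIntegrable 0 t).const_mul _) hEQi,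
    intervalIntegral.integral_const_mul, hexp, hftc]
  have a3 : Q 0 = 0 := by simp [hQ]
  have a4 : I 0 = 0 := by simp [hI]
  have a5 : Real.exp (-(l * t)) * Real.exp (l * t) = 1 := by
    rw [← Real.exp_add]
    simp
  rw [a3, a4]
  change y t - Real.exp (-(l * t)) * (y 0 + I t) = Real.exp (-(l * t)) * (y t - y 0 - Q t) +
    Real.exp (-(l * t)) * ((y t - Q t) * (Real.exp (l * t) - 1) +
      (Real.exp (l * t) * Q t - I t - (Real.exp (l * 0) * 0 - 0)))
  linear_combination (-y t) * a5

/-- Jensen's inequality for the square and a mixture of a point mass and a density. -/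
lemma sq_le_average_sq {D w : ℝ → ℝ} {p z t : ℝ} (ht : 0 ≤ t) (hp : 0 ≤ p) (hw : Continuous w)
    (hw0 : ∀ s, 0 ≤ w s) (hD : IntervalIntegrable D volume 0 t)
    (hD2 : IntervalIntegrable (fun s => D s ^ 2) volume 0 t)
    (h1 : p + ∫ s in (0 : ℝ)..t, w s = 1) (hz : z = p * D 0 + ∫ s in (0 : ℝ)..t, w s * D s) :
    z ^ 2 ≤ p * D 0 ^ 2 + ∫ s in (0 : ℝ)..t, w s * D s ^ 2 := by
  have i1 : IntervalIntegrable (fun s => w s * D s) volume 0 t :=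
    hD.continuousOn_mul hw.continuousOn
  have i2 : IntervalIntegrable (fun s => w s * D s ^ 2) volume 0 t :=
    hD2.continuousOn_mul hw.continuousOn
  have i3 := hw.intervalIntegrable (μ := volume) 0 t
  have e : ∫ s in (0 : ℝ)..t, w s * (D s - z) ^ 2 = (∫ s in (0 : ℝ)..t, w s * D s ^ 2)
      - 2 * z * (∫ s in (0 : ℝ)..t, w s * D s) + z ^ 2 * ∫ s in (0 : ℝ)..t, w s := by
    rw [← intervalIntegral.integral_const_mul, ← intervalIntegral.integral_const_mul,
      ← intervalIntegral.integral_sub i2 (i1.const_mul _),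
      ← intervalIntegral.integral_add (i2.sub (i1.const_mul _)) (i3.const_mul _)]
    refine intervalIntegral.integral_congr fun s _ => ?_
    ring
  have h2 : 0 ≤ ∫ s in (0 : ℝ)..t, w s * (D s - z) ^ 2 :=
    intervalIntegral.integral_nonneg ht fun s _ => mul_nonneg (hw0 s) (sq_nonneg _)
  have h3 : 0 ≤ p * (D 0 - z) ^ 2 := mul_nonneg hp (sq_nonneg _)
  have h4 : (∫ s in (0 : ℝ)..t, w s) = 1 - p := by linarith
  have h5 : (∫ s in (0 : ℝ)..t, w s * D s) = z - p * D 0 := by linarith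
  rw [e, h4, h5] at h2
  nlinarith

section Relax

variable {S ι Ω : Type*} [MeasurableSpace S] [DiscreteMeasurableSpace S] [Fintype ι]
  [MeasurableSpace Ω] {c : ι → S → ℝ} {τ : ι → S → S} {x₀ : S} {P : Measure Ω} {Y : ℝ → Ω → S}
  {m : S → ℕ} {K A C l : ℝ} {d : ℕ} {f b : S → ℝ}

/-- The solution of `w' = -l w + b(Y)` with `w(0) = f(Y 0)`. -/
noncomputable def relax (l : ℝ) (f b : S → ℝ) (Y : ℝ → Ω → S) (t : ℝ) (ω : Ω) : ℝ :=
  Real.exp (-(l * t)) * (f (Y 0 ω) + ∫ s in (0 : ℝ)..t, Real.exp (l * s) * b (Y s ω))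

lemma IsJumpProcess.measurable_increment (hY : IsJumpProcess c τ x₀ P Y) (f g : S → ℝ) (t : ℝ) :
    Measurable fun p : ℝ × Ω => f (Y t p.2) - f (Y p.1 p.2) - ∫ q in p.1..t, g (Y q p.2) := by
  have h1 : Measurable fun p : ℝ × Ω => f (Y t p.2) :=
    (hY.measurable_state f t).comp measurable_snd
  have e : (fun p : ℝ × Ω => ∫ q in p.1..t, g (Y q p.2)) =
      fun p => -∫ q in t..p.1, g (Y q p.2) :=
    funext fun p => intervalIntegral.integral_symm _ _
  have h2 : Measurable fun p : ℝ × Ω => ∫ q in p.1..t, g (Y q p.2) := by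
    rw [e]
    exact (hY.measurable_integral g t).neg
  exact (h1.sub (hY.measurable_comp f)).sub h2

lemma integral_exp_weight {t : ℝ} (hl : l ≠ 0) :
    Real.exp (-(l * t)) * t + ∫ s in (0 : ℝ)..t, l * Real.exp (-(l * (t - s))) * (t - s) =
      (1 - Real.exp (-(l * t))) / l := by
  have hc : Continuous fun s => l * Real.exp (-(l * (t - s))) * (t - s) := by fun_prop
  have := intervalIntegral.integral_eq_sub_of_hasDerivAt (a := 0) (b := t)
    (f := fun s => (t - s) * Real.exp (-(l * (t - s))) + Real.exp (-(l * (t - s))) / l)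
    (f' := fun s => l * Real.exp (-(l * (t - s))) * (t - s)) (fun x _ => by
      have h1 : HasDerivAt (fun s : ℝ => t - s) (-1) x := by
        simpa using (hasDerivAt_id' x).const_sub t
      have h2 := ((h1.const_mul l).fun_neg).exp
      refine ((h1.fun_mul h2).fun_add (h2.div_const l)).congr_deriv ?_
      field_simp
      ring) (hc.intervalIntegrable _ _)
  rw [this]
  simp
  field_simp
  ring

lemma integral_exp_density {t : ℝ} :
    Real.exp (-(l * t)) + ∫ s in (0 : ℝ)..t, l * Real.exp (-(l * (t - s))) = 1 := by
  have hc : Continuous fun s => l * Real.exp (-(l * (t - s))) := by fun_prop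
  have := intervalIntegral.integral_eq_sub_of_hasDerivAt (a := 0) (b := t)
    (f := fun s => Real.exp (-(l * (t - s))))
    (f' := fun s => l * Real.exp (-(l * (t - s)))) (fun x _ => by
      have h1 : HasDerivAt (fun s : ℝ => t - s) (-1) x := by
        simpa using (hasDerivAt_id' x).const_sub t
      refine ((h1.const_mul l).fun_neg).exp.congr_deriv ?_
      ring) (hc.intervalIntegrable _ _)
  rw [this]
  simp

/-- The fluctuation of an eigenmode around its relaxation is at most the size of the carré du champ
divided by the eigenvalue. -/
lemma IsJumpProcess.lintegral_sub_relax_sq_le [IsProbabilityMeasure P]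
    (hY : IsJumpProcess c τ x₀ P Y) (hr : JumpRates c τ m K)
    (hf : ∀ x, |f x| ≤ A * (m x + 1) ^ d) (hb : ∀ x, |b x| ≤ C) (hl : 0 < l)
    (hG : ∀ x, jumpGen c τ f x = -l * f x + b x) {t B : ℝ} (ht : 0 ≤ t)
    (hB : ∀ r ∈ Icc 0 t, ∫ ω, carreDuChamp c τ f (Y r ω) ∂P ≤ B) :
    ∫⁻ ω, ENNReal.ofReal ((f (Y t ω) - relax l f b Y t ω) ^ 2) ∂P ≤ ENNReal.ofReal (B / l) := by
  set D : ℝ → Ω → ℝ := fun s ω => f (Y t ω) - f (Y s ω) - ∫ r in s..t, jumpGen c τ f (Y r ω)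
    with hD
  have hDm : Measurable (Function.uncurry D) := hY.measurable_increment f _ t
  have hB0 : 0 ≤ B := by
    refine le_trans (integral_nonneg fun ω => ?_) (hB 0 ⟨le_rfl, ht⟩)
    exact Finset.sum_nonneg fun i _ => mul_nonneg (hr.nonneg _ _) (sq_nonneg _)
  have hDB : ∀ s ∈ Icc 0 t, ∫⁻ ω, ENNReal.ofReal (D s ω ^ 2) ∂P ≤ ENNReal.ofReal (B * (t - s)) :=
    fun s hs => hY.lintegral_increment_sq_le hr hf hs.1 hs.2 fun r hr' =>
      hB r ⟨hs.1.trans hr'.1, hr'.2⟩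
  set w : ℝ → ℝ := fun s => l * Real.exp (-(l * (t - s))) with hw
  have hwc : Continuous w := by
    simp only [hw]
    fun_prop
  have hw0 : ∀ s, 0 ≤ w s := fun s => by positivity
  have hf2 : ∀ x, |f x ^ 2| ≤ A ^ 2 * (m x + 1) ^ (d * 2) := fun x => by
    rw [abs_pow, pow_mul, ← mul_pow]
    exact pow_le_pow_left₀ (abs_nonneg _) (hf x) 2
  have hpath : ∀ᵐ ω ∂P, ENNReal.ofReal ((f (Y t ω) - relax l f b Y t ω) ^ 2) ≤
      ENNReal.ofReal (Real.exp (-(l * t))) * ENNReal.ofReal (D 0 ω ^ 2) +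
        ∫⁻ s in Ioc 0 t, ENNReal.ofReal (w s) * ENNReal.ofReal (D s ω ^ 2) := by
    filter_upwards [hY.ae_intervalIntegrable hr hf ht, hY.ae_intervalIntegrable hr hf2 ht]
      with ω hω hω2
    have h0 : (0 : ℝ) ∈ Icc 0 t := ⟨le_rfl, ht⟩
    have ht' : t ∈ Icc 0 t := ⟨ht, le_rfl⟩
    have iy := hω 0 h0 t ht'
    have iy2 := hω2 0 h0 t ht'
    have rc : ∀ g : S → ℝ, ∀ t, ∀ᶠ r in 𝓝[≥] t, g (Y r ω) = g (Y t ω) := fun g t => by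
      filter_upwards [hY.right_const ω t] with r hr'
      rw [hr']
    have hid := sub_variation_of_constants (l := l) (hY.measurable_path f ω)
      (hY.measurable_path b ω) (rc f) (rc b) ht iy (fun r => hb (Y r ω))
    have hDeq : ∀ s, f (Y t ω) - f (Y s ω) - ∫ r in s..t, (-l * f (Y r ω) + b (Y r ω)) = D s ω :=
      fun s => by simp only [hD, hG]
    simp only [hDeq] at hid
    have iG : IntervalIntegrable (fun r => jumpGen c τ f (Y r ω)) volume 0 t := by
      simp only [hG]
      exact (iy.const_mul _).add
        (intervalIntegrable_of_bound (hY.measurable_path b ω) (fun r => hb (Y r ω)) _ _)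
    have hJc : ContinuousOn (fun s => ∫ r in s..t, jumpGen c τ f (Y r ω)) (uIcc 0 t) := by
      have := (intervalIntegral.continuousOn_primitive_interval' iG (right_mem_uIcc)).neg
      refine this.congr fun s _ => ?_
      simp only [Pi.neg_apply]
      rw [intervalIntegral.integral_symm]
    set J : ℝ → ℝ := fun s => f (Y t ω) - ∫ r in s..t, jumpGen c τ f (Y r ω) with hJ
    have hJc' : ContinuousOn J (uIcc 0 t) := continuousOn_const.sub hJc
    have hDJ : ∀ s, D s ω = J s - f (Y s ω) := fun s => by
      simp only [hD, hJ]
      ring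
    have iD : IntervalIntegrable (fun s => D s ω) volume 0 t := by
      simp only [hDJ]
      exact hJc'.intervalIntegrable.sub iy
    have iD2 : IntervalIntegrable (fun s => D s ω ^ 2) volume 0 t := by
      have e : (fun s => D s ω ^ 2) = fun s => J s ^ 2 - 2 * (J s * f (Y s ω)) + f (Y s ω) ^ 2 := by
        funext s
        rw [hDJ]
        ring
      rw [e]
      exact ((hJc'.pow 2).intervalIntegrable.sub ((iy.continuousOn_mul hJc').const_mul 2)).add iy2
    have hJen := sq_le_average_sq ht (Real.exp_pos (-(l * t))).le hwc hw0 iD iD2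
      integral_exp_density hid
    refine (ENNReal.ofReal_le_ofReal hJen).trans ?_
    refine ENNReal.ofReal_add_le.trans (add_le_add ?_ ?_)
    · rw [ENNReal.ofReal_mul (Real.exp_pos _).le]
    · rw [intervalIntegral.integral_of_le ht, ofReal_integral_eq_lintegral_ofReal]
      · refine le_of_eq (lintegral_congr fun s => ?_)
        rw [ENNReal.ofReal_mul (hw0 s)]
      · exact ((intervalIntegrable_iff_integrableOn_Ioc_of_le ht).1
          (iD2.continuousOn_mul hwc.continuousOn))
      · exact ae_of_all _ fun s => mul_nonneg (hw0 s) (sq_nonneg _)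
  have hDm2 : ∀ s, Measurable fun ω => ENNReal.ofReal (D s ω ^ 2) := fun s =>
    ((hDm.comp (measurable_const.prodMk measurable_id)).pow_const 2).ennreal_ofReal
  have hint : IntervalIntegrable (fun s => w s * (B * (t - s))) volume 0 t := by
    refine Continuous.intervalIntegrable ?_ _ _
    fun_prop
  calc ∫⁻ ω, ENNReal.ofReal ((f (Y t ω) - relax l f b Y t ω) ^ 2) ∂P
      ≤ ∫⁻ ω, (ENNReal.ofReal (Real.exp (-(l * t))) * ENNReal.ofReal (D 0 ω ^ 2) +
        ∫⁻ s in Ioc 0 t, ENNReal.ofReal (w s) * ENNReal.ofReal (D s ω ^ 2)) ∂P :=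
        lintegral_mono_ae hpath
    _ = ENNReal.ofReal (Real.exp (-(l * t))) * (∫⁻ ω, ENNReal.ofReal (D 0 ω ^ 2) ∂P) +
        ∫⁻ s in Ioc 0 t, ENNReal.ofReal (w s) * (∫⁻ ω, ENNReal.ofReal (D s ω ^ 2) ∂P) := by
        rw [lintegral_add_left ((hDm2 0).const_mul _), lintegral_const_mul _ (hDm2 0),
          lintegral_lintegral_swap]
        · congr 1
          exact lintegral_congr fun s => lintegral_const_mul _ (hDm2 s)
        · exact (((hwc.measurable.comp measurable_snd).ennreal_ofReal).mul
            ((hDm.comp measurable_swap).pow_const 2).ennreal_ofReal).aemeasurable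
    _ ≤ ENNReal.ofReal (Real.exp (-(l * t))) * ENNReal.ofReal (B * (t - 0)) +
        ∫⁻ s in Ioc 0 t, ENNReal.ofReal (w s * (B * (t - s))) := by
        refine add_le_add (mul_le_mul_right ?_ _) ?_
        · exact hDB 0 ⟨le_rfl, ht⟩
        · refine setLIntegral_mono' measurableSet_Ioc fun s hs => ?_
          rw [ENNReal.ofReal_mul (hw0 s)]
          gcongr
          exact hDB s ⟨hs.1.le, hs.2⟩
    _ = ENNReal.ofReal (B * ((1 - Real.exp (-(l * t))) / l)) := by
        rw [← ofReal_integral_eq_lintegral_ofReal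
            ((intervalIntegrable_iff_integrableOn_Ioc_of_le ht).1 hint), ←
          ENNReal.ofReal_mul (Real.exp_pos _).le, ← ENNReal.ofReal_add,
          ← intervalIntegral.integral_of_le ht, ← integral_exp_weight hl.ne', mul_add,
          ← intervalIntegral.integral_const_mul]
        · congr 2
          · ring
          · refine intervalIntegral.integral_congr fun s _ => ?_
            simp only [hw]
            ring
        · rw [sub_zero]
          positivity
        · refine setIntegral_nonneg measurableSet_Ioc fun s hs => ?_
          exact mul_nonneg (hw0 s) (mul_nonneg hB0 (by linarith [hs.2]))
        · filter_upwards [ae_restrict_mem measurableSet_Ioc] with s hs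
          exact mul_nonneg (hw0 s) (mul_nonneg hB0 (by linarith [hs.2]))
    _ ≤ ENNReal.ofReal (B / l) := by
        refine ENNReal.ofReal_le_ofReal ?_
        rw [← mul_div_assoc]
        refine div_le_div_of_nonneg_right ?_ hl.le
        nlinarith [Real.exp_pos (-(l * t))]

lemma IsJumpProcess.hasDerivWithinAt_relax (hY : IsJumpProcess c τ x₀ P Y) (hb : ∀ x, |b x| ≤ C)
    (t : ℝ) (ω : Ω) : HasDerivWithinAt (fun s => relax l f b Y s ω)
      (-l * relax l f b Y t ω + b (Y t ω)) (Ioi t) t := by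
  have hE : Continuous fun s : ℝ => Real.exp (l * s) := by fun_prop
  have hbm := hY.measurable_path b ω
  have d2 : HasDerivWithinAt (fun t => ∫ s in (0 : ℝ)..t, Real.exp (l * s) * b (Y s ω))
      (Real.exp (l * t) * b (Y t ω)) (Ioi t) t := by
    have hcont : ContinuousWithinAt (fun s => Real.exp (l * s) * b (Y s ω)) (Ioi t) t := by
      have hbt : Tendsto (fun s => b (Y s ω)) (𝓝[>] t) (𝓝 (b (Y t ω))) := by
        refine tendsto_const_nhds.congr' ?_
        filter_upwards [nhdsWithin_mono t Ioi_subset_Ici_self (hY.right_const ω t)] with r hr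
        rw [hr]
      exact (hE.continuousWithinAt).mul hbt
    exact (intervalIntegral.integral_hasDerivWithinAt_right
      ((intervalIntegrable_of_bound hbm (fun r => hb (Y r ω)) 0 t).continuousOn_mul
        hE.continuousOn) (s := Ici t) (t := Ioi t)
      (hE.measurable.mul hbm).stronglyMeasurable.stronglyMeasurableAtFilter hcont).mono
      Ioi_subset_Ici_self
  have d3 : HasDerivWithinAt (fun s : ℝ => Real.exp (-(l * s))) (Real.exp (-(l * t)) * -l)
      (Ioi t) t := by
    have := (((hasDerivAt_id' t).const_mul l).fun_neg).exp
    simp only [mul_one] at this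
    exact this.hasDerivWithinAt
  refine (d3.fun_mul (d2.const_add (f (Y 0 ω)))).congr_deriv ?_
  have a5 : Real.exp (-(l * t)) * Real.exp (l * t) = 1 := by
    rw [← Real.exp_add]
    simp
  unfold relax
  linear_combination (b (Y t ω)) * a5

lemma IsJumpProcess.continuous_relax (hY : IsJumpProcess c τ x₀ P Y) (hb : ∀ x, |b x| ≤ C)
    (ω : Ω) : Continuous fun s => relax l f b Y s ω := by
  have hE : Continuous fun s : ℝ => Real.exp (l * s) := by fun_prop
  have h1 : Continuous fun t => ∫ s in (0 : ℝ)..t, Real.exp (l * s) * b (Y s ω) :=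
    intervalIntegral.continuous_primitive (fun s t =>
      (intervalIntegrable_of_bound (hY.measurable_path b ω) (fun r => hb (Y r ω)) s t).continuousOn_mul
        hE.continuousOn) 0
  unfold relax
  fun_prop

end Relax

/-! ### The discrete sine transform -/

/-- `sin (π k x / (N + 1))`, the `k`-th eigenfunction of the discrete Laplacian on `{1, …, N}` with
Dirichlet conditions at `0` and `N + 1`. -/
noncomputable def sineMode (N k : ℕ) (x : ℝ) : ℝ := Real.sin (Real.pi * k / (N + 1) * x)

lemma sineMode_zero (N k : ℕ) : sineMode N k 0 = 0 := by simp [sineMode]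

lemma sineMode_zero_left (N : ℕ) (x : ℝ) : sineMode N 0 x = 0 := by simp [sineMode]

lemma sineMode_end (N k : ℕ) : sineMode N k (N + 1) = 0 := by
  have : (N + 1 : ℝ) ≠ 0 := by positivity
  rw [sineMode, div_mul_cancel₀ _ this, mul_comm]
  exact Real.sin_nat_mul_pi k

lemma abs_sineMode_le (N k : ℕ) (x : ℝ) : |sineMode N k x| ≤ 1 := Real.abs_sin_le_one _

lemma sum_cos_eq {n : ℕ} {p : ℤ} (hp0 : p ≠ 0) (hp : |(p : ℝ)| < 2 * n) :
    ∑ k ∈ Finset.range n, Real.cos (Real.pi * k / n * p) = (1 - Real.cos (Real.pi * p)) / 2 := by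
  have hn : (0 : ℝ) < n := by
    have := abs_nonneg (p : ℝ)
    linarith
  set θ := Real.pi * p / n with hθ
  have hs : Real.sin (θ / 2) ≠ 0 := by
    have hp' : (p : ℝ) ≠ 0 := by exact_mod_cast hp0
    have h1 : |θ / 2| < Real.pi := by
      have : |θ / 2| = Real.pi * (|(p : ℝ)| / (2 * n)) := by
        rw [hθ, abs_div, abs_div, abs_mul, abs_of_pos Real.pi_pos, abs_of_pos hn, abs_two]
        field_simp
      rw [this]
      have h2 : |(p : ℝ)| / (2 * n) < 1 := (div_lt_one (by positivity)).2 hp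
      nlinarith [Real.pi_pos]
    obtain ⟨h2, h3⟩ := abs_lt.1 h1
    have h4 : θ / 2 ≠ 0 := by
      have := Real.pi_ne_zero
      positivity
    intro h
    rw [Real.sin_eq_zero_iff_of_lt_of_lt h2 h3] at h
    exact h4 h
  have h1 : ∀ k ∈ Finset.range n, 2 * Real.sin (θ / 2) * Real.cos (Real.pi * k / n * p) =
      Real.sin (((k + 1 : ℕ) : ℝ) * θ - θ / 2) - Real.sin ((k : ℝ) * θ - θ / 2) := by
    intro k _
    have e : Real.pi * k / n * p = k * θ := by
      rw [hθ]
      ring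
    have e1 : ((k + 1 : ℕ) : ℝ) * θ - θ / 2 = k * θ + θ / 2 := by
      push_cast
      ring
    rw [e, e1, Real.sin_add, Real.sin_sub]
    ring
  have h2 : 2 * Real.sin (θ / 2) * ∑ k ∈ Finset.range n, Real.cos (Real.pi * k / n * p) =
      Real.sin (θ / 2) * (1 - Real.cos (Real.pi * p)) := by
    rw [Finset.mul_sum, Finset.sum_congr rfl h1,
      Finset.sum_range_sub (fun k : ℕ => Real.sin ((k : ℝ) * θ - θ / 2))]
    have e : (n : ℝ) * θ = p * Real.pi := by
      rw [hθ]
      field_simp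
    rw [e, Real.sin_sub, Real.sin_int_mul_pi, mul_comm Real.pi]
    simp
    ring
  have h3 : Real.sin (θ / 2) * (2 * ∑ k ∈ Finset.range n, Real.cos (Real.pi * k / n * p)
      - (1 - Real.cos (Real.pi * p))) = 0 := by linarith
  rcases mul_eq_zero.1 h3 with h | h
  · exact absurd h hs
  · linarith

/-- Orthogonality of the sine modes. -/
lemma sum_sineMode_mul {N x y : ℕ} (hx : x < N + 1) (hy : y < N + 1) (hx0 : x ≠ 0) :
    ∑ k ∈ Finset.range (N + 1), sineMode N k x * sineMode N k y =
      if x = y then ((N : ℝ) + 1) / 2 else 0 := by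
  have hcast : (((N + 1 : ℕ) : ℕ) : ℝ) = (N : ℝ) + 1 := by push_cast; ring
  have e : ∀ k ∈ Finset.range (N + 1), sineMode N k x * sineMode N k y =
      (Real.cos (Real.pi * k / (N + 1 : ℕ) * ((x - y : ℤ) : ℝ))
        - Real.cos (Real.pi * k / (N + 1 : ℕ) * ((x + y : ℤ) : ℝ))) / 2 := by
    intro k _
    unfold sineMode
    rw [hcast]
    push_cast
    rw [mul_sub, mul_add, Real.cos_sub, Real.cos_add]
    ring
  have hsum : ∑ k ∈ Finset.range (N + 1), Real.cos (Real.pi * k / (N + 1 : ℕ) * ((x + y : ℤ) : ℝ)) =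
      (1 - Real.cos (Real.pi * ((x + y : ℤ) : ℝ))) / 2 := by
    refine sum_cos_eq (by omega) ?_
    rw [abs_of_nonneg (by positivity)]
    have : x + y < 2 * (N + 1) := by omega
    exact_mod_cast this
  rw [Finset.sum_congr rfl e, ← Finset.sum_div, Finset.sum_sub_distrib, hsum]
  have hcos : Real.cos (Real.pi * ((x - y : ℤ) : ℝ)) = Real.cos (Real.pi * ((x + y : ℤ) : ℝ)) := by
    rw [show Real.pi * ((x + y : ℤ) : ℝ) = Real.pi * ((x - y : ℤ) : ℝ) + y * (2 * Real.pi) by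
      push_cast; ring, Real.cos_add_nat_mul_two_pi]
  split_ifs with h
  · subst h
    have h1 : Real.cos (Real.pi * ((x + x : ℤ) : ℝ)) = 1 := by
      rw [← hcos]
      simp
    rw [h1]
    simp
  · rw [sum_cos_eq (by omega), hcos]
    · ring
    · rw [abs_lt]
      constructor
      · have : -(2 * (N + 1) : ℤ) < (x - y : ℤ) := by omega
        exact_mod_cast this
      · have : (x - y : ℤ) < (2 * (N + 1) : ℤ) := by omega
        exact_mod_cast this

/-- The coefficients of the discrete sine transform. -/
noncomputable def sineCoeff (N : ℕ) (g : ℕ → ℝ) (k : ℕ) : ℝ :=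
  ∑ x ∈ Finset.range (N + 1), sineMode N k x * g x

lemma sineCoeff_zero (N : ℕ) (g : ℕ → ℝ) : sineCoeff N g 0 = 0 := by
  simp [sineCoeff, sineMode_zero_left]

lemma sineCoeff_sub (N : ℕ) (g h : ℕ → ℝ) (k : ℕ) :
    sineCoeff N (fun x => g x - h x) k = sineCoeff N g k - sineCoeff N h k := by
  simp only [sineCoeff, mul_sub, Finset.sum_sub_distrib]

lemma sineCoeff_const_mul (N : ℕ) (a : ℝ) (g : ℕ → ℝ) (k : ℕ) :
    sineCoeff N (fun x => a * g x) k = a * sineCoeff N g k := by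
  simp only [sineCoeff, Finset.mul_sum]
  exact Finset.sum_congr rfl fun x _ => by ring

lemma abs_sineCoeff_le {N : ℕ} {g : ℕ → ℝ} {C : ℝ} (hg : ∀ x < N + 1, |g x| ≤ C) (k : ℕ) :
    |sineCoeff N g k| ≤ (N + 1) * C := by
  refine (Finset.abs_sum_le_sum_abs _ _).trans ?_
  have : ∀ x ∈ Finset.range (N + 1), |sineMode N k x * g x| ≤ C := fun x hx => by
    rw [abs_mul]
    have h1 := hg x (Finset.mem_range.1 hx)
    have h2 := abs_sineMode_le N k x
    nlinarith [abs_nonneg (g x)]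
  refine (Finset.sum_le_sum this).trans (le_of_eq ?_)
  simp

/-- Parseval's identity. -/
lemma sum_sineCoeff_mul {N : ℕ} {g : ℕ → ℝ} (hg : g 0 = 0) (h : ℕ → ℝ) :
    ∑ k ∈ Finset.range (N + 1), sineCoeff N g k * sineCoeff N h k =
      ((N : ℝ) + 1) / 2 * ∑ x ∈ Finset.range (N + 1), g x * h x := by
  have e : ∀ k ∈ Finset.range (N + 1), sineCoeff N g k * sineCoeff N h k =
      ∑ x ∈ Finset.range (N + 1), ∑ y ∈ Finset.range (N + 1),
        g x * h y * (sineMode N k x * sineMode N k y) := fun k _ => by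
    rw [sineCoeff, sineCoeff, Finset.sum_mul_sum]
    exact Finset.sum_congr rfl fun x _ => Finset.sum_congr rfl fun y _ => by ring
  rw [Finset.sum_congr rfl e, Finset.sum_comm, Finset.mul_sum]
  refine Finset.sum_congr rfl fun x hx => ?_
  rw [Finset.sum_comm]
  simp only [← Finset.mul_sum]
  rcases eq_or_ne x 0 with h0 | h0
  · simp [h0, hg]
  · rw [Finset.sum_congr rfl fun y hy => by
      rw [sum_sineMode_mul (Finset.mem_range.1 hx) (Finset.mem_range.1 hy) h0]]
    simp only [mul_ite, mul_zero, Finset.sum_ite_eq, if_pos hx]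
    ring

/-- The discrete Laplacian in the sine transform. -/
lemma sineCoeff_laplacian {N : ℕ} {g : ℕ → ℝ} (h0 : g 0 = 0) (h1 : g (N + 1) = 0) (k : ℕ) :
    sineCoeff N (fun x => g (x + 1) - 2 * g x + g (x - 1)) k =
      -(2 * (1 - Real.cos (Real.pi * k / (N + 1)))) * sineCoeff N g k := by
  have a1 : ∑ x ∈ Finset.range (N + 1), sineMode N k x * g (x + 1) =
      ∑ x ∈ Finset.range (N + 1), sineMode N k ((x : ℝ) - 1) * g x := by
    have e1 := Finset.sum_range_succ (fun x : ℕ => sineMode N k ((x : ℝ) - 1) * g x) (N + 1)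
    have e2 := Finset.sum_range_succ' (fun x : ℕ => sineMode N k ((x : ℝ) - 1) * g x) (N + 1)
    simp only [h0, h1, mul_zero, add_zero, Nat.cast_add, Nat.cast_one, add_sub_cancel_right]
      at e1 e2
    rw [← e1, e2]
  have a2 : ∑ x ∈ Finset.range (N + 1), sineMode N k x * g (x - 1) =
      ∑ x ∈ Finset.range (N + 1), sineMode N k ((x : ℝ) + 1) * g x := by
    rw [Finset.sum_range_succ', Finset.sum_range_succ, sineMode_end]
    simp [sineMode_zero]
  have a3 : ∀ x : ℝ, sineMode N k (x + 1) + sineMode N k (x - 1) - 2 * sineMode N k x =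
      -(2 * (1 - Real.cos (Real.pi * k / (N + 1)))) * sineMode N k x := by
    intro x
    unfold sineMode
    rw [mul_add, mul_sub, Real.sin_add, Real.sin_sub]
    simp only [mul_one]
    ring
  simp only [sineCoeff]
  rw [Finset.mul_sum]
  calc ∑ x ∈ Finset.range (N + 1), sineMode N k x * (g (x + 1) - 2 * g x + g (x - 1))
      = ∑ x ∈ Finset.range (N + 1), sineMode N k x * g (x + 1)
        + ∑ x ∈ Finset.range (N + 1), sineMode N k x * g (x - 1)
        - ∑ x ∈ Finset.range (N + 1), 2 * (sineMode N k x * g x) := by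
        rw [← Finset.sum_add_distrib, ← Finset.sum_sub_distrib]
        exact Finset.sum_congr rfl fun x _ => by ring
    _ = ∑ x ∈ Finset.range (N + 1), (sineMode N k ((x : ℝ) + 1) + sineMode N k ((x : ℝ) - 1)
        - 2 * sineMode N k x) * g x := by
        rw [a1, a2, ← Finset.sum_add_distrib, ← Finset.sum_sub_distrib]
        exact Finset.sum_congr rfl fun x _ => by ring
    _ = _ := Finset.sum_congr rfl fun x _ => by rw [a3]; ring

/-- The rate at which the `k`-th sine mode relaxes under the diffusively accelerated dynamics. -/
noncomputable def modeRate (N k : ℕ) : ℝ := (N : ℝ) ^ 2 * (1 - Real.cos (Real.pi * k / (N + 1)))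

lemma modeRate_nonneg (N k : ℕ) : 0 ≤ modeRate N k :=
  mul_nonneg (by positivity) (by linarith [Real.cos_le_one (Real.pi * k / (N + 1))])

lemma sq_half_le_modeRate {N k : ℕ} (hN : 0 < N) (hk : k ≤ N + 1) :
    (k : ℝ) ^ 2 / 2 ≤ modeRate N k := by
  have hn : (0 : ℝ) < N + 1 := by positivity
  have hk' : (k : ℝ) ≤ N + 1 := by exact_mod_cast hk
  have h1 : |Real.pi * k / (N + 1)| ≤ Real.pi := by
    rw [abs_of_nonneg (by positivity), div_le_iff₀ hn]
    exact mul_le_mul_of_nonneg_left hk' Real.pi_pos.le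
  have h2 := Real.cos_le_one_sub_mul_cos_sq h1
  have h3 : 2 / Real.pi ^ 2 * (Real.pi * k / (N + 1)) ^ 2 = 2 * k ^ 2 / (N + 1) ^ 2 := by
    have := Real.pi_ne_zero
    field_simp
  rw [h3] at h2
  have hN1 : (1 : ℝ) ≤ N := by exact_mod_cast hN
  calc (k : ℝ) ^ 2 / 2 ≤ (N : ℝ) ^ 2 * (2 * k ^ 2 / (N + 1) ^ 2) := by
        rw [← mul_div_assoc, div_le_div_iff₀ (by norm_num) (by positivity)]
        have : ((N : ℝ) + 1) ^ 2 ≤ 4 * N ^ 2 := by nlinarith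
        nlinarith [mul_le_mul_of_nonneg_left this (sq_nonneg (k : ℝ))]
    _ ≤ modeRate N k := by
        refine mul_le_mul_of_nonneg_left ?_ (by positivity)
        linarith

lemma sum_inv_sq_le (N : ℕ) : ∑ k ∈ Finset.range N, 1 / ((k : ℝ) + 1) ^ 2 ≤ 2 := by
  have h : ∑ k ∈ Finset.range N, 1 / ((k : ℝ) + 1) ^ 2 ≤ 2 - 2 / ((N : ℝ) + 1) := by
    induction N with
    | zero => norm_num
    | succ N ih =>
      rw [Finset.sum_range_succ]
      have : 1 / ((N : ℝ) + 1) ^ 2 ≤ 2 / ((N : ℝ) + 1) - 2 / ((N : ℝ) + 1 + 1) := by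
        rw [div_sub_div _ _ (by positivity) (by positivity), div_le_div_iff₀ (by positivity)
          (by positivity)]
        nlinarith [sq_nonneg (N : ℝ), (Nat.cast_nonneg N : (0 : ℝ) ≤ N)]
      push_cast
      linarith
  have : (0 : ℝ) ≤ 2 / ((N : ℝ) + 1) := by positivity
  linarith

/-! ### The particle system as a jump process -/

section Model

variable {N : ℕ}

/-- The labels of the jumps: hops to the right, hops to the left, birth, death. -/
abbrev JumpLabel (N : ℕ) : Type := (Fin N ⊕ Fin N) ⊕ (Unit ⊕ Unit)

/-- The jump rates of the particle system, accelerated by `N ^ 2`. -/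
noncomputable def rate (j : ℝ) : JumpLabel N → Config N → ℝ
  | .inl (.inl x), ξ => (N : ℝ) ^ 2 * (1 / 2 * ξ x.castSucc)
  | .inl (.inr x), ξ => (N : ℝ) ^ 2 * (1 / 2 * ξ x.succ)
  | .inr (.inl _), _ => (N : ℝ) ^ 2 * (j * eps N)
  | .inr (.inr _), ξ => open Classical in if ξ = 0 then 0 else (N : ℝ) ^ 2 * (j * eps N)

/-- The effect of the jumps of the particle system. -/
def jump : JumpLabel N → Config N → Config N
  | .inl (.inl x), ξ => hop ξ x.castSucc x.succ
  | .inl (.inr x), ξ => hop ξ x.succ x.castSucc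
  | .inr (.inl _), ξ => inject ξ
  | .inr (.inr _), ξ => remove ξ

lemma jumpGen_rate (j : ℝ) (f : Config N → ℝ) (ξ : Config N) :
    jumpGen (rate j) jump f ξ = (N : ℝ) ^ 2 * gen j f ξ := by
  simp only [jumpGen, Fintype.sum_sum_type, gen, genBulk, genBirth, genDeath, rate, jump,
    Finset.sum_add_distrib, Finset.univ_unique, Finset.sum_singleton, mul_add, Finset.mul_sum]
  rw [← add_assoc]
  congr 1
  · congr 1
    · congr 1 <;> exact Finset.sum_congr rfl fun x _ => by ring
    · ring
  · split_ifs <;> ring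

/-- The number of particles. -/
def numParticles (ξ : Config N) : ℕ := ∑ y, ξ y

/-- The linear observable with weights `a`. -/
noncomputable def pair (a : Fin (N + 1) → ℝ) (ξ : Config N) : ℝ := ∑ y, a y * ξ y

lemma pair_one (ξ : Config N) : pair (fun _ => 1) ξ = numParticles ξ := by
  simp [pair, numParticles]

lemma hop_cast {ξ : Config N} {x y : Fin (N + 1)} (hxy : x ≠ y) (h : 0 < ξ x) (z : Fin (N + 1)) :
    ((hop ξ x y z : ℕ) : ℝ) = ξ z - (if z = x then 1 else 0) + (if z = y then 1 else 0) := by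
  unfold hop
  split_ifs with h1 h2 h2
  · exact absurd (h1.symm.trans h2) hxy
  · rw [h1, Nat.cast_sub h]
    simp
  · push_cast
    ring
  · ring

lemma inject_cast (ξ : Config N) (z : Fin (N + 1)) :
    ((inject ξ z : ℕ) : ℝ) = ξ z + (if z = 0 then 1 else 0) := by
  unfold inject
  split_ifs <;> simp

lemma exists_pos_of_ne_zero {ξ : Config N} (h : ξ ≠ 0) : ∃ x, 0 < ξ x := by
  by_contra h'
  simp only [not_exists, not_lt, Nat.le_zero] at h'
  exact h (funext h')

lemma rightmost_lt (ξ : Config N) : rightmost ξ < N + 1 := by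
  rw [rightmost, Finset.sup_lt_iff (by simp)]
  exact fun x _ => x.2

/-- `rightmost` as a site of the lattice. -/
def topSite (ξ : Config N) : Fin (N + 1) := ⟨rightmost ξ, rightmost_lt ξ⟩

lemma le_rightmost {ξ : Config N} {x : Fin (N + 1)} (h : 0 < ξ x) : (x : ℕ) ≤ rightmost ξ :=
  Finset.le_sup (f := fun x : Fin (N + 1) => (x : ℕ)) (Finset.mem_filter.2 ⟨Finset.mem_univ _, h⟩)

lemma pos_topSite {ξ : Config N} (h : ξ ≠ 0) : 0 < ξ (topSite ξ) := by
  obtain ⟨x, hx⟩ := exists_pos_of_ne_zero h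
  obtain ⟨y, hy, hy'⟩ := Finset.exists_mem_eq_sup
    (Finset.univ.filter fun x : Fin (N + 1) => 0 < ξ x) ⟨x, by simp [hx]⟩
    (fun x : Fin (N + 1) => (x : ℕ))
  have : topSite ξ = y := Fin.ext hy'
  rw [this]
  exact (Finset.mem_filter.1 hy).2

lemma remove_cast {ξ : Config N} (h : ξ ≠ 0) (z : Fin (N + 1)) :
    ((remove ξ z : ℕ) : ℝ) = ξ z - (if z = topSite ξ then 1 else 0) := by
  have e : ((z : ℕ) = rightmost ξ) ↔ z = topSite ξ := by rw [Fin.ext_iff, topSite]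
  unfold remove
  simp only [e]
  split_ifs with h1
  · rw [h1, Nat.cast_sub (pos_topSite h)]
    simp
  · ring

lemma pair_hop (a : Fin (N + 1) → ℝ) {ξ : Config N} {x y : Fin (N + 1)} (hxy : x ≠ y)
    (h : 0 < ξ x) : pair a (hop ξ x y) = pair a ξ - a x + a y := by
  simp [pair, hop_cast hxy h, mul_sub, mul_add, Finset.sum_add_distrib, Finset.sum_sub_distrib]

lemma pair_inject (a : Fin (N + 1) → ℝ) (ξ : Config N) : pair a (inject ξ) = pair a ξ + a 0 := by
  simp [pair, inject_cast, mul_add, Finset.sum_add_distrib]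

lemma pair_remove (a : Fin (N + 1) → ℝ) {ξ : Config N} (h : ξ ≠ 0) :
    pair a (remove ξ) = pair a ξ - a (topSite ξ) := by
  simp [pair, remove_cast h, mul_sub, Finset.sum_sub_distrib]

lemma numParticles_hop {ξ : Config N} {x y : Fin (N + 1)} (hxy : x ≠ y) (h : 0 < ξ x) :
    numParticles (hop ξ x y) = numParticles ξ := by
  have := pair_hop (fun _ => 1) hxy h
  rw [pair_one, pair_one] at this
  have h2 : (numParticles (hop ξ x y) : ℝ) = numParticles ξ := by linarith
  exact_mod_cast h2

lemma numParticles_inject (ξ : Config N) : numParticles (inject ξ) = numParticles ξ + 1 := by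
  have := pair_inject (fun _ => 1) ξ
  rw [pair_one, pair_one] at this
  exact_mod_cast this

lemma numParticles_remove {ξ : Config N} (h : ξ ≠ 0) :
    numParticles (remove ξ) + 1 = numParticles ξ := by
  have := pair_remove (fun _ => 1) h
  rw [pair_one, pair_one] at this
  have h2 : (numParticles (remove ξ) : ℝ) + 1 = numParticles ξ := by linarith
  exact_mod_cast h2

lemma remove_zero : remove (0 : Config N) = 0 := by
  funext z
  simp [remove]

lemma hop_of_eq_zero {ξ : Config N} {x y : Fin (N + 1)} (hxy : x ≠ y) (h : ξ x = 0) :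
    numParticles (hop ξ x y) = numParticles ξ + 1 := by
  have e : ∀ z, hop ξ x y z = ξ z + if z = y then 1 else 0 := fun z => by
    unfold hop
    split_ifs with h1 h2 h2
    · exact absurd (h1.symm.trans h2) hxy
    · rw [h1, h]
    · rfl
    · rfl
  simp [numParticles, e, Finset.sum_add_distrib]

lemma castSucc_ne_succ (x : Fin N) : x.castSucc ≠ x.succ := (Fin.castSucc_lt_succ).ne

lemma sq_mul_eps (hN : 0 < N) (j : ℝ) : (N : ℝ) ^ 2 * (j * eps N) = j * N := by
  have : (N : ℝ) ≠ 0 := by positivity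
  unfold eps
  field_simp

lemma le_numParticles (ξ : Config N) (x : Fin (N + 1)) : ξ x ≤ numParticles ξ :=
  Finset.single_le_sum (f := ξ) (fun _ _ => Nat.zero_le _) (Finset.mem_univ x)

lemma jumpRates_rate {j : ℝ} (hj : 0 < j) :
    JumpRates (rate (N := N) j) jump numParticles ((N : ℝ) ^ 2 * (1 / 2 + j * eps N)) := by
  have he : 0 ≤ eps N := by
    unfold eps
    positivity
  have hstep : ∀ (i : JumpLabel N) ξ, (numParticles (jump i ξ) ≤ numParticles ξ ∨
      (numParticles (jump i ξ) = numParticles ξ + 1 ∧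
        rate j i ξ ≤ (N : ℝ) ^ 2 * (1 / 2 + j * eps N))) ∧
      numParticles ξ ≤ numParticles (jump i ξ) + 1 := by
    have hh : ∀ (ξ : Config N) (x y : Fin (N + 1)), x ≠ y →
        (numParticles (hop ξ x y) ≤ numParticles ξ ∨ (numParticles (hop ξ x y) = numParticles ξ + 1
          ∧ ξ x = 0)) ∧ numParticles ξ ≤ numParticles (hop ξ x y) + 1 := fun ξ x y hxy => by
      rcases Nat.eq_zero_or_pos (ξ x) with h | h
      · have := hop_of_eq_zero hxy h
        exact ⟨Or.inr ⟨this, h⟩, by omega⟩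
      · have := numParticles_hop hxy h
        exact ⟨Or.inl this.le, by omega⟩
    have hz : (0 : ℝ) ≤ (N : ℝ) ^ 2 * (1 / 2 + j * eps N) := by positivity
    intro i ξ
    match i with
    | .inl (.inl x) =>
      obtain ⟨h1, h2⟩ := hh ξ x.castSucc x.succ (castSucc_ne_succ x)
      exact ⟨h1.imp_right fun h => ⟨h.1, by simpa [rate, h.2] using hz⟩, h2⟩
    | .inl (.inr x) =>
      obtain ⟨h1, h2⟩ := hh ξ x.succ x.castSucc (castSucc_ne_succ x).symm
      exact ⟨h1.imp_right fun h => ⟨h.1, by simpa [rate, h.2] using hz⟩, h2⟩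
    | .inr (.inl _) =>
      have := numParticles_inject ξ
      refine ⟨Or.inr ⟨this, ?_⟩, ?_⟩
      · simp only [rate]
        gcongr
        linarith
      · change numParticles ξ ≤ numParticles (inject ξ) + 1
        omega
    | .inr (.inr _) =>
      change (numParticles (remove ξ) ≤ numParticles ξ ∨ _) ∧
        numParticles ξ ≤ numParticles (remove ξ) + 1
      rcases eq_or_ne ξ 0 with h | h
      · subst h
        rw [remove_zero]
        exact ⟨Or.inl le_rfl, by omega⟩
      · have := numParticles_remove h
        exact ⟨Or.inl (by omega), by omega⟩
  refine ⟨fun i ξ => ?_, fun i ξ => ?_, fun i ξ => ?_, fun i ξ => (hstep i ξ).2, fun i ξ => ?_,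
    fun n => ?_⟩
  · match i with
    | .inl (.inl x) => simp only [rate]; positivity
    | .inl (.inr x) => simp only [rate]; positivity
    | .inr (.inl _) => simp only [rate]; positivity
    | .inr (.inr _) => simp only [rate]; split_ifs <;> positivity
  · have h0 : (0 : ℝ) ≤ numParticles ξ := Nat.cast_nonneg _
    have hx : ∀ x, (N : ℝ) ^ 2 * (1 / 2 * ξ x) ≤
        (N : ℝ) ^ 2 * (1 / 2 + j * eps N) * (numParticles ξ + 1) := fun x => by
      have h1 : (ξ x : ℝ) ≤ numParticles ξ + 1 := by
        exact_mod_cast (le_numParticles ξ x).trans (Nat.le_succ _)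
      rw [mul_assoc]
      gcongr
      have : 0 ≤ j * eps N := by positivity
      linarith
    have hb : (N : ℝ) ^ 2 * (j * eps N) ≤
        (N : ℝ) ^ 2 * (1 / 2 + j * eps N) * (numParticles ξ + 1) := by
      rw [mul_assoc]
      refine mul_le_mul_of_nonneg_left ?_ (by positivity)
      have : 0 ≤ j * eps N := by positivity
      nlinarith
    match i with
    | .inl (.inl x) => exact hx _
    | .inl (.inr x) => exact hx _
    | .inr (.inl _) => exact hb
    | .inr (.inr _) =>
      simp only [rate]
      split_ifs
      · positivity
      · exact hb
  · rcases (hstep i ξ).1 with h | h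
    · omega
    · omega
  · exact (hstep i ξ).1.imp_right fun h => h.2
  · refine (Set.finite_Iic (fun _ : Fin (N + 1) => n)).subset fun ξ hξ x => ?_
    exact (le_numParticles ξ x).trans hξ

/-- The generator on linear observables. -/
lemma jumpGen_pair (hN : 0 < N) (j : ℝ) (a : Fin (N + 1) → ℝ) (ξ : Config N) :
    jumpGen (rate j) jump (pair a) ξ =
      (N : ℝ) ^ 2 / 2 * ∑ x : Fin N, ((ξ x.castSucc : ℝ) - ξ x.succ) * (a x.succ - a x.castSucc)
      + j * N * a 0 - (open Classical in if ξ = 0 then 0 else j * N * a (topSite ξ)) := by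
  have hh : ∀ x y : Fin (N + 1), x ≠ y →
      (ξ x : ℝ) * (pair a (hop ξ x y) - pair a ξ) = ξ x * (a y - a x) := fun x y hxy => by
    rcases Nat.eq_zero_or_pos (ξ x) with h | h
    · simp [h]
    · rw [pair_hop a hxy h]
      ring
  rw [jumpGen_rate]
  simp only [gen, genBulk, genBirth, genDeath, hh _ _ (castSucc_ne_succ _),
    hh _ _ (castSucc_ne_succ _).symm, pair_inject]
  rw [mul_add, mul_add, sub_eq_add_neg]
  congr 1
  · congr 1
    · rw [← mul_assoc]
      congr 1
      · ring
      · exact Finset.sum_congr rfl fun x _ => by ring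
    · rw [← mul_assoc, sq_mul_eps hN]
      ring
  · split_ifs with h
    · simp
    · rw [pair_remove a h, ← mul_assoc, sq_mul_eps hN]
      ring

/-- The carré du champ of linear observables. -/
lemma carreDuChamp_pair_le (hN : 0 < N) {j : ℝ} (hj : 0 < j) (a : Fin (N + 1) → ℝ) {α β : ℝ}
    (hα : ∀ x : Fin N, (a x.succ - a x.castSucc) ^ 2 ≤ α) (hβ : ∀ x, a x ^ 2 ≤ β) (ξ : Config N) :
    carreDuChamp (rate j) jump (pair a) ξ ≤
      (N : ℝ) ^ 2 * α * numParticles ξ + 2 * (j * N * β) := by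
  have hh : ∀ x y : Fin (N + 1), x ≠ y →
      (ξ x : ℝ) * (pair a (hop ξ x y) - pair a ξ) ^ 2 = ξ x * (a y - a x) ^ 2 := fun x y hxy => by
    rcases Nat.eq_zero_or_pos (ξ x) with h | h
    · simp [h]
    · rw [pair_hop a hxy h]
      ring
  have h1 : ∑ x : Fin N, (N : ℝ) ^ 2 * (1 / 2 * ξ x.castSucc) *
      (pair a (hop ξ x.castSucc x.succ) - pair a ξ) ^ 2 ≤
      (N : ℝ) ^ 2 * α / 2 * numParticles ξ := by
    calc ∑ x : Fin N, (N : ℝ) ^ 2 * (1 / 2 * ξ x.castSucc) *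
      (pair a (hop ξ x.castSucc x.succ) - pair a ξ) ^ 2
        ≤ ∑ x : Fin N, (N : ℝ) ^ 2 * α / 2 * ξ x.castSucc := Finset.sum_le_sum fun x _ => by
          have e := hh x.castSucc x.succ (castSucc_ne_succ x)
          have := mul_le_mul_of_nonneg_left (hα x)
            (by positivity : (0 : ℝ) ≤ (N : ℝ) ^ 2 * (1 / 2 * ξ x.castSucc))
          calc _ = (N : ℝ) ^ 2 * (1 / 2) * (ξ x.castSucc *
              (pair a (hop ξ x.castSucc x.succ) - pair a ξ) ^ 2) := by ring
            _ ≤ _ := by rw [e]; linarith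
      _ ≤ (N : ℝ) ^ 2 * α / 2 * numParticles ξ := by
          have hα0 : 0 ≤ α := (sq_nonneg _).trans (hα ⟨0, hN⟩)
          rw [← Finset.mul_sum]
          refine mul_le_mul_of_nonneg_left ?_ (by positivity)
          rw [numParticles, Fin.sum_univ_castSucc]
          push_cast
          linarith [(Nat.cast_nonneg (ξ (Fin.last N)) : (0 : ℝ) ≤ _)]
  have h2 : ∑ x : Fin N, (N : ℝ) ^ 2 * (1 / 2 * ξ x.succ) *
      (pair a (hop ξ x.succ x.castSucc) - pair a ξ) ^ 2 ≤
      (N : ℝ) ^ 2 * α / 2 * numParticles ξ := by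
    calc ∑ x : Fin N, (N : ℝ) ^ 2 * (1 / 2 * ξ x.succ) *
      (pair a (hop ξ x.succ x.castSucc) - pair a ξ) ^ 2
        ≤ ∑ x : Fin N, (N : ℝ) ^ 2 * α / 2 * ξ x.succ := Finset.sum_le_sum fun x _ => by
          have e := hh x.succ x.castSucc (castSucc_ne_succ x).symm
          have := mul_le_mul_of_nonneg_left (hα x)
            (by positivity : (0 : ℝ) ≤ (N : ℝ) ^ 2 * (1 / 2 * ξ x.succ))
          calc _ = (N : ℝ) ^ 2 * (1 / 2) * (ξ x.succ *
              (pair a (hop ξ x.succ x.castSucc) - pair a ξ) ^ 2) := by ring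
            _ ≤ _ := by rw [e, ← neg_sub, neg_sq]; linarith
      _ ≤ (N : ℝ) ^ 2 * α / 2 * numParticles ξ := by
          have hα0 : 0 ≤ α := (sq_nonneg _).trans (hα ⟨0, hN⟩)
          rw [← Finset.mul_sum]
          refine mul_le_mul_of_nonneg_left ?_ (by positivity)
          rw [numParticles, Fin.sum_univ_succ]
          push_cast
          linarith [(Nat.cast_nonneg (ξ 0) : (0 : ℝ) ≤ _)]
  have h3 : (N : ℝ) ^ 2 * (j * eps N) * (pair a (inject ξ) - pair a ξ) ^ 2 ≤ j * N * β := by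
    rw [pair_inject, sq_mul_eps hN, add_sub_cancel_left]
    exact mul_le_mul_of_nonneg_left (hβ 0) (by positivity)
  have h4 : rate j (.inr (.inr ())) ξ * (pair a (remove ξ) - pair a ξ) ^ 2 ≤ j * N * β := by
    have hβ0 : 0 ≤ β := (sq_nonneg _).trans (hβ 0)
    simp only [rate]
    split_ifs with h
    · rw [zero_mul]
      positivity
    · rw [pair_remove a h, sq_mul_eps hN]
      have : (pair a ξ - a (topSite ξ) - pair a ξ) ^ 2 = a (topSite ξ) ^ 2 := by ring
      rw [this]
      exact mul_le_mul_of_nonneg_left (hβ _) (by positivity)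
  have e : carreDuChamp (rate j) jump (pair a) ξ =
      (∑ x : Fin N, (N : ℝ) ^ 2 * (1 / 2 * ξ x.castSucc) *
        (pair a (hop ξ x.castSucc x.succ) - pair a ξ) ^ 2)
      + (∑ x : Fin N, (N : ℝ) ^ 2 * (1 / 2 * ξ x.succ) *
        (pair a (hop ξ x.succ x.castSucc) - pair a ξ) ^ 2)
      + ((N : ℝ) ^ 2 * (j * eps N) * (pair a (inject ξ) - pair a ξ) ^ 2
      + rate j (.inr (.inr ())) ξ * (pair a (remove ξ) - pair a ξ) ^ 2) := by
    simp only [carreDuChamp, Fintype.sum_sum_type, Finset.univ_unique, Finset.sum_singleton]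
    rfl
  rw [e]
  linarith

/-- The generator on the squared deviation of the mass. -/
lemma jumpGen_mass_sq_le (hN : 0 < N) {j : ℝ} (hj : 0 < j) {M : ℝ} (hM : 0 ≤ M) (ξ : Config N) :
    jumpGen (rate j) jump (fun η => (eps N * numParticles η - M) ^ 2) ξ ≤ 2 * j * eps N := by
  have hh : ∀ x y : Fin (N + 1), x ≠ y →
      (ξ x : ℝ) * ((eps N * numParticles (hop ξ x y) - M) ^ 2 - (eps N * numParticles ξ - M) ^ 2)
        = 0 := fun x y hxy => by
    rcases Nat.eq_zero_or_pos (ξ x) with h | h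
    · simp [h]
    · rw [numParticles_hop hxy h]
      ring
  have hN' : (N : ℝ) ≠ 0 := by positivity
  have he : eps N * N = 1 := by
    unfold eps
    field_simp
  have he0 : 0 < eps N := by
    unfold eps
    positivity
  rw [jumpGen_rate]
  simp only [gen, genBulk, genBirth, genDeath, hh _ _ (castSucc_ne_succ _),
    hh _ _ (castSucc_ne_succ _).symm, numParticles_inject]
  simp only [add_zero, Finset.sum_const_zero, mul_zero, zero_add]
  push_cast
  rw [mul_add, ← mul_assoc, sq_mul_eps hN]
  split_ifs with h
  · subst h
    have : (numParticles (0 : Config N) : ℝ) = 0 := by simp [numParticles]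
    rw [this]
    have e : j * N * ((eps N * (0 + 1) - M) ^ 2 - (eps N * 0 - M) ^ 2) =
        j * (eps N * N) * (eps N - 2 * M) := by ring
    rw [e, he]
    nlinarith
  · have h1 : (numParticles (remove ξ) : ℝ) = numParticles ξ - 1 := by
      rw [← numParticles_remove h]
      push_cast
      ring
    rw [h1, ← mul_assoc, sq_mul_eps hN]
    have e : j * N * ((eps N * (numParticles ξ + 1) - M) ^ 2 - (eps N * numParticles ξ - M) ^ 2) +
        j * N * ((eps N * (numParticles ξ - 1) - M) ^ 2 - (eps N * numParticles ξ - M) ^ 2) =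
        2 * j * eps N * (eps N * N) := by ring
    rw [e, he, mul_one]

end Model

lemma measurable_path_of_right_const {S : Type*} [MeasurableSpace S] [DiscreteMeasurableSpace S]
    {y : ℝ≥0 → S} (hy : ∀ t, ∀ᶠ s in 𝓝[≥] t, y s = y t) (g : S → ℝ) :
    Measurable fun r : ℝ => g (y r.toNNReal) := by
  have hc : ∀ (_ : Unit) (r : ℝ), ∀ᶠ s in 𝓝[≥] r, y s.toNNReal = y r.toNNReal := by
    intro _ r
    have h1 : Tendsto Real.toNNReal (𝓝[≥] r) (𝓝[≥] r.toNNReal) :=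
      tendsto_nhdsWithin_iff.2 ⟨continuous_real_toNNReal.continuousWithinAt, by
        filter_upwards [self_mem_nhdsWithin] with s hs using Real.toNNReal_mono hs⟩
    exact h1.eventually (hy _)
  have h := measurable_comp_of_right_const (Ω := Unit) (Y := fun r _ => y r.toNNReal)
    (fun r => measurable_const) hc g
  have h2 : Measurable fun r : ℝ => (r, ()) := measurable_id.prodMk measurable_const
  exact h.comp h2

/-- The particle process in macroscopic time. -/
noncomputable def speedUp {N : ℕ} {Ω : Type*} (X : ℝ≥0 → Ω → Config N) (t : ℝ) (ω : Ω) : Config N :=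
  X ((N : ℝ≥0) ^ 2 * t.toNNReal) ω

/-- In macroscopic time the particle process is a jump process with the rates `rate`. -/
lemma IsParticleProcess.isJumpProcess_speedUp {N : ℕ} (hN : 0 < N) {j : ℝ} (hj : 0 < j) {ξ₀ : Config N}
    {Ω : Type*} [mΩ : MeasurableSpace Ω] {P : Measure Ω} [IsProbabilityMeasure P]
    {X : ℝ≥0 → Ω → Config N} (hX : IsParticleProcess j ξ₀ P X) :
    IsJumpProcess (rate j) jump ξ₀ P (speedUp X) := by
  have hφ : Continuous fun s : ℝ => (N : ℝ≥0) ^ 2 * s.toNNReal := by fun_prop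
  have hmono : Monotone fun s : ℝ => (N : ℝ≥0) ^ 2 * s.toNNReal := fun a b hab =>
    mul_le_mul_right (Real.toNNReal_mono hab) _
  have hXc : ∀ ω t, ∀ᶠ s in 𝓝[≥] t, X s ω = X t ω := fun ω t =>
    (hX.right_continuous ω t).tendsto.eventually ((isOpen_discrete {X t ω}).mem_nhds rfl)
  have hrc : ∀ ω t, ∀ᶠ s in 𝓝[≥] t, speedUp X s ω = speedUp X t ω := by
    intro ω t
    have h1 : Tendsto (fun s : ℝ => (N : ℝ≥0) ^ 2 * s.toNNReal) (𝓝[≥] t)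
        (𝓝[≥] ((N : ℝ≥0) ^ 2 * t.toNNReal)) :=
      tendsto_nhdsWithin_iff.2 ⟨hφ.continuousWithinAt, by
        filter_upwards [self_mem_nhdsWithin] with s hs using hmono hs⟩
    exact h1.eventually (hXc ω _)
  have hmeas : ∀ t, Measurable (speedUp X t) := fun t => hX.measurable _
  refine ⟨hmeas, ?_, hrc, ?_⟩
  · filter_upwards [hX.initial] with ω hω
    simpa [speedUp] using hω
  · intro f hf h C hC s t hs hst
    obtain ⟨ℱ, hadap, hmart⟩ := hX.martingale
    have hM := hmart f hf
    obtain ⟨C', hC'⟩ := exists_bound_of_finite_support ((jumpRates_rate hj).finite_support_jumpGen hf)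
    have hN2 : (0 : ℝ) < (N : ℝ) ^ 2 := by positivity
    have hgen : ∀ ξ, gen j f ξ = (N : ℝ) ^ (-2 : ℤ) * jumpGen (rate j) jump f ξ := fun ξ => by
      rw [jumpGen_rate, zpow_neg, ← mul_assoc]
      simp [hN.ne']
    have hgenb : ∀ ξ, |gen j f ξ| ≤ (N : ℝ) ^ (-2 : ℤ) * C' := fun ξ => by
      rw [hgen, abs_mul, abs_of_pos (by positivity)]
      exact mul_le_mul_of_nonneg_left (hC' ξ) (by positivity)
    set a : ℝ≥0 := (N : ℝ≥0) ^ 2 * s.toNNReal with ha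
    set b : ℝ≥0 := (N : ℝ≥0) ^ 2 * t.toNNReal with hb
    have hab : a ≤ b := hmono hst
    have ha' : (a : ℝ) = (N : ℝ) ^ 2 * s := by
      rw [ha]
      push_cast
      rw [Real.coe_toNNReal _ hs]
    have hb' : (b : ℝ) = (N : ℝ) ^ 2 * t := by
      rw [hb]
      push_cast
      rw [Real.coe_toNNReal _ (hs.trans hst)]
    have hpath : ∀ ω, Measurable fun r : ℝ => gen j f (X r.toNNReal ω) := fun ω =>
      measurable_path_of_right_const (hXc ω) (gen j f)
    have hint : ∀ ω (u v : ℝ),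
        IntervalIntegrable (fun r : ℝ => gen j f (X r.toNNReal ω)) volume u v := fun ω u v =>
      intervalIntegrable_of_bound (hpath ω) (fun r => hgenb _) u v
    have hincr : ∀ ω, f (speedUp X t ω) - f (speedUp X s ω)
        - ∫ r in s..t, jumpGen (rate j) jump f (speedUp X r ω) =
        (f (X b ω) - f (X 0 ω) - ∫ r in (0 : ℝ)..(b : ℝ), gen j f (X r.toNNReal ω)) -
        (f (X a ω) - f (X 0 ω) - ∫ r in (0 : ℝ)..(a : ℝ), gen j f (X r.toNNReal ω)) := by
      intro ω
      have e1 := intervalIntegral.integral_add_adjacent_intervals (hint ω 0 a) (hint ω a b)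
      have e2 : ∫ r in s..t, jumpGen (rate j) jump f (speedUp X r ω) =
          ∫ r in (a : ℝ)..b, gen j f (X r.toNNReal ω) := by
        rw [ha', hb', ← intervalIntegral.mul_integral_comp_mul_left,
          ← intervalIntegral.integral_const_mul]
        refine intervalIntegral.integral_congr fun r _ => ?_
        rw [jumpGen_rate, speedUp, Real.toNNReal_mul hN2.le]
        congr 4
        rw [← NNReal.coe_inj]
        simp
      rw [e2]
      change f (X b ω) - f (X a ω) - _ = _
      linarith
    simp only [hincr]
    set Mt : Ω → ℝ := fun ω =>
      f (X b ω) - f (X 0 ω) - ∫ r in (0 : ℝ)..(b : ℝ), gen j f (X r.toNNReal ω) with hMt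
    set Ms : Ω → ℝ := fun ω =>
      f (X a ω) - f (X 0 ω) - ∫ r in (0 : ℝ)..(a : ℝ), gen j f (X r.toNNReal ω) with hMs
    have iMt : Integrable Mt P := hM.integrable b
    have iMs : Integrable Ms P := hM.integrable a
    have hcond : P[Mt | ℱ a] =ᵐ[P] Ms := hM.condExp_ae_eq hab
    set H : Ω → ℝ := fun ω => h (X a ω) with hH
    have hHm : StronglyMeasurable[ℱ a] H :=
      ((Measurable.of_discrete (f := h)).comp (hadap a)).stronglyMeasurable
    have hHm' : AEStronglyMeasurable H P := (hHm.mono (ℱ.le a)).aestronglyMeasurable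
    have iHt : Integrable (fun ω => H ω * Mt ω) P :=
      iMt.bdd_mul hHm' (ae_of_all _ fun ω => hC _)
    have iHs : Integrable (fun ω => H ω * Ms ω) P :=
      iMs.bdd_mul hHm' (ae_of_all _ fun ω => hC _)
    have h1 : P[fun ω => H ω * Mt ω | ℱ a] =ᵐ[P] fun ω => H ω * Ms ω := by
      refine (condExp_mul_of_stronglyMeasurable_left hHm iHt iMt).trans ?_
      filter_upwards [hcond] with ω hω
      simp only [Pi.mul_apply, hω]
    have h2 : ∫ ω, H ω * Mt ω ∂P = ∫ ω, H ω * Ms ω ∂P := by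
      rw [← integral_condExp (ℱ.le a), integral_congr_ae h1]
    change ∫ ω, H ω * (Mt ω - Ms ω) ∂P = 0
    simp only [mul_sub]
    rw [integral_sub iHt iHs, h2, sub_self]

/-! ### The modes of the tail process -/

section Modes

variable {N : ℕ}

/-- The number of particles at or to the right of `x`. -/
noncomputable def tailSum (ξ : Config N) (x : ℕ) : ℝ :=
  ∑ y : Fin (N + 1), if x ≤ (y : ℕ) then (ξ y : ℝ) else 0

/-- The rescaled tail count, minus its linear interpolation between `0` and `N + 1`. -/
noncomputable def centredTail (ξ : Config N) (x : ℕ) : ℝ :=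
  eps N * (tailSum ξ x - (1 - (x : ℝ) / (N + 1)) * tailSum ξ 0)

/-- The mean effect of birth and death on `centredTail`, divided by `-j`. The linear parts of birth
and death cancel each other; in the empty configuration there are only births, which leave their
linear part. -/
noncomputable def absorb (ξ : Config N) (x : ℕ) : ℝ :=
  open Classical in if ξ = 0 then 1 - (x : ℝ) / (N + 1) else if x ≤ rightmost ξ then 1 else 0

/-- The weights of the `k`-th sine coefficient of `centredTail`, as a linear observable. -/
noncomputable def modeWeight (N k : ℕ) (y : Fin (N + 1)) : ℝ :=
  eps N * ∑ x ∈ Finset.range (N + 1), sineMode N k x *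
    ((if x ≤ (y : ℕ) then 1 else 0) - (1 - (x : ℝ) / (N + 1)))

lemma lin_mem {x : ℕ} (hx : x < N + 1) : (1 - (x : ℝ) / (N + 1)) ∈ Icc (0 : ℝ) 1 := by
  have h : (x : ℝ) ≤ N + 1 := by exact_mod_cast hx.le
  have h1 : (x : ℝ) / (N + 1) ≤ 1 := (div_le_one (by positivity)).2 h
  have h2 : (0 : ℝ) ≤ (x : ℝ) / (N + 1) := by positivity
  exact ⟨by linarith, by linarith⟩

lemma tailSum_zero (ξ : Config N) : tailSum ξ 0 = numParticles ξ := by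
  simp [tailSum, numParticles]

lemma tailSum_end (ξ : Config N) : tailSum ξ (N + 1) = 0 := by
  refine Finset.sum_eq_zero fun y _ => ?_
  rw [if_neg (by omega)]

lemma tailSum_eq_add (ξ : Config N) (z : Fin (N + 1)) :
    tailSum ξ z = ξ z + tailSum ξ (z + 1) := by
  have e : ∀ y : Fin (N + 1), (if (z : ℕ) ≤ (y : ℕ) then (ξ y : ℝ) else 0) =
      (if y = z then (ξ y : ℝ) else 0) + if (z : ℕ) + 1 ≤ (y : ℕ) then (ξ y : ℝ) else 0 := fun y => by
    rcases lt_trichotomy (z : ℕ) (y : ℕ) with h | h | h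
    · rw [if_pos h.le, if_neg (fun h' => by simp [h'] at h), if_pos (by omega), zero_add]
    · rw [if_pos h.le, if_pos (Fin.ext h.symm), if_neg (by omega), add_zero]
    · rw [if_neg (by omega), if_neg (fun h' => by simp [h'] at h), if_neg (by omega), add_zero]
  simp only [tailSum, e, Finset.sum_add_distrib]
  simp

lemma tailSum_nonneg (ξ : Config N) (x : ℕ) : 0 ≤ tailSum ξ x :=
  Finset.sum_nonneg fun y _ => by split_ifs <;> positivity

lemma tailSum_antitone (ξ : Config N) : Antitone (tailSum ξ) := fun a b hab =>
  Finset.sum_le_sum fun y _ => by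
    split_ifs with h1 h2 h2
    · exact le_rfl
    · exact absurd (hab.trans h1) h2
    · positivity
    · exact le_rfl

lemma tailSum_le (ξ : Config N) (x : ℕ) : tailSum ξ x ≤ numParticles ξ := by
  rw [← tailSum_zero]
  exact tailSum_antitone ξ (Nat.zero_le x)

lemma tailSum_eq_zero {ξ : Config N} {x : ℕ} (h : rightmost ξ < x) : tailSum ξ x = 0 := by
  refine Finset.sum_eq_zero fun y _ => ?_
  split_ifs with h1
  · rcases Nat.eq_zero_or_pos (ξ y) with h2 | h2
    · simp [h2]
    · have := le_rightmost h2
      omega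
  · rfl

lemma centredTail_zero (ξ : Config N) : centredTail ξ 0 = 0 := by simp [centredTail]

lemma centredTail_end (ξ : Config N) : centredTail ξ (N + 1) = 0 := by
  have : (N + 1 : ℝ) ≠ 0 := by positivity
  simp [centredTail, tailSum_end, this]

lemma pair_modeWeight (ξ : Config N) (k : ℕ) :
    pair (modeWeight N k) ξ = sineCoeff N (centredTail ξ) k := by
  simp only [pair, modeWeight, sineCoeff, Finset.mul_sum, Finset.sum_mul]
  rw [Finset.sum_comm]
  refine Finset.sum_congr rfl fun x _ => ?_
  have e : ∀ y : Fin (N + 1), eps N * (sineMode N k x *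
      ((if x ≤ (y : ℕ) then 1 else 0) - (1 - (x : ℝ) / (N + 1)))) * (ξ y : ℝ) =
      sineMode N k x * (eps N * ((if x ≤ (y : ℕ) then (ξ y : ℝ) else 0)
        - (1 - (x : ℝ) / (N + 1)) * (if 0 ≤ (y : ℕ) then (ξ y : ℝ) else 0))) := fun y => by
    rw [if_pos (Nat.zero_le _)]
    split_ifs <;> ring
  rw [Finset.sum_congr rfl fun y _ => e y, ← Finset.mul_sum, ← Finset.mul_sum,
    Finset.sum_sub_distrib, ← Finset.mul_sum]
  rfl

lemma modeWeight_sub (k : ℕ) (x : Fin N) :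
    modeWeight N k x.succ - modeWeight N k x.castSucc = eps N * sineMode N k ((x : ℕ) + 1 : ℕ) := by
  unfold modeWeight
  rw [← mul_sub, ← Finset.sum_sub_distrib]
  congr 1
  rw [Finset.sum_eq_single ((x : ℕ) + 1)]
  · simp
    ring
  · intro y _ hy
    have h1 : (y ≤ (x.succ : ℕ)) ↔ (y ≤ (x.castSucc : ℕ)) := by
      rw [Fin.val_succ, Fin.val_castSucc]
      omega
    simp only [h1, sub_self]
  · intro h
    exact absurd (Finset.mem_range.2 (by omega)) h

lemma abs_modeWeight_le (hN : 0 < N) (k : ℕ) (y : Fin (N + 1)) : |modeWeight N k y| ≤ 2 := by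
  have he : 0 < eps N := by
    unfold eps
    positivity
  have h1 := abs_sineCoeff_le (N := N) (C := 1)
    (g := fun x => (if x ≤ (y : ℕ) then 1 else 0) - (1 - (x : ℝ) / (N + 1)))
    (fun x hx => by
      obtain ⟨h0, h1⟩ := lin_mem hx
      rw [abs_le]
      split_ifs <;> constructor <;> linarith) k
  unfold modeWeight
  rw [abs_mul, abs_of_pos he]
  calc eps N * _ ≤ eps N * ((N + 1) * 1) := mul_le_mul_of_nonneg_left h1 he.le
    _ ≤ 2 := by
      have hN1 : (1 : ℝ) ≤ N := by exact_mod_cast hN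
      unfold eps
      rw [mul_one, one_div, inv_mul_le_iff₀ (by positivity)]
      linarith

/-- The sine modes of the centred tail are eigenfunctions of the generator up to the effect of the
reservoirs. -/
lemma jumpGen_modeWeight (hN : 0 < N) (j : ℝ) (k : ℕ) (ξ : Config N) :
    jumpGen (rate j) jump (pair (modeWeight N k)) ξ =
      -modeRate N k * pair (modeWeight N k) ξ + -j * sineCoeff N (absorb ξ) k := by
  have hN' : (N : ℝ) ≠ 0 := by positivity
  have he : N * eps N = 1 := by
    unfold eps
    field_simp
  rw [jumpGen_pair hN, pair_modeWeight]
  have e1 : (N : ℝ) ^ 2 / 2 * ∑ x : Fin N, ((ξ x.castSucc : ℝ) - ξ x.succ) *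
      (modeWeight N k x.succ - modeWeight N k x.castSucc) =
      -modeRate N k * sineCoeff N (centredTail ξ) k := by
    have h1 : ∀ x : Fin N, ((ξ x.castSucc : ℝ) - ξ x.succ) *
        (modeWeight N k x.succ - modeWeight N k x.castSucc) =
        sineMode N k ((x : ℕ) + 1 : ℕ) * (eps N * (tailSum ξ ((x : ℕ) + 1 + 1)
          - 2 * tailSum ξ ((x : ℕ) + 1) + tailSum ξ (x : ℕ))) := fun x => by
      have a1 := tailSum_eq_add ξ x.castSucc
      have a2 := tailSum_eq_add ξ x.succ
      rw [Fin.val_castSucc] at a1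
      rw [Fin.val_succ] at a2
      rw [modeWeight_sub, a1, a2]
      ring
    have h2 := sineCoeff_laplacian (centredTail_zero ξ) (centredTail_end ξ) k
    have h3 : sineCoeff N (fun x => centredTail ξ (x + 1) - 2 * centredTail ξ x
        + centredTail ξ (x - 1)) k = ∑ x ∈ Finset.range N, sineMode N k ((x : ℕ) + 1 : ℕ) *
          (eps N * (tailSum ξ (x + 1 + 1) - 2 * tailSum ξ (x + 1) + tailSum ξ x)) := by
      rw [sineCoeff, Finset.sum_range_succ']
      simp only [Nat.cast_zero, sineMode_zero, zero_mul, add_zero]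
      refine Finset.sum_congr rfl fun x _ => ?_
      simp only [centredTail, Nat.add_sub_cancel]
      push_cast
      ring
    rw [Finset.sum_congr rfl fun x _ => h1 x,
      Fin.sum_univ_eq_sum_range (fun x => sineMode N k ((x : ℕ) + 1 : ℕ) *
        (eps N * (tailSum ξ (x + 1 + 1) - 2 * tailSum ξ (x + 1) + tailSum ξ x))), ← h3, h2, modeRate]
    ring
  have e2 : j * N * modeWeight N k 0
      - (open Classical in if ξ = 0 then 0 else j * N * modeWeight N k (topSite ξ)) =
      -j * sineCoeff N (absorb ξ) k := by
    have h1 : ∀ y, j * N * modeWeight N k y = j * ∑ x ∈ Finset.range (N + 1), sineMode N k x *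
        ((if x ≤ (y : ℕ) then 1 else 0) - (1 - (x : ℝ) / (N + 1))) := fun y => by
      unfold modeWeight
      rw [← mul_assoc, mul_assoc j, he, mul_one]
    rw [h1, h1]
    split_ifs with h
    · rw [sub_zero, sineCoeff, neg_mul, ← mul_neg, ← Finset.sum_neg_distrib]
      congr 1
      refine Finset.sum_congr rfl fun x _ => ?_
      rw [absorb, if_pos h]
      rcases Nat.eq_zero_or_pos x with h0 | h0
      · simp [h0, sineMode_zero]
      · rw [if_neg (by simp; omega)]
        ring
    · rw [← mul_sub, ← Finset.sum_sub_distrib, sineCoeff, neg_mul, ← mul_neg,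
        ← Finset.sum_neg_distrib]
      congr 1
      refine Finset.sum_congr rfl fun x _ => ?_
      rw [absorb, if_neg h]
      change _ - sineMode N k x * ((if x ≤ rightmost ξ then 1 else 0) - _) = _
      rcases Nat.eq_zero_or_pos x with h0 | h0
      · simp [h0, sineMode_zero]
      · rw [if_neg (by simp; omega)]
        ring
  rw [e1, add_sub_assoc, e2]

lemma carreDuChamp_modeWeight_le (hN : 0 < N) {j : ℝ} (hj : 0 < j) (k : ℕ) (ξ : Config N) :
    carreDuChamp (rate j) jump (pair (modeWeight N k)) ξ ≤ N * (eps N * numParticles ξ + 8 * j) := by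
  have hN' : (N : ℝ) ≠ 0 := by positivity
  have h := carreDuChamp_pair_le hN hj (modeWeight N k) (α := eps N ^ 2) (β := 4)
    (fun x => by
      rw [modeWeight_sub, mul_pow]
      have : sineMode N k ((x : ℕ) + 1 : ℕ) ^ 2 ≤ 1 := by
        rw [← sq_abs]
        exact pow_le_one₀ (abs_nonneg _) (abs_sineMode_le _ _ _)
      nlinarith [sq_nonneg (eps N)])
    (fun x => by
      rw [← sq_abs]
      calc |modeWeight N k x| ^ 2 ≤ 2 ^ 2 :=
            pow_le_pow_left₀ (abs_nonneg _) (abs_modeWeight_le hN k x) 2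
        _ = 4 := by norm_num) ξ
  refine h.trans (le_of_eq ?_)
  unfold eps
  field_simp
  ring

lemma abs_pair_le {a : Fin (N + 1) → ℝ} {C : ℝ} (ha : ∀ y, |a y| ≤ C) (ξ : Config N) :
    |pair a ξ| ≤ C * (numParticles ξ + 1) ^ 1 := by
  have hC : 0 ≤ C := (abs_nonneg _).trans (ha 0)
  refine (Finset.abs_sum_le_sum_abs _ _).trans ?_
  calc ∑ y, |a y * (ξ y : ℝ)| ≤ ∑ y, C * (ξ y : ℝ) := Finset.sum_le_sum fun y _ => by
        rw [abs_mul, abs_of_nonneg (Nat.cast_nonneg (ξ y) : (0 : ℝ) ≤ _)]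
        exact mul_le_mul_of_nonneg_right (ha y) (Nat.cast_nonneg _)
    _ = C * numParticles ξ := by
        rw [← Finset.mul_sum, numParticles]
        push_cast
        rfl
    _ ≤ C * (numParticles ξ + 1) ^ 1 := by
        rw [pow_one]
        nlinarith

lemma abs_absorb_le (ξ : Config N) {x : ℕ} (hx : x < N + 1) : |absorb ξ x| ≤ 1 := by
  obtain ⟨h0, h1⟩ := lin_mem hx
  unfold absorb
  rw [abs_le]
  split_ifs <;> constructor <;> linarith

end Modes

/-! ### The energy estimate -/

/-- Energy inequality for finitely many damped modes. -/
lemma sum_sq_le_of_hasDerivWithinAt {n : ℕ} {d q : ℕ → ℝ → ℝ} {l : ℕ → ℝ} {φ : ℝ → ℝ} {t : ℝ}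
    (ht : 0 ≤ t) (hl : ∀ k, 0 ≤ l k) (hd : ∀ k, ContinuousOn (d k) (Icc 0 t))
    (hd' : ∀ k, ∀ s ∈ Ioo 0 t, HasDerivWithinAt (d k) (-l k * d k s + q k s) (Ioi s) s)
    (hφ : IntervalIntegrable φ volume 0 t)
    (hq : ∀ s ∈ Ioo 0 t, 2 * ∑ k ∈ Finset.range n, d k s * q k s ≤ φ s) :
    ∑ k ∈ Finset.range n, d k t ^ 2 ≤
      ∑ k ∈ Finset.range n, d k 0 ^ 2 + ∫ s in (0 : ℝ)..t, φ s := by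
  have h := intervalIntegral.sub_le_integral_of_hasDeriv_right_of_le
    (g := fun s => ∑ k ∈ Finset.range n, d k s ^ 2)
    (g' := fun s => ∑ k ∈ Finset.range n, 2 * d k s * (-l k * d k s + q k s)) (φ := φ) ht
    (continuousOn_finsetSum _ fun k _ => (hd k).pow 2)
    (fun s hs => HasDerivWithinAt.fun_sum fun k _ =>
      ((hd' k s hs).fun_pow 2).congr_deriv (by simp))
    ((intervalIntegrable_iff_integrableOn_Icc_of_le ht).1 hφ) (fun s hs => ?_)
  · linarith
  · refine le_trans ?_ (hq s hs)
    rw [Finset.mul_sum]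
    refine Finset.sum_le_sum fun k _ => ?_
    nlinarith [mul_nonneg (hl k) (sq_nonneg (d k s))]

/-- An approximate solution on the grid, minus its linear interpolation. The spacing is `1 / (N + 1)`
and not `eps N`, because the tails of a configuration vanish at `N + 1`. -/
noncomputable def gridProfile (V : ℝ → ℝ → ℝ) (M : ℝ) (N : ℕ) (s : ℝ) (x : ℕ) : ℝ :=
  V s ((x : ℝ) / (N + 1)) - M * (1 - (x : ℝ) / (N + 1))

/-- The consistency error of the discrete Laplacian. -/
noncomputable def defect (V W : ℝ → ℝ → ℝ) (M : ℝ) (N : ℕ) (s : ℝ) (x : ℕ) : ℝ :=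
  (N : ℝ) ^ 2 / 2 * (gridProfile V M N s (x + 1) - 2 * gridProfile V M N s x
    + gridProfile V M N s (x - 1)) - W s ((x : ℝ) / (N + 1)) / 2

/-- The forcing in the equation for the difference of the particle system and the profile. -/
noncomputable def forcing (j : ℝ) (V W H : ℝ → ℝ → ℝ) (M : ℝ) {N : ℕ} (ξ : Config N) (s : ℝ)
    (x : ℕ) : ℝ :=
  -j * absorb ξ x + (defect V W M N s x + j * H s ((x : ℝ) / (N + 1)))

section Energy

variable {N : ℕ} {j M : ℝ} {V W H : ℝ → ℝ → ℝ}

lemma gridProfile_zero (h0 : ∀ s, V s 0 = M) (s : ℝ) : gridProfile V M N s 0 = 0 := by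
  simp [gridProfile, h0]

lemma gridProfile_end (h1 : ∀ s, V s 1 = 0) (s : ℝ) : gridProfile V M N s (N + 1) = 0 := by
  have : (N + 1 : ℝ) ≠ 0 := by positivity
  simp [gridProfile, this, h1]

lemma hasDerivAt_sineCoeff_gridProfile (h0 : ∀ s, V s 0 = M) (h1 : ∀ s, V s 1 = 0) {s : ℝ}
    (hV : ∀ r, HasDerivAt (fun s => V s r) (W s r / 2 - j * H s r) s) (k : ℕ) :
    HasDerivAt (fun s => sineCoeff N (gridProfile V M N s) k)
      (-modeRate N k * sineCoeff N (gridProfile V M N s) k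
        - sineCoeff N (fun x => defect V W M N s x + j * H s ((x : ℝ) / (N + 1))) k) s := by
  have hd : HasDerivAt (fun s => sineCoeff N (gridProfile V M N s) k)
      (∑ x ∈ Finset.range (N + 1), sineMode N k x *
        (W s ((x : ℝ) / (N + 1)) / 2 - j * H s ((x : ℝ) / (N + 1)))) s := by
    unfold sineCoeff gridProfile
    exact HasDerivAt.fun_sum fun x _ => ((hV _).sub_const _).const_mul _
  refine hd.congr_deriv ?_
  have hL := sineCoeff_laplacian (gridProfile_zero (N := N) h0 s) (gridProfile_end (N := N) h1 s) k
  have e : -modeRate N k * sineCoeff N (gridProfile V M N s) k = (N : ℝ) ^ 2 / 2 *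
      sineCoeff N (fun x => gridProfile V M N s (x + 1) - 2 * gridProfile V M N s x
        + gridProfile V M N s (x - 1)) k := by
    rw [hL, modeRate]
    ring
  rw [e, ← sineCoeff_const_mul, ← sineCoeff_sub, sineCoeff]
  refine Finset.sum_congr rfl fun x _ => ?_
  unfold defect
  ring

/-- The monotonicity of the relation between the profile and the absorption, with all errors. The
numbers `u` and `v` are the tail of the particle system and the approximate solution at a site, `A`
and `h` the absorption terms, `u₀` and `M` the total masses, `L` the linear interpolation. -/
lemma sub_mul_absorption_le {j M a η B L u u₀ v h A e : ℝ} (hj : 0 < j) (hM : 0 ≤ M)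
    (ha : 0 < a) (ha1 : a ≤ 1) (hB : 0 ≤ B) (hL0 : 0 ≤ L) (hL1 : L ≤ 1) (hu0 : 0 ≤ u)
    (huu : u ≤ u₀) (hA : |A| ≤ 1) (hcase : u₀ = 0 ∨ A = 1 ∨ A = 0 ∧ u = 0) (hH : |h| ≤ 1 + a)
    (hVH : |v| - a ≤ v * h) (hVB : |v - M * L| ≤ B * M) (hdef : |e| ≤ η) :
    (u - L * u₀ - (v - M * L)) * (-j * A + (e + j * h)) ≤
      (j * a * (1 + M) + η * M * (1 + B)) + (j * a + 3 * j * (1 + B) + η) * |u₀ - M| := by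
  obtain ⟨δ, hδ⟩ : ∃ δ, δ = |u₀ - M| := ⟨_, rfl⟩
  rw [← hδ]
  have hδ0 : 0 ≤ δ := hδ ▸ abs_nonneg _
  have huM : u₀ ≤ M + δ := by linarith [le_abs_self (u₀ - M)]
  have hcabs : |u - L * u₀| ≤ u₀ := by
    rw [abs_le]
    constructor <;> nlinarith
  have hah : |A - h| ≤ 3 := (abs_sub _ _).trans (by linarith)
  -- the contribution of the consistency error
  have hpart1 : (u - L * u₀ - (v - M * L)) * e ≤ η * (M + δ + B * M) := by
    calc _ ≤ |(u - L * u₀ - (v - M * L)) * e| := le_abs_self _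
      _ = |u - L * u₀ - (v - M * L)| * |e| := abs_mul _ _
      _ ≤ (M + δ + B * M) * η :=
          mul_le_mul ((abs_sub _ _).trans (add_le_add (hcabs.trans huM) hVB)) hdef
            (abs_nonneg _) (by positivity)
      _ = _ := mul_comm _ _
  -- the contribution of the absorption
  have hpart2 : (u - L * u₀ - (v - M * L)) * (-(A - h)) ≤ a * (1 + M + δ) + 3 * (1 + B) * δ := by
    rcases hcase with h0 | hcase
    · have hδM : δ = M := by
        rw [hδ, h0, zero_sub, abs_neg, abs_of_nonneg hM]
      have hc0 : u - L * u₀ = 0 := by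
        rw [h0] at hcabs ⊢
        exact abs_nonpos_iff.1 hcabs
      rw [hc0, zero_sub, neg_mul_neg]
      calc _ ≤ |(v - M * L) * (A - h)| := le_abs_self _
        _ = |v - M * L| * |A - h| := abs_mul _ _
        _ ≤ (B * M) * 3 := mul_le_mul hVB hah (abs_nonneg _) (by positivity)
        _ ≤ _ := by
            rw [hδM]
            have : 0 ≤ a * (1 + M + M) := by positivity
            linarith
    · have hsplit : u - L * u₀ - (v - M * L) = (u - v) + L * (M - u₀) := by ring
      rw [hsplit, add_mul]
      have hq1 : L * (M - u₀) * (-(A - h)) ≤ 3 * δ := by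
        calc _ ≤ |L * (M - u₀) * (-(A - h))| := le_abs_self _
          _ = L * δ * |A - h| := by
              rw [abs_mul, abs_neg, abs_mul, abs_of_nonneg hL0, abs_sub_comm M, ← hδ]
          _ ≤ 1 * δ * 3 := by gcongr
          _ = 3 * δ := by ring
      have hq2 : (u - v) * (-(A - h)) ≤ a * (1 + u) := by
        have huh : u * h ≤ u * (1 + a) :=
          mul_le_mul_of_nonneg_left ((le_abs_self _).trans hH) hu0
        rcases hcase with hA1 | ⟨hA0, hu00⟩
        · rw [hA1]
          nlinarith [le_abs_self v]
        · rw [hA0, hu00]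
          nlinarith [abs_nonneg v]
      have h3 : a * (1 + u) ≤ a * (1 + M + δ) := mul_le_mul_of_nonneg_left (by linarith) ha.le
      have h4 : 0 ≤ B * δ := mul_nonneg hB hδ0
      linarith
  have h5 := mul_le_mul_of_nonneg_left hpart2 hj.le
  linarith

/-- Pairing of the difference between the particle system and the profile with the forcing. -/
lemma centredTail_sub_mul_forcing_le (hj : 0 < j) (hM : 0 ≤ M) {a η B κ : ℝ}
    (ha : 0 < a) (ha1 : a ≤ 1) (hη : 0 ≤ η) (hB : 0 ≤ B) (hκ : 0 < κ) (ξ : Config N) {s : ℝ}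
    {x : ℕ} (hx : x < N + 1)
    (hH : |H s ((x : ℝ) / (N + 1))| ≤ 1 + a)
    (hVH : |V s ((x : ℝ) / (N + 1))| - a ≤ V s ((x : ℝ) / (N + 1)) * H s ((x : ℝ) / (N + 1)))
    (hVB : |gridProfile V M N s x| ≤ B * M) (hdef : |defect V W M N s x| ≤ η) :
    (centredTail ξ x - gridProfile V M N s x) * forcing j V W H M ξ s x ≤
      (j * a * (1 + M) + η * M * (1 + B)) + (j * a + 3 * j * (1 + B) + η) *
        (κ + (eps N * numParticles ξ - M) ^ 2 / κ) := by
  obtain ⟨hL0, hL1⟩ := lin_mem hx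
  have he : 0 ≤ eps N := by
    unfold eps
    positivity
  have hδκ : ∀ y : ℝ, |y| ≤ κ + y ^ 2 / κ := fun y => by
    rw [← sq_abs]
    have h0 := abs_nonneg y
    have h1 : 0 ≤ |y| ^ 2 / κ := by positivity
    rcases le_total |y| κ with h2 | h2
    · linarith
    · have : |y| ≤ |y| ^ 2 / κ := by
        rw [le_div_iff₀ hκ]
        nlinarith
      linarith
  have hcase : eps N * (numParticles ξ : ℝ) = 0 ∨ absorb ξ x = 1 ∨
      absorb ξ x = 0 ∧ eps N * tailSum ξ x = 0 := by
    by_cases hξ : ξ = 0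
    · left
      simp [hξ, numParticles]
    · right
      unfold absorb
      rw [if_neg hξ]
      split_ifs with hxr
      · exact Or.inl rfl
      · exact Or.inr ⟨rfl, by rw [tailSum_eq_zero (not_le.1 hxr), mul_zero]⟩
  have h := sub_mul_absorption_le hj hM ha ha1 hB hL0 hL1
    (mul_nonneg he (tailSum_nonneg ξ x)) (mul_le_mul_of_nonneg_left (tailSum_le ξ x) he)
    (abs_absorb_le ξ hx) hcase hH hVH hVB hdef
  have hc : centredTail ξ x = eps N * tailSum ξ x
      - (1 - (x : ℝ) / (N + 1)) * (eps N * numParticles ξ) := by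
    rw [centredTail, tailSum_zero]
    ring
  rw [hc]
  refine h.trans (add_le_add le_rfl (mul_le_mul_of_nonneg_left (hδκ _) (by positivity)))

/-- The pairing in the sine transform, with the fluctuations `z` subtracted. -/
lemma sum_mode_mul_forcing_le {a A Q : ℝ} (ha : 0 < a) (hA : 0 ≤ A) {g q : ℕ → ℝ} (hg : g 0 = 0)
    (z : ℕ → ℝ)
    (hgq : ∀ x < N + 1, x ≠ 0 → g x * q x ≤ A) (hq : ∀ x < N + 1, x ≠ 0 → |q x| ≤ Q) :
    2 / ((N : ℝ) + 1) ^ 2 *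
      ∑ k ∈ Finset.range (N + 1), (sineCoeff N g k - z k) * sineCoeff N q k ≤
      A + a * Q ^ 2 / 2 +
        1 / (2 * a) * (2 / ((N : ℝ) + 1) ^ 2 * ∑ k ∈ Finset.range (N + 1), z k ^ 2) := by
  have hn : (0 : ℝ) < (N : ℝ) + 1 := by positivity
  set q' : ℕ → ℝ := fun x => if x = 0 then 0 else q x with hq'
  have hqq : ∀ k, sineCoeff N q k = sineCoeff N q' k := fun k => by
    refine Finset.sum_congr rfl fun x _ => ?_
    rcases eq_or_ne x 0 with h | h
    · simp [h, sineMode_zero]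
    · simp [hq', h]
  simp only [hqq]
  have p1 := sum_sineCoeff_mul hg q' (N := N)
  have p2 := sum_sineCoeff_mul (g := q') (by simp [hq']) q' (N := N)
  have s1 : ∑ x ∈ Finset.range (N + 1), g x * q' x ≤ ((N : ℝ) + 1) * A := by
    have : ∀ x ∈ Finset.range (N + 1), g x * q' x ≤ A := fun x hx => by
      rcases eq_or_ne x 0 with h | h
      · simpa [hq', h] using hA
      · simpa [hq', h] using hgq x (Finset.mem_range.1 hx) h
    refine (Finset.sum_le_sum this).trans (le_of_eq ?_)
    simp
  have s2 : ∑ x ∈ Finset.range (N + 1), q' x * q' x ≤ ((N : ℝ) + 1) * Q ^ 2 := by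
    have : ∀ x ∈ Finset.range (N + 1), q' x * q' x ≤ Q ^ 2 := fun x hx => by
      rcases eq_or_ne x 0 with h | h
      · simpa [hq', h] using sq_nonneg Q
      · have := hq x (Finset.mem_range.1 hx) h
        simp only [hq', if_neg h, ← sq]
        exact sq_le_sq' (abs_le.1 this).1 (abs_le.1 this).2
    refine (Finset.sum_le_sum this).trans (le_of_eq ?_)
    simp
  have s3 : -∑ k ∈ Finset.range (N + 1), z k * sineCoeff N q' k ≤
      1 / (2 * a) * (∑ k ∈ Finset.range (N + 1), z k ^ 2)
        + a / 2 * ∑ k ∈ Finset.range (N + 1), sineCoeff N q' k * sineCoeff N q' k := by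
    rw [Finset.mul_sum, Finset.mul_sum, ← Finset.sum_neg_distrib, ← Finset.sum_add_distrib]
    refine Finset.sum_le_sum fun k _ => ?_
    have h1 : 0 ≤ (z k + a * sineCoeff N q' k) ^ 2 / (2 * a) := by positivity
    have h2 : (z k + a * sineCoeff N q' k) ^ 2 / (2 * a) = 1 / (2 * a) * z k ^ 2 +
        z k * sineCoeff N q' k + a / 2 * (sineCoeff N q' k * sineCoeff N q' k) := by
      field_simp
      ring
    linarith
  have s4 : ∑ k ∈ Finset.range (N + 1), (sineCoeff N g k - z k) * sineCoeff N q' k ≤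
      ((N : ℝ) + 1) / 2 * (((N : ℝ) + 1) * A) +
      (1 / (2 * a) * (∑ k ∈ Finset.range (N + 1), z k ^ 2)
        + a / 2 * (((N : ℝ) + 1) / 2 * (((N : ℝ) + 1) * Q ^ 2))) := by
    simp only [sub_mul, Finset.sum_sub_distrib]
    rw [p1, sub_eq_add_neg]
    refine add_le_add (mul_le_mul_of_nonneg_left s1 (by positivity)) (s3.trans ?_)
    rw [p2]
    gcongr
  calc _ ≤ 2 / ((N : ℝ) + 1) ^ 2 * (((N : ℝ) + 1) / 2 * (((N : ℝ) + 1) * A) +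
      (1 / (2 * a) * (∑ k ∈ Finset.range (N + 1), z k ^ 2)
        + a / 2 * (((N : ℝ) + 1) / 2 * (((N : ℝ) + 1) * Q ^ 2)))) :=
        mul_le_mul_of_nonneg_left s4 (by positivity)
    _ = _ := by
        field_simp
        ring

end Energy

/-! ### Mean square distance between the particle system and a profile -/

section Fluctuations

variable {N : ℕ} {j : ℝ} {Ω : Type*} {Y : ℝ → Ω → Config N}

/-- The part of the `k`-th mode of the tail process which is due to the fluctuations of the bulk. -/
noncomputable def fluct (j : ℝ) (Y : ℝ → Ω → Config N) (k : ℕ) (t : ℝ) (ω : Ω) : ℝ :=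
  pair (modeWeight N k) (Y t ω) - relax (modeRate N k) (pair (modeWeight N k))
    (fun ξ => -j * sineCoeff N (absorb ξ) k) Y t ω

/-- The normalized square sum of the fluctuations. -/
noncomputable def fluctEnergy (j : ℝ) (Y : ℝ → Ω → Config N) (t : ℝ) (ω : Ω) : ℝ :=
  2 / ((N : ℝ) + 1) ^ 2 * ∑ k ∈ Finset.range (N + 1), fluct j Y k t ω ^ 2

lemma fluctEnergy_nonneg (t : ℝ) (ω : Ω) : 0 ≤ fluctEnergy j Y t ω :=
  mul_nonneg (by positivity) (Finset.sum_nonneg fun _ _ => sq_nonneg _)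

lemma fluct_zero (t : ℝ) (ω : Ω) : fluct j Y 0 t ω = 0 := by
  have h : ∀ ξ : Config N, pair (modeWeight N 0) ξ = 0 := fun ξ => by
    rw [pair_modeWeight, sineCoeff_zero]
  simp [fluct, relax, h, sineCoeff_zero]

end Fluctuations

section Mean

variable {N : ℕ} {j M : ℝ} {ξ₀ : Config N} {Ω : Type*} [MeasurableSpace Ω] {P : Measure Ω}
  {Y : ℝ → Ω → Config N}

lemma abs_mass_sq_le (M : ℝ) (ξ : Config N) :
    |(eps N * numParticles ξ - M) ^ 2| ≤ (eps N + |M|) ^ 2 * (numParticles ξ + 1) ^ 2 := by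
  have he : 0 ≤ eps N := by
    unfold eps
    positivity
  have hm : (0 : ℝ) ≤ numParticles ξ := Nat.cast_nonneg _
  have h1 : |eps N * numParticles ξ - M| ≤ (eps N + |M|) * (numParticles ξ + 1) := by
    refine (abs_sub _ _).trans ?_
    rw [abs_of_nonneg (mul_nonneg he hm)]
    nlinarith [abs_nonneg M, mul_nonneg (abs_nonneg M) hm]
  rw [abs_pow, ← mul_pow]
  exact pow_le_pow_left₀ (abs_nonneg _) h1 2

lemma integral_mass_sq_le [IsProbabilityMeasure P] (hN : 0 < N) (hj : 0 < j) (hM : 0 ≤ M)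
    (hY : IsJumpProcess (rate j) jump ξ₀ P Y) {t : ℝ} (ht : 0 ≤ t) :
    ∫ ω, (eps N * numParticles (Y t ω) - M) ^ 2 ∂P ≤
      (eps N * numParticles ξ₀ - M) ^ 2 + 2 * j * eps N * t := by
  have hr := jumpRates_rate (N := N) hj
  have hf := abs_mass_sq_le (N := N) M
  have hG := hr.abs_jumpGen_le hf
  rw [hY.dynkin_growth hr hf ht]
  have h1 : ∫ r in (0 : ℝ)..t, (∫ ω, jumpGen (rate j) jump
      (fun η : Config N => (eps N * numParticles η - M) ^ 2) (Y r ω) ∂P) ≤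
      ∫ _ in (0 : ℝ)..t, 2 * j * eps N := by
    refine intervalIntegral.integral_mono_on ht (hY.intervalIntegrable_mean hr hG le_rfl ht)
      intervalIntegrable_const fun r hr' => ?_
    have := integral_mono (μ := P) (hY.integrable_state hr hG hr'.1)
      (integrable_const (2 * j * eps N)) fun ω => jumpGen_mass_sq_le hN hj hM (Y r ω)
    simpa using this
  rw [intervalIntegral.integral_const, sub_zero, smul_eq_mul] at h1
  linarith

lemma integral_carreDuChamp_modeWeight_le [IsProbabilityMeasure P] (hN : 0 < N) (hj : 0 < j)
    (hM : 0 ≤ M) (hY : IsJumpProcess (rate j) jump ξ₀ P Y) {t D : ℝ} (ht : 0 ≤ t)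
    (hD : (eps N * numParticles ξ₀ - M) ^ 2 + 2 * j * eps N * t ≤ D) (k : ℕ) :
    ∫ ω, carreDuChamp (rate j) jump (pair (modeWeight N k)) (Y t ω) ∂P ≤
      N * (M + 1 + D + 8 * j) := by
  have hr := jumpRates_rate (N := N) hj
  have hf : ∀ ξ : Config N, |pair (modeWeight N k) ξ| ≤ 2 * (numParticles ξ + 1) ^ 1 :=
    abs_pair_le (abs_modeWeight_le hN k)
  have i1 := hY.integrable_state hr (hr.abs_carreDuChamp_le hf) ht
  have i2 : Integrable (fun ω => (eps N * numParticles (Y t ω) - M) ^ 2) P :=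
    hY.integrable_state hr (abs_mass_sq_le (N := N) M) ht
  have i3 : Integrable (fun ω => (N : ℝ) * ((M + 1 + 8 * j)
      + (eps N * numParticles (Y t ω) - M) ^ 2)) P := ((integrable_const _).add i2).const_mul _
  have h := integral_mono i1 i3 fun ω => by
    refine (carreDuChamp_modeWeight_le hN hj k (Y t ω)).trans ?_
    refine mul_le_mul_of_nonneg_left ?_ (Nat.cast_nonneg N)
    nlinarith [sq_nonneg (eps N * numParticles (Y t ω) - M - 1 / 2)]
  rw [integral_const_mul, integral_add (integrable_const _) i2] at h
  refine h.trans (mul_le_mul_of_nonneg_left ?_ (Nat.cast_nonneg N))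
  have := integral_mass_sq_le hN hj hM hY ht
  rw [integral_const, probReal_univ, one_smul]
  linarith

lemma abs_absorption_mode_le (j : ℝ) (k : ℕ) (ξ : Config N) :
    |-j * sineCoeff N (absorb ξ) k| ≤ |j| * ((N + 1) * 1) := by
  rw [abs_mul, abs_neg]
  exact mul_le_mul_of_nonneg_left (abs_sineCoeff_le (fun x hx => abs_absorb_le ξ hx) k)
    (abs_nonneg _)

lemma measurable_relax (hY : IsJumpProcess (rate j) jump ξ₀ P Y) {l C : ℝ} {f b : Config N → ℝ}
    (hb : ∀ ξ, |b ξ| ≤ C) : Measurable fun p : ℝ × Ω => relax l f b Y p.1 p.2 := by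
  refine measurable_uncurry_of_continuous_of_measurable (u := fun t ω => relax l f b Y t ω)
    (fun ω => hY.continuous_relax hb ω) fun t => ?_
  have h1 : Measurable fun p : Ω × ℝ => Real.exp (l * p.2) * b (Y p.2 p.1) :=
    (((measurable_snd.const_mul l)).exp).mul ((hY.measurable_comp b).comp measurable_swap)
  have h2 : ∀ s : Set ℝ, Measurable fun ω => ∫ r in s, Real.exp (l * r) * b (Y r ω) := fun s =>
    (StronglyMeasurable.integral_prod_right (ν := volume.restrict s)
      (f := fun ω r => Real.exp (l * r) * b (Y r ω)) h1.stronglyMeasurable).measurable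
  unfold relax intervalIntegral
  exact ((hY.measurable_state f 0).add ((h2 _).sub (h2 _))).const_mul _

lemma measurable_fluctEnergy (hY : IsJumpProcess (rate j) jump ξ₀ P Y) :
    Measurable fun p : ℝ × Ω => fluctEnergy j Y p.1 p.2 := by
  unfold fluctEnergy
  refine (Finset.measurable_sum _ fun k _ => ?_).const_mul _
  exact ((hY.measurable_comp _).sub (measurable_relax hY (abs_absorption_mode_le j k))).pow_const 2

/-- The fluctuations of the bulk vanish in the limit: the `k`-th mode relaxes at a rate of order
`k ^ 2`, which makes the sum over the modes converge. -/
lemma lintegral_fluctEnergy_le [IsProbabilityMeasure P] (hN : 0 < N) (hj : 0 < j)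
    (hM : 0 ≤ M) (hY : IsJumpProcess (rate j) jump ξ₀ P Y) {t D : ℝ} (ht : 0 ≤ t)
    (hD : (eps N * numParticles ξ₀ - M) ^ 2 + 2 * j * eps N * t ≤ D) :
    ∫⁻ ω, ENNReal.ofReal (fluctEnergy j Y t ω) ∂P ≤
      ENNReal.ofReal (8 * (M + 1 + D + 8 * j) / (N + 1)) := by
  have hr := jumpRates_rate (N := N) hj
  have hn : (0 : ℝ) < N + 1 := by positivity
  have hN' : (0 : ℝ) < N := by exact_mod_cast hN
  have he : 0 ≤ eps N := by
    unfold eps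
    positivity
  have hD0 : 0 ≤ D := le_trans (by positivity) hD
  obtain ⟨Λ, hΛ⟩ : ∃ Λ, Λ = M + 1 + D + 8 * j := ⟨_, rfl⟩
  have hΛ0 : 0 ≤ Λ := by
    rw [hΛ]
    positivity
  have hmode : ∀ k ∈ Finset.range N, ∫⁻ ω, ENNReal.ofReal (fluct j Y (k + 1) t ω ^ 2) ∂P ≤
      ENNReal.ofReal (2 * N * Λ * (1 / ((k : ℝ) + 1) ^ 2)) := fun k hk => by
    have hk' := Finset.mem_range.1 hk
    have hl := sq_half_le_modeRate hN (k := k + 1) (by omega)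
    push_cast at hl
    have hk0 : (0 : ℝ) < ((k : ℝ) + 1) ^ 2 / 2 := by positivity
    refine (hY.lintegral_sub_relax_sq_le hr (abs_pair_le (abs_modeWeight_le hN (k + 1)))
      (abs_absorption_mode_le j (k + 1)) (hk0.trans_le hl) (jumpGen_modeWeight hN j (k + 1))
      ht (B := N * Λ) fun r hr' => ?_).trans ?_
    · rw [hΛ]
      refine integral_carreDuChamp_modeWeight_le hN hj hM hY hr'.1 (le_trans ?_ hD) (k + 1)
      have : 2 * j * eps N * r ≤ 2 * j * eps N * t :=
        mul_le_mul_of_nonneg_left hr'.2 (by positivity)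
      linarith
    · refine ENNReal.ofReal_le_ofReal ?_
      calc N * Λ / modeRate N (k + 1) ≤ N * Λ / (((k : ℝ) + 1) ^ 2 / 2) :=
            div_le_div_of_nonneg_left (by positivity) hk0 hl
        _ = _ := by
            field_simp
  have hmeas : ∀ k, Measurable fun ω => ENNReal.ofReal (fluct j Y k t ω ^ 2) := fun k => by
    have : Measurable fun ω => fluct j Y k t ω := (hY.measurable_state _ t).sub
      ((measurable_relax hY (abs_absorption_mode_le j k)).comp
        (measurable_const.prodMk measurable_id))
    exact (this.pow_const 2).ennreal_ofReal
  have e : ∀ ω, ENNReal.ofReal (fluctEnergy j Y t ω) = ENNReal.ofReal (2 / ((N : ℝ) + 1) ^ 2) *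
      ∑ k ∈ Finset.range N, ENNReal.ofReal (fluct j Y (k + 1) t ω ^ 2) := fun ω => by
    rw [fluctEnergy, ENNReal.ofReal_mul (by positivity), Finset.sum_range_succ', fluct_zero,
      zero_pow two_ne_zero, add_zero, ENNReal.ofReal_sum_of_nonneg fun _ _ => sq_nonneg _]
  simp only [e]
  rw [lintegral_const_mul _ (Finset.measurable_sum _ fun k _ => hmeas (k + 1)),
    lintegral_finsetSum _ fun k _ => hmeas (k + 1)]
  calc _ ≤ ENNReal.ofReal (2 / ((N : ℝ) + 1) ^ 2) *
      ∑ k ∈ Finset.range N, ENNReal.ofReal (2 * N * Λ * (1 / ((k : ℝ) + 1) ^ 2)) := by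
        gcongr with k hk
        exact hmode k hk
    _ = ENNReal.ofReal (2 / ((N : ℝ) + 1) ^ 2 * (2 * N * Λ *
        ∑ k ∈ Finset.range N, 1 / ((k : ℝ) + 1) ^ 2)) := by
        rw [← ENNReal.ofReal_sum_of_nonneg fun _ _ => by positivity, ← Finset.mul_sum,
          ← ENNReal.ofReal_mul (by positivity)]
    _ ≤ _ := by
        refine ENNReal.ofReal_le_ofReal ?_
        rw [← hΛ]
        calc 2 / ((N : ℝ) + 1) ^ 2 * (2 * N * Λ * ∑ k ∈ Finset.range N, 1 / ((k : ℝ) + 1) ^ 2)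
            ≤ 2 / ((N : ℝ) + 1) ^ 2 * (2 * (N + 1) * Λ * 2) := by
              gcongr
              · linarith
              · exact sum_inv_sq_le N
          _ = _ := by
              field_simp
              ring

end Mean

section Distance

variable {N : ℕ} {j M : ℝ} {ξ₀ : Config N} {Ω : Type*} [MeasurableSpace Ω] {P : Measure Ω}
  {Y : ℝ → Ω → Config N} {V W H : ℝ → ℝ → ℝ}

/-- The mean square distance between the centred tails and the profile. -/
noncomputable def meanSqDist (V : ℝ → ℝ → ℝ) (M : ℝ) (ξ : Config N) (s : ℝ) : ℝ :=
  1 / ((N : ℝ) + 1) *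
    ∑ x ∈ Finset.range (N + 1), (centredTail ξ x - gridProfile V M N s x) ^ 2

lemma meanSqDist_eq_modes (h0 : ∀ s, V s 0 = M) (ξ : Config N) (s : ℝ) :
    meanSqDist V M ξ s = 2 / ((N : ℝ) + 1) ^ 2 * ∑ k ∈ Finset.range (N + 1),
      sineCoeff N (fun x => centredTail ξ x - gridProfile V M N s x) k ^ 2 := by
  have hn : (N : ℝ) + 1 ≠ 0 := by positivity
  have h := sum_sineCoeff_mul (N := N) (g := fun x => centredTail ξ x - gridProfile V M N s x)
    (by simp [centredTail_zero, gridProfile_zero h0])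
    (fun x => centredTail ξ x - gridProfile V M N s x)
  simp only [← sq] at h
  rw [h, meanSqDist]
  field_simp

lemma sineCoeff_forcing (ξ : Config N) (s : ℝ) (k : ℕ) :
    sineCoeff N (forcing j V W H M ξ s) k = -j * sineCoeff N (absorb ξ) k +
      sineCoeff N (fun x => defect V W M N s x + j * H s ((x : ℝ) / (N + 1))) k := by
  rw [← sineCoeff_const_mul]
  simp only [sineCoeff, forcing, mul_add, Finset.sum_add_distrib]

/-- The mean square distance is controlled by its initial value, the fluctuations of the bulk, and
the deviation of the total mass; the reservoirs contribute only through the errors because the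
absorption is a monotone function of the tails. -/
lemma meanSqDist_le (hY : IsJumpProcess (rate j) jump ξ₀ P Y) (hj : 0 < j) (hM : 0 ≤ M)
    {a η B κ t : ℝ} (ht : 0 ≤ t) (ha : 0 < a) (ha1 : a ≤ 1) (hη : 0 ≤ η) (hB : 0 ≤ B) (hκ : 0 < κ)
    (h0 : ∀ s, V s 0 = M) (h1 : ∀ s, V s 1 = 0)
    (hV : ∀ s, 0 < s → ∀ r, HasDerivAt (fun s => V s r) (W s r / 2 - j * H s r) s)
    (hVc : ∀ r, Continuous fun s => V s r)
    (hH : ∀ s ∈ Icc 0 t, ∀ r ∈ Icc (0 : ℝ) 1, |H s r| ≤ 1 + a)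
    (hVH : ∀ s ∈ Icc 0 t, ∀ r ∈ Icc (0 : ℝ) 1, |V s r| - a ≤ V s r * H s r)
    (hVB : ∀ s ∈ Icc 0 t, ∀ r ∈ Icc (0 : ℝ) 1, |V s r - M * (1 - r)| ≤ B * M)
    (hdef : ∀ s ∈ Icc 0 t, ∀ x < N + 1, x ≠ 0 → |defect V W M N s x| ≤ η) {ω : Ω}
    (hi1 : ∀ k, IntervalIntegrable (fun s => pair (modeWeight N k) (Y s ω)) volume 0 t)
    (hi2 : ∀ k, IntervalIntegrable (fun s => pair (modeWeight N k) (Y s ω) ^ 2) volume 0 t)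
    (him : IntervalIntegrable (fun s => (eps N * numParticles (Y s ω) - M) ^ 2) volume 0 t) :
    meanSqDist V M (Y t ω) t ≤ 2 * meanSqDist V M (Y 0 ω) 0 + 2 * fluctEnergy j Y t ω +
      4 * ∫ s in (0 : ℝ)..t, ((j * a * (1 + M) + η * M * (1 + B)
        + (j * a + 3 * j * (1 + B) + η) * κ + a * (3 * j + η) ^ 2 / 2)
        + (j * a + 3 * j * (1 + B) + η) / κ * (eps N * numParticles (Y s ω) - M) ^ 2
        + 1 / (2 * a) * fluctEnergy j Y s ω) := by
  have hn : (0 : ℝ) < (N : ℝ) + 1 := by positivity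
  have hunit : ∀ {x : ℕ}, x < N + 1 → (x : ℝ) / (N + 1) ∈ Icc (0 : ℝ) 1 := fun {x} hx => by
    have := lin_mem hx
    exact ⟨by positivity, by linarith [this.1]⟩
  obtain ⟨d, hd⟩ : ∃ d : ℕ → ℝ → ℝ, ∀ k s, d k s = relax (modeRate N k) (pair (modeWeight N k))
    (fun ξ => -j * sineCoeff N (absorb ξ) k) Y s ω - sineCoeff N (gridProfile V M N s) k :=
    ⟨_, fun _ _ => rfl⟩
  have hdz : ∀ k s, d k s = sineCoeff N
      (fun x => centredTail (Y s ω) x - gridProfile V M N s x) k - fluct j Y k s ω := fun k s => by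
    rw [hd, fluct, sineCoeff_sub, pair_modeWeight]
    ring
  obtain ⟨ψ, hψ⟩ : ∃ ψ : ℝ → ℝ, ∀ s, ψ s = (j * a * (1 + M) + η * M * (1 + B)
        + (j * a + 3 * j * (1 + B) + η) * κ + a * (3 * j + η) ^ 2 / 2)
        + (j * a + 3 * j * (1 + B) + η) / κ * (eps N * numParticles (Y s ω) - M) ^ 2
        + 1 / (2 * a) * fluctEnergy j Y s ω := ⟨_, fun _ => rfl⟩
  simp only [← hψ]
  have hrc : ∀ k, Continuous fun s => relax (modeRate N k) (pair (modeWeight N k))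
    (fun ξ => -j * sineCoeff N (absorb ξ) k) Y s ω := fun k =>
      hY.continuous_relax (abs_absorption_mode_le j k) ω
  have hψi : IntervalIntegrable ψ volume 0 t := by
    have hF : IntervalIntegrable (fun s => fluctEnergy j Y s ω) volume 0 t := by
      unfold fluctEnergy
      refine IntervalIntegrable.const_mul ?_ _
      have : (fun s => ∑ k ∈ Finset.range (N + 1), fluct j Y k s ω ^ 2) =
          ∑ k ∈ Finset.range (N + 1), fun s => fluct j Y k s ω ^ 2 := by
        funext s
        simp
      rw [this]
      refine IntervalIntegrable.sum _ fun k _ => ?_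
      have e : (fun s => fluct j Y k s ω ^ 2) = fun s => pair (modeWeight N k) (Y s ω) ^ 2
          - 2 * (relax (modeRate N k) (pair (modeWeight N k))
            (fun ξ => -j * sineCoeff N (absorb ξ) k) Y s ω * pair (modeWeight N k) (Y s ω))
          + relax (modeRate N k) (pair (modeWeight N k))
            (fun ξ => -j * sineCoeff N (absorb ξ) k) Y s ω ^ 2 := by
        funext s
        unfold fluct
        ring
      rw [e]
      exact ((hi2 k).sub (((hi1 k).continuousOn_mul (hrc k).continuousOn).const_mul 2)).add
        (((hrc k).fun_pow 2).intervalIntegrable _ _)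
    have : ψ = _ := funext hψ
    rw [this]
    exact (intervalIntegrable_const.add (him.const_mul _)).add (hF.const_mul _)
  have hdc : ∀ k, Continuous (d k) := fun k => by
    have : d k = _ := funext (hd k)
    rw [this]
    refine (hrc k).sub ?_
    unfold sineCoeff gridProfile
    exact continuous_finsetSum _ fun x _ => ((hVc _).sub continuous_const).const_mul _
  have hmain := sum_sq_le_of_hasDerivWithinAt (n := N + 1) (d := d)
    (q := fun k s => sineCoeff N (forcing j V W H M (Y s ω) s) k) (l := modeRate N)
    (φ := fun s => ((N : ℝ) + 1) ^ 2 * ψ s) ht (modeRate_nonneg N)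
    (fun k => (hdc k).continuousOn) (fun k s hs => ?_) (hψi.const_mul _) (fun s hs => ?_)
  · -- the mode sums are turned into averages over the sites
    have hstart : 2 / ((N : ℝ) + 1) ^ 2 * ∑ k ∈ Finset.range (N + 1), d k 0 ^ 2 =
        meanSqDist V M (Y 0 ω) 0 := by
      rw [meanSqDist_eq_modes h0]
      congr 1
      refine Finset.sum_congr rfl fun k _ => ?_
      rw [hdz]
      simp [fluct, relax]
    have hend : meanSqDist V M (Y t ω) t ≤
        2 * (2 / ((N : ℝ) + 1) ^ 2 * ∑ k ∈ Finset.range (N + 1), d k t ^ 2)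
          + 2 * fluctEnergy j Y t ω := by
      rw [meanSqDist_eq_modes h0, fluctEnergy, ← mul_add, ← mul_add, ← mul_left_comm]
      refine mul_le_mul_of_nonneg_left ?_ (by positivity)
      rw [← Finset.sum_add_distrib, Finset.mul_sum]
      refine Finset.sum_le_sum fun k _ => ?_
      rw [hdz]
      nlinarith [sq_nonneg (sineCoeff N
        (fun x => centredTail (Y t ω) x - gridProfile V M N t x) k - 2 * fluct j Y k t ω)]
    rw [intervalIntegral.integral_const_mul] at hmain
    have h2 := mul_le_mul_of_nonneg_left hmain (show (0 : ℝ) ≤ 2 / ((N : ℝ) + 1) ^ 2 by positivity)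
    rw [mul_add, hstart, ← mul_assoc, div_mul_cancel₀ _ (by positivity)] at h2
    linarith
  · have hb := hY.hasDerivWithinAt_relax (l := modeRate N k) (f := pair (modeWeight N k))
      (abs_absorption_mode_le j k) s ω
    have hg := (hasDerivAt_sineCoeff_gridProfile (N := N) h0 h1 (hV s hs.1) k).hasDerivWithinAt
      (s := Ioi s)
    have : d k = _ := funext (hd k)
    rw [this]
    refine (hb.fun_sub hg).congr_deriv ?_
    rw [sineCoeff_forcing]
    ring
  · have hs' : s ∈ Icc 0 t := ⟨hs.1.le, hs.2.le⟩
    have hA : 0 ≤ (j * a * (1 + M) + η * M * (1 + B)) + (j * a + 3 * j * (1 + B) + η) *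
        (κ + (eps N * numParticles (Y s ω) - M) ^ 2 / κ) := by positivity
    have h := sum_mode_mul_forcing_le (N := N) (a := a) (Q := 3 * j + η)
      (g := fun x => centredTail (Y s ω) x - gridProfile V M N s x)
      (q := forcing j V W H M (Y s ω) s) ha hA
      (by simp [centredTail_zero, gridProfile_zero h0]) (fun k => fluct j Y k s ω)
      (fun x hx hx0 => by
        have hu := hunit hx
        refine centredTail_sub_mul_forcing_le hj hM ha ha1 hη hB hκ _ hx (hH s hs' _ hu)
          (hVH s hs' _ hu) ?_ (hdef s hs' x hx hx0)
        exact hVB s hs' _ hu)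
      (fun x hx hx0 => by
        have hu := hunit hx
        have b1 := abs_le.1 (abs_absorb_le (Y s ω) hx)
        have b2 := abs_le.1 (hH s hs' _ hu)
        have b3 := abs_le.1 (hdef s hs' x hx hx0)
        unfold forcing
        rw [abs_le]
        constructor <;> nlinarith)
    simp only [hdz]
    rw [hψ, fluctEnergy]
    rw [div_mul_eq_mul_div, div_le_iff₀ (by positivity)] at h
    refine h.trans (le_of_eq ?_)
    field_simp
    ring

lemma measurable_meanSqDist (hY : IsJumpProcess (rate j) jump ξ₀ P Y) (t : ℝ) :
    Measurable fun ω => ENNReal.ofReal (meanSqDist V M (Y t ω) t) :=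
  (hY.measurable_state (fun ξ => meanSqDist V M ξ t) t).ennreal_ofReal

lemma lintegral_meanSqDist_le [IsProbabilityMeasure P]
    (hY : IsJumpProcess (rate j) jump ξ₀ P Y) (hN : 0 < N) (hj : 0 < j) (hM : 0 ≤ M)
    {a η B κ t ι D Z : ℝ} (ht : 0 ≤ t) (ha : 0 < a) (ha1 : a ≤ 1) (hη : 0 ≤ η) (hB : 0 ≤ B)
    (hκ : 0 < κ) (h0 : ∀ s, V s 0 = M) (h1 : ∀ s, V s 1 = 0)
    (hV : ∀ s, 0 < s → ∀ r, HasDerivAt (fun s => V s r) (W s r / 2 - j * H s r) s)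
    (hVc : ∀ r, Continuous fun s => V s r)
    (hH : ∀ s ∈ Icc 0 t, ∀ r ∈ Icc (0 : ℝ) 1, |H s r| ≤ 1 + a)
    (hVH : ∀ s ∈ Icc 0 t, ∀ r ∈ Icc (0 : ℝ) 1, |V s r| - a ≤ V s r * H s r)
    (hVB : ∀ s ∈ Icc 0 t, ∀ r ∈ Icc (0 : ℝ) 1, |V s r - M * (1 - r)| ≤ B * M)
    (hdef : ∀ s ∈ Icc 0 t, ∀ x < N + 1, x ≠ 0 → |defect V W M N s x| ≤ η)
    (hι : meanSqDist V M ξ₀ 0 ≤ ι) (hι0 : 0 ≤ ι)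
    (hD : (eps N * numParticles ξ₀ - M) ^ 2 + 2 * j * eps N * t ≤ D)
    (hZ : 8 * (M + 1 + D + 8 * j) / (N + 1) ≤ Z) :
    ∫⁻ ω, ENNReal.ofReal (meanSqDist V M (Y t ω) t) ∂P ≤
      ENNReal.ofReal (2 * ι + 2 * Z + 4 * (t * ((j * a * (1 + M) + η * M * (1 + B)
        + (j * a + 3 * j * (1 + B) + η) * κ + a * (3 * j + η) ^ 2 / 2)
        + (j * a + 3 * j * (1 + B) + η) / κ * D + 1 / (2 * a) * Z))) := by
  have hr := jumpRates_rate (N := N) hj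
  have he : 0 ≤ eps N := by
    unfold eps
    positivity
  have hD0 : 0 ≤ D := le_trans (by positivity) hD
  have hZ0 : 0 ≤ Z := le_trans (by positivity) hZ
  obtain ⟨c₀, hc₀⟩ : ∃ c₀, c₀ = j * a * (1 + M) + η * M * (1 + B)
        + (j * a + 3 * j * (1 + B) + η) * κ + a * (3 * j + η) ^ 2 / 2 := ⟨_, rfl⟩
  obtain ⟨c₁, hc₁⟩ : ∃ c₁, c₁ = (j * a + 3 * j * (1 + B) + η) / κ := ⟨_, rfl⟩
  obtain ⟨c₂, hc₂⟩ : ∃ c₂, c₂ = 1 / (2 * a) := ⟨_, rfl⟩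
  have hc₀0 : 0 ≤ c₀ := by
    rw [hc₀]
    positivity
  have hc₁0 : 0 ≤ c₁ := by
    rw [hc₁]
    positivity
  have hc₂0 : 0 ≤ c₂ := by
    rw [hc₂]
    positivity
  rw [← hc₀, ← hc₁, ← hc₂]
  have hDs : ∀ s ∈ Icc 0 t, (eps N * numParticles ξ₀ - M) ^ 2 + 2 * j * eps N * s ≤ D :=
    fun s hs => by
      have : 2 * j * eps N * s ≤ 2 * j * eps N * t :=
        mul_le_mul_of_nonneg_left hs.2 (by positivity)
      linarith
  have hZs : ∀ s ∈ Icc 0 t, ∫⁻ ω, ENNReal.ofReal (fluctEnergy j Y s ω) ∂P ≤ ENNReal.ofReal Z :=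
    fun s hs => (lintegral_fluctEnergy_le hN hj hM hY hs.1 (hDs s hs)).trans
      (ENNReal.ofReal_le_ofReal hZ)
  have hmF : ∀ s, Measurable fun ω => ENNReal.ofReal (fluctEnergy j Y s ω) := fun s =>
    ((measurable_fluctEnergy hY).comp (measurable_const.prodMk measurable_id)).ennreal_ofReal
  have hmm : ∀ s, Measurable fun ω => ENNReal.ofReal ((eps N * numParticles (Y s ω) - M) ^ 2) :=
    fun s => (hY.measurable_state (fun ξ => (eps N * numParticles ξ - M) ^ 2) s).ennreal_ofReal
  have hmean : ∀ s ∈ Icc 0 t, ∫⁻ ω, (ENNReal.ofReal c₀ + ENNReal.ofReal c₁ *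
      ENNReal.ofReal ((eps N * numParticles (Y s ω) - M) ^ 2) + ENNReal.ofReal c₂ *
      ENNReal.ofReal (fluctEnergy j Y s ω)) ∂P ≤ ENNReal.ofReal (c₀ + c₁ * D + c₂ * Z) :=
    fun s hs => by
      rw [lintegral_add_right _ ((hmF s).const_mul _), lintegral_add_right _ ((hmm s).const_mul _),
        lintegral_const_mul _ (hmm s), lintegral_const_mul _ (hmF s), lintegral_const,
        measure_univ, mul_one, ENNReal.ofReal_add (by positivity) (by positivity),
        ENNReal.ofReal_add hc₀0 (by positivity), ENNReal.ofReal_mul hc₁0, ENNReal.ofReal_mul hc₂0]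
      gcongr
      · rw [← ofReal_integral_eq_lintegral_ofReal
          (hY.integrable_state hr (abs_mass_sq_le (N := N) M) hs.1)
          (ae_of_all _ fun ω => sq_nonneg _)]
        exact ENNReal.ofReal_le_ofReal
          ((integral_mass_sq_le hN hj hM hY hs.1).trans (hDs s hs))
      · exact hZs s hs
  have hpath : ∀ᵐ ω ∂P, ENNReal.ofReal (meanSqDist V M (Y t ω) t) ≤
      (ENNReal.ofReal (2 * ι) + ENNReal.ofReal 2 * ENNReal.ofReal (fluctEnergy j Y t ω)) +
      ENNReal.ofReal 4 * ∫⁻ s in Ioc 0 t, (ENNReal.ofReal c₀ + ENNReal.ofReal c₁ *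
      ENNReal.ofReal ((eps N * numParticles (Y s ω) - M) ^ 2) + ENNReal.ofReal c₂ *
      ENNReal.ofReal (fluctEnergy j Y s ω)) := by
    have hgr := fun k => abs_pair_le (abs_modeWeight_le hN k)
    have a1 : ∀ᵐ ω ∂P, ∀ k : ℕ, ∀ s ∈ Icc 0 t, ∀ s' ∈ Icc 0 t,
        IntervalIntegrable (fun r => pair (modeWeight N k) (Y r ω)) volume s s' :=
      ae_all_iff.2 fun k => hY.ae_intervalIntegrable hr (hgr k) ht
    have a2 : ∀ᵐ ω ∂P, ∀ k : ℕ, ∀ s ∈ Icc 0 t, ∀ s' ∈ Icc 0 t,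
        IntervalIntegrable (fun r => pair (modeWeight N k) (Y r ω) ^ 2) volume s s' :=
      ae_all_iff.2 fun k => hY.ae_intervalIntegrable hr (f := fun ξ => pair (modeWeight N k) ξ ^ 2)
        (A := 2 ^ 2) (d := 1 * 2) (fun ξ => by
          rw [abs_pow, pow_mul, ← mul_pow]
          exact pow_le_pow_left₀ (abs_nonneg _) (hgr k ξ) 2) ht
    have h0t : (0 : ℝ) ∈ Icc 0 t := ⟨le_rfl, ht⟩
    have htt : t ∈ Icc 0 t := ⟨ht, le_rfl⟩
    filter_upwards [hY.initial, a1, a2,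
      hY.ae_intervalIntegrable hr (abs_mass_sq_le (N := N) M) ht] with ω hω w1 w2 w3
    have h := meanSqDist_le hY hj hM ht ha ha1 hη hB hκ h0 h1 hV hVc hH hVH hVB hdef
      (fun k => w1 k 0 h0t t htt) (fun k => w2 k 0 h0t t htt) (w3 0 h0t t htt)
    rw [hω, ← hc₀, ← hc₁, ← hc₂] at h
    have hFE := fluctEnergy_nonneg (j := j) (Y := Y)
    refine (ENNReal.ofReal_le_ofReal (h.trans (add_le_add (add_le_add
      (mul_le_mul_of_nonneg_left hι zero_le_two) le_rfl) le_rfl))).trans ?_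
    refine ENNReal.ofReal_add_le.trans (add_le_add (ENNReal.ofReal_add_le.trans ?_) ?_)
    · rw [← ENNReal.ofReal_mul zero_le_two]
    · rw [ENNReal.ofReal_mul zero_le_four, intervalIntegral.integral_of_le ht]
      gcongr
      refine (Real.ofReal_le_enorm _).trans ((enorm_integral_le_lintegral_enorm _).trans ?_)
      refine lintegral_mono fun s => ?_
      have p1 : 0 ≤ c₁ * (eps N * numParticles (Y s ω) - M) ^ 2 := by positivity
      have p2 : 0 ≤ c₂ * fluctEnergy j Y s ω := mul_nonneg hc₂0 (hFE s ω)
      rw [Real.enorm_of_nonneg (by positivity), ENNReal.ofReal_add (by positivity) p2,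
        ENNReal.ofReal_add hc₀0 p1, ENNReal.ofReal_mul hc₁0, ENNReal.ofReal_mul hc₂0]
  have hjoint : Measurable fun p : Ω × ℝ => ENNReal.ofReal c₀ + ENNReal.ofReal c₁ *
      ENNReal.ofReal ((eps N * numParticles (Y p.2 p.1) - M) ^ 2) + ENNReal.ofReal c₂ *
      ENNReal.ofReal (fluctEnergy j Y p.2 p.1) :=
    (((((hY.measurable_comp fun ξ => (eps N * numParticles ξ - M) ^ 2).comp
      measurable_swap).ennreal_ofReal).const_mul _).const_add _).add
      ((((measurable_fluctEnergy hY).comp measurable_swap).ennreal_ofReal).const_mul _)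
  refine (lintegral_mono_ae hpath).trans ?_
  rw [lintegral_add_left (((hmF t).const_mul _).const_add _), lintegral_const_mul _
    (Measurable.lintegral_prod_right (ν := volume.restrict (Ioc 0 t)) hjoint),
    lintegral_add_right _ ((hmF t).const_mul _), lintegral_const, measure_univ, mul_one,
    lintegral_const_mul _ (hmF t), lintegral_lintegral_swap hjoint.aemeasurable]
  have hfin : ∫⁻ s in Ioc 0 t, (∫⁻ ω, (ENNReal.ofReal c₀ + ENNReal.ofReal c₁ *
      ENNReal.ofReal ((eps N * numParticles (Y s ω) - M) ^ 2) + ENNReal.ofReal c₂ *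
      ENNReal.ofReal (fluctEnergy j Y s ω)) ∂P) ≤
      ENNReal.ofReal (t * (c₀ + c₁ * D + c₂ * Z)) := by
    refine (setLIntegral_mono' measurableSet_Ioc fun s hs => hmean s ⟨hs.1.le, hs.2⟩).trans ?_
    rw [setLIntegral_const, Real.volume_Ioc, sub_zero, mul_comm, ENNReal.ofReal_mul ht]
  rw [ENNReal.ofReal_add (by positivity) (by positivity),
    ENNReal.ofReal_add (by positivity) (by positivity),
    ENNReal.ofReal_mul (p := 2) (q := Z) zero_le_two,
    ENNReal.ofReal_mul (p := 4) zero_le_four]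
  gcongr
  exact hZs t ⟨ht, le_rfl⟩

end Distance

/-! ### Consistency of the discrete Laplacian -/

lemma abs_second_difference_sub_le {f f' f'' : ℝ → ℝ} (h1 : ∀ r, HasDerivAt f (f' r) r)
    (h2 : ∀ r, HasDerivAt f' (f'' r) r) {r h w : ℝ} (hh : 0 ≤ h)
    (hw : ∀ y ∈ Icc (r - h) (r + h), |f'' y - f'' r| ≤ w) :
    |f (r + h) - 2 * f r + f (r - h) - h ^ 2 * f'' r| ≤ 2 * w * h ^ 2 := by
  have e1 : ∀ u ∈ Icc 0 h, |f' (r + u) - f' (r - u) - 2 * u * f'' r| ≤ 2 * w * h := fun u hu => by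
    have hc : ∀ y, HasDerivAt (fun y => f' y - y * f'' r) (f'' y - f'' r) y := fun y => by
      simpa using (h2 y).fun_sub ((hasDerivAt_id' y).mul_const (f'' r))
    have := (convex_Icc (r - h) (r + h)).norm_image_sub_le_of_norm_hasDerivWithin_le
      (fun y _ => (hc y).hasDerivWithinAt) hw (x := r - u) (y := r + u)
      ⟨by linarith [hu.2], by linarith [hu.1]⟩ ⟨by linarith [hu.1], by linarith [hu.2]⟩
    have hw0 : 0 ≤ w := (abs_nonneg _).trans (hw r ⟨by linarith, by linarith⟩)
    have hu2 : ‖r + u - (r - u)‖ = 2 * u := by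
      rw [Real.norm_eq_abs, show r + u - (r - u) = 2 * u by ring, abs_of_nonneg (by linarith [hu.1])]
    rw [hu2, Real.norm_eq_abs] at this
    calc _ = |f' (r + u) - (r + u) * f'' r - (f' (r - u) - (r - u) * f'' r)| := by
          congr 1
          ring
      _ ≤ w * (2 * u) := this
      _ ≤ 2 * w * h := by nlinarith [hu.2]
  have hc : ∀ u, HasDerivAt (fun u => f (r + u) + f (r - u) - u ^ 2 * f'' r)
      (f' (r + u) - f' (r - u) - 2 * u * f'' r) u := fun u => by
    have d1 := (h1 (r + u)).comp u ((hasDerivAt_id' u).const_add r)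
    have d2 := (h1 (r - u)).comp u ((hasDerivAt_id' u).const_sub r)
    refine ((d1.add d2).fun_sub (((hasDerivAt_id' u).fun_pow 2).mul_const (f'' r))).congr_deriv ?_
    simp
    ring
  have := (convex_Icc 0 h).norm_image_sub_le_of_norm_hasDerivWithin_le
    (fun y _ => (hc y).hasDerivWithinAt) e1 (x := 0) (y := h) ⟨le_rfl, hh⟩ ⟨hh, le_rfl⟩
  simp only [Real.norm_eq_abs, sub_zero, add_zero, abs_of_nonneg hh] at this
  calc _ = |f (r + h) + f (r - h) - h ^ 2 * f'' r - (f r + f r - 0 ^ 2 * f'' r)| := by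
        congr 1
        ring
    _ ≤ 2 * w * h * h := this
    _ = _ := by ring

lemma eventually_abs_defect_le {V VD W : ℝ → ℝ → ℝ} (hW : Continuous (Function.uncurry W))
    (h1 : ∀ s r, HasDerivAt (V s) (VD s r) r) (h2 : ∀ s r, HasDerivAt (VD s) (W s r) r)
    (M T : ℝ) {η : ℝ} (hη : 0 < η) :
    ∀ᶠ N : ℕ in atTop, ∀ s ∈ Icc 0 T, ∀ x < N + 1, x ≠ 0 → |defect V W M N s x| ≤ η := by
  have hK : IsCompact (Icc (0 : ℝ) T ×ˢ Icc (0 : ℝ) 1) := isCompact_Icc.prod isCompact_Icc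
  obtain ⟨C, hC⟩ := hK.exists_bound_of_continuousOn hW.continuousOn
  obtain ⟨δ, hδ, hu⟩ := Metric.uniformContinuousOn_iff.1
    (hK.uniformContinuousOn_of_continuous hW.continuousOn) (η / 2) (by positivity)
  have l1 : Tendsto (fun N : ℕ => 1 / ((N : ℝ) + 1)) atTop (𝓝 0) :=
    tendsto_one_div_add_atTop_nhds_zero_nat
  have l2 : Tendsto (fun N : ℕ => C * (1 / ((N : ℝ) + 1))) atTop (𝓝 0) := by
    simpa using l1.const_mul C
  filter_upwards [l1.eventually_lt_const hδ, l2.eventually_le_const (half_pos hη)]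
    with N hN1 hN2 s hs x hx hx0
  have hn : (0 : ℝ) < (N : ℝ) + 1 := by positivity
  obtain ⟨h, hh⟩ : ∃ h : ℝ, h = 1 / ((N : ℝ) + 1) := ⟨_, rfl⟩
  rw [← hh] at hN1 hN2
  have hh0 : 0 < h := by
    rw [hh]
    positivity
  have hNh : (N : ℝ) * h = 1 - h := by
    rw [hh]
    field_simp
    ring
  have hh1 : h ≤ 1 := by
    rw [hh, div_le_one hn]
    linarith [(Nat.cast_nonneg N : (0 : ℝ) ≤ N)]
  have hx1 : (1 : ℝ) ≤ x := by exact_mod_cast Nat.one_le_iff_ne_zero.2 hx0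
  have hxN : (x : ℝ) ≤ N := by exact_mod_cast Nat.lt_succ_iff.1 hx
  have hr : ∀ b : ℝ, b / ((N : ℝ) + 1) = b * h := fun b => by
    rw [hh]
    ring
  have hrlo : h ≤ x * h := by nlinarith
  have hrhi : x * h ≤ 1 - h := by nlinarith
  have hsd := abs_second_difference_sub_le (h1 s) (h2 s) (r := x * h) (w := η / 2) hh0.le
    (fun y hy => by
      have := hu (s, y) ⟨hs, by linarith [hy.1], by linarith [hy.2]⟩ (s, x * h)
        ⟨hs, by linarith, by linarith⟩ (by
          rw [Prod.dist_eq, dist_self, Real.dist_eq]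
          refine max_lt hδ (lt_of_le_of_lt ?_ hN1)
          rw [abs_le]
          constructor <;> linarith [hy.1, hy.2])
      rw [Real.dist_eq] at this
      exact this.le)
  have hWr : |W s (x * h)| ≤ C := hC (s, x * h) ⟨hs, by linarith, by linarith⟩
  have hcast : ((x - 1 : ℕ) : ℝ) = x - 1 := by
    rw [Nat.cast_sub (Nat.one_le_iff_ne_zero.2 hx0), Nat.cast_one]
  have e : defect V W M N s x = (N : ℝ) ^ 2 / 2 *
      (V s (x * h + h) - 2 * V s (x * h) + V s (x * h - h) - h ^ 2 * W s (x * h))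
      + (((N : ℝ) * h) ^ 2 - 1) * (W s (x * h) / 2) := by
    unfold defect gridProfile
    rw [hcast]
    push_cast
    rw [hr, hr, hr, add_mul, sub_mul, one_mul]
    ring
  rw [e, hNh]
  have p1 : |(N : ℝ) ^ 2 / 2 *
      (V s (x * h + h) - 2 * V s (x * h) + V s (x * h - h) - h ^ 2 * W s (x * h))| ≤ η / 2 := by
    rw [abs_mul, abs_of_nonneg (by positivity)]
    calc _ ≤ (N : ℝ) ^ 2 / 2 * (2 * (η / 2) * h ^ 2) :=
          mul_le_mul_of_nonneg_left hsd (by positivity)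
      _ = η / 2 * ((N : ℝ) * h) ^ 2 := by ring
      _ ≤ η / 2 * 1 := by
          refine mul_le_mul_of_nonneg_left ?_ (by positivity)
          rw [hNh]
          exact pow_le_one₀ (by linarith) (by linarith)
      _ = _ := mul_one _
  have p2 : |((1 - h) ^ 2 - 1) * (W s (x * h) / 2)| ≤ C * h := by
    have : |(1 - h) ^ 2 - 1| ≤ 2 * h := by
      rw [abs_le]
      constructor <;> nlinarith
    rw [abs_mul, abs_div, abs_two]
    calc _ ≤ 2 * h * (C / 2) := by gcongr
      _ = _ := by ring
  exact (abs_add_le _ _).trans (by linarith)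

/-! ### The initial data -/

section Initial

lemma tailCount_eq_tailSum {N : ℕ} (ξ : Config N) (x : Fin (N + 1)) :
    (tailCount ξ x : ℝ) = tailSum ξ x := by
  rw [tailCount, tailSum, Finset.sum_filter]
  push_cast
  rfl

lemma tailSum_sub {N : ℕ} (ξ : Config N) (x l : ℕ) : tailSum ξ x - tailSum ξ (x + l) =
    ∑ y ∈ Finset.univ.filter (fun y : Fin (N + 1) => x ≤ (y : ℕ) ∧ (y : ℕ) < x + l), (ξ y : ℝ) := by
  rw [tailSum, tailSum, ← Finset.sum_sub_distrib, Finset.sum_filter]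
  refine Finset.sum_congr rfl fun y _ => ?_
  split_ifs <;> first | omega | simp

lemma blockLength_bounds {N : ℕ} (hN : 0 < N) : 1 ≤ blockLength N ∧ blockLength N ≤ N ∧
    eps N * blockLength N ≤ eps N ^ (1 / 10 : ℝ) := by
  have hN1 : (1 : ℝ) ≤ N := by exact_mod_cast hN
  have he : 0 < eps N := by
    unfold eps
    positivity
  have he1 : eps N ≤ 1 := by
    unfold eps
    rw [div_le_one (by linarith)]
    exact hN1
  have h1 : 1 ≤ eps N ^ (-(9 / 10) : ℝ) :=
    Real.one_le_rpow_of_pos_of_le_one_of_nonpos he he1 (by norm_num)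
  have h2 : eps N ^ (-(9 / 10) : ℝ) ≤ eps N ^ (-1 : ℝ) :=
    Real.rpow_le_rpow_of_exponent_ge he he1 (by norm_num)
  have h3 : eps N ^ (-1 : ℝ) = N := by
    rw [Real.rpow_neg_one, eps, one_div, inv_inv]
  refine ⟨Nat.le_floor (by simpa using h1), ?_, ?_⟩
  · exact_mod_cast (Nat.floor_le (by linarith)).trans (h2.trans h3.le)
  · calc eps N * blockLength N ≤ eps N * eps N ^ (-(9 / 10) : ℝ) :=
          mul_le_mul_of_nonneg_left (Nat.floor_le (by linarith)) he.le
      _ = eps N ^ (1 + -(9 / 10) : ℝ) := by rw [Real.rpow_add he, Real.rpow_one]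
      _ = _ := by norm_num

/-- Approximation of the block averages gives uniform approximation of the tails. -/
lemma abs_tailSum_sub_le {N : ℕ} (hN : 0 < N) {ξ : Config N} {u : ℝ → ℝ}
    (hξ : Approximates ξ u) (hanti : ∀ x y : ℕ, x ≤ y → tailMass u (eps N * y) ≤ tailMass u (eps N * x))
    (x : ℕ) : |eps N * tailSum ξ x - tailMass u (eps N * x)| ≤
      tailMass u (eps N * (N + 1 - blockLength N : ℕ)) + 3 * eps N ^ (1 / 20 : ℝ) := by
  obtain ⟨hl1, hlN, -⟩ := blockLength_bounds hN
  have hN1 : (1 : ℝ) ≤ N := by exact_mod_cast hN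
  have he : 0 < eps N := by
    unfold eps
    positivity
  have hNe : eps N * N = 1 := by
    unfold eps
    field_simp
  have he1 : eps N ≤ 1 := by nlinarith
  obtain ⟨l, hl⟩ : ∃ l, l = blockLength N := ⟨_, rfl⟩
  obtain ⟨p, hp⟩ : ∃ p, p = eps N ^ (1 / 20 : ℝ) := ⟨_, rfl⟩
  have hp0 : 0 ≤ p := by
    rw [hp]
    positivity
  have hb := hξ.1
  rw [← hl] at hl1 hlN hb ⊢
  rw [← hp] at hb ⊢
  have hl0 : (0 : ℝ) < l := by exact_mod_cast hl1
  have hend : ∀ y : ℕ, N + 1 ≤ y → tailSum ξ y = 0 ∧ tailMass u (eps N * y) = 0 := fun y hy => by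
    constructor
    · refine le_antisymm ?_ (tailSum_nonneg ξ y)
      rw [← tailSum_end ξ]
      exact tailSum_antitone ξ hy
    · have hy' : (N : ℝ) + 1 ≤ y := by exact_mod_cast hy
      rw [tailMass, Icc_eq_empty (by nlinarith), setIntegral_empty]
  have hblock : ∀ y : ℕ, y + l ≤ N + 1 → |eps N * tailSum ξ y - tailMass u (eps N * y)| ≤
      |eps N * tailSum ξ (y + l) - tailMass u (eps N * (y + l : ℕ))| + eps N * l * p := fun y hy => by
    have h := hb y hy
    rw [microAvg, macroAvg, ← tailSum_sub] at h
    have e : eps N * tailSum ξ y - tailMass u (eps N * y) =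
        (eps N * tailSum ξ (y + l) - tailMass u (eps N * (y + l : ℕ))) + eps N * l *
        (1 / (l : ℝ) * (tailSum ξ y - tailSum ξ (y + l)) - 1 / (eps N * (l : ℝ)) *
          (tailMass u (eps N * (y : ℝ)) - tailMass u (eps N * ((y : ℝ) + (l : ℝ))))) := by
      push_cast
      field_simp
      ring
    rw [e]
    refine (abs_add_le _ _).trans (add_le_add le_rfl ?_)
    rw [abs_mul, abs_of_pos (mul_pos he hl0)]
    exact mul_le_mul_of_nonneg_left h (by positivity)
  have hF0 : ∀ y : ℕ, 0 ≤ tailMass u (eps N * y) := fun y => by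
    rw [← (hend (max y (N + 1)) (le_max_right _ _)).2]
    exact hanti _ _ (le_max_left _ _)
  have hel : eps N * l ≤ 1 := by
    rw [← hNe]
    exact mul_le_mul_of_nonneg_left (by exact_mod_cast hlN) he.le
  -- the last block, where both tails are small
  have hlast : ∀ y : ℕ, N + 1 - l ≤ y → |eps N * tailSum ξ y - tailMass u (eps N * y)| ≤
      tailMass u (eps N * (N + 1 - l : ℕ)) + p := fun y hy => by
    have h1 := hblock (N + 1 - l) (by omega)
    rw [Nat.sub_add_cancel (by omega), (hend _ le_rfl).1, (hend _ le_rfl).2, mul_zero, sub_zero,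
      abs_zero, zero_add] at h1
    have h2 := (abs_le.1 h1).2
    have h3 := mul_le_mul_of_nonneg_left (tailSum_antitone ξ hy) he.le
    have h4 := hanti _ _ hy
    have h5 := mul_nonneg he.le (tailSum_nonneg ξ y)
    have h6 := hF0 y
    have h7 := hF0 (N + 1 - l)
    have h8 : eps N * l * p ≤ p := mul_le_of_le_one_left hp0 hel
    rw [abs_le]
    constructor <;> linarith
  have hall : ∀ k y : ℕ, N + 1 - l ≤ y + k → |eps N * tailSum ξ y - tailMass u (eps N * y)| ≤
      tailMass u (eps N * (N + 1 - l : ℕ)) + p + eps N * (k + l) * p := fun k => by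
    induction k using Nat.strong_induction_on with
    | _ k ih =>
      intro y hy
      rcases le_total (N + 1 - l) y with h | h
      · refine (hlast y h).trans (le_add_of_nonneg_right (by positivity))
      · rcases Nat.lt_or_ge k l with hk | hk
        · have h1 := hblock y (by omega)
          have h2 := hlast (y + l) (by omega)
          have h3 : eps N * l * p ≤ eps N * (k + l) * p := by
            gcongr
            linarith [(Nat.cast_nonneg k : (0 : ℝ) ≤ k)]
          linarith
        · have h1 := hblock y (by omega)
          have h2 := ih (k - l) (by omega) (y + l) (by omega)
          rw [Nat.cast_sub hk] at h2
          refine h1.trans ((add_le_add h2 le_rfl).trans (le_of_eq ?_))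
          ring
  have h := hall (N + 1 - l) x (by omega)
  have h9 : eps N * ((N + 1 - l : ℕ) + l : ℝ) * p ≤ 2 * p := by
    refine mul_le_mul_of_nonneg_right ?_ hp0
    rw [Nat.cast_sub (by omega)]
    push_cast
    linarith
  linarith

lemma tendsto_eps : Tendsto eps atTop (𝓝 0) := by
  unfold eps
  exact tendsto_one_div_atTop_nhds_zero_nat

lemma tendsto_eps_rpow {b : ℝ} (hb : 0 < b) : Tendsto (fun N => eps N ^ b) atTop (𝓝 0) := by
  have := tendsto_eps.rpow_const (p := b) (Or.inr hb.le)
  rwa [Real.zero_rpow hb.ne'] at this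

/-- The tails of the initial configurations converge uniformly. -/
lemma eventually_abs_tailSum_sub_le {u : ℝ → ℝ}
    (hu : MemLp u ⊤ (volume.restrict (Icc (0 : ℝ) 1)))
    (hu0 : ∀ᵐ r ∂(volume.restrict (Icc (0 : ℝ) 1)), 0 ≤ u r) {ξ : (N : ℕ) → Config N}
    (hξ : ∀ N : ℕ, 0 < N → Approximates (ξ N) u) {e : ℝ} (he : 0 < e) :
    ∀ᶠ N : ℕ in atTop, ∀ x < N + 1,
      |eps N * tailSum (ξ N) x - tailIntegral u ((x : ℝ) / (N + 1))| ≤ e := by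
  have hcont := continuous_tailIntegral hu
  have hmono := antitone_tailIntegral hu hu0
  have t1 : Tendsto (fun N : ℕ => eps N * (N + 1 - blockLength N : ℕ)) atTop (𝓝 1) := by
    have hlim : Tendsto (fun N : ℕ => eps N * blockLength N) atTop (𝓝 0) := by
      refine squeeze_zero' (Eventually.of_forall fun N => ?_) ?_
        (tendsto_eps_rpow (by norm_num : (0 : ℝ) < 1 / 10))
      · unfold eps
        positivity
      · filter_upwards [eventually_gt_atTop 0] with N hN using (blockLength_bounds hN).2.2
    have := (tendsto_eps.const_add 1).sub hlim
    rw [add_zero, sub_zero] at this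
    refine this.congr' ?_
    filter_upwards [eventually_gt_atTop 0] with N hN
    have hb := (blockLength_bounds hN).2.1
    have hN' : (N : ℝ) ≠ 0 := by positivity
    rw [Nat.cast_sub (by omega)]
    unfold eps
    push_cast
    field_simp
  have t2 : Tendsto (fun N : ℕ => tailIntegral u (eps N * (N + 1 - blockLength N : ℕ))
      + 3 * eps N ^ (1 / 20 : ℝ)) atTop (𝓝 0) := by
    have h1 := ((hcont.tendsto 1).comp t1).add
      ((tendsto_eps_rpow (by norm_num : (0 : ℝ) < 1 / 20)).const_mul 3)
    rw [tailIntegral_one, mul_zero, add_zero] at h1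
    exact h1
  obtain ⟨δ, hδ, huc⟩ := Metric.uniformContinuousOn_iff.1
    (isCompact_Icc.uniformContinuousOn_of_continuous (hcont.continuousOn (s := Icc 0 1)))
    (e / 2) (by positivity)
  filter_upwards [t2.eventually_le_const (half_pos he), tendsto_eps.eventually_lt_const hδ,
    eventually_gt_atTop 0] with N h1 h2 hN x hx
  obtain ⟨hl1, hlN, -⟩ := blockLength_bounds hN
  have hN1 : (1 : ℝ) ≤ N := by exact_mod_cast hN
  have he0 : 0 < eps N := by
    unfold eps
    positivity
  have hNe : eps N * N = 1 := by
    unfold eps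
    field_simp
  have hmem : ∀ y : ℕ, y ≤ N → eps N * y ∈ Icc (0 : ℝ) 1 := fun y hy => by
    have : (y : ℝ) ≤ N := by exact_mod_cast hy
    exact ⟨by positivity, by nlinarith⟩
  have hx' : x ≤ N := Nat.lt_succ_iff.1 hx
  have h3 := abs_tailSum_sub_le hN (hξ N hN) (fun y z hyz => by
    have hyz' : (y : ℝ) ≤ z := by exact_mod_cast hyz
    rcases le_or_gt z N with hz | hz
    · rw [tailMass_eq_tailIntegral u (hmem y (hyz.trans hz)), tailMass_eq_tailIntegral u (hmem z hz)]
      exact hmono (mul_le_mul_of_nonneg_left hyz' he0.le)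
    · have hz' : (N : ℝ) < z := by exact_mod_cast hz
      have : tailMass u (eps N * z) = 0 := by
        rw [tailMass, Icc_eq_empty (by nlinarith), setIntegral_empty]
      rw [this]
      rcases le_or_gt y N with hy | hy
      · rw [tailMass_eq_tailIntegral u (hmem y hy), ← tailIntegral_one (u := u)]
        exact hmono (hmem y hy).2
      · have hy' : (N : ℝ) < y := by exact_mod_cast hy
        rw [tailMass, Icc_eq_empty (by nlinarith), setIntegral_empty]) x
  rw [tailMass_eq_tailIntegral u (hmem x hx'),
    tailMass_eq_tailIntegral u (hmem (N + 1 - blockLength N) (by omega))] at h3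
  have hxN : (x : ℝ) ≤ N := by exact_mod_cast hx'
  have hlin := lin_mem hx
  have h4 := huc (eps N * x) (hmem x hx') ((x : ℝ) / (N + 1))
    ⟨by positivity, by linarith [hlin.1]⟩ (by
      refine lt_of_le_of_lt ?_ h2
      rw [Real.dist_eq]
      have e1 : eps N * x - (x : ℝ) / (N + 1) = eps N * (x / (N + 1)) := by
        unfold eps
        field_simp
        ring
      rw [e1, abs_of_nonneg (by positivity)]
      exact mul_le_of_le_one_right he0.le (by linarith [hlin.1]))
  rw [Real.dist_eq] at h4
  have := abs_add_le (eps N * tailSum (ξ N) x - tailIntegral u (eps N * x))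
    (tailIntegral u (eps N * x) - tailIntegral u ((x : ℝ) / (N + 1)))
  rw [sub_add_sub_cancel] at this
  linarith

end Initial

/-! ### From the mean square distance to uniform convergence in probability -/

section Uniform

variable {N : ℕ} {ξ : Config N} {V : ℝ → ℝ → ℝ} {U : ℝ → ℝ} {M t ζ κ : ℝ}

/-- If the mean square distance is small, then any `κ N` sites include one with a small distance. -/
lemma exists_close_site (hN : 0 < N) (hζ : 0 < ζ) (hκ : 0 < κ)
    (hd : meanSqDist V M ξ t < κ * ζ ^ 2 / 8) {s : Finset ℕ} (hs : ∀ y ∈ s, y < N + 1)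
    (hcard : κ * N ≤ s.card) :
    ∃ y ∈ s, |centredTail ξ y - gridProfile V M N t y| ≤ ζ / 2 := by
  have hN1 : (1 : ℝ) ≤ N := by exact_mod_cast hN
  by_contra hcon
  simp only [not_exists, not_and, not_le] at hcon
  refine absurd hd (not_lt.2 ?_)
  have h1 : (s.card : ℝ) * (ζ / 2) ^ 2 ≤
      ∑ x ∈ Finset.range (N + 1), (centredTail ξ x - gridProfile V M N t x) ^ 2 := by
    calc (s.card : ℝ) * (ζ / 2) ^ 2 = ∑ _x ∈ s, (ζ / 2) ^ 2 := by simp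
      _ ≤ ∑ x ∈ s, (centredTail ξ x - gridProfile V M N t x) ^ 2 :=
          Finset.sum_le_sum fun y hy => by
            rw [← sq_abs (centredTail ξ y - _)]
            exact pow_le_pow_left₀ (by positivity) (hcon y hy).le 2
      _ ≤ _ := Finset.sum_le_sum_of_subset_of_nonneg
          (fun y hy => Finset.mem_range.2 (hs y hy)) fun _ _ _ => sq_nonneg _
  rw [meanSqDist, one_div, ← div_eq_inv_mul, le_div_iff₀ (by positivity)]
  refine le_trans ?_ h1
  refine le_trans ?_ (mul_le_mul_of_nonneg_right hcard (by positivity))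
  have : 0 < κ * ζ ^ 2 := by positivity
  nlinarith

/-- By monotonicity of the tails, closeness at most sites is closeness at all sites. -/
lemma abs_tail_sub_le_of_meanSqDist_lt (hN : 0 < N) (hζ : 0 < ζ) (hκ : 0 < κ) (hκN : 1 ≤ κ * N)
    (hU : ∀ r ∈ Icc (0 : ℝ) 1, ∀ r' ∈ Icc (0 : ℝ) 1, |r - r'| ≤ 2 * κ → |U r - U r'| ≤ ζ / 8)
    (hU1 : U 1 = 0) (hV0 : V t 0 = M) (hVU : ∀ r ∈ Icc (0 : ℝ) 1, |V t r - U r| ≤ ζ / 8)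
    (hm : |eps N * numParticles ξ - M| ≤ ζ / 8) (hd : meanSqDist V M ξ t < κ * ζ ^ 2 / 8)
    {x : ℕ} (hx : x < N + 1) : |eps N * tailSum ξ x - U (eps N * x)| ≤ ζ := by
  have hN1 : (1 : ℝ) ≤ N := by exact_mod_cast hN
  have he : 0 < eps N := by
    unfold eps
    positivity
  have hNe : N * eps N = 1 := by
    unfold eps
    field_simp
  have heκ : eps N ≤ κ := by nlinarith
  have hxN : x ≤ N := Nat.lt_succ_iff.1 hx
  have hmem : ∀ y : ℕ, y < N + 1 → eps N * y ∈ Icc (0 : ℝ) 1 := fun y hy => by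
    have : (y : ℝ) ≤ N := by exact_mod_cast Nat.lt_succ_iff.1 hy
    exact ⟨by positivity, by nlinarith⟩
  have hmem' : ∀ y : ℕ, y < N + 1 → (y : ℝ) / (N + 1) ∈ Icc (0 : ℝ) 1 := fun y hy =>
    ⟨by positivity, by linarith [(lin_mem hy).1]⟩
  obtain ⟨K, hK⟩ : ∃ K, K = ⌊κ * N⌋₊ := ⟨_, rfl⟩
  have hKle : (K : ℝ) ≤ κ * N := hK ▸ Nat.floor_le (by positivity)
  have hKlt : κ * N < K + 1 := hK ▸ Nat.lt_floor_add_one _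
  -- the profile at nearby sites
  have hclose : ∀ y : ℕ, y < N + 1 → |(x : ℝ) - y| ≤ K →
      |U (eps N * x) - U ((y : ℝ) / (N + 1))| ≤ ζ / 8 := fun y hy hxy => by
    refine hU _ (hmem x hx) _ (hmem' y hy) ?_
    have e1 : eps N * x - (y : ℝ) / (N + 1) =
        eps N * (x - y) + eps N * (y / (N + 1)) := by
      unfold eps
      field_simp
      ring
    rw [e1]
    refine (abs_add_le _ _).trans ?_
    rw [abs_mul, abs_mul, abs_of_pos he, abs_of_nonneg (hmem' y hy).1]
    have h1 : eps N * |(x : ℝ) - y| ≤ eps N * (κ * N) :=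
      mul_le_mul_of_nonneg_left (hxy.trans hKle) he.le
    have h2 : eps N * (y / (N + 1)) ≤ eps N * 1 := mul_le_mul_of_nonneg_left (hmem' y hy).2 he.le
    have h3 : eps N * (κ * N) = κ := by
      rw [mul_left_comm, mul_comm (eps N), hNe, mul_one]
    linarith
  -- the distance at a good site
  have hgood : ∀ y : ℕ, y < N + 1 → |centredTail ξ y - gridProfile V M N t y| ≤ ζ / 2 →
      |eps N * tailSum ξ y - U ((y : ℝ) / (N + 1))| ≤ 3 * ζ / 4 := fun y hy hyg => by
    have h1 := hVU _ (hmem' y hy)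
    have e1 : eps N * tailSum ξ y - U ((y : ℝ) / (N + 1)) =
        (centredTail ξ y - gridProfile V M N t y)
        + (1 - (y : ℝ) / (N + 1)) * (eps N * numParticles ξ - M)
        + (V t ((y : ℝ) / (N + 1)) - U ((y : ℝ) / (N + 1))) := by
      rw [centredTail, gridProfile, tailSum_zero]
      ring
    have h2 : |(1 - (y : ℝ) / (N + 1)) * (eps N * numParticles ξ - M)| ≤ ζ / 8 := by
      obtain ⟨l0, l1⟩ := lin_mem hy
      rw [abs_mul, abs_of_nonneg l0]
      exact (mul_le_of_le_one_left (abs_nonneg _) l1).trans hm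
    rw [e1]
    refine (abs_add_le _ _).trans ?_
    have := abs_add_le (centredTail ξ y - gridProfile V M N t y)
      ((1 - (y : ℝ) / (N + 1)) * (eps N * numParticles ξ - M))
    linarith
  have h0 := abs_le.1 (hVU 0 ⟨le_rfl, zero_le_one⟩)
  rw [hV0] at h0
  have hm' := abs_le.1 hm
  rw [abs_le]
  constructor
  · -- the sites to the right of `x`
    rcases le_or_gt (x + K) N with hxK | hxK
    · obtain ⟨y, hy, hyg⟩ := exists_close_site hN hζ hκ hd (s := Finset.Icc x (x + K))
        (fun y hy => by
          have := (Finset.mem_Icc.1 hy).2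
          omega) (by
          rw [Nat.card_Icc, show x + K + 1 - x = K + 1 by omega]
          push_cast
          exact hKlt.le)
      obtain ⟨hy1, hy2⟩ := Finset.mem_Icc.1 hy
      have hy1' : (x : ℝ) ≤ y := by exact_mod_cast hy1
      have hy2' : (y : ℝ) ≤ x + K := by exact_mod_cast hy2
      have a1 := abs_le.1 (hclose y (by omega) (by rw [abs_le]; constructor <;> linarith))
      have a2 := abs_le.1 (hgood y (by omega) hyg)
      have a3 := mul_le_mul_of_nonneg_left (tailSum_antitone ξ hy1) he.le
      linarith
    · have hxK' : (N : ℝ) ≤ x + K := by exact_mod_cast hxK.le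
      have a1 := hU _ (hmem x hx) 1 ⟨zero_le_one, le_rfl⟩ (by
        have h1 := (hmem x hx).2
        have : N * eps N ≤ (x + K) * eps N := mul_le_mul_of_nonneg_right hxK' he.le
        have h3 : eps N * K ≤ eps N * (κ * N) := mul_le_mul_of_nonneg_left hKle he.le
        have h4 : eps N * (κ * N) = κ := by
          rw [mul_left_comm, mul_comm (eps N), hNe, mul_one]
        rw [abs_le]
        constructor <;> nlinarith)
      rw [hU1, sub_zero] at a1
      have a2 := mul_nonneg he.le (tailSum_nonneg ξ x)
      linarith [(abs_le.1 a1).2]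
  · -- the sites to the left of `x`
    rcases le_or_gt K x with hxK | hxK
    · obtain ⟨y, hy, hyg⟩ := exists_close_site hN hζ hκ hd (s := Finset.Icc (x - K) x)
        (fun y hy => by
          have := (Finset.mem_Icc.1 hy).2
          omega) (by
          rw [Nat.card_Icc, show x + 1 - (x - K) = K + 1 by omega]
          push_cast
          exact hKlt.le)
      obtain ⟨hy1, hy2⟩ := Finset.mem_Icc.1 hy
      have hy1' : (x : ℝ) ≤ y + K := by exact_mod_cast (by omega : x ≤ y + K)
      have hy2' : (y : ℝ) ≤ x := by exact_mod_cast hy2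
      have a1 := abs_le.1 (hclose y (by omega) (by rw [abs_le]; constructor <;> linarith))
      have a2 := abs_le.1 (hgood y (by omega) hyg)
      have a3 := mul_le_mul_of_nonneg_left (tailSum_antitone ξ hy2) he.le
      linarith
    · have hxK' : (x : ℝ) ≤ K := by exact_mod_cast hxK.le
      have a1 := abs_le.1 (hU 0 ⟨le_rfl, zero_le_one⟩ _ (hmem x hx) (by
        have h1 := (hmem x hx).1
        have h3 : eps N * x ≤ eps N * (κ * N) :=
          mul_le_mul_of_nonneg_left (hxK'.trans hKle) he.le
        have h4 : eps N * (κ * N) = κ := by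
          rw [mul_left_comm, mul_comm (eps N), hNe, mul_one]
        rw [zero_sub, abs_neg, abs_of_nonneg h1]
        linarith))
      have a2 := mul_le_mul_of_nonneg_left (tailSum_le ξ x) he.le
      linarith

/-- Markov's inequality for the event that the tails are not uniformly close to the profile. -/
lemma measure_not_close_le {Ω : Type*} [MeasurableSpace Ω] {P : Measure Ω} {Y : Ω → Config N}
    (hN : 0 < N) (hζ : 0 < ζ) (hκ : 0 < κ) (hκN : 1 ≤ κ * N)
    (hm1 : Measurable fun ω => ENNReal.ofReal (meanSqDist V M (Y ω) t))
    (hm2 : Measurable fun ω => ENNReal.ofReal ((eps N * numParticles (Y ω) - M) ^ 2))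
    (hU : ∀ r ∈ Icc (0 : ℝ) 1, ∀ r' ∈ Icc (0 : ℝ) 1, |r - r'| ≤ 2 * κ → |U r - U r'| ≤ ζ / 8)
    (hU1 : U 1 = 0) (hV0 : V t 0 = M) (hVU : ∀ r ∈ Icc (0 : ℝ) 1, |V t r - U r| ≤ ζ / 8)
    {p q : ℝ} (hp : 0 ≤ p) (hq : 0 ≤ q)
    (h1 : ∫⁻ ω, ENNReal.ofReal (meanSqDist V M (Y ω) t) ∂P ≤ ENNReal.ofReal (p * (κ * ζ ^ 2 / 8)))
    (h2 : ∫⁻ ω, ENNReal.ofReal ((eps N * numParticles (Y ω) - M) ^ 2) ∂P ≤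
      ENNReal.ofReal (q * (ζ / 8) ^ 2)) :
    P {ω | ∀ x : Fin (N + 1), |eps N * (tailCount (Y ω) x : ℝ) - U (eps N * ((x : ℕ) : ℝ))| ≤ ζ}ᶜ ≤
      ENNReal.ofReal (p + q) := by
  have hc1 : 0 < κ * ζ ^ 2 / 8 := by positivity
  have hc2 : 0 < (ζ / 8) ^ 2 := by positivity
  have hsub : {ω | ∀ x : Fin (N + 1),
      |eps N * (tailCount (Y ω) x : ℝ) - U (eps N * ((x : ℕ) : ℝ))| ≤ ζ}ᶜ ⊆
      {ω | ENNReal.ofReal (κ * ζ ^ 2 / 8) ≤ ENNReal.ofReal (meanSqDist V M (Y ω) t)} ∪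
      {ω | ENNReal.ofReal ((ζ / 8) ^ 2) ≤
        ENNReal.ofReal ((eps N * numParticles (Y ω) - M) ^ 2)} := by
    intro ω hω
    by_contra hcon
    rw [mem_union, not_or, mem_ofPred_eq, mem_ofPred_eq, not_le, not_le,
      ENNReal.ofReal_lt_ofReal_iff hc1, ENNReal.ofReal_lt_ofReal_iff hc2] at hcon
    refine hω fun x => ?_
    rw [tailCount_eq_tailSum]
    exact abs_tail_sub_le_of_meanSqDist_lt hN hζ hκ hκN hU hU1 hV0 hVU
      (abs_le_of_sq_le_sq hcon.2.le (by positivity)) hcon.1 x.2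
  have hmark : ∀ {g : Ω → ℝ≥0∞} {b c : ℝ}, Measurable g → 0 ≤ b → 0 < c →
      ∫⁻ ω, g ω ∂P ≤ ENNReal.ofReal (b * c) →
      P {ω | ENNReal.ofReal c ≤ g ω} ≤ ENNReal.ofReal b := fun {g b c} hg hb hc h => by
    refine (meas_ge_le_lintegral_div hg.aemeasurable (ENNReal.ofReal_pos.2 hc).ne'
      ENNReal.ofReal_ne_top).trans ?_
    refine ENNReal.div_le_of_le_mul ?_
    rwa [← ENNReal.ofReal_mul hb]
  refine (measure_mono hsub).trans ((measure_union_le _ _).trans ?_)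
  rw [ENNReal.ofReal_add hp hq]
  exact add_le_add (hmark hm1 hp hc1 h1) (hmark hm2 hq hc2 h2)

end Uniform

/-! ### The hydrodynamic limit -/

section Limit

variable {j c e T m B : ℝ} {u : ℝ → ℝ} {k : ℝ → ℝ → ℝ} {ξ : (N : ℕ) → Config N}

/-- The deviation of the rescaled number of particles from the mass of the profile. -/
lemma tendsto_mass_bound (hu : MemLp u ⊤ (volume.restrict (Icc (0 : ℝ) 1)))
    (hu0 : ∀ᵐ r ∂(volume.restrict (Icc (0 : ℝ) 1)), 0 ≤ u r)
    (hξ : ∀ N : ℕ, 0 < N → Approximates (ξ N) u) (j T : ℝ) :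
    Tendsto (fun N => (eps N * numParticles (ξ N) - tailIntegral u 0) ^ 2 + 2 * j * eps N * T)
      atTop (𝓝 0) := by
  have h1 : Tendsto (fun N => eps N * numParticles (ξ N) - tailIntegral u 0) atTop (𝓝 0) := by
    rw [Metric.tendsto_nhds]
    intro e he
    filter_upwards [eventually_abs_tailSum_sub_le hu hu0 hξ (half_pos he)] with N hN
    have := hN 0 (Nat.succ_pos N)
    rw [tailSum_zero, Nat.cast_zero, zero_div] at this
    rw [Real.dist_eq, sub_zero]
    linarith
  have h2 := (h1.pow 2).add ((tendsto_eps.const_mul (2 * j)).mul_const T)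
  simpa using h2

lemma eventually_meanSqDist_initial_le (hu : MemLp u ⊤ (volume.restrict (Icc (0 : ℝ) 1)))
    (hu0 : ∀ᵐ r ∂(volume.restrict (Icc (0 : ℝ) 1)), 0 ≤ u r)
    (hξ : ∀ N : ℕ, 0 < N → Approximates (ξ N) u) (he : 0 < e)
    (h : IsApprox j (tailIntegral u 0) c (tailDatum j c u) e T m k) :
    ∀ᶠ N in atTop, meanSqDist (approxV j (tailIntegral u 0) c m (tailDatum j c u) k)
      (tailIntegral u 0) (ξ N) 0 ≤ (3 * e) ^ 2 := by
  filter_upwards [eventually_abs_tailSum_sub_le hu hu0 hξ he] with N hN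
  have hx : ∀ x ∈ Finset.range (N + 1), (centredTail (ξ N) x - gridProfile
      (approxV j (tailIntegral u 0) c m (tailDatum j c u) k) (tailIntegral u 0) N 0 x) ^ 2 ≤
      (3 * e) ^ 2 := fun x hx => by
    have hx := Finset.mem_range.1 hx
    obtain ⟨l0, l1⟩ := lin_mem hx
    have b1 := hN x hx
    have b2 := hN 0 (Nat.succ_pos N)
    rw [Nat.cast_zero, zero_div] at b2
    have b3 := approxV_initial_sub h ((x : ℝ) / (N + 1))
    rw [refProfile_add_tailDatum ⟨by positivity, by linarith⟩, abs_sub_comm] at b3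
    have b4 : |(1 - (x : ℝ) / (N + 1)) * (eps N * tailSum (ξ N) 0 - tailIntegral u 0)| ≤ e := by
      rw [abs_mul, abs_of_nonneg l0]
      exact (mul_le_of_le_one_left (abs_nonneg _) l1).trans b2
    rw [← sq_abs]
    refine pow_le_pow_left₀ (abs_nonneg _) ?_ 2
    have b1' := abs_le.1 b1
    have b3' := abs_le.1 b3
    have b4' := abs_le.1 b4
    rw [centredTail, gridProfile, abs_le]
    constructor <;> linarith
  have := Finset.sum_le_sum hx
  rw [Finset.sum_const, Finset.card_range, nsmul_eq_mul] at this
  rw [meanSqDist, one_div, inv_mul_le_iff₀ (by positivity)]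
  refine this.trans (le_of_eq ?_)
  push_cast
  ring

/-- In the limit only the error `e` of the approximate solution remains. -/
lemma eventually_lintegral_meanSqDist_le (hj : 0 < j)
    (hu : MemLp u ⊤ (volume.restrict (Icc (0 : ℝ) 1)))
    (hu0 : ∀ᵐ r ∂(volume.restrict (Icc (0 : ℝ) 1)), 0 ≤ u r)
    (hξ : ∀ N : ℕ, 0 < N → Approximates (ξ N) u)
    {Ω : ℕ → Type*} [∀ N, MeasurableSpace (Ω N)] {P : (N : ℕ) → Measure (Ω N)}
    [∀ N, IsProbabilityMeasure (P N)] {Y : (N : ℕ) → ℝ → Ω N → Config N}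
    (hY : ∀ N : ℕ, 0 < N → IsJumpProcess (rate j) jump (ξ N) (P N) (Y N))
    (hT : 0 ≤ T) (he : 0 < e) (he1 : e ≤ 1)
    (h : IsApprox j (tailIntegral u 0) c (tailDatum j c u) e T m k)
    (hB : ∀ t ∈ Icc 0 T, ∀ r ∈ Icc (0 : ℝ) 1,
      |approxV j (tailIntegral u 0) c m (tailDatum j c u) k t r
        - tailIntegral u 0 * (1 - r)| ≤ B * tailIntegral u 0)
    {δ : ℝ} (hδ : 2 * (3 * e) ^ 2 + 4 * (T * (j * e * (1 + tailIntegral u 0)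
      + e * (3 * j) ^ 2 / 2)) < δ) :
    ∀ᶠ N in atTop, ∫⁻ ω, ENNReal.ofReal (meanSqDist
      (approxV j (tailIntegral u 0) c m (tailDatum j c u) k) (tailIntegral u 0) (Y N T ω) T) ∂(P N)
      ≤ ENNReal.ofReal δ := by
  have hM : 0 ≤ tailIntegral u 0 := by
    have := antitone_tailIntegral hu hu0 (zero_le_one (α := ℝ))
    rwa [tailIntegral_one] at this
  obtain ⟨hX, -⟩ := isDatum_tailDatum (j := j) (c := c) hu
  obtain ⟨M, hMdef⟩ : ∃ M, M = tailIntegral u 0 := ⟨_, rfl⟩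
  have hmass := tendsto_mass_bound hu hu0 hξ j T
  have hinit := eventually_meanSqDist_initial_le hu hu0 hξ he h
  simp only [← hMdef] at hM h hB hδ hmass hinit ⊢
  obtain ⟨V, hVdef⟩ : ∃ V, V = approxV j M c m (tailDatum j c u) k := ⟨_, rfl⟩
  have hVH := h.sign
  simp only [← hVdef] at hB hVH hinit ⊢
  have hB' : ∀ t ∈ Icc 0 T, ∀ r ∈ Icc (0 : ℝ) 1, |V t r - M * (1 - r)| ≤ |B| * M :=
    fun t ht r hr => (hB t ht r hr).trans (mul_le_mul_of_nonneg_right (le_abs_self B) hM)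
  -- the consistency error and the cutoff for the mass are chosen small
  have hF : Tendsto (fun s : ℝ => 2 * (3 * e) ^ 2 + 2 * 0 + 4 * (T * ((j * e * (1 + M)
      + s * M * (1 + |B|) + (j * e + 3 * j * (1 + |B|) + s) * s + e * (3 * j + s) ^ 2 / 2)
      + 0 + 1 / (2 * e) * 0))) (𝓝[>] 0) (𝓝 (2 * (3 * e) ^ 2 + 2 * 0 + 4 * (T * ((j * e * (1 + M)
      + 0 * M * (1 + |B|) + (j * e + 3 * j * (1 + |B|) + 0) * 0 + e * (3 * j + 0) ^ 2 / 2)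
      + 0 + 1 / (2 * e) * 0)))) := by
    refine tendsto_nhdsWithin_of_tendsto_nhds (Continuous.tendsto ?_ 0)
    fun_prop
  obtain ⟨s, hs, hs0⟩ := ((hF.eventually_lt_const (u := δ) (by
    simp only [zero_mul, mul_zero, add_zero]
    exact hδ)).and self_mem_nhdsWithin).exists
  have hs0 : 0 < s := hs0
  have hZ : Tendsto (fun N => 8 * (M + 1 + ((eps N * numParticles (ξ N) - M) ^ 2
      + 2 * j * eps N * T) + 8 * j) / ((N : ℝ) + 1)) atTop (𝓝 0) := by
    have h1 := (((hmass.const_add (M + 1)).add_const (8 * j)).const_mul 8).mul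
      tendsto_one_div_add_atTop_nhds_zero_nat
    rw [mul_zero] at h1
    refine h1.congr fun N => ?_
    rw [mul_one_div]
  have hG := ((hZ.const_mul 2).const_add (2 * (3 * e) ^ 2)).add ((((((hmass.const_mul
    ((j * e + 3 * j * (1 + |B|) + s) / s)).const_add (j * e * (1 + M)
      + s * M * (1 + |B|) + (j * e + 3 * j * (1 + |B|) + s) * s + e * (3 * j + s) ^ 2 / 2)).add
      (hZ.const_mul (1 / (2 * e))))).const_mul T).const_mul 4)
  rw [mul_zero ((j * e + 3 * j * (1 + |B|) + s) / s)] at hG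
  filter_upwards [hG.eventually_lt_const hs, hinit, eventually_gt_atTop 0,
    eventually_abs_defect_le (continuous_approxVDD (j := j) (c := c) hX h.source h.pos)
      (hasDerivAt_approxV (M := M) hX h.source h.pos) (hasDerivAt_approxVD hX h.source h.pos)
      M T hs0] with N h1 h2 h3 h4
  rw [← hVdef] at h4
  refine (lintegral_meanSqDist_le (hY N h3) h3 hj hM hT he he1 hs0.le (abs_nonneg B) hs0
    (fun s => ?_) (fun s => ?_) (fun s hs r => ?_) (fun r => ?_) h.abs_le hVH hB' h4
    h2 (sq_nonneg _) le_rfl le_rfl).trans (ENNReal.ofReal_le_ofReal h1.le)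
  · rw [hVdef]
    exact approxV_at_zero hX h.source s
  · rw [hVdef]
    exact approxV_at_one hX h.source s
  · rw [hVdef]
    exact hasDerivAt_approxV_time hX h.source h.pos hs r
  · rw [hVdef]
    exact (continuous_approxV hX h.source h.pos).comp (by fun_prop : Continuous fun s : ℝ => (s, r))

lemma eventually_lintegral_mass_sq_le (hj : 0 < j)
    (hu : MemLp u ⊤ (volume.restrict (Icc (0 : ℝ) 1)))
    (hu0 : ∀ᵐ r ∂(volume.restrict (Icc (0 : ℝ) 1)), 0 ≤ u r)
    (hξ : ∀ N : ℕ, 0 < N → Approximates (ξ N) u)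
    {Ω : ℕ → Type*} [∀ N, MeasurableSpace (Ω N)] {P : (N : ℕ) → Measure (Ω N)}
    [∀ N, IsProbabilityMeasure (P N)] {Y : (N : ℕ) → ℝ → Ω N → Config N}
    (hY : ∀ N : ℕ, 0 < N → IsJumpProcess (rate j) jump (ξ N) (P N) (Y N))
    (hT : 0 ≤ T) {δ : ℝ} (hδ : 0 < δ) :
    ∀ᶠ N in atTop, ∫⁻ ω, ENNReal.ofReal ((eps N * numParticles (Y N T ω) - tailIntegral u 0) ^ 2)
      ∂(P N) ≤ ENNReal.ofReal δ := by
  have hM : 0 ≤ tailIntegral u 0 := by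
    have := antitone_tailIntegral hu hu0 (zero_le_one (α := ℝ))
    rwa [tailIntegral_one] at this
  filter_upwards [(tendsto_mass_bound hu hu0 hξ j T).eventually_le_const hδ,
    eventually_gt_atTop 0] with N h1 h2
  rw [← ofReal_integral_eq_lintegral_ofReal ((hY N h2).integrable_state (jumpRates_rate hj)
    (abs_mass_sq_le (N := N) (tailIntegral u 0)) hT) (ae_of_all _ fun ω => sq_nonneg _)]
  exact ENNReal.ofReal_le_ofReal ((integral_mass_sq_le h2 hj hM (hY N h2) hT).trans h1)

lemma continuousOn_tailMass {v : ℝ → ℝ} (hv : ContinuousOn v (Icc 0 1)) :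
    ContinuousOn (tailMass v) (Icc 0 1) := by
  obtain ⟨C, hC⟩ := isCompact_Icc.exists_bound_of_continuousOn hv
  have h : MemLp v ⊤ (volume.restrict (Icc (0 : ℝ) 1)) :=
    memLp_top_of_bound (hv.aestronglyMeasurable measurableSet_Icc) C
      ((ae_restrict_iff' measurableSet_Icc).2 (ae_of_all _ hC))
  exact (continuous_tailIntegral h).continuousOn.congr fun r hr => tailMass_eq_tailIntegral v hr

lemma tendsto_measure_one_of_compl {Ω : ℕ → Type*} [∀ N, MeasurableSpace (Ω N)]
    {P : (N : ℕ) → Measure (Ω N)} [∀ N, IsProbabilityMeasure (P N)] {s : ∀ N, Set (Ω N)}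
    (h : Tendsto (fun N => P N (s N)ᶜ) atTop (𝓝 0)) :
    Tendsto (fun N => P N (s N)) atTop (𝓝 1) := by
  have h1 := ENNReal.Tendsto.sub (tendsto_const_nhds (x := (1 : ℝ≥0∞)) (f := atTop)) h
    (Or.inl ENNReal.one_ne_top)
  rw [tsub_zero] at h1
  refine tendsto_of_tendsto_of_tendsto_of_le_of_le h1 tendsto_const_nhds (fun N => ?_)
    (fun N => prob_le_one)
  rw [tsub_le_iff_right, ← measure_univ (μ := P N), ← union_compl_self (s N)]
  exact measure_union_le _ _

end Limit

end TopReservoir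

open TopReservoir
theorem theorem2p1
    (j : ℝ) (hj : 0 < j)
    (ρinit : ℝ → ℝ)
    (hρ_bdd : MemLp ρinit ⊤ (volume.restrict (Icc (0 : ℝ) 1)))
    (hρ_nonneg : ∀ᵐ r ∂(volume.restrict (Icc (0 : ℝ) 1)), 0 ≤ ρinit r)
    (ξ : (N : ℕ) → Config N)
    (hξ : ∀ N : ℕ, 0 < N → Approximates (ξ N) ρinit) :
    ∃ ρ : ℝ → ℝ → ℝ,
      (∀ r ∈ Icc (0 : ℝ) 1, ∀ t : ℝ, 0 < t → 0 ≤ ρ r t) ∧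
      ContinuousOn (fun p : ℝ × ℝ => ρ p.1 p.2) (Icc (0 : ℝ) 1 ×ˢ Ioi (0 : ℝ)) ∧
      (∀ r ∈ Icc (0 : ℝ) 1,
        Tendsto (fun t : ℝ => tailMass (fun r' => ρ r' t) r) (𝓝[>] 0)
          (𝓝 (tailMass ρinit r))) ∧
      (∀ (Ω : ℕ → Type*) [∀ N, MeasurableSpace (Ω N)]
          (P : (N : ℕ) → Measure (Ω N)) [∀ N, IsProbabilityMeasure (P N)]
          (X : (N : ℕ) → ℝ≥0 → Ω N → Config N),
        (∀ N : ℕ, 0 < N → IsParticleProcess j (ξ N) (P N) (X N)) →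
        ∀ t : ℝ≥0, 0 < t → ∀ ζ : ℝ, 0 < ζ →
          Tendsto (fun N : ℕ => P N {ω | ∀ x : Fin (N + 1),
              |eps N * (tailCount (X N ((N : ℝ≥0) ^ 2 * t) ω) x : ℝ)
                - tailMass (fun r => ρ r (t : ℝ)) (eps N * ((x : ℕ) : ℝ))| ≤ ζ})
            atTop (𝓝 1)) ∧
      (ContinuousOn ρinit (Icc (0 : ℝ) 1) →
        ContinuousOn (fun p : ℝ × ℝ => ρ p.1 p.2) (Icc (0 : ℝ) 1 ×ˢ Ici (0 : ℝ)) ∧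
        ∀ r ∈ Icc (0 : ℝ) 1, ρ r 0 = ρinit r) := by
  obtain ⟨ρ, c, hnn, hcont, hlim, hinit, happ⟩ := exists_profile hj hρ_bdd hρ_nonneg
  refine ⟨ρ, hnn, hcont, hlim, ?_, hinit⟩
  intro Ω _ P _ X hX t ht ζ hζ
  have ht' : (0 : ℝ) < t := NNReal.coe_pos.2 ht
  have hY : ∀ N : ℕ, 0 < N → IsJumpProcess (rate j) jump (ξ N) (P N) (speedUp (X N)) :=
    fun N hN => (hX N hN).isJumpProcess_speedUp hN hj
  have hXY : ∀ N ω, X N ((N : ℝ≥0) ^ 2 * t) ω = speedUp (X N) (t : ℝ) ω := fun N ω => by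
    rw [speedUp, Real.toNNReal_coe]
  simp only [hXY]
  set U : ℝ → ℝ := tailMass (fun r => ρ r (t : ℝ)) with hU
  have hρt : ContinuousOn (fun r => ρ r (t : ℝ)) (Icc 0 1) :=
    hcont.comp (by fun_prop : Continuous fun r : ℝ => (r, (t : ℝ))).continuousOn
      fun r hr => ⟨hr, ht'⟩
  obtain ⟨η, hη, huc⟩ := Metric.uniformContinuousOn_iff.1
    (isCompact_Icc.uniformContinuousOn_of_continuous (continuousOn_tailMass hρt))
    (ζ / 8) (by positivity)
  obtain ⟨κ, hκ⟩ : ∃ κ, κ = η / 3 := ⟨_, rfl⟩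
  have hκ0 : 0 < κ := by
    rw [hκ]
    positivity
  have hUc : ∀ r ∈ Icc (0 : ℝ) 1, ∀ r' ∈ Icc (0 : ℝ) 1, |r - r'| ≤ 2 * κ →
      |U r - U r'| ≤ ζ / 8 := fun r hr r' hr' hrr => by
    have := huc r hr r' hr' (by
      rw [Real.dist_eq]
      linarith)
    rw [Real.dist_eq] at this
    exact this.le
  have hU1 : U 1 = 0 := by simp [hU, tailMass]
  refine tendsto_measure_one_of_compl (ENNReal.tendsto_nhds_zero.2 fun b hb => ?_)
  obtain ⟨b', hb0, hb', hbb⟩ := ENNReal.lt_iff_exists_real_btwn.1 hb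
  have hb'0 : 0 < b' := ENNReal.ofReal_pos.1 hb'
  -- the error of the approximate solution is small compared with the bounds wanted
  have hF : Tendsto (fun e : ℝ => 2 * (3 * e) ^ 2 + 4 * ((t : ℝ) * (j * e *
      (1 + tailIntegral ρinit 0) + e * (3 * j) ^ 2 / 2))) (𝓝[>] 0) (𝓝 (2 * (3 * 0) ^ 2
      + 4 * ((t : ℝ) * (j * 0 * (1 + tailIntegral ρinit 0) + 0 * (3 * j) ^ 2 / 2)))) := by
    refine tendsto_nhdsWithin_of_tendsto_nhds (Continuous.tendsto ?_ 0)
    fun_prop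
  have hδ : 0 < b' / 2 * (κ * ζ ^ 2 / 8) := by positivity
  obtain ⟨e, ⟨he2, he3⟩, he0⟩ := (((hF.eventually_lt_const (u := b' / 2 * (κ * ζ ^ 2 / 8)) (by
    simpa using hδ)).and (tendsto_nhdsWithin_of_tendsto_nhds (tendsto_id (x := 𝓝 (0 : ℝ)))
      |>.eventually_lt_const (lt_min one_pos (by positivity : 0 < ζ / 8)))).and
    self_mem_nhdsWithin).exists
  have he1 : e ≤ 1 := he3.le.trans (min_le_left _ _)
  have heζ : e ≤ ζ / 8 := he3.le.trans (min_le_right _ _)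
  obtain ⟨m, k, hk, ⟨B, hB⟩, hVU⟩ := happ t e he0
  obtain ⟨hX₀, -⟩ := isDatum_tailDatum (j := j) (c := c) hρ_bdd
  have hNκ : ∀ᶠ N : ℕ in atTop, 1 ≤ κ * N := by
    filter_upwards [(tendsto_natCast_atTop_atTop (R := ℝ)).eventually_ge_atTop (1 / κ)] with N hN
    rw [div_le_iff₀ hκ0] at hN
    linarith
  filter_upwards [eventually_lintegral_meanSqDist_le hj hρ_bdd hρ_nonneg hξ hY ht'.le he0 he1 hk
    hB he2, eventually_lintegral_mass_sq_le hj hρ_bdd hρ_nonneg hξ hY ht'.le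
    (by positivity : 0 < b' / 2 * (ζ / 8) ^ 2), hNκ, eventually_gt_atTop 0] with N h1 h2 h3 h4
  have h5 := measure_not_close_le h4 hζ hκ0 h3 (measurable_meanSqDist (hY N h4) t)
    ((hY N h4).measurable_state (fun ξ => (eps N * numParticles ξ - tailIntegral ρinit 0) ^ 2)
      t).ennreal_ofReal hUc hU1 (approxV_at_zero hX₀ hk.source t)
    (fun r hr => (hVU t ⟨ht', le_rfl⟩ r hr).trans heζ) (half_pos hb'0).le (half_pos hb'0).le h1 h2
  rw [add_halves] at h5
  exact h5.trans hbb.le
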